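/- Let $g$ be a smooth Riemannian metric on $\mathbb T^2=\mathbb R^2/\mathbb Z^2$ and let $\sigma$ be a smooth 2-form on $\mathbb T^2$ that is oscillating, i.e. negative at some point and positive at another (with respect to $dq^1\wedge dq^2$). Let $\mathcal M=H^1(\mathbb T,\mathbb T^2)\times(0,\infty)$ be the Hilbert manifold of $H^1$-loops $\gamma=(x,T)$ with arbitrary period, with its $\mathbb T$-action $\psi\cdot(x,T)=(x(\psi+\cdot),T)$ and the iterates $\gamma^n=(x(n\,\cdot),nT)$ for integers $n\ge1$; let $\mathcal M_0$ be its component of contractible loops. For $k>0$ let $\eta_k$ be the closed 1-form on $\mathcal M$ $$\eta_k=d\mathbb A_k+\int_0^1\sigma_{x(s)}(\cdot,x'(s))\,ds,\qquad \mathbb A_k(x,T)=\frac1{2T}\int_0^1|x'|_g^2\,ds+kT .$$ A vanishing circle of $\eta_k$ is a set $\mathbb T\cdot\gamma$ with $\eta_k(\gamma)=0$. Let $\tau$ be the closed 1-form $\tau_{(x,T)}=\int_0^1 (dq^1\wedge dq^2)(\cdot,x'(s))\,ds$ on $\mathcal M$. Integrals of closed 1-forms along continuous paths are defined through local primitives.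 For $\gamma=(x,T)\in\mathcal M$ whose image is not all of $\mathbb T^2$, choose a point $q$ off the image of $\gamma$ and a smooth primitive $\theta^\gamma$ of $\sigma$ on $\mathbb T^2\setminus\{q\}$, let $\mathcal V^\gamma\subset\mathcal M$ be the open set of loops that avoid $q$, and let $$\mathbb S_k^\gamma(y,T)=T\int_0^1\Big[\tfrac12\big|\tfrac{y'}{T}\big|_g^2+\theta^\gamma_{y}\big(\tfrac{y'}{T}\big)+k\Big]ds,\qquad (y,T)\in\mathcal V^\gamma .$$ All choices of $q$ and $\theta^\gamma$ are allowed below. Setting. Let $k^*>0$ and let $\alpha\in\mathcal M\setminus\mathcal M_0$ be a strict local minimizer of the action with energy $k^*$: there is an open neighbourhood $O\subset\mathcal V^\alpha$ of $\mathbb T\cdot\alpha$ such that $\mathbb S^\alpha_{k^*}(\gamma)>\mathbb S^\alpha_{k^*}(\alpha)$ for all $\gamma\in O\setminus\mathbb T\cdot\alpha$. Let $\mathcal U$ be a bounded open neighbourhood of $\mathbb T\cdot\alpha$, contained in the connected component of $\alpha$, with $\overline{\mathcal U}\subset\mathcal V^\alpha$ and $\inf_{\partial\mathcal U}\mathbb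 S^\alpha_{k^*}>\mathbb S^\alpha_{k^*}(\alpha)$. Let $M_k$ be the closure of the set of local minimizers of $\mathbb S_k^\alpha$ that lie in $\mathcal U$. Let $I\subset(0,\infty)$ be an open interval containing $k^*$ such that (i) $M_k$ is non-empty and compact for every $k\in I$; (ii) for all $k_-<k_+$ in $I$ and every $\beta\in M_{k_+}$ there is a continuous path $w:[0,1]\to\mathcal U$ with $w(0)\in M_{k_-}$, $w(1)=\beta$ and $\mathbb S^\alpha_{k_-}\circ w\le\mathbb S^\alpha_{k_-}(\beta)$. For $n\ge1$ let $\mathcal N^n$ be the connected component of $\mathcal M$ that contains $\alpha^n$, and for $k\in I$ set $$\mathcal P_n(k)=\Big\{u\in C([0,1],\mathcal N^n)\ \Big|\ u(0)=u(1)\in\{\beta^n:\beta\in M_k\},\ \int_0^1u^*\tau\ne0\Big\},$$ $$\mathbb S_k(u,s)=\mathbb S^\alpha_k(u(0))+\int_0^su^*\eta_k,\qquad c_n(k)=\inf_{u\in\mathcal P_n(k)}\max_{s\in[0,1]}\mathbb S_k(u,s).$$ Lemma 6.2 (mountain pass lemma). Let $n\ge1$ and $k\in I$ be such that $c_n:I\to\mathbb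 R$ is differentiable at $k$. Let $T_*>0$ be a Lipschitz constant for $c_n$ at $k$, i.e. $|c_n(k')-c_n(k)|\le T_*|k'-k|$ for all $k'$ near $k$, such that $T_*>n\cdot\sup_{\mathcal U}T-2$. Suppose that the vanishing circles of $\eta_k$ contained in $\mathcal N^n\cap\{T\le T_*+3\}$ form a discrete set, i.e. each of them has a neighbourhood that meets no other one of them. Then their union $\mathcal E_n(k)=\bigcup_{j\in J}\mathbb T\cdot\gamma_j$ (one $\gamma_j$ chosen on each circle) is an essential family for $\mathcal P_n(k)$, that is: for all pairwise disjoint connected open sets $\mathcal W_j$ with $\mathbb T\cdot\gamma_j\subset\mathcal W_j\subset\mathcal V^{\gamma_j}$, $j\in J$, there exist $u\in\mathcal P_n(k)$ and $\lambda>0$ such that (A) $\mathbb S_k(u,0)\le c_n(k)-\lambda$ and $\mathbb S_k(u,1)\le c_n(k)-\lambda$; (B) for every $s\in[0,1]$ with $\mathbb S_k(u,s)>c_n(k)-\lambda$ there is $j\in J$ such that $u(s)\in\mathcal W_j$ and $$c_n(k)-\mathbb S_k(u,s)=\mathbb S_k^{\gamma_j}(\gamma_j)-\mathbb S_k^{\gamma_j}(u(s)).$$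 -/

import Mathlib

open MeasureTheory Topology Filter Set
open scoped ContDiff

noncomputable section

namespace MagneticTorus

/-! ### The torus, Riemannian metrics, two-forms, primitives on the punctured torus -/

/-- The Euclidean plane, universal cover of the two-torus. -/
abbrev Plane : Type := EuclideanSpace ℝ (Fin 2)

/-- The two-torus `ℝ² / ℤ²`. -/
abbrev Torus : Type := Fin 2 → UnitAddCircle

/-- The covering map `ℝ² → ℝ² / ℤ²`. -/
def proj (p : Plane) : Torus := fun i => (p i : UnitAddCircle)

/-- The lift of a point of the torus to the fundamental domain `[0,1)²`. -/
def rep (q : Torus) : Plane :=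
  WithLp.toLp 2 fun i => (AddCircle.equivIco (1 : ℝ) 0 (q i) : ℝ)

/-- A smooth Riemannian metric on the torus, as a smooth metric on the plane that is invariant
under the deck transformations. -/
structure RiemannianMetric where
  toFun : Plane → Plane →L[ℝ] Plane →L[ℝ] ℝ
  smooth : ContDiff ℝ ∞ toFun
  periodic : ∀ p p', proj p = proj p' → toFun p = toFun p'
  symm : ∀ p v w, toFun p v w = toFun p w v
  pos : ∀ p v, v ≠ 0 → 0 < toFun p v v

/-- A smooth two-form on the torus, `σ = f dq¹ ∧ dq²` with `f` smooth and `ℤ²`-periodic. -/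
structure TwoForm where
  density : Plane → ℝ
  smooth : ContDiff ℝ ∞ density
  periodic : ∀ p p', proj p = proj p' → density p = density p'

/-- The value `σ_p (v, w)`. -/
def TwoForm.eval (σ : TwoForm) (p v w : Plane) : ℝ := σ.density p * (v 0 * w 1 - v 1 * w 0)

/-- A two-form is oscillating if it is negative at one point and positive at another one. -/
def TwoForm.Oscillating (σ : TwoForm) : Prop :=
  (∃ p, σ.density p < 0) ∧ ∃ p, 0 < σ.density p

/-- The standard two-form `dq¹ ∧ dq²`. -/
def stdTwoForm : TwoForm where
  density := fun _ => 1
  smooth := contDiff_const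
  periodic := fun _ _ _ => rfl

/-- A point `q` of the torus together with a smooth one-form `θ` on `𝕋² ∖ {q}` such that
`dθ = σ` there. The values of `θ` over `q` are irrelevant. -/
structure PuncturedPrimitive (σ : TwoForm) where
  q : Torus
  θ : Plane → Plane →L[ℝ] ℝ
  smooth : ContDiffOn ℝ ∞ θ {p | proj p ≠ q}
  periodic : ∀ p p', proj p ≠ q → proj p = proj p' → θ p = θ p'
  primitive : ∀ p, proj p ≠ q → ∀ v w, fderiv ℝ θ p v w - fderiv ℝ θ p w v = σ.eval p v w

/-! ### The Hilbert manifold of `H¹`-loops with arbitrary period -/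

/-- Square integrable vector valued functions on `𝕋 = ℝ / ℤ`. -/
abbrev L2 : Type := Lp Plane 2 (volume : Measure UnitAddCircle)

theorem integral_add_L2 (v w : L2) : ∫ s, (v + w) s = (∫ s, v s) + ∫ s, w s := by
  rw [integral_congr_ae (Lp.coeFn_add v w)]
  exact integral_add ((Lp.memLp v).integrable one_le_two) ((Lp.memLp w).integrable one_le_two)

theorem integral_smul_L2 (c : ℝ) (v : L2) : ∫ s, (c • v) s = c • ∫ s, v s := by
  rw [integral_congr_ae (Lp.coeFn_smul c v)]
  exact integral_smul c v

theorem integral_zero_L2 : ∫ s, (0 : L2) s = 0 := by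
  rw [integral_congr_ae (Lp.coeFn_zero Plane 2 volume)]
  simp

theorem integral_comp_L2 (v : L2) {φ : UnitAddCircle → UnitAddCircle}
    (hφ : MeasurePreserving φ volume volume) :
    ∫ s, Lp.compMeasurePreserving φ hφ v s = ∫ s, v s := by
  rw [integral_congr_ae (Lp.coeFn_compMeasurePreserving v hφ)]
  have h := integral_map (μ := volume) hφ.measurable.aemeasurable (f := (v : UnitAddCircle → Plane))
    (by rw [hφ.map_eq]; exact Lp.aestronglyMeasurable v)
  rw [hφ.map_eq] at h
  exact h.symm

/-- The lattice `ℤ²` in the plane. -/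
def lattice : AddSubgroup Plane where
  carrier := {m | ∀ i, ∃ z : ℤ, m i = z}
  zero_mem' := fun _ => ⟨0, by simp⟩
  add_mem' := fun {a b} ha hb i => by
    obtain ⟨y, hy⟩ := ha i
    obtain ⟨z, hz⟩ := hb i
    exact ⟨y + z, by simp [hy, hz]⟩
  neg_mem' := fun {a} ha i => by
    obtain ⟨y, hy⟩ := ha i
    exact ⟨-y, by simp [hy]⟩

/-- The space `H¹(𝕋, 𝕋²)`. A loop `x` is of class `H¹` if and only if each lift is of the form
`s ↦ p + ∫₀ˢ v` with `v` square integrable and `∫₀¹ v ∈ ℤ²`, so `x` is recorded as the pair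
`(x 0, x')`. The topology (and the group structure) inherited from `𝕋² × L²` is that of
`H¹(𝕋, 𝕋²)`. -/
def loops : AddSubgroup (Torus × L2) where
  carrier := {x | ∫ s, x.2 s ∈ lattice}
  zero_mem' := by
    change ∫ s, (0 : L2) s ∈ lattice
    rw [integral_zero_L2]
    exact lattice.zero_mem
  add_mem' := fun {a b} ha hb => by
    change ∫ s, (a.2 + b.2) s ∈ lattice
    rw [integral_add_L2]
    exact lattice.add_mem ha hb
  neg_mem' := fun {a} ha => by
    change ∫ s, (-a.2) s ∈ lattice
    have h : (-a.2 : L2) = (-1 : ℝ) • a.2 := by simp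
    rw [h, integral_smul_L2]
    simpa using lattice.neg_mem ha

/-- Pairs `(x, T)` of an `H¹`-loop and a real number. -/
abbrev LoopsR : Type := loops × ℝ

/-- The Hilbert manifold `𝓜 = H¹(𝕋, 𝕋²) × (0, ∞)` of `H¹`-loops with arbitrary period. Its
bounded sets (for the distance inherited from `𝕋² × L² × ℝ`) are those on which both the kinetic
energy and the period are bounded. -/
abbrev FreeLoop : Type := {γ : LoopsR // 0 < γ.2}

/-- The derivative `x'` of the loop. -/
def vel (γ : LoopsR) (s : ℝ) : Plane := γ.1.1.2 (s : UnitAddCircle)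

/-- A lift `ℝ → ℝ²` of the loop `x`. -/
def lift (γ : LoopsR) (s : ℝ) : Plane := rep γ.1.1.1 + ∫ r in (0 : ℝ)..s, vel γ r

/-- The point `x s` of the torus. -/
def pt (γ : LoopsR) (s : ℝ) : Torus := proj (lift γ s)

/-- The period `T` of `(x, T)`. -/
def period (γ : FreeLoop) : ℝ := γ.1.2

/-- The action of `𝕋` (here of `ℝ`): `ψ · (x, T) = (x (ψ + ·), T)`. -/
def shift (ψ : ℝ) (γ : FreeLoop) : FreeLoop :=
  ⟨(⟨(pt γ.1 ψ, Lp.compMeasurePreserving (fun s : UnitAddCircle => (ψ : UnitAddCircle) + s)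
      (measurePreserving_add_left volume (ψ : UnitAddCircle)) γ.1.1.1.2), by
        change ∫ s, Lp.compMeasurePreserving _ _ _ s ∈ lattice
        rw [integral_comp_L2]
        exact γ.1.1.2⟩, γ.1.2), γ.2⟩

/-- The circle `𝕋 · γ`. -/
def orbit (γ : FreeLoop) : Set FreeLoop := range fun ψ : ℝ => shift ψ γ

theorem measurePreserving_mul (n : ℕ+) :
    MeasurePreserving (fun s : UnitAddCircle => (n : ℤ) • s) volume volume :=
  MeasureTheory.Measure.measurePreserving_zsmul volume (by exact_mod_cast n.ne_zero)

/-- The `n`-th iterate `γⁿ = (x (n ·), n T)` of `γ = (x, T)`, for a positive integer `n`. -/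
def iterate (n : ℕ+) (γ : FreeLoop) : FreeLoop :=
  ⟨(⟨(γ.1.1.1.1, ((n : ℕ) : ℝ) • Lp.compMeasurePreserving (fun s : UnitAddCircle => (n : ℤ) • s)
      (measurePreserving_mul n) γ.1.1.1.2), by
        change ∫ s, (((n : ℕ) : ℝ) • Lp.compMeasurePreserving _ _ _ : L2) s ∈ lattice
        rw [integral_smul_L2, integral_comp_L2, Nat.cast_smul_eq_nsmul]
        exact lattice.nsmul_mem γ.1.1.2 _⟩, ((n : ℕ) : ℝ) * γ.1.2),
    mul_pos (by exact_mod_cast n.pos) γ.2⟩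

/-- The loop that is constant at the base point of the torus, with period one. -/
def constLoop : FreeLoop := ⟨(0, 1), one_pos⟩

/-- The connected component `𝓜₀` of the contractible loops. -/
def contractibleLoops : Set FreeLoop := connectedComponent constLoop

/-! ### Tangent vectors, one-forms and their integrals along continuous paths -/

/-- The space of `H¹` vector fields along a loop, that is of `H¹`-maps `𝕋 → ℝ²`: a field `ξ` is
recorded as the pair `(ξ 0, ξ')`. -/
def fields : Submodule ℝ (Plane × L2) where
  carrier := {ξ | ∫ s, ξ.2 s = 0}
  zero_mem' := integral_zero_L2
  add_mem' := fun {a b} ha hb => by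
    change ∫ s, (a.2 + b.2) s = 0
    rw [integral_add_L2, show ∫ s, a.2 s = 0 from ha, show ∫ s, b.2 s = 0 from hb, add_zero]
  smul_mem' := fun c a ha => by
    change ∫ s, (c • a.2) s = 0
    rw [integral_smul_L2, show ∫ s, a.2 s = 0 from ha, smul_zero]

/-- The tangent space of `𝓜`, which is the same at all points because the tangent bundle of the
torus is trivialized by the coordinate fields. -/
abbrev Tangent : Type := fields × ℝ

/-- The value `ξ s` of a vector field along a loop. -/
def fieldAt (ξ : fields) (s : ℝ) : Plane :=
  ξ.1.1 + ∫ r in (0 : ℝ)..s, ξ.1.2 (r : UnitAddCircle)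

/-- The loop `s ↦ ξ s` mod `ℤ²`. -/
def toLoop (ξ : fields) : loops :=
  ⟨(proj ξ.1.1, ξ.1.2), by
    change ∫ s, ξ.1.2 s ∈ lattice
    rw [show ∫ s, ξ.1.2 s = 0 from ξ.2]
    exact lattice.zero_mem⟩

/-- The displacement `(x + ξ, T + t)` of `(x, T)` by the tangent vector `(ξ, t)`. For small
tangent vectors these displacements are the standard charts of `𝓜`. -/
def displace (γ : FreeLoop) (h : Tangent) : LoopsR := γ.1 + (toLoop h.1, h.2)

/-- One-forms on `𝓜`. -/
abbrev OneForm : Type := FreeLoop → Tangent → ℝ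

/-- `F` is a primitive of `η` on the set `O`: it is differentiable, with differential `η`, at
each point of `O`. (`F` is a function of pairs `(x, T)` with `T` real, but only its values near
points with `T > 0` matter.) -/
def IsPrimitiveOn (η : OneForm) (F : LoopsR → ℝ) (O : Set FreeLoop) : Prop :=
  ∀ γ ∈ O, DifferentiableAt ℝ (fun h : Tangent => F (displace γ h)) 0 ∧
    ∀ h, fderiv ℝ (fun h : Tangent => F (displace γ h)) 0 h = η γ h

/-- `Φ s = ∫₀ˢ u^*η` for all `s`: the increments of `Φ` are those of local primitives of `η`
along the continuous path `u`. -/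
def IsIntegralAlong (η : OneForm) (u : C(unitInterval, FreeLoop)) (Φ : unitInterval → ℝ) : Prop :=
  Φ 0 = 0 ∧ ∀ s₀, ∃ O : Set FreeLoop, ∃ F : LoopsR → ℝ, IsOpen O ∧ u s₀ ∈ O ∧
    IsPrimitiveOn η F O ∧ ∀ᶠ s in 𝓝 s₀, Φ s - Φ s₀ = F (u s).1 - F (u s₀).1

open Classical in
/-- The integral `∫₀ˢ u^*η` of a closed one-form along a continuous path. -/
def pathIntegral (η : OneForm) (u : C(unitInterval, FreeLoop)) (s : unitInterval) : ℝ :=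
  if h : ∃ Φ, IsIntegralAlong η u Φ then h.choose s else 0

/-! ### The action one-form and its local primitives -/

/-- The kinetic energy `e x = ½ ∫₀¹ |x'|²`. -/
def kinetic (g : RiemannianMetric) (γ : LoopsR) : ℝ :=
  1 / 2 * ∫ s in (0 : ℝ)..1, g.toFun (lift γ s) (vel γ s) (vel γ s)

/-- `𝔸_k (x, T) = e x / T + k T`. -/
def freeAction (g : RiemannianMetric) (k : ℝ) (γ : LoopsR) : ℝ := kinetic g γ / γ.2 + k * γ.2

/-- The one-form `∫₀¹ σ_x (·, x') ds` on `𝓜`. -/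
def transgression (σ : TwoForm) : OneForm := fun γ h =>
  ∫ s in (0 : ℝ)..1, σ.eval (lift γ.1 s) (fieldAt h.1 s) (vel γ.1 s)

/-- The action one-form `η_k = d𝔸_k + ∫₀¹ σ_x (·, x') ds`. -/
def actionForm (g : RiemannianMetric) (σ : TwoForm) (k : ℝ) : OneForm := fun γ h =>
  fderiv ℝ (fun h' : Tangent => freeAction g k (displace γ h')) 0 h + transgression σ γ h

/-- `γ` is a zero of `η_k`. -/
def IsZero (g : RiemannianMetric) (σ : TwoForm) (k : ℝ) (γ : FreeLoop) : Prop :=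
  ∀ h, actionForm g σ k γ h = 0

/-- The vanishing circles of `η_k`. -/
def vanishingCircles (g : RiemannianMetric) (σ : TwoForm) (k : ℝ) : Set (Set FreeLoop) :=
  {C | ∃ γ, IsZero g σ k γ ∧ C = orbit γ}

variable {σ : TwoForm}

/-- The open set `𝓥` of loops whose image is contained in `𝕋² ∖ {q}`. -/
def PuncturedPrimitive.domain (P : PuncturedPrimitive σ) : Set FreeLoop :=
  {γ | ∀ s, pt γ.1 s ≠ P.q}

/-- The free period action functional `𝕊_k (x, T) = T ∫₀¹ (½ |x'/T|² + θ_x (x'/T) + k) ds`, a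
primitive of `η_k` on `𝓥`. -/
def localAction (g : RiemannianMetric) (P : PuncturedPrimitive σ) (k : ℝ) (γ : FreeLoop) : ℝ :=
  period γ * ∫ s in (0 : ℝ)..1,
    (1 / 2 * g.toFun (lift γ.1 s) ((period γ)⁻¹ • vel γ.1 s) ((period γ)⁻¹ • vel γ.1 s)
      + P.θ (lift γ.1 s) ((period γ)⁻¹ • vel γ.1 s) + k)

/-! ### Local minimizers -/

/-- `α` is a strict local minimizer of the action with energy `k`. -/
def IsStrictLocalMinimizer (g : RiemannianMetric) (P : PuncturedPrimitive σ) (k : ℝ) (α : FreeLoop) :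
    Prop :=
  ∃ O, IsOpen O ∧ orbit α ⊆ O ∧ O ⊆ P.domain ∧
    ∀ γ ∈ O \ orbit α, localAction g P k α < localAction g P k γ

/-- `U` is a bounded open neighborhood of `𝕋 · α`, contained in `𝓥` and in the connected component
of `α`, with `inf_{∂U} 𝕊_k > 𝕊_k α`. -/
structure IsWell (g : RiemannianMetric) (P : PuncturedPrimitive σ) (k : ℝ) (α : FreeLoop)
    (U : Set FreeLoop) : Prop where
  isOpen : IsOpen U
  bounded : Bornology.IsBounded U
  orbit_subset : orbit α ⊆ U
  subset_domain : U ⊆ P.domain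
  subset_component : U ⊆ connectedComponent α
  frontier_subset : frontier U ⊆ P.domain
  boundary : ∃ c, localAction g P k α < c ∧ ∀ γ ∈ frontier U, c ≤ localAction g P k γ

/-- `M_k`, the closure of the set of local minimizers of `𝕊_k` in `U`. -/
def minimizers (g : RiemannianMetric) (P : PuncturedPrimitive σ) (U : Set FreeLoop) (k : ℝ) : Set FreeLoop :=
  closure {γ | γ ∈ U ∧ IsLocalMin (localAction g P k) γ}

/-- The requirements on the interval of energies `I` around `k₀`: the sets `M_k` are non-empty
and compact, and each point of `M_{k₊}` can be joined to `M_{k₋}` inside `U` without exceeding its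
own value of `𝕊_{k₋}`. -/
structure IsEnergyInterval (g : RiemannianMetric) (P : PuncturedPrimitive σ) (U : Set FreeLoop) (k₀ : ℝ)
    (I : Set ℝ) : Prop where
  isOpen : IsOpen I
  ordConnected : I.OrdConnected
  pos : ∀ k ∈ I, 0 < k
  mem : k₀ ∈ I
  minimizers_nonempty : ∀ k ∈ I, (minimizers g P U k).Nonempty
  minimizers_compact : ∀ k ∈ I, IsCompact (minimizers g P U k)
  exists_path : ∀ k₁ ∈ I, ∀ k₂ ∈ I, k₁ < k₂ → ∀ β ∈ minimizers g P U k₂,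
    ∃ w : C(unitInterval, FreeLoop), (∀ s, w s ∈ U) ∧ w 0 ∈ minimizers g P U k₁ ∧ w 1 = β ∧
      ∀ s, localAction g P k₁ (w s) ≤ localAction g P k₁ β

/-! ### Minimax classes and minimax values -/

/-- The connected component `𝓝ⁿ` of `αⁿ`. -/
def component (α : FreeLoop) (n : ℕ+) : Set FreeLoop := connectedComponent (iterate n α)

/-- The minimax class `𝓟ₙ(k)`: paths in `𝓝ⁿ` that start and end at the same point of `M_kⁿ`, along
which the transgression of `dq¹ ∧ dq²` has non-zero integral. -/
def minimaxClass (g : RiemannianMetric) (P : PuncturedPrimitive σ) (α : FreeLoop) (U : Set FreeLoop)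
    (n : ℕ+) (k : ℝ) : Set C(unitInterval, FreeLoop) :=
  {u | (∀ s, u s ∈ component α n) ∧ u 0 = u 1 ∧ u 0 ∈ iterate n '' minimizers g P U k ∧
    pathIntegral (transgression stdTwoForm) u 1 ≠ 0}

/-- `𝕊_k (u, s) = 𝕊_k (u 0) + ∫₀ˢ u^*η_k`. -/
def actionAlong (g : RiemannianMetric) (P : PuncturedPrimitive σ) (k : ℝ) (u : C(unitInterval, FreeLoop))
    (s : unitInterval) : ℝ :=
  localAction g P k (u 0) + pathIntegral (actionForm g σ k) u s

/-- The minimax function `cₙ(k) = inf_u max_s 𝕊_k (u, s)`, `u ∈ 𝓟ₙ(k)`. -/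
def minimaxValue (g : RiemannianMetric) (P : PuncturedPrimitive σ) (α : FreeLoop) (U : Set FreeLoop)
    (n : ℕ+) (k : ℝ) : ℝ :=
  ⨅ u : minimaxClass g P α U n k, ⨆ s : unitInterval, actionAlong g P k u.1 s

/-! ### Essential families -/

/-- `W = (W_j)` is a separating neighborhood of the family of circles `𝕋 · γ_j`, where `P j` is the
chosen point and primitive that define `𝓥` for `γ_j`. -/
structure IsSeparating {J : Type*} (γ : J → FreeLoop) (P : J → PuncturedPrimitive σ)
    (W : J → Set FreeLoop) : Prop where
  isOpen : ∀ j, IsOpen (W j)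
  connected : ∀ j, IsConnected (W j)
  disjoint : ∀ i j, i ≠ j → Disjoint (W i) (W j)
  orbit_subset : ∀ j, orbit (γ j) ⊆ W j
  subset_domain : ∀ j, W j ⊆ (P j).domain

/-- The circles `𝕋 · γ_j` are vanishing circles of `η_k` in `𝓝ⁿ`, isolated from each other, and
their union is an essential family for `𝓟ₙ(k)`. -/
structure IsEssentialFamily (g : RiemannianMetric) (P₀ : PuncturedPrimitive σ) (α : FreeLoop)
    (U : Set FreeLoop) (n : ℕ+) (k : ℝ) {J : Type*} (γ : J → FreeLoop)
    (P : J → PuncturedPrimitive σ) : Prop where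
  isZero : ∀ j, IsZero g σ k (γ j)
  subset_component : ∀ j, orbit (γ j) ⊆ component α n
  isolated : ∀ j, ∃ O, IsOpen O ∧ orbit (γ j) ⊆ O ∧ ∀ i ≠ j, Disjoint (orbit (γ i)) O
  essential : ∀ W : J → Set FreeLoop, IsSeparating γ P W →
    ∃ u ∈ minimaxClass g P₀ α U n k, ∃ lam : ℝ, 0 < lam ∧
      (actionAlong g P₀ k u 0 ≤ minimaxValue g P₀ α U n k - lam ∧
        actionAlong g P₀ k u 1 ≤ minimaxValue g P₀ α U n k - lam) ∧
      ∀ s, minimaxValue g P₀ α U n k - lam < actionAlong g P₀ k u s →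
        ∃ j, u s ∈ W j ∧
          minimaxValue g P₀ α U n k - actionAlong g P₀ k u s =
            localAction g (P j) k (γ j) - localAction g (P j) k (u s)

/-- The vanishing circles of `η_k` contained in `𝓝ⁿ ∩ {T ≤ B}`. -/
def circlesBelow (g : RiemannianMetric) (σ : TwoForm) (α : FreeLoop) (n : ℕ+) (k B : ℝ) :
    Set (Set FreeLoop) :=
  {C ∈ vanishingCircles g σ k | C ⊆ component α n ∩ {γ | period γ ≤ B}}

/-- A set of circles is discrete if each of them has a neighborhood that meets no other one. -/
def IsDiscreteFamily (𝓒 : Set (Set FreeLoop)) : Prop :=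
  ∀ C ∈ 𝓒, ∃ O, IsOpen O ∧ C ⊆ O ∧ ∀ C' ∈ 𝓒, C' ≠ C → Disjoint C' O

end MagneticTorus

end

noncomputable section

namespace MagneticTorus

/-! The argument is Struwe's monotonicity trick followed by a gradient deformation, carried out on
the universal cover. A loop is lifted to a starting point in the plane, a velocity and a period, an
element of `Lifted`. The loops of one homology class `m` are the points of the affine slice of total
displacement `m`, up to integer translations. On that slice η_k has a global primitive `act`, whose
differential on tangent vectors is `act'`; translating a lift by a lattice vector w changes `act` by
(w⁰m¹ − w¹m⁰) times the flux of σ through the torus. Integrals of η_k along paths are therefore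
differences of `act` along lifted paths (`IsRepresented.pathIntegral_eq`), and each local action
agrees with `act` up to a constant and multiples of the flux (`localAction_sub_act_mem`).

Almost optimal paths. For k' = k + ε take a path in 𝓟_n(k') whose maximum is below c_n(k) + (T_* +
1)ε; the Lipschitz bound allows this. The actions at the two energies differ by ε times the period,
so the period is at most T_* + 2 wherever the action at energy k exceeds c_n(k) − ε. Conjugation
with the n-th iterate of a path inside 𝓤 moves the base point from M_{k'} to M_k and keeps these
bounds (`exists_path_period_le`).

Deformation. In a non-contractible class the velocity has norm at least one, so a bound of the
kinetic energy by a multiple of T² keeps the period away from zero, and sequences of bounded period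
with slope tending to zero have convergent subsequences (`exists_subseq_loop`). Enlarging the period
where the kinetic energy is too big for it and then taking a cut-off gradient step leaves only loops
near the vanishing circles close to the top level (`exists_deformation`). Zeros of η_k do not move,
so the endpoints stay fixed.

Condition (A). By discreteness each point of M_k lies on the circle of a genuine local minimizer
(`isLocalMin_of_mem_minimizers`), and in dimension two iterates of local minimizers are local
minimizers (`isLocalMin_iterate`): a loop near the (N+1)-st iterate crosses itself after about one
period of the original loop, so it splits into a loop near the original one and a loop near its N-th
iterate, and the actions add. The crossing comes from the Poincaré–Miranda theorem
(`exists_closing_time`) and needs a continuous velocity without zeros, which the Euler–Lagrange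
equation and conservation of energy supply (`exists_velocity`). On a small sphere around an isolated
circle of local minimizers the action exceeds the minimum by a definite amount, and a path with
non-zero integral of τ has to leave the ball because its enclosed area changes by a non-zero integer
(`exists_barrier`). Applied to the path and to its reverse, this puts both endpoints well below the
maximum.

Condition (B). The defect in the claimed identity lies in one of finitely many cosets of the
subgroup generated by the flux (`sub_localAction_mem`); the family of circles is finite because the
zeros of bounded period form a compact set. Near the top level and near the circles the defect is
small, and zero is isolated from the other elements of each coset (`exists_eq_zero_of_abs_lt`), so
the defect vanishes. -/

/-- Covectors of the plane. -/
abbrev Covec : Type := Plane →L[ℝ] ℝ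

/-- Bilinear forms on the plane. -/
abbrev BilForm : Type := Plane →L[ℝ] Plane →L[ℝ] ℝ

/-! ### Normed spaces of bilinear forms and of continuous functions -/

/-- Bilinear forms on the plane as an abstract normed space. -/
def QForm : Type := BilForm

namespace QForm

instance : NormedAddCommGroup QForm := inferInstanceAs (NormedAddCommGroup BilForm)

instance : NormedSpace ℝ QForm := inferInstanceAs (NormedSpace ℝ BilForm)

/-- The underlying bilinear form. -/
def toBil (Q : QForm) : BilForm := Q

/-- The partial application of a bilinear form. -/
def app (Q : QForm) (v : Plane) : Covec := Q.toBil v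

instance : CoeFun QForm (fun _ => Plane → Covec) := ⟨app⟩

theorem app_add (Q : QForm) (v w : Plane) : Q (v + w) = Q v + Q w := map_add Q.toBil v w

theorem app_sub (Q : QForm) (v w : Plane) : Q (v - w) = Q v - Q w := map_sub Q.toBil v w

theorem app_smul (c : ℝ) (Q : QForm) (v : Plane) : Q (c • v) = c • Q v := map_smul Q.toBil c v

@[simp] theorem app_zero (Q : QForm) : Q 0 = 0 := map_zero Q.toBil

theorem add_apply (Q Q' : QForm) (v w : Plane) : (Q + Q') v w = Q v w + Q' v w := rfl

theorem sub_apply (Q Q' : QForm) (v w : Plane) : (Q - Q') v w = Q v w - Q' v w := rfl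

theorem smul_apply (c : ℝ) (Q : QForm) (v w : Plane) : (c • Q) v w = c * Q v w := rfl

theorem norm_apply_le (Q : QForm) (v w : Plane) : ‖Q v w‖ ≤ ‖Q‖ * ‖v‖ * ‖w‖ :=
  ContinuousLinearMap.le_opNorm₂ Q.toBil v w

theorem continuous_apply : Continuous fun x : QForm × Plane × Plane => x.1 x.2.1 x.2.2 := by
  have h : Continuous fun x : BilForm × Plane × Plane => x.1 x.2.1 x.2.2 := by fun_prop
  exact h

end QForm

/-- Continuous functions on the unit interval, with the supremum norm. -/
def CI (F : Type*) [NormedAddCommGroup F] : Type _ := C(unitInterval, F)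

namespace CI

variable {F : Type*} [NormedAddCommGroup F]

instance : NormedAddCommGroup (CI F) := inferInstanceAs (NormedAddCommGroup C(unitInterval, F))

instance [NormedSpace ℝ F] : NormedSpace ℝ (CI F) := inferInstanceAs (NormedSpace ℝ C(unitInterval, F))

instance : FunLike (CI F) unitInterval F := inferInstanceAs (FunLike C(unitInterval, F) unitInterval F)

instance : ContinuousMapClass (CI F) unitInterval F :=
  inferInstanceAs (ContinuousMapClass C(unitInterval, F) unitInterval F)

/-- The element of `CI F` given by a continuous function. -/
def mk (f : unitInterval → F) (hf : Continuous f) : CI F := (⟨f, hf⟩ : C(unitInterval, F))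

@[simp] theorem mk_apply (f : unitInterval → F) (hf : Continuous f) (s : unitInterval) : mk f hf s = f s := rfl

@[ext] theorem ext {f g : CI F} (h : ∀ s, f s = g s) : f = g := DFunLike.ext f g h

theorem continuous (f : CI F) : Continuous f := map_continuous f

theorem norm_le {f : CI F} {C : ℝ} (hC : 0 ≤ C) : ‖f‖ ≤ C ↔ ∀ s, ‖f s‖ ≤ C :=
  ContinuousMap.norm_le (f : C(unitInterval, F)) hC

theorem norm_apply_le (f : CI F) (s : unitInterval) : ‖f s‖ ≤ ‖f‖ :=
  ContinuousMap.norm_coe_le_norm (f : C(unitInterval, F)) s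

@[simp] theorem add_apply (f g : CI F) (s : unitInterval) : (f + g) s = f s + g s := rfl

@[simp] theorem sub_apply (f g : CI F) (s : unitInterval) : (f - g) s = f s - g s := rfl

@[simp] theorem smul_apply [NormedSpace ℝ F] (c : ℝ) (f : CI F) (s : unitInterval) : (c • f) s = c • f s := rfl

end CI

/-! ### Square integrable functions on the circle as periodic functions on the line -/

/-- The periodic function on the line that represents a square integrable function on the circle. -/
def ev (v : L2) (s : ℝ) : Plane := v (s : UnitAddCircle)

theorem ev_add_one (v : L2) (s : ℝ) : ev v (s + 1) = ev v s := by
  simp only [ev]; congr 1; exact AddCircle.coe_add_period 1 s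

theorem ev_periodic (v : L2) : Function.Periodic (ev v) 1 := ev_add_one v

/-- The projection of each interval (n, n + 1] onto the circle preserves measure, and countably many
such intervals cover the line. -/
theorem ae_of_ae_circle {P : UnitAddCircle → Prop} (h : ∀ᵐ x, P x) : ∀ᵐ s : ℝ, P (s : UnitAddCircle) := by
  have h1 : ∀ n : ℤ, ∀ᵐ s : ℝ ∂volume.restrict (Ioc (n : ℝ) (n + 1)), P (s : UnitAddCircle) := fun n =>
    (UnitAddCircle.measurePreserving_mk (n : ℝ)).quasiMeasurePreserving.ae h
  have h2 : ∀ᵐ s : ℝ ∂volume.restrict (⋃ n : ℤ, Ioc (n : ℝ) (n + 1)), P (s : UnitAddCircle) := by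
    rw [ae_restrict_iUnion_iff]; exact h1
  rwa [iUnion_Ioc_intCast, Measure.restrict_univ] at h2

theorem ev_add (v w : L2) : ∀ᵐ s, ev (v + w) s = ev v s + ev w s :=
  ae_of_ae_circle (P := fun x => (v + w : L2) x = v x + w x) (Lp.coeFn_add v w)

theorem ev_sub (v w : L2) : ∀ᵐ s, ev (v - w) s = ev v s - ev w s :=
  ae_of_ae_circle (P := fun x => (v - w : L2) x = v x - w x) (Lp.coeFn_sub v w)

theorem ev_smul (c : ℝ) (v : L2) : ∀ᵐ s, ev (c • v) s = c • ev v s :=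
  ae_of_ae_circle (P := fun x => (c • v : L2) x = c • v x) (Lp.coeFn_smul c v)

theorem integral_circle {F : Type*} [NormedAddCommGroup F] [NormedSpace ℝ F] (f : UnitAddCircle → F) :
    ∫ s in (0 : ℝ)..1, f (s : UnitAddCircle) = ∫ x, f x := by
  simpa using UnitAddCircle.intervalIntegral_preimage 0 f

theorem intervalIntegrable_circle {F : Type*} [NormedAddCommGroup F] {f : UnitAddCircle → F}
    (hf : Integrable f) (a b : ℝ) : IntervalIntegrable (fun s : ℝ => f (s : UnitAddCircle)) volume a b := by
  have hp : Function.Periodic (fun s : ℝ => f (s : UnitAddCircle)) 1 := fun s => by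
    simp only; congr 1; exact AddCircle.coe_add_period 1 s
  refine hp.intervalIntegrable one_ne_zero (t := 0) ?_ a b
  rw [intervalIntegrable_iff_integrableOn_Ioc_of_le (by norm_num)]
  exact (UnitAddCircle.measurePreserving_mk (0 : ℝ)).integrable_comp_of_integrable hf

theorem intervalIntegrable_ev (v : L2) (a b : ℝ) : IntervalIntegrable (ev v) volume a b :=
  intervalIntegrable_circle ((Lp.memLp v).integrable one_le_two) a b

theorem intervalIntegrable_norm_sq_ev (v : L2) (a b : ℝ) :
    IntervalIntegrable (fun s => ‖ev v s‖ ^ 2) volume a b :=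
  intervalIntegrable_circle (f := fun x => ‖v x‖ ^ 2) (Lp.memLp v).norm.integrable_sq a b

theorem integral_norm_sq_ev (v : L2) : ∫ s in (0 : ℝ)..1, ‖ev v s‖ ^ 2 = ‖v‖ ^ 2 := by
  have h := integral_circle (fun x => ‖v x‖ ^ 2)
  have h2 : inner ℝ v v = ∫ x, inner ℝ (v x) (v x) := MeasureTheory.L2.inner_def v v
  simp only [real_inner_self_eq_norm_sq] at h2
  rw [h2, ← h]; rfl

theorem aestronglyMeasurable_ev (v : L2) : AEStronglyMeasurable (ev v) volume := by
  obtain ⟨f, hf, hfe⟩ := Lp.aestronglyMeasurable v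
  exact ⟨fun s => f (s : UnitAddCircle), hf.comp_measurable AddCircle.measurable_mk',
    ae_of_ae_circle (P := fun x => v x = f x) hfe⟩

theorem intervalIntegrable_norm_mul_ev (v w : L2) (a b : ℝ) :
    IntervalIntegrable (fun s => ‖ev v s‖ * ‖ev w s‖) volume a b :=
  intervalIntegrable_circle (f := fun x => ‖v x‖ * ‖w x‖)
    ((Lp.memLp v).norm.integrable_mul (Lp.memLp w).norm) a b

/-- Cauchy–Schwarz, by choosing the parameter `c` in the integrated pointwise inequality 2cab ≤ a² +
c²b². -/
theorem integral_norm_mul_ev_le (v w : L2) :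
    ∫ s in (0 : ℝ)..1, ‖ev v s‖ * ‖ev w s‖ ≤ ‖v‖ * ‖w‖ := by
  have key : ∀ c : ℝ, 2 * c * ∫ s in (0 : ℝ)..1, ‖ev v s‖ * ‖ev w s‖ ≤ ‖v‖ ^ 2 + c ^ 2 * ‖w‖ ^ 2 := by
    intro c
    rw [← integral_norm_sq_ev v, ← integral_norm_sq_ev w, ← intervalIntegral.integral_const_mul,
      ← intervalIntegral.integral_const_mul, ← intervalIntegral.integral_add
      (intervalIntegrable_norm_sq_ev v 0 1) ((intervalIntegrable_norm_sq_ev w 0 1).const_mul _)]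
    refine intervalIntegral.integral_mono_on (by norm_num)
      ((intervalIntegrable_norm_mul_ev v w 0 1).const_mul _)
      ((intervalIntegrable_norm_sq_ev v 0 1).add ((intervalIntegrable_norm_sq_ev w 0 1).const_mul _)) ?_
    intro s _
    nlinarith [sq_nonneg (‖ev v s‖ - c * ‖ev w s‖)]
  set X := ∫ s in (0 : ℝ)..1, ‖ev v s‖ * ‖ev w s‖
  rcases eq_or_ne w 0 with rfl | hw
  · have : ∀ c : ℝ, 2 * c * X ≤ ‖v‖ ^ 2 := by simpa using key
    by_contra! hX
    simp only [norm_zero, mul_zero] at hX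
    -- For w = 0 the quadratic term in `c` disappears, so a positive integral is excluded by a large
    -- `c`.
    have := this ((‖v‖ ^ 2 + 1) / X)
    field_simp at this
    nlinarith [sq_nonneg ‖v‖]
  · have hw' : 0 < ‖w‖ := norm_pos_iff.2 hw
    have h := key (‖v‖ / ‖w‖)
    rcases eq_or_ne v 0 with rfl | hv
    · have h0 := fun c => key c
      simp only [norm_zero] at h0
      by_contra! hX
      simp only [norm_zero, zero_mul] at hX
      have := h0 (X / ‖w‖ ^ 2)
      field_simp at this
      nlinarith
    · have hv' : 0 < ‖v‖ := norm_pos_iff.2 hv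
      field_simp at h
      nlinarith

theorem integral_norm_ev_le (v : L2) : ∫ s in (0 : ℝ)..1, ‖ev v s‖ ≤ ‖v‖ := by
  have h1 : ∫ s in (0 : ℝ)..1, (1 - ‖ev v s‖) = 1 - ∫ s in (0 : ℝ)..1, ‖ev v s‖ := by
    rw [intervalIntegral.integral_sub intervalIntegrable_const (intervalIntegrable_ev v 0 1).norm]; simp
  have key : ∀ c : ℝ, 2 * c * ∫ s in (0 : ℝ)..1, ‖ev v s‖ ≤ ‖v‖ ^ 2 + c ^ 2 := by
    intro c
    have h2 : ∫ s in (0 : ℝ)..1, (‖ev v s‖ ^ 2 + c ^ 2) = ‖v‖ ^ 2 + c ^ 2 := by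
      rw [intervalIntegral.integral_add (intervalIntegrable_norm_sq_ev v 0 1) intervalIntegrable_const,
        integral_norm_sq_ev]; simp
    rw [← h2, ← intervalIntegral.integral_const_mul]
    refine intervalIntegral.integral_mono_on (by norm_num) ((intervalIntegrable_ev v 0 1).norm.const_mul _)
      ((intervalIntegrable_norm_sq_ev v 0 1).add intervalIntegrable_const) ?_
    intro s _
    nlinarith [sq_nonneg (‖ev v s‖ - c)]
  set X := ∫ s in (0 : ℝ)..1, ‖ev v s‖
  have := key X
  exact le_of_sq_le_sq (by nlinarith) (norm_nonneg v)

/-! ### Curves -/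

/-- The total displacement `∫ v`. -/
def total : L2 →ₗ[ℝ] Plane where
  toFun v := ∫ s, v s
  map_add' := integral_add_L2
  map_smul' := integral_smul_L2

theorem total_eq (v : L2) : total v = ∫ s in (0 : ℝ)..1, ev v s := (integral_circle _).symm

/-- The curve `s ↦ p + ∫₀ˢ v`. -/
def curve (p : Plane) (v : L2) (s : ℝ) : Plane := p + ∫ r in (0 : ℝ)..s, ev v r

theorem continuous_curve (p : Plane) (v : L2) : Continuous (curve p v) :=
  continuous_const.add (intervalIntegral.continuous_primitive (intervalIntegrable_ev v) 0)

@[simp] theorem curve_zero (p : Plane) (v : L2) : curve p v 0 = p := by simp [curve]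

theorem curve_one (p : Plane) (v : L2) : curve p v 1 = p + total v := by rw [curve, total_eq]

theorem curve_sub_curve (p : Plane) (v : L2) (a b : ℝ) :
    curve p v b - curve p v a = ∫ r in a..b, ev v r := by
  simp only [curve, add_sub_add_left_eq_sub]
  exact intervalIntegral.integral_interval_sub_left (intervalIntegrable_ev v 0 b) (intervalIntegrable_ev v 0 a)

theorem curve_add_one (p : Plane) (v : L2) (s : ℝ) : curve p v (s + 1) = curve p v s + total v := by
  rw [← sub_eq_iff_eq_add', curve_sub_curve, total_eq]
  have := (ev_periodic v).intervalIntegral_add_eq s 0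
  simpa using this

theorem curve_translate (p z : Plane) (v : L2) (s : ℝ) : curve (p + z) v s = curve p v s + z := by
  simp only [curve]; abel

theorem curve_add (p q : Plane) (v w : L2) (s : ℝ) :
    curve (p + q) (v + w) s = curve p v s + curve q w s := by
  simp only [curve]
  rw [intervalIntegral.integral_congr_ae (g := fun r => ev v r + ev w r)
    ((ev_add v w).mono fun _ h _ => h), intervalIntegral.integral_add (intervalIntegrable_ev v 0 s)
    (intervalIntegrable_ev w 0 s)]
  abel

theorem curve_smul (c : ℝ) (p : Plane) (v : L2) (s : ℝ) : curve (c • p) (c • v) s = c • curve p v s := by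
  simp only [curve]
  rw [intervalIntegral.integral_congr_ae (g := fun r => c • ev v r)
    ((ev_smul c v).mono fun _ h _ => h), intervalIntegral.integral_smul, smul_add]

theorem norm_curve_le (p : Plane) (v : L2) {s : ℝ} (hs : s ∈ Icc (0 : ℝ) 1) :
    ‖curve p v s‖ ≤ ‖p‖ + ‖v‖ := by
  refine (norm_add_le _ _).trans (add_le_add le_rfl ?_)
  refine (intervalIntegral.norm_integral_le_integral_norm hs.1).trans (le_trans ?_ (integral_norm_ev_le v))
  exact intervalIntegral.integral_mono_interval le_rfl hs.1 hs.2
    (ae_of_all _ fun _ => norm_nonneg _) (intervalIntegrable_ev v 0 1).norm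

/-- The curve as a continuous map on the unit interval, depending linearly on its data. -/
def curveC : (Plane × L2) →L[ℝ] CI Plane :=
  LinearMap.mkContinuous
    { toFun := fun x => CI.mk (fun s => curve x.1 x.2 s) ((continuous_curve x.1 x.2).comp continuous_subtype_val)
      map_add' := fun x y => by ext1 s; exact curve_add _ _ _ _ _
      map_smul' := fun c x => by ext1 s; exact curve_smul _ _ _ _ } 2 (fun x => by
    rw [CI.norm_le (by positivity)]
    intro s
    refine (norm_curve_le x.1 x.2 s.2).trans ?_
    have h1 := norm_fst_le x
    have h2 := norm_snd_le x
    linarith)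

@[simp] theorem curveC_apply (x : Plane × L2) (s : unitInterval) : curveC x s = curve x.1 x.2 s := rfl

theorem norm_curveC_le (x : Plane × L2) : ‖curveC x‖ ≤ 2 * ‖x‖ :=
  (curveC.le_opNorm x).trans (mul_le_mul_of_nonneg_right
    (LinearMap.mkContinuous_norm_le _ (by norm_num) _) (norm_nonneg x))

theorem norm_total_le (v : L2) : ‖total v‖ ≤ ‖v‖ := by
  rw [total_eq]
  exact (intervalIntegral.norm_integral_le_integral_norm (by norm_num)).trans (integral_norm_ev_le v)

theorem continuous_total : Continuous total :=
  (total.mkContinuous 1 fun v => by simpa using norm_total_le v).continuous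

/-! ### Integrals along curves as continuous multilinear maps -/

/-- Extension of a continuous function on the unit interval to the line. -/
def ext01 {F : Type*} [NormedAddCommGroup F] (Q : CI F) (s : ℝ) : F := Q (projIcc 0 1 zero_le_one s)

theorem ext01_of_mem {F : Type*} [NormedAddCommGroup F] (Q : CI F) {s : ℝ} (hs : s ∈ Icc (0:ℝ) 1) :
    ext01 Q s = Q ⟨s, hs⟩ := by simp only [ext01]; rw [projIcc_of_mem]

theorem continuous_ext01 {F : Type*} [NormedAddCommGroup F] (Q : CI F) : Continuous (ext01 Q) :=
  Q.continuous.comp continuous_projIcc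

theorem norm_ext01_le {F : Type*} [NormedAddCommGroup F] (Q : CI F) (s : ℝ) : ‖ext01 Q s‖ ≤ ‖Q‖ :=
  Q.norm_apply_le _

theorem norm_ext01_apply_le (Q : CI Covec) (s : ℝ) (v : Plane) : ‖ext01 Q s v‖ ≤ ‖Q‖ * ‖v‖ :=
  (ContinuousLinearMap.le_opNorm _ _).trans
    (mul_le_mul_of_nonneg_right (norm_ext01_le Q s) (norm_nonneg v))

theorem norm_ext01_apply₂_le (Q : CI QForm) (s : ℝ) (v w : Plane) :
    ‖ext01 Q s v w‖ ≤ ‖Q‖ * (‖v‖ * ‖w‖) := by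
  refine (QForm.norm_apply_le _ _ _).trans ?_
  rw [mul_assoc]
  exact mul_le_mul_of_nonneg_right (norm_ext01_le Q s) (by positivity)

theorem integrable_lin (Q : CI Covec) (v : L2) (a b : ℝ) :
    IntervalIntegrable (fun s => ext01 Q s (ev v s)) volume a b := by
  refine IntervalIntegrable.mono_fun' (g := fun s => ‖Q‖ * ‖ev v s‖)
    ((intervalIntegrable_ev v a b).norm.const_mul _) ?_ (ae_of_all _ fun s => ?_)
  · have h : Continuous fun x : Covec × Plane => x.1 x.2 := by fun_prop
    exact (h.comp_aestronglyMeasurable ((continuous_ext01 Q).aestronglyMeasurable.prodMk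
      (aestronglyMeasurable_ev v))).restrict
  · exact norm_ext01_apply_le Q s _

theorem integrable_bil (Q : CI QForm) (v w : L2) (a b : ℝ) :
    IntervalIntegrable (fun s => ext01 Q s (ev v s) (ev w s)) volume a b := by
  refine IntervalIntegrable.mono_fun' (g := fun s => ‖Q‖ * (‖ev v s‖ * ‖ev w s‖))
    ((intervalIntegrable_norm_mul_ev v w a b).const_mul _) ?_ (ae_of_all _ fun s => ?_)
  · exact (QForm.continuous_apply.comp_aestronglyMeasurable ((continuous_ext01 Q).aestronglyMeasurable.prodMk
      ((aestronglyMeasurable_ev v).prodMk (aestronglyMeasurable_ev w)))).restrict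
  · exact norm_ext01_apply₂_le Q s _ _

/-- `Lin Q v = ∫₀¹ Q (v)`. -/
def Lin : CI Covec →L[ℝ] L2 →L[ℝ] ℝ :=
  LinearMap.mkContinuous₂ (LinearMap.mk₂ ℝ (fun Q v => ∫ s in (0 : ℝ)..1, ext01 Q s (ev v s))
    (fun Q Q' v => by
      rw [← intervalIntegral.integral_add (integrable_lin Q v 0 1) (integrable_lin Q' v 0 1)]; rfl)
    (fun c Q v => by rw [← intervalIntegral.integral_smul]; rfl)
    (fun Q v w => by
      rw [← intervalIntegral.integral_add (integrable_lin Q v 0 1) (integrable_lin Q w 0 1)]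
      exact intervalIntegral.integral_congr_ae ((ev_add v w).mono fun s h _ => by rw [h, map_add]))
    (fun c Q v => by
      rw [← intervalIntegral.integral_smul]
      exact intervalIntegral.integral_congr_ae ((ev_smul c v).mono fun s h _ => by rw [h, map_smul]))) 1
    (fun Q v => by
      simp only [LinearMap.mk₂_apply, one_mul]
      refine (intervalIntegral.norm_integral_le_of_norm_le (g := fun s => ‖Q‖ * ‖ev v s‖) (by norm_num)
        (ae_of_all _ fun s _ => ?_) ((intervalIntegrable_ev v 0 1).norm.const_mul _)).trans ?_
      · exact norm_ext01_apply_le Q s _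
      · rw [intervalIntegral.integral_const_mul]; gcongr; exact integral_norm_ev_le v)

theorem Lin_apply (Q : CI Covec) (v : L2) : Lin Q v = ∫ s in (0 : ℝ)..1, ext01 Q s (ev v s) := rfl

theorem norm_Lin_le (Q : CI Covec) (v : L2) : |Lin Q v| ≤ ‖Q‖ * ‖v‖ := by
  have h := Lin.le_opNorm₂ Q v
  have h1 : ‖Lin‖ ≤ 1 := LinearMap.mkContinuous₂_norm_le _ zero_le_one _
  rw [Real.norm_eq_abs] at h
  nlinarith [mul_nonneg (norm_nonneg Q) (norm_nonneg v)]

/-- For fixed `Q`, the bilinear form `∫₀¹ Q (v, w)` on square integrable functions. -/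
def bilAux (Q : CI QForm) : L2 →L[ℝ] L2 →L[ℝ] ℝ :=
  LinearMap.mkContinuous₂ (LinearMap.mk₂ ℝ (fun v w => ∫ s in (0 : ℝ)..1, ext01 Q s (ev v s) (ev w s))
    (fun v v' w => by
      rw [← intervalIntegral.integral_add (integrable_bil Q v w 0 1) (integrable_bil Q v' w 0 1)]
      exact intervalIntegral.integral_congr_ae ((ev_add v v').mono fun s h _ => by
        rw [h, QForm.app_add]; rfl))
    (fun c v w => by
      rw [← intervalIntegral.integral_smul]
      exact intervalIntegral.integral_congr_ae ((ev_smul c v).mono fun s h _ => by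
        rw [h, QForm.app_smul]; rfl))
    (fun v w w' => by
      rw [← intervalIntegral.integral_add (integrable_bil Q v w 0 1) (integrable_bil Q v w' 0 1)]
      exact intervalIntegral.integral_congr_ae ((ev_add w w').mono fun s h _ => by rw [h, map_add]))
    (fun c v w => by
      rw [← intervalIntegral.integral_smul]
      exact intervalIntegral.integral_congr_ae ((ev_smul c w).mono fun s h _ => by rw [h, map_smul]))) ‖Q‖
    (fun v w => by
      simp only [LinearMap.mk₂_apply]
      refine (intervalIntegral.norm_integral_le_of_norm_le (g := fun s => ‖Q‖ * (‖ev v s‖ * ‖ev w s‖))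
        (by norm_num)
        (ae_of_all _ fun s _ => ?_) ((intervalIntegrable_norm_mul_ev v w 0 1).const_mul _)).trans ?_
      · exact norm_ext01_apply₂_le Q s _ _
      · rw [intervalIntegral.integral_const_mul, mul_assoc]; gcongr; exact integral_norm_mul_ev_le v w)

theorem norm_bilAux_le (Q : CI QForm) : ‖bilAux Q‖ ≤ ‖Q‖ := by
  unfold bilAux
  exact LinearMap.mkContinuous₂_norm_le _ (norm_nonneg _) _

/-- `Bil Q v w = ∫₀¹ Q (v, w)`. -/
def Bil : CI QForm →L[ℝ] L2 →L[ℝ] L2 →L[ℝ] ℝ :=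
  LinearMap.mkContinuous
    { toFun := bilAux
      map_add' := fun Q Q' => by
        ext v w
        exact (intervalIntegral.integral_add (integrable_bil Q v w 0 1) (integrable_bil Q' v w 0 1))
      map_smul' := fun c Q => by
        ext v w
        exact (intervalIntegral.integral_smul c (fun s => ext01 Q s (ev v s) (ev w s))) } 1
    (fun Q => by
      rw [one_mul]
      exact norm_bilAux_le Q)

theorem Bil_apply (Q : CI QForm) (v w : L2) :
    Bil Q v w = ∫ s in (0 : ℝ)..1, ext01 Q s (ev v s) (ev w s) := rfl

theorem norm_Bil_le (Q : CI QForm) (v w : L2) : |Bil Q v w| ≤ ‖Q‖ * ‖v‖ * ‖w‖ := by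
  have h := (Bil Q).le_opNorm₂ v w
  have h1 : ‖Bil Q‖ ≤ ‖Q‖ := norm_bilAux_le Q
  rw [Real.norm_eq_abs] at h
  exact h.trans (by gcongr)

/-! ### The lattice and periodic functions -/

theorem proj_eq_iff {p p' : Plane} : proj p = proj p' ↔ p' - p ∈ lattice := by
  constructor
  · intro h i
    have hi : ((p i : ℝ) : UnitAddCircle) = (p' i : ℝ) := congrFun h i
    obtain ⟨z, hz⟩ := (QuotientAddGroup.eq.1 hi)
    exact ⟨z, by simp at hz; simp; linarith⟩
  · intro h
    funext i
    obtain ⟨z, hz⟩ := h i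
    refine QuotientAddGroup.eq.2 ⟨z, ?_⟩
    simp at hz ⊢; linarith

theorem proj_add_lattice {z : Plane} (hz : z ∈ lattice) (p : Plane) : proj (p + z) = proj p :=
  (proj_eq_iff.2 (by simpa using hz)).symm

theorem proj_add (p p' : Plane) : proj (p + p') = proj p + proj p' := rfl

theorem proj_rep (q : Torus) : proj (rep q) = q := by
  funext i
  have := (AddCircle.equivIco (1 : ℝ) 0).symm_apply_apply (q i)
  exact this

theorem rep_mem (q : Torus) (i : Fin 2) : rep q i ∈ Ico (0 : ℝ) 1 := by
  have := (AddCircle.equivIco (1 : ℝ) 0 (q i)).2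
  simpa [rep] using this

theorem continuous_proj : Continuous proj := by
  refine continuous_pi fun i => ?_
  exact (AddCircle.continuous_mk' 1).comp (by fun_prop : Continuous fun p : Plane => p i)

theorem norm_le_of_Icc {p : Plane} (h : ∀ i, p i ∈ Icc (0 : ℝ) 1) : ‖p‖ ≤ 2 := by
  rw [EuclideanSpace.norm_eq, Fin.sum_univ_two, Real.sqrt_le_left (by norm_num)]
  have h0 := h 0
  have h1 := h 1
  simp only [Real.norm_eq_abs, sq_abs]
  nlinarith [h0.1, h0.2, h1.1, h1.2]

theorem norm_rep_le (q : Torus) : ‖rep q‖ ≤ 2 :=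
  norm_le_of_Icc fun i => Ico_subset_Icc_self (rep_mem q i)

/-- Invariance under the lattice. -/
def LatticePeriodic {F : Type*} (G : Plane → F) : Prop := ∀ p, ∀ z ∈ lattice, G (p + z) = G p

theorem LatticePeriodic.eq_rep {F : Type*} {G : Plane → F} (h : LatticePeriodic G) (p : Plane) :
    G p = G (rep (proj p)) := by
  have h1 : proj p = proj (rep (proj p)) := (proj_rep _).symm
  have := h p _ (proj_eq_iff.1 h1)
  rw [← this]; congr 1; abel

theorem LatticePeriodic.fderiv {F : Type*} [NormedAddCommGroup F] [NormedSpace ℝ F] {G : Plane → F}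
    (h : LatticePeriodic G) : LatticePeriodic (fderiv ℝ G) := fun p z hz => by
  have : (fun x => G (x + z)) = G := funext fun x => h x z hz
  rw [← fderiv_comp_add_right, this]

/-- All values are attained on the fundamental square, which lies in the compact ball of radius 2.
-/
theorem LatticePeriodic.exists_norm_le {F : Type*} [NormedAddCommGroup F] {G : Plane → F}
    (h : LatticePeriodic G) (hc : Continuous G) : ∃ C, 0 < C ∧ ∀ p, ‖G p‖ ≤ C := by
  obtain ⟨C, hC⟩ := (isCompact_closedBall (0 : Plane) 2).exists_bound_of_continuousOn hc.continuousOn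
  refine ⟨max C 1, by positivity, fun p => ?_⟩
  rw [h.eq_rep p]
  exact (hC _ (by simpa using norm_rep_le _)).trans (le_max_left _ _)

theorem LatticePeriodic.exists_lipschitz {F : Type*} [NormedAddCommGroup F] [NormedSpace ℝ F] {G : Plane → F}
    (h : LatticePeriodic G) (hc : ContDiff ℝ 1 G) : ∃ C, 0 < C ∧ ∀ p p', ‖G p - G p'‖ ≤ C * ‖p - p'‖ := by
  obtain ⟨C, hC, hb⟩ := h.fderiv.exists_norm_le (hc.continuous_fderiv one_ne_zero)
  refine ⟨C, hC, fun p p' => ?_⟩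
  exact Convex.norm_image_sub_le_of_norm_fderiv_le (fun x _ => (hc.differentiable one_ne_zero) x)
    (fun x _ => hb x) convex_univ (mem_univ _) (mem_univ _)

theorem RiemannianMetric.latticePeriodic (g : RiemannianMetric) : LatticePeriodic g.toFun := fun _ _ hz =>
  g.periodic _ _ (proj_add_lattice hz _)

theorem TwoForm.latticePeriodic (σ : TwoForm) : LatticePeriodic σ.density := fun _ _ hz =>
  σ.periodic _ _ (proj_add_lattice hz _)

/-- The metric is positive on the compact set of unit vectors over the ball of radius 2, so it has a
positive minimum there; periodicity and homogeneity extend the bound to all vectors. -/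
theorem RiemannianMetric.exists_coercive (g : RiemannianMetric) :
    ∃ c, 0 < c ∧ ∀ p v, c * ‖v‖ ^ 2 ≤ g.toFun p v v := by
  have hcomp : IsCompact ((Metric.closedBall (0 : Plane) 2) ×ˢ Metric.sphere (0 : Plane) 1) :=
    (isCompact_closedBall _ _).prod (isCompact_sphere _ _)
  have hcont : Continuous fun x : Plane × Plane => g.toFun x.1 x.2 x.2 := by
    have := g.smooth.continuous
    fun_prop
  have hne : ((Metric.closedBall (0 : Plane) 2) ×ˢ Metric.sphere (0 : Plane) 1).Nonempty :=
    ⟨(0, EuclideanSpace.single 0 1), by simp⟩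
  obtain ⟨x, hx, hmin⟩ := hcomp.exists_isMinOn hne hcont.continuousOn
  have hx2 : x.2 ≠ 0 := by
    intro h; have := hx.2; simp [h] at this
  refine ⟨_, g.pos x.1 x.2 hx2, fun p v => ?_⟩
  rcases eq_or_ne v 0 with rfl | hv
  · simp
  rw [g.latticePeriodic.eq_rep p]
  have hv' : ‖v‖ ≠ 0 := norm_ne_zero_iff.2 hv
  have h := hmin (show (rep (proj p), ‖v‖⁻¹ • v) ∈ _ from
    ⟨by simpa using norm_rep_le _, by simp [norm_smul, hv']⟩)
  simp only [mem_ofPred_eq, map_smul, smul_apply, smul_eq_mul] at h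
  have e : ‖v‖⁻¹ * (‖v‖⁻¹ * g.toFun (rep (proj p)) v v) * ‖v‖ ^ 2 = g.toFun (rep (proj p)) v v := by
    field_simp
  rw [← e]
  gcongr

/-! ### Superposition operators -/

section Superposition

variable {F : Type*} [NormedAddCommGroup F]

/-- The superposition operator `x ↦ G ∘ x`. -/
def nem {G : Plane → F} (hG : Continuous G) (x : CI Plane) : CI F :=
  CI.mk (fun s => G (x s)) (hG.comp x.continuous)

@[simp] theorem nem_apply {G : Plane → F} (hG : Continuous G) (x : CI Plane) (s : unitInterval) :
    nem hG x s = G (x s) := rfl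

theorem continuous_nem {G : Plane → F} (hG : Continuous G) : Continuous (nem hG) :=
  ContinuousMap.continuous_postcomp (X := unitInterval) (⟨G, hG⟩ : C(Plane, F))

theorem norm_nem_le {G : Plane → F} (hG : Continuous G) {C : ℝ} (hb : ∀ p, ‖G p‖ ≤ C) (x : CI Plane) :
    ‖nem hG x‖ ≤ C :=
  (CI.norm_le ((norm_nonneg _).trans (hb 0))).2 fun _ => hb _

theorem norm_nem_sub_le {G : Plane → F} (hG : Continuous G) {C : ℝ} (hC : 0 ≤ C)
    (hb : ∀ p p', ‖G p - G p'‖ ≤ C * ‖p - p'‖) (x y : CI Plane) : ‖nem hG x - nem hG y‖ ≤ C * ‖x - y‖ :=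
  (CI.norm_le (by positivity)).2 fun s =>
    (hb _ _).trans (mul_le_mul_of_nonneg_left ((x - y).norm_apply_le s) hC)

variable [NormedSpace ℝ F]

/-- Pointwise application of linear maps to vectors. -/
def applyC : CI (Plane →L[ℝ] F) →L[ℝ] CI Plane →L[ℝ] CI F :=
  LinearMap.mkContinuous₂ (LinearMap.mk₂ ℝ
    (fun (Q : CI (Plane →L[ℝ] F)) (ξ : CI Plane) => CI.mk (fun s => Q s (ξ s)) (Q.continuous.clm_apply ξ.continuous))
    (fun _ _ _ => by ext s; simp) (fun _ _ _ => by ext s; simp)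
    (fun _ _ _ => by ext s; simp) (fun _ _ _ => by ext s; simp)) 1
    (fun Q ξ => by
      rw [one_mul]
      refine (CI.norm_le (by positivity)).2 fun s => ((Q s).le_opNorm _).trans ?_
      exact mul_le_mul (Q.norm_apply_le s) (ξ.norm_apply_le s) (norm_nonneg _) (norm_nonneg _))

@[simp] theorem applyC_apply (Q : CI (Plane →L[ℝ] F)) (ξ : CI Plane) (s : unitInterval) :
    applyC Q ξ s = Q s (ξ s) := rfl

theorem norm_applyC_le (Q : CI (Plane →L[ℝ] F)) (ξ : CI Plane) : ‖applyC Q ξ‖ ≤ ‖Q‖ * ‖ξ‖ := by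
  refine (CI.norm_le (by positivity)).2 fun s => ((Q s).le_opNorm _).trans ?_
  exact mul_le_mul (Q.norm_apply_le s) (ξ.norm_apply_le s) (norm_nonneg _) (norm_nonneg _)

/-- Continuity of the superposition operator of `G'` already contains the uniformity needed along
the curve: tested on constant displacements it gives one δ for all parameters. The mean value
inequality on balls of radius δ then bounds the remainder. -/
theorem hasFDerivAt_nem {G : Plane → F} {G' : Plane → Plane →L[ℝ] F} (hG : Continuous G)
    (hG' : Continuous G') (hd : ∀ p, HasFDerivAt G (G' p) p) (x : CI Plane) :
    HasFDerivAt (nem hG) (applyC (nem hG' x)) x := by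
  rw [hasFDerivAt_iff_isLittleO_nhds_zero, Asymptotics.isLittleO_iff]
  intro ε hε
  obtain ⟨δ, hδ, hb⟩ := Metric.continuousAt_iff.1 ((continuous_nem hG').continuousAt (x := x)) ε hε
  have hb' : ∀ s : unitInterval, ∀ h : Plane, ‖h‖ < δ → ‖G' (x s + h) - G' (x s)‖ ≤ ε := by
    intro s h hh
    have h1 := hb (x := x + CI.mk (fun _ => h) continuous_const) (by
      rw [dist_eq_norm, add_sub_cancel_left]
      exact ((CI.norm_le (norm_nonneg h)).2 fun _ => le_rfl).trans_lt hh)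
    rw [dist_eq_norm] at h1
    exact ((CI.norm_apply_le _ s).trans h1.le)
  filter_upwards [Metric.ball_mem_nhds (0 : CI Plane) hδ] with ξ hξ
  rw [mem_ball_zero_iff] at hξ
  refine (CI.norm_le (by positivity)).2 fun s => ?_
  have hs : ‖ξ s‖ ≤ ‖ξ‖ := ξ.norm_apply_le s
  have h2 := (convex_ball (x s) δ).norm_image_sub_le_of_norm_hasFDerivWithin_le'
    (f := G) (f' := G') (φ := G' (x s)) (x := x s) (y := x s + ξ s) (C := ε)
    (fun y _ => (hd y).hasFDerivWithinAt) (fun y hy => by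
      have := hb' s (y - x s) (by simpa [dist_eq_norm] using hy)
      simpa using this) (Metric.mem_ball_self hδ) (by simpa using hs.trans_lt hξ)
  simp only [add_sub_cancel_left] at h2
  exact h2.trans (by gcongr)

end Superposition

/-! ### Integration by parts along curves -/

/-- Integral identities along curves are checked for continuous velocities, where the fundamental
theorem of calculus applies, and extended by density. -/
theorem dense_continuous_L2 : DenseRange (ContinuousMap.toLp (E := Plane) 2 (volume : Measure UnitAddCircle) ℝ) :=
  ContinuousMap.toLp_denseRange Plane volume ℝ (p := 2) ENNReal.ofNat_ne_top

theorem hasDerivAt_curve_toLp (p : Plane) (f : C(UnitAddCircle, Plane)) (s : ℝ) :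
    HasDerivAt (curve p (ContinuousMap.toLp (E := Plane) 2 volume ℝ f)) (f (s : UnitAddCircle)) s := by
  have he : ∀ᵐ r : ℝ, ev (ContinuousMap.toLp (E := Plane) 2 volume ℝ f) r = f (r : UnitAddCircle) :=
    ae_of_ae_circle (P := fun x => (ContinuousMap.toLp (E := Plane) 2 volume ℝ f) x = f x)
      (ContinuousMap.coeFn_toLp volume f)
  have hc : Continuous fun r : ℝ => f (r : UnitAddCircle) := f.continuous.comp (AddCircle.continuous_mk' 1)
  have h1 : curve p (ContinuousMap.toLp (E := Plane) 2 volume ℝ f)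
      = fun s => p + ∫ r in (0 : ℝ)..s, f (r : UnitAddCircle) := by
    funext s
    simp only [curve]
    rw [intervalIntegral.integral_congr_ae (he.mono fun _ h _ => h)]
  rw [h1]
  exact (hc.integral_hasStrictDerivAt 0 s).hasDerivAt.const_add p

/-- For continuous velocities the left-hand side integrates the derivative of s ↦ Θ(x(s))(h(s)); the
flip puts the velocity of the curve into the slot of differentiation. Both sides are continuous in
the two velocities. -/
theorem integral_by_parts {Θ : Plane → Covec} {Θ' : Plane → BilForm} (hΘ : Continuous Θ)
    (hΘ' : Continuous fun p => (Θ' p).flip) (hd : ∀ p, HasFDerivAt Θ (Θ' p) p) (x h : Plane × L2) :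
    Lin (applyC (nem hΘ' (curveC x)) (curveC h)) x.2 + Lin (nem hΘ (curveC x)) h.2
      = Θ (x.1 + total x.2) (h.1 + total h.2) - Θ x.1 h.1 := by
  obtain ⟨p, v⟩ := x
  obtain ⟨a, w⟩ := h
  refine isClosed_property2 dense_continuous_L2 (p := fun v w =>
    Lin (applyC (nem hΘ' (curveC (p, v))) (curveC (a, w))) v + Lin (nem hΘ (curveC (p, v))) w
      = Θ (p + total v) (a + total w) - Θ p a) ?_ ?_ v w
  · have c1 := continuous_nem (F := BilForm) hΘ'
    have c2 := continuous_nem (F := Covec) hΘ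
    have c3 := continuous_total
    refine isClosed_eq ?_ ?_ <;> fun_prop
  · intro f1 f2
    have h1 := hasDerivAt_curve_toLp p f1
    have h2 := hasDerivAt_curve_toLp a f2
    have e1 : ∀ᵐ r : ℝ, ev (ContinuousMap.toLp (E := Plane) 2 volume ℝ f1) r = f1 (r : UnitAddCircle) :=
      ae_of_ae_circle (P := fun x => (ContinuousMap.toLp (E := Plane) 2 volume ℝ f1) x = f1 x)
        (ContinuousMap.coeFn_toLp volume f1)
    have e2 : ∀ᵐ r : ℝ, ev (ContinuousMap.toLp (E := Plane) 2 volume ℝ f2) r = f2 (r : UnitAddCircle) :=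
      ae_of_ae_circle (P := fun x => (ContinuousMap.toLp (E := Plane) 2 volume ℝ f2) x = f2 x)
        (ContinuousMap.coeFn_toLp volume f2)
    set v := ContinuousMap.toLp (E := Plane) 2 (volume : Measure UnitAddCircle) ℝ f1
    set w := ContinuousMap.toLp (E := Plane) 2 (volume : Measure UnitAddCircle) ℝ f2
    have hc1 : Continuous fun r : ℝ => f1 (r : UnitAddCircle) := f1.continuous.comp (AddCircle.continuous_mk' 1)
    have hc2 : Continuous fun r : ℝ => f2 (r : UnitAddCircle) := f2.continuous.comp (AddCircle.continuous_mk' 1)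
    have h3 : ∀ s : ℝ, HasDerivAt (fun s => Θ (curve p v s) (curve a w s))
        ((Θ' (curve p v s)).flip (curve a w s) (f1 (s : UnitAddCircle)) + Θ (curve p v s) (f2 (s : UnitAddCircle))) s := by
      intro s
      have h4 := ((hd (curve p v s)).comp_hasDerivAt s (h1 s)).clm_apply (h2 s)
      exact h4
    have hI := intervalIntegral.integral_eq_sub_of_hasDerivAt (a := 0) (b := 1) (fun s _ => h3 s)
      (by
        have cc1 := continuous_curve p v
        have cc2 := continuous_curve a w
        have := hΘ'.comp cc1
        have := hΘ.comp cc1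
        refine Continuous.intervalIntegrable ?_ _ _
        fun_prop)
    rw [curve_one, curve_one, curve_zero, curve_zero] at hI
    rw [← hI, Lin_apply, Lin_apply, ← intervalIntegral.integral_add (integrable_lin _ _ _ _) (integrable_lin _ _ _ _)]
    refine intervalIntegral.integral_congr_ae ?_
    filter_upwards [e1, e2] with s hs1 hs2 hs
    rw [uIoc_of_le zero_le_one] at hs
    have hs' : s ∈ Icc (0 : ℝ) 1 := Ioc_subset_Icc_self hs
    rw [ext01_of_mem _ hs', ext01_of_mem _ hs', hs1, hs2]
    simp

/-! ### A primitive of a periodic two-form on the plane -/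

/-- The coordinate covectors. -/
def dq (i : Fin 2) : Covec := EuclideanSpace.proj i

@[simp] theorem dq_apply (i : Fin 2) (v : Plane) : dq i v = v i := rfl

/-- The standard area form. -/
def cross : BilForm := (dq 0).smulRight (dq 1) - (dq 1).smulRight (dq 0)

@[simp] theorem cross_apply (v w : Plane) : cross v w = v 0 * w 1 - v 1 * w 0 := by simp [cross]

/-- The bilinear form of a two-form at a point. -/
def TwoForm.form (σ : TwoForm) (p : Plane) : BilForm := σ.density p • cross

theorem TwoForm.form_apply (σ : TwoForm) (p v w : Plane) : σ.form p v w = σ.eval p v w := by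
  simp [TwoForm.form, TwoForm.eval]

theorem TwoForm.continuous_density (σ : TwoForm) : Continuous σ.density := σ.smooth.continuous

theorem TwoForm.continuous_form (σ : TwoForm) : Continuous σ.form :=
  σ.continuous_density.smul continuous_const

theorem abs_cross_le (v w : Plane) : |v 0 * w 1 - v 1 * w 0| ≤ 2 * ‖v‖ * ‖w‖ := by
  have h := fun (u : Plane) i => PiLp.norm_apply_le u i
  simp only [Real.norm_eq_abs] at h
  calc |v 0 * w 1 - v 1 * w 0| ≤ |v 0 * w 1| + |v 1 * w 0| := abs_sub _ _
    _ ≤ ‖v‖ * ‖w‖ + ‖v‖ * ‖w‖ := by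
      rw [abs_mul, abs_mul]
      exact add_le_add (mul_le_mul (h v 0) (h w 1) (abs_nonneg _) (norm_nonneg _))
        (mul_le_mul (h v 1) (h w 0) (abs_nonneg _) (norm_nonneg _))
    _ = _ := by ring

theorem TwoForm.norm_form_le (σ : TwoForm) (p : Plane) : ‖σ.form p‖ ≤ ‖σ.density p‖ * 2 :=
  ContinuousLinearMap.opNorm_le_bound₂ _ (by positivity) fun v w => by
    rw [TwoForm.form_apply, TwoForm.eval, norm_mul, mul_assoc, mul_assoc]
    refine mul_le_mul_of_nonneg_left ?_ (norm_nonneg _)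
    rw [← mul_assoc]; exact abs_cross_le v w

theorem TwoForm.norm_form_sub_le (σ : TwoForm) (p p' : Plane) :
    ‖σ.form p - σ.form p'‖ ≤ ‖σ.density p - σ.density p'‖ * 2 :=
  ContinuousLinearMap.opNorm_le_bound₂ _ (by positivity) fun v w => by
    have : (σ.form p - σ.form p') v w = (σ.density p - σ.density p') * (v 0 * w 1 - v 1 * w 0) := by
      rw [sub_apply, sub_apply, TwoForm.form_apply, TwoForm.form_apply, TwoForm.eval, TwoForm.eval, sub_mul]
    rw [this, norm_mul, mul_assoc, mul_assoc]
    refine mul_le_mul_of_nonneg_left ?_ (norm_nonneg _)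
    rw [← mul_assoc]; exact abs_cross_le v w

theorem TwoForm.latticePeriodic_form (σ : TwoForm) : LatticePeriodic σ.form := fun p z hz => by
  simp only [TwoForm.form, σ.latticePeriodic p z hz]

/-- Integration over the unit interval. -/
def int01 : CI ℝ →L[ℝ] ℝ :=
  LinearMap.mkContinuous
    { toFun := fun f => ∫ s in (0 : ℝ)..1, ext01 f s
      map_add' := fun f f' => intervalIntegral.integral_add
        ((continuous_ext01 f).intervalIntegrable _ _) ((continuous_ext01 f').intervalIntegrable _ _)
      map_smul' := fun c f => intervalIntegral.integral_smul c _ } 1 (fun f => by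
    rw [one_mul]
    change ‖∫ s in (0 : ℝ)..1, ext01 f s‖ ≤ ‖f‖
    simpa using intervalIntegral.norm_integral_le_of_norm_le_const (a := 0) (b := 1)
      (fun s _ => norm_ext01_le f s))

theorem int01_apply (f : CI ℝ) : int01 f = ∫ s in (0 : ℝ)..1, ext01 f s := rfl

/-- The horizontal segment that ends at `q`. -/
def hseg : Plane →L[ℝ] CI Plane :=
  LinearMap.mkContinuous
    { toFun := fun q => CI.mk (fun t : unitInterval => !₂[(t : ℝ) * q 0, q 1]) (by fun_prop)
      map_add' := fun q q' => by ext t i; fin_cases i <;> simp [mul_add]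
      map_smul' := fun c q => by ext t i; fin_cases i <;> simp; ring } 1 (fun q => by
    rw [one_mul]
    refine (CI.norm_le (norm_nonneg _)).2 fun t => ?_
    simp only [LinearMap.coe_mk, AddHom.coe_mk, CI.mk_apply]
    rw [EuclideanSpace.norm_eq, EuclideanSpace.norm_eq]
    refine Real.sqrt_le_sqrt ?_
    simp only [Fin.sum_univ_two, Matrix.cons_val_zero, Matrix.cons_val_one, Real.norm_eq_abs, sq_abs]
    have h0 := t.2.1
    have h1 := t.2.2
    have : (t : ℝ) ^ 2 ≤ 1 := by nlinarith
    nlinarith [sq_nonneg (q 0)])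

section Primitive

variable (σ : TwoForm)

/-- The mean of the density over a horizontal segment. -/
def hmean (q : Plane) : ℝ := int01 (nem σ.continuous_density (hseg q))

theorem hmean_eq (q : Plane) : hmean σ q = ∫ t in (0 : ℝ)..1, σ.density !₂[t * q 0, q 1] := by
  rw [hmean, int01_apply]
  refine intervalIntegral.integral_congr fun t ht => ?_
  rw [uIcc_of_le zero_le_one] at ht
  simp only [ext01_of_mem _ ht]; rfl

/-- The coefficient of `dq²` in a primitive of the two-form. -/
def primCoeff (q : Plane) : ℝ := q 0 * hmean σ q

/-- The integral of the density over a horizontal period. -/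
def hflux (y : ℝ) : ℝ := ∫ t in (0 : ℝ)..1, σ.density !₂[t, y]

theorem primCoeff_eq (q : Plane) : primCoeff σ q = ∫ t in (0 : ℝ)..q 0, σ.density !₂[t, q 1] := by
  rw [primCoeff, hmean_eq]
  have := intervalIntegral.mul_integral_comp_mul_right (a := 0) (b := 1)
    (f := fun t => σ.density !₂[t, q 1]) (c := q 0)
  simpa using this

theorem density_fderiv_continuous : Continuous (fderiv ℝ σ.density) :=
  σ.smooth.continuous_fderiv (by simp)

theorem hasFDerivAt_density (p : Plane) : HasFDerivAt σ.density (fderiv ℝ σ.density p) p :=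
  ((σ.smooth.differentiable (by simp)) p).hasFDerivAt

/-- The differential of `primCoeff`. -/
def primCoeff' (q : Plane) : Covec :=
  q 0 • int01.comp ((applyC (nem (density_fderiv_continuous σ) (hseg q))).comp hseg) + hmean σ q • dq 0

/-- Writing the coefficient as q⁰ times a mean over a segment parametrized by the fixed unit
interval makes it a product of a linear form and a superposition operator, so no differentiation
under an integral with moving ends is needed. -/
theorem hasFDerivAt_primCoeff (q : Plane) : HasFDerivAt (primCoeff σ) (primCoeff' σ q) q := by
  have h1 : HasFDerivAt (hmean σ)
      (int01.comp ((applyC (nem (density_fderiv_continuous σ) (hseg q))).comp hseg)) q :=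
    int01.hasFDerivAt.comp q ((hasFDerivAt_nem σ.continuous_density (density_fderiv_continuous σ)
      (hasFDerivAt_density σ) (hseg q)).comp q hseg.hasFDerivAt)
  exact ((dq 0).hasFDerivAt (x := q)).mul h1

theorem continuous_hmean : Continuous (hmean σ) :=
  int01.continuous.comp ((continuous_nem _).comp hseg.continuous)

theorem continuous_primCoeff : Continuous (primCoeff σ) :=
  (dq 0).continuous.mul (continuous_hmean σ)

theorem continuous_primCoeff' : Continuous (primCoeff' σ) := by
  have h1 := continuous_hmean σ
  have h2 : Continuous fun q : Plane => applyC (nem (density_fderiv_continuous σ) (hseg q)) :=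
    applyC.continuous.comp ((continuous_nem _).comp hseg.continuous)
  have h3 : Continuous fun q : Plane => q 0 := (dq 0).continuous
  exact (h3.smul (continuous_const.clm_comp (h2.clm_comp continuous_const))).add (h1.smul continuous_const)

theorem primCoeff'_single (q : Plane) : primCoeff' σ q (EuclideanSpace.single 0 1) = σ.density q := by
  have h1 : HasDerivAt (fun t : ℝ => q + t • (EuclideanSpace.single 0 1 : Plane)) (EuclideanSpace.single 0 1) 0 := by
    simpa using ((hasDerivAt_id (0:ℝ)).smul_const (EuclideanSpace.single 0 1 : Plane)).const_add q
  have h0 : HasFDerivAt (primCoeff σ) (primCoeff' σ q) (q + (0 : ℝ) • (EuclideanSpace.single 0 1 : Plane)) := by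
    simpa using hasFDerivAt_primCoeff σ q
  have h2 := h0.comp_hasDerivAt (0 : ℝ) h1
  have hc : Continuous fun t : ℝ => σ.density !₂[t, q 1] := σ.continuous_density.comp (by fun_prop)
  have h3 : HasDerivAt (fun t : ℝ => ∫ r in (0 : ℝ)..(q 0 + t), σ.density !₂[r, q 1]) (σ.density !₂[q 0 + 0, q 1]) 0 := by
    have := (hc.integral_hasStrictDerivAt 0 (q 0 + 0)).hasDerivAt.comp (0 : ℝ) ((hasDerivAt_id (0 : ℝ)).const_add (q 0))
    simpa [Function.comp_def] using this
  have h4 : (primCoeff σ ∘ fun t : ℝ => q + t • (EuclideanSpace.single 0 1 : Plane))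
      = fun t : ℝ => ∫ r in (0 : ℝ)..(q 0 + t), σ.density !₂[r, q 1] := by
    funext t; simp [primCoeff_eq]
  rw [h4] at h2
  have := h2.unique h3
  rw [this]
  congr 1
  ext i; fin_cases i <;> simp

/-- In d(f dq²) only the horizontal partial derivative of f survives, and that one is the density by
`primCoeff'_single`. -/
theorem primCoeff'_antisymm (q v w : Plane) :
    primCoeff' σ q v * w 1 - primCoeff' σ q w * v 1 = σ.density q * (v 0 * w 1 - v 1 * w 0) := by
  have h : ∀ v : Plane, primCoeff' σ q v = σ.density q * v 0 + primCoeff' σ q (EuclideanSpace.single 1 1) * v 1 := by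
    intro v
    have : v = v 0 • (EuclideanSpace.single 0 1 : Plane) + v 1 • (EuclideanSpace.single 1 1 : Plane) := by
      ext i; fin_cases i <;> simp
    conv_lhs => rw [this]
    rw [map_add, map_smul, map_smul, primCoeff'_single]
    simp only [smul_eq_mul]; ring
  rw [h v, h w]; ring

theorem mem_lattice_pair (a b : ℤ) : (!₂[(a : ℝ), (b : ℝ)] : Plane) ∈ lattice := by
  intro i; fin_cases i
  · exact ⟨a, by simp⟩
  · exact ⟨b, by simp⟩

theorem density_periodic₀ (y : ℝ) : Function.Periodic (fun t : ℝ => σ.density !₂[t, y]) 1 := fun t => by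
  have := σ.latticePeriodic !₂[t, y] _ (mem_lattice_pair 1 0)
  simp only
  rw [← this]; congr 1; ext i; fin_cases i <;> simp

theorem density_add_int₁ (t y : ℝ) (b : ℤ) : σ.density !₂[t, y + b] = σ.density !₂[t, y] := by
  have := σ.latticePeriodic !₂[t, y] _ (mem_lattice_pair 0 b)
  rw [← this]; congr 1; ext i; fin_cases i <;> simp

theorem hflux_add_int (y : ℝ) (b : ℤ) : hflux σ (y + b) = hflux σ y := by
  simp only [hflux, density_add_int₁]

theorem hflux_eq (y : ℝ) : hflux σ y = hmean σ !₂[1, y] := by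
  rw [hmean_eq]; simp [hflux]

theorem continuous_hflux : Continuous (hflux σ) := by
  have : hflux σ = fun y => hmean σ !₂[1, y] := funext (hflux_eq σ)
  rw [this]
  exact (continuous_hmean σ).comp (by fun_prop)

/-- A vertical integer shift does not change the integrand, and a horizontal one adds whole periods
of it. This failure of periodicity of the primitive is the source of all multiples of the flux
below. -/
theorem primCoeff_add_lattice (p : Plane) {z : Plane} (hz : z ∈ lattice) :
    primCoeff σ (p + z) = primCoeff σ p + z 0 * hflux σ (p 1) := by
  obtain ⟨a, ha⟩ := hz 0
  obtain ⟨b, hb⟩ := hz 1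
  have hc : ∀ y : ℝ, Continuous fun t : ℝ => σ.density !₂[t, y] := fun y =>
    σ.continuous_density.comp (by fun_prop)
  rw [primCoeff_eq, primCoeff_eq]
  simp only [PiLp.add_apply, ha, hb, density_add_int₁]
  rw [← intervalIntegral.integral_add_adjacent_intervals (b := p 0)
    ((hc _).intervalIntegrable _ _) ((hc _).intervalIntegrable _ _)]
  congr 1
  have := (density_periodic₀ σ (p 1)).intervalIntegral_add_zsmul_eq a (p 0)
    (fun t1 t2 => (hc _).intervalIntegrable t1 t2)
  have h2 := (density_periodic₀ σ (p 1)).intervalIntegral_add_eq (p 0) 0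
  simp only [zero_add] at h2
  simpa [hflux, h2] using this

/-- The vertical primitive of `hflux`. -/
def vprim (y : ℝ) : ℝ := ∫ t in (0 : ℝ)..y, hflux σ t

theorem hasDerivAt_vprim (y : ℝ) : HasDerivAt (vprim σ) (hflux σ y) y :=
  ((continuous_hflux σ).integral_hasStrictDerivAt 0 y).hasDerivAt

/-- The integral of the two-form over the torus. -/
def flux : ℝ := ∫ t in (0 : ℝ)..1, hflux σ t

theorem vprim_add_int (y : ℝ) (b : ℤ) : vprim σ (y + b) = vprim σ y + b * flux σ := by
  have hp : Function.Periodic (hflux σ) 1 := fun y => by simpa using hflux_add_int σ y 1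
  have hc := continuous_hflux σ
  rw [vprim, vprim, ← intervalIntegral.integral_add_adjacent_intervals (b := y)
    (hc.intervalIntegrable _ _) (hc.intervalIntegrable _ _)]
  congr 1
  have := hp.intervalIntegral_add_zsmul_eq b y (fun t1 t2 => hc.intervalIntegrable t1 t2)
  have h2 := hp.intervalIntegral_add_eq y 0
  simp only [zero_add] at h2
  simpa [flux, h2] using this

theorem flux_stdTwoForm : flux stdTwoForm = 1 := by simp [flux, hflux, stdTwoForm]

/-- The primitive `primCoeff · dq²` of the two-form. -/
def prim (p : Plane) : Covec := primCoeff σ p • dq 1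

/-- The derivative of `prim`. -/
def prim' (p : Plane) : BilForm := (primCoeff' σ p).smulRight (dq 1)

theorem continuous_prim : Continuous (prim σ) := (continuous_primCoeff σ).smul continuous_const

theorem continuous_prim' : Continuous (prim' σ) := by
  have : Continuous fun f : Covec => (f.smulRight (dq 1) : BilForm) :=
    ((ContinuousLinearMap.smulRightL ℝ Plane Covec).flip (dq 1)).continuous
  exact this.comp (continuous_primCoeff' σ)

theorem continuous_prim'_flip : Continuous fun p => (prim' σ p).flip := by
  have h := continuous_prim' σ
  exact (ContinuousLinearMap.flipₗᵢ ℝ Plane Plane ℝ).continuous.comp h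

theorem hasFDerivAt_prim (p : Plane) : HasFDerivAt (prim σ) (prim' σ p) p :=
  (hasFDerivAt_primCoeff σ p).smul_const (dq 1)

theorem prim'_sub_flip (p v w : Plane) : prim' σ p v w - prim' σ p w v = σ.form p v w := by
  rw [TwoForm.form_apply, TwoForm.eval, ← primCoeff'_antisymm]
  simp [prim']

/-! ### The magnetic functional on lifted loops -/

/-- The primitive of the transgression on lifted loops with total displacement `m`. -/
def mag (m : Plane) (x : Plane × L2) : ℝ :=
  Lin (nem (continuous_prim σ) (curveC x)) x.2 - m 0 * vprim σ (x.1 1)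

/-- The transgression as a continuous linear form. -/
def tau (x : Plane × L2) : (Plane × L2) →L[ℝ] ℝ :=
  (Lin.flip x.2).comp ((applyC (nem σ.continuous_form (curveC x))).comp curveC)

theorem tau_apply (x h : Plane × L2) :
    tau σ x h = Lin (applyC (nem σ.continuous_form (curveC x)) (curveC h)) x.2 := rfl

/-- On variations with total displacement zero the integration by parts leaves one boundary term,
the increment of `primCoeff` over the translation by `m` applied to the variation of the starting
point. By `primCoeff_add_lattice` it equals m⁰ times `hflux`, the derivative of the term subtracted
in `mag`. -/
theorem exists_hasFDerivAt_mag (m : Plane) (hm : m ∈ lattice) (x : Plane × L2) (hx : total x.2 = m) :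
    ∃ D : (Plane × L2) →L[ℝ] ℝ, HasFDerivAt (mag σ m) D x ∧ ∀ h, total h.2 = 0 → D h = tau σ x h := by
  have h1 : HasFDerivAt (fun x : Plane × L2 => nem (continuous_prim σ) (curveC x))
      ((applyC (nem (continuous_prim' σ) (curveC x))).comp curveC) x :=
    (hasFDerivAt_nem (continuous_prim σ) (continuous_prim' σ) (hasFDerivAt_prim σ) _).comp x curveC.hasFDerivAt
  have h2 := (Lin.hasFDerivAt.comp x h1).clm_apply (hasFDerivAt_snd (𝕜 := ℝ) (p := x))
  have h3 : HasFDerivAt (fun x : Plane × L2 => vprim σ (x.1 1))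
      (hflux σ (x.1 1) • (dq 1).comp (ContinuousLinearMap.fst ℝ Plane L2)) x := by
    have := (hasDerivAt_vprim σ (x.1 1)).comp_hasFDerivAt x
      (((dq 1).comp (ContinuousLinearMap.fst ℝ Plane L2)).hasFDerivAt (x := x))
    exact this
  refine ⟨_, h2.sub (h3.const_mul (m 0)), fun h hh => ?_⟩
  have hI := integral_by_parts (continuous_prim σ) (continuous_prim'_flip σ) (hasFDerivAt_prim σ) x h
  rw [hh, hx, add_zero] at hI
  have e : nem σ.continuous_form (curveC x)
      = nem (continuous_prim' σ) (curveC x) - nem (F := BilForm) (continuous_prim'_flip σ) (curveC x) := by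
    ext s v w
    simp [prim'_sub_flip]
  rw [tau_apply, e]
  simp only [map_sub, sub_apply, add_apply, ContinuousLinearMap.comp_apply,
    ContinuousLinearMap.flip_apply, smul_apply, smul_eq_mul, dq_apply,
    ContinuousLinearMap.coe_fst', ContinuousLinearMap.coe_snd']
  simp only [prim, primCoeff_add_lattice σ x.1 hm, smul_apply, smul_eq_mul, dq_apply] at hI
  simp only [Function.comp_apply] at *
  linarith

theorem curveC_translate (p z : Plane) (v : L2) :
    curveC (p + z, v) = curveC (p, v) + CI.mk (fun _ => z) continuous_const := by
  ext1 s; exact curve_translate p z v s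

theorem nem_translate {F : Type*} [NormedAddCommGroup F] {G : Plane → F} (hG : Continuous G)
    (hp : LatticePeriodic G) (p : Plane) {z : Plane} (hz : z ∈ lattice) (v : L2) :
    nem hG (curveC (p + z, v)) = nem hG (curveC (p, v)) := by
  rw [curveC_translate]; ext1 s; exact hp _ z hz

theorem tau_translate (p : Plane) {z : Plane} (hz : z ∈ lattice) (v : L2) :
    tau σ (p + z, v) = tau σ (p, v) := by
  simp only [tau, nem_translate σ.continuous_form σ.latticePeriodic_form p hz v]

/-- The shift adds z⁰ times the integral of `hflux` along the second coordinate of the curve, that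
is z⁰m¹ times the flux, and the correction term contributes −z¹m⁰ times the flux. Hence `mag` is
determined on loops only up to integer multiples of the flux. -/
theorem mag_translate (m : Plane) (hm : m ∈ lattice) (p : Plane) {z : Plane} (hz : z ∈ lattice) (v : L2)
    (hv : total v = m) :
    mag σ m (p + z, v) = mag σ m (p, v) + (z 0 * m 1 - z 1 * m 0) * flux σ := by
  obtain ⟨b, hb⟩ := hz 1
  obtain ⟨c, hc⟩ := hm 1
  have hΘ : Continuous fun p : Plane => hflux σ (p 1) • dq 1 :=
    ((continuous_hflux σ).comp (dq 1).continuous).smul continuous_const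
  have e1 : nem (continuous_prim σ) (curveC (p + z, v)) =
      nem (continuous_prim σ) (curveC (p, v)) + z 0 • nem hΘ (curveC (p, v)) := by
    rw [curveC_translate]
    ext s w
    simp [prim, primCoeff_add_lattice σ _ hz]
    ring
  have e2 : Lin (nem hΘ (curveC (p, v))) v = vprim σ (p 1 + m 1) - vprim σ (p 1) := by
    -- The displacement is left free here, so that the density of the continuous velocities can be
    -- used in all of L² and not only in a slice.
    have key : ∀ v : L2, Lin (nem hΘ (curveC (p, v))) v = vprim σ ((p + total v) 1) - vprim σ (p 1) := by
      intro v
      refine isClosed_property dense_continuous_L2 (p := fun v =>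
        Lin (nem hΘ (curveC (p, v))) v = vprim σ ((p + total v) 1) - vprim σ (p 1)) ?_ ?_ v
      · have c1 := continuous_nem (F := Covec) hΘ
        have c2 := continuous_total
        have c3 : Continuous (vprim σ) := continuous_iff_continuousAt.2 fun y => (hasDerivAt_vprim σ y).continuousAt
        have c4 : Continuous fun v => vprim σ ((p + total v) 1) :=
          c3.comp ((dq 1).continuous.comp (continuous_const.add c2))
        refine isClosed_eq ?_ (c4.sub continuous_const)
        fun_prop
      · intro f
        have h1 := hasDerivAt_curve_toLp p f
        have e1 : ∀ᵐ r : ℝ, ev (ContinuousMap.toLp (E := Plane) 2 volume ℝ f) r = f (r : UnitAddCircle) :=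
          ae_of_ae_circle (P := fun x => (ContinuousMap.toLp (E := Plane) 2 volume ℝ f) x = f x)
            (ContinuousMap.coeFn_toLp volume f)
        set v := ContinuousMap.toLp (E := Plane) 2 (volume : Measure UnitAddCircle) ℝ f
        have hc1 : Continuous fun r : ℝ => f (r : UnitAddCircle) := f.continuous.comp (AddCircle.continuous_mk' 1)
        have h3 : ∀ s : ℝ, HasDerivAt (fun s => vprim σ (curve p v s 1))
            (hflux σ (curve p v s 1) * f (s : UnitAddCircle) 1) s := by
          intro s
          exact (hasDerivAt_vprim σ _).comp s ((dq 1).hasFDerivAt.comp_hasDerivAt s (h1 s))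
        have hI := intervalIntegral.integral_eq_sub_of_hasDerivAt (a := 0) (b := 1) (fun s _ => h3 s)
          (by
            refine Continuous.intervalIntegrable ?_ _ _
            exact ((continuous_hflux σ).comp ((dq 1).continuous.comp (continuous_curve p v))).mul
              ((dq 1).continuous.comp hc1))
        rw [curve_one, curve_zero] at hI
        rw [← hI, Lin_apply]
        refine intervalIntegral.integral_congr_ae ?_
        filter_upwards [e1] with s hs1 hs
        rw [uIoc_of_le zero_le_one] at hs
        have hs' : s ∈ Icc (0 : ℝ) 1 := Ioc_subset_Icc_self hs
        rw [ext01_of_mem _ hs', hs1]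
        simp
    rw [key, hv]; simp
  simp only [mag]
  rw [e1, map_add, map_smul, add_apply, smul_apply, e2]
  simp only [PiLp.add_apply, hb, hc, vprim_add_int, smul_eq_mul]
  ring

end Primitive

/-! ### The action functional on lifted loops -/

/-- Lifted loops of arbitrary period: a starting point in the plane, a velocity and a period. -/
abbrev Lifted : Type := (Plane × L2) × ℝ

section Constants

variable (g : RiemannianMetric) (σ : TwoForm)

/-- The metric as a map into the normed space of bilinear forms. -/
def RiemannianMetric.q (p : Plane) : QForm := g.toFun p

theorem RiemannianMetric.contDiff_q : ContDiff ℝ ∞ g.q := g.smooth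

theorem RiemannianMetric.latticePeriodic_q : LatticePeriodic g.q := g.latticePeriodic

theorem continuous_metric : Continuous g.q := g.contDiff_q.continuous

theorem continuous_metric' : Continuous (fderiv ℝ g.q) := g.contDiff_q.continuous_fderiv (by simp)

/-- `C` bounds the metric, its first derivatives and the two-form and their Lipschitz constants. -/
structure IsBound (C : ℝ) : Prop where
  pos : 0 < C
  metric : ∀ p, ‖g.q p‖ ≤ C
  metric_sub : ∀ p p', ‖g.q p - g.q p'‖ ≤ C * ‖p - p'‖
  metric' : ∀ p, ‖fderiv ℝ g.q p‖ ≤ C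
  metric'_sub : ∀ p p', ‖fderiv ℝ g.q p - fderiv ℝ g.q p'‖ ≤ C * ‖p - p'‖
  form : ∀ p, ‖σ.form p‖ ≤ C
  form_sub : ∀ p p', ‖σ.form p - σ.form p'‖ ≤ C * ‖p - p'‖

theorem exists_isBound : ∃ C, IsBound g σ C := by
  obtain ⟨C1, h1, b1⟩ := g.latticePeriodic_q.exists_norm_le (continuous_metric g)
  obtain ⟨C2, h2, b2⟩ := g.latticePeriodic_q.exists_lipschitz (g.contDiff_q.of_le (by simp))
  obtain ⟨C3, h3, b3⟩ := g.latticePeriodic_q.fderiv.exists_norm_le (continuous_metric' g)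
  obtain ⟨C4, h4, b4⟩ := g.latticePeriodic_q.fderiv.exists_lipschitz
    (g.contDiff_q.fderiv_right (m := 1) (by rw [one_add_one_eq_two]; exact WithTop.coe_le_coe.2 le_top))
  obtain ⟨C5, h5, b5⟩ := σ.latticePeriodic.exists_norm_le σ.continuous_density
  obtain ⟨C6, h6, b6⟩ := σ.latticePeriodic.exists_lipschitz (σ.smooth.of_le (by simp))
  refine ⟨C1 + C2 + C3 + C4 + C5 * 2 + C6 * 2, by positivity, ?_, ?_, ?_, ?_, ?_, ?_⟩
  · exact fun p => (b1 p).trans (by linarith)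
  · exact fun p p' => (b2 p p').trans (mul_le_mul_of_nonneg_right (by linarith) (norm_nonneg _))
  · exact fun p => (b3 p).trans (by linarith)
  · exact fun p p' => (b4 p p').trans (mul_le_mul_of_nonneg_right (by linarith) (norm_nonneg _))
  · exact fun p => (σ.norm_form_le p).trans (by linarith [b5 p])
  · intro p p'
    refine (σ.norm_form_sub_le p p').trans ?_
    nlinarith [b6 p p', norm_nonneg (p - p')]

end Constants

section Action

variable (g : RiemannianMetric) (σ : TwoForm)

/-- The kinetic energy of a lifted loop. -/
def kin (x : Plane × L2) : ℝ := 1 / 2 * Bil (nem (continuous_metric g) (curveC x)) x.2 x.2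

/-- The differential of the kinetic energy. -/
def kin' (x : Plane × L2) : (Plane × L2) →L[ℝ] ℝ :=
  (1 / 2 : ℝ) • ((Bil.flip x.2).flip x.2).comp ((applyC (nem (continuous_metric' g) (curveC x))).comp curveC)
    + (Bil (nem (continuous_metric g) (curveC x)) x.2).comp (ContinuousLinearMap.snd ℝ Plane L2)

theorem kin'_apply (x h : Plane × L2) :
    kin' g x h = 1 / 2 * Bil (applyC (nem (continuous_metric' g) (curveC x)) (curveC h)) x.2 x.2
      + Bil (nem (continuous_metric g) (curveC x)) x.2 h.2 := by
  simp [kin']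

theorem Bil_metric_symm (x : CI Plane) (v w : L2) :
    Bil (nem (continuous_metric g) x) v w = Bil (nem (continuous_metric g) x) w v := by
  rw [Bil_apply, Bil_apply]
  refine intervalIntegral.integral_congr fun s _ => ?_
  exact g.symm _ _ _

theorem hasFDerivAt_kin (x : Plane × L2) : HasFDerivAt (kin g) (kin' g x) x := by
  have h1 : HasFDerivAt (fun x : Plane × L2 => nem (continuous_metric g) (curveC x))
      ((applyC (nem (continuous_metric' g) (curveC x))).comp curveC) x :=
    (hasFDerivAt_nem (continuous_metric g) (continuous_metric' g)
      (fun p => ((g.contDiff_q.differentiable (by simp)) p).hasFDerivAt) _).comp x curveC.hasFDerivAt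
  have h3 : HasFDerivAt (fun x : Plane × L2 => Bil (nem (continuous_metric g) (curveC x)))
      (Bil.comp ((applyC (nem (continuous_metric' g) (curveC x))).comp curveC)) x := by
    have hB : HasFDerivAt (fun Q => Bil Q) Bil (nem (continuous_metric g) (curveC x)) :=
      ContinuousLinearMap.hasFDerivAt (F := L2 →L[ℝ] L2 →L[ℝ] ℝ) Bil
    exact HasFDerivAt.comp (G := L2 →L[ℝ] L2 →L[ℝ] ℝ) (g := fun Q => Bil Q) (g' := Bil) x hB h1
  have h4 : HasFDerivAt (fun x : Plane × L2 => Bil (nem (continuous_metric g) (curveC x)) x.2) _ x :=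
    HasFDerivAt.clm_apply h3 (hasFDerivAt_snd (𝕜 := ℝ) (p := x))
  have h2 : HasFDerivAt (fun x : Plane × L2 => Bil (nem (continuous_metric g) (curveC x)) x.2 x.2) _ x :=
    HasFDerivAt.clm_apply h4 (hasFDerivAt_snd (𝕜 := ℝ) (p := x))
  refine (h2.const_mul (1 / 2 : ℝ)).congr_fderiv ?_
  refine ContinuousLinearMap.ext fun h => ?_
  rw [kin'_apply]
  simp only [smul_apply, add_apply, ContinuousLinearMap.comp_apply,
    ContinuousLinearMap.flip_apply, smul_eq_mul, ContinuousLinearMap.coe_snd']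
  rw [Bil_metric_symm g _ h.2 x.2]
  ring

variable {g σ}

theorem kin_nonneg (x : Plane × L2) : 0 ≤ kin g x := by
  refine mul_nonneg (by norm_num) ?_
  rw [Bil_apply]
  refine intervalIntegral.integral_nonneg zero_le_one fun s hs => ?_
  rcases eq_or_ne (ev x.2 s) 0 with h | h
  · simp [h]
  · exact (g.pos _ _ h).le

theorem kin_coercive {c : ℝ} (hc : ∀ p v, c * ‖v‖ ^ 2 ≤ g.toFun p v v) (x : Plane × L2) :
    c / 2 * ‖x.2‖ ^ 2 ≤ kin g x := by
  have : c * ‖x.2‖ ^ 2 ≤ Bil (nem (continuous_metric g) (curveC x)) x.2 x.2 := by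
    rw [Bil_apply, ← integral_norm_sq_ev, ← intervalIntegral.integral_const_mul]
    exact intervalIntegral.integral_mono_on zero_le_one ((intervalIntegrable_norm_sq_ev _ _ _).const_mul _)
      (integrable_bil _ _ _ _ _) fun s _ => hc _ _
  rw [kin]; linarith

theorem kin_translate (p : Plane) {z : Plane} (hz : z ∈ lattice) (v : L2) :
    kin g (p + z, v) = kin g (p, v) := by
  simp only [kin, nem_translate (continuous_metric g) g.latticePeriodic_q p hz v]

theorem kin'_translate (p : Plane) {z : Plane} (hz : z ∈ lattice) (v : L2) :
    kin' g (p + z, v) = kin' g (p, v) := by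
  simp only [kin', nem_translate (continuous_metric g) g.latticePeriodic_q p hz v,
    nem_translate (continuous_metric' g) g.latticePeriodic_q.fderiv p hz v]

variable {C R : ℝ}

theorem abs_kin'_le (hC : IsBound g σ C) (x h : Plane × L2) : |kin' g x h| ≤ C * (‖x.2‖ ^ 2 + ‖x.2‖) * ‖h‖ := by
  rw [kin'_apply]
  have hCp := hC.pos.le
  have h1 := norm_Bil_le (applyC (nem (continuous_metric' g) (curveC x)) (curveC h)) x.2 x.2
  have h2 := norm_Bil_le (nem (continuous_metric g) (curveC x)) x.2 h.2
  have h3 := norm_applyC_le (nem (continuous_metric' g) (curveC x)) (curveC h)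
  have h4 := norm_nem_le (continuous_metric' g) hC.metric' (curveC x)
  have h5 := norm_nem_le (continuous_metric g) hC.metric (curveC x)
  have h6 := norm_curveC_le h
  have h7 := norm_snd_le h
  have h8 : ‖applyC (nem (continuous_metric' g) (curveC x)) (curveC h)‖ ≤ C * (2 * ‖h‖) :=
    h3.trans (mul_le_mul h4 h6 (norm_nonneg _) hC.pos.le)
  calc _ ≤ |1 / 2 * Bil (applyC (nem (continuous_metric' g) (curveC x)) (curveC h)) x.2 x.2|
        + |Bil (nem (continuous_metric g) (curveC x)) x.2 h.2| := abs_add_le _ _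
    _ ≤ 1 / 2 * (C * (2 * ‖h‖) * ‖x.2‖ * ‖x.2‖) + C * ‖x.2‖ * ‖h‖ := by
      rw [abs_mul, abs_of_pos (by norm_num : (0 : ℝ) < 1 / 2)]
      gcongr
      · exact h1.trans (by gcongr)
      · exact h2.trans (by gcongr)
    _ = _ := by ring

theorem abs_tau_le (hC : IsBound g σ C) (x h : Plane × L2) : |tau σ x h| ≤ C * 2 * ‖x.2‖ * ‖h‖ := by
  rw [tau_apply]
  have hCp := hC.pos.le
  have h3 := norm_applyC_le (nem (F := BilForm) σ.continuous_form (curveC x)) (curveC h)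
  have h4 := norm_nem_le (F := BilForm) σ.continuous_form hC.form (curveC x)
  have h6 := norm_curveC_le h
  calc _ ≤ _ := norm_Lin_le _ _
    _ ≤ C * (2 * ‖h‖) * ‖x.2‖ := by
      gcongr
      exact h3.trans (mul_le_mul h4 h6 (norm_nonneg _) hC.pos.le)
    _ = _ := by ring

theorem norm_curveC_sub_le (x y : Plane × L2) : ‖curveC x - curveC y‖ ≤ 2 * ‖x - y‖ := by
  rw [← map_sub]; exact norm_curveC_le _

theorem abs_kin'_sub_le (hC : IsBound g σ C) {x y : Plane × L2} (hx : ‖x.2‖ ≤ R) (hy : ‖y.2‖ ≤ R) (h : Plane × L2) :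
    |kin' g x h - kin' g y h| ≤ C * (2 * R ^ 2 + 4 * R + 1) * ‖x - y‖ * ‖h‖ := by
  have hR : 0 ≤ R := (norm_nonneg _).trans hx
  have hCp := hC.pos.le
  set X := curveC x
  set Y := curveC y
  set ξ := curveC h
  set v := x.2
  set v' := y.2
  set w := h.2
  have hXY : ‖X - Y‖ ≤ 2 * ‖x - y‖ := norm_curveC_sub_le x y
  have hξ : ‖ξ‖ ≤ 2 * ‖h‖ := norm_curveC_le h
  have hv : ‖v - v'‖ ≤ ‖x - y‖ := norm_snd_le (x - y)
  have hw : ‖w‖ ≤ ‖h‖ := norm_snd_le h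
  have a1 : ‖nem (continuous_metric' g) X - nem (continuous_metric' g) Y‖ ≤ C * (2 * ‖x - y‖) :=
    (norm_nem_sub_le _ hC.pos.le hC.metric'_sub X Y).trans (by gcongr)
  have a2 : ‖nem (continuous_metric g) X - nem (continuous_metric g) Y‖ ≤ C * (2 * ‖x - y‖) :=
    (norm_nem_sub_le _ hC.pos.le hC.metric_sub X Y).trans (by gcongr)
  have a3 := norm_nem_le (continuous_metric' g) hC.metric' Y
  have a4 := norm_nem_le (continuous_metric g) hC.metric Y
  have b1 : ‖applyC (nem (continuous_metric' g) X - nem (continuous_metric' g) Y) ξ‖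
      ≤ C * (2 * ‖x - y‖) * (2 * ‖h‖) :=
    (norm_applyC_le _ _).trans (mul_le_mul a1 hξ (norm_nonneg _) (by positivity))
  have b2 : ‖applyC (nem (continuous_metric' g) Y) ξ‖ ≤ C * (2 * ‖h‖) :=
    (norm_applyC_le _ _).trans (mul_le_mul a3 hξ (norm_nonneg _) (by positivity))
  -- The difference is telescoped, with one of the curve and the velocity slots changed at a time.
  have e : kin' g x h - kin' g y h =
      1 / 2 * (Bil (applyC (nem (continuous_metric' g) X - nem (continuous_metric' g) Y) ξ) v v
        + Bil (applyC (nem (continuous_metric' g) Y) ξ) (v - v') v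
        + Bil (applyC (nem (continuous_metric' g) Y) ξ) v' (v - v'))
      + Bil (nem (continuous_metric g) X - nem (continuous_metric g) Y) v w
      + Bil (nem (continuous_metric g) Y) (v - v') w := by
    rw [kin'_apply, kin'_apply]
    simp only [map_sub, sub_apply]
    ring
  have c1 := (norm_Bil_le (applyC (nem (continuous_metric' g) X - nem (continuous_metric' g) Y) ξ) v v).trans
    (show _ ≤ C * (2 * ‖x - y‖) * (2 * ‖h‖) * R * R by gcongr)
  have c2 := (norm_Bil_le (applyC (nem (continuous_metric' g) Y) ξ) (v - v') v).trans
    (show _ ≤ C * (2 * ‖h‖) * ‖x - y‖ * R by gcongr)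
  have c3 := (norm_Bil_le (applyC (nem (continuous_metric' g) Y) ξ) v' (v - v')).trans
    (show _ ≤ C * (2 * ‖h‖) * R * ‖x - y‖ by gcongr)
  have c4 := (norm_Bil_le (nem (continuous_metric g) X - nem (continuous_metric g) Y) v w).trans
    (show _ ≤ C * (2 * ‖x - y‖) * R * ‖h‖ by gcongr)
  have c5 := (norm_Bil_le (nem (continuous_metric g) Y) (v - v') w).trans
    (show _ ≤ C * ‖x - y‖ * ‖h‖ by gcongr)
  rw [e]
  rw [abs_le] at c1 c2 c3 c4 c5 ⊢
  constructor <;> linarith [c1.1, c1.2, c2.1, c2.2, c3.1, c3.2, c4.1, c4.2, c5.1, c5.2]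

theorem abs_kin_sub_le (hC : IsBound g σ C) {x y : Plane × L2} (hx : ‖x.2‖ ≤ R) (hy : ‖y.2‖ ≤ R) :
    |kin g x - kin g y| ≤ C * (R ^ 2 + R) * ‖x - y‖ := by
  have hR : 0 ≤ R := (norm_nonneg _).trans hx
  have hCp := hC.pos.le
  set X := curveC x
  set Y := curveC y
  set v := x.2
  set v' := y.2
  have hXY : ‖X - Y‖ ≤ 2 * ‖x - y‖ := norm_curveC_sub_le x y
  have hv : ‖v - v'‖ ≤ ‖x - y‖ := norm_snd_le (x - y)
  have a2 : ‖nem (continuous_metric g) X - nem (continuous_metric g) Y‖ ≤ C * (2 * ‖x - y‖) :=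
    (norm_nem_sub_le _ hC.pos.le hC.metric_sub X Y).trans (by gcongr)
  have a4 := norm_nem_le (continuous_metric g) hC.metric Y
  have e : kin g x - kin g y =
      1 / 2 * (Bil (nem (continuous_metric g) X - nem (continuous_metric g) Y) v v
      + Bil (nem (continuous_metric g) Y) (v - v') v + Bil (nem (continuous_metric g) Y) v' (v - v')) := by
    simp only [kin, map_sub, sub_apply]
    ring
  have c1 := (norm_Bil_le (nem (continuous_metric g) X - nem (continuous_metric g) Y) v v).trans
    (show _ ≤ C * (2 * ‖x - y‖) * R * R by gcongr)
  have c2 := (norm_Bil_le (nem (continuous_metric g) Y) (v - v') v).trans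
    (show _ ≤ C * ‖x - y‖ * R by gcongr)
  have c3 := (norm_Bil_le (nem (continuous_metric g) Y) v' (v - v')).trans
    (show _ ≤ C * R * ‖x - y‖ by gcongr)
  rw [e]
  rw [abs_le] at c1 c2 c3 ⊢
  constructor <;> linarith [c1.1, c1.2, c2.1, c2.2, c3.1, c3.2]

theorem abs_tau_sub_le (hC : IsBound g σ C) {x y : Plane × L2} (hx : ‖x.2‖ ≤ R) (h : Plane × L2) :
    |tau σ x h - tau σ y h| ≤ C * (4 * R + 2) * ‖x - y‖ * ‖h‖ := by
  have hR : 0 ≤ R := (norm_nonneg _).trans hx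
  have hCp := hC.pos.le
  set X := curveC x
  set Y := curveC y
  set ξ := curveC h
  set v := x.2
  set v' := y.2
  have hXY : ‖X - Y‖ ≤ 2 * ‖x - y‖ := norm_curveC_sub_le x y
  have hξ : ‖ξ‖ ≤ 2 * ‖h‖ := norm_curveC_le h
  have hv : ‖v - v'‖ ≤ ‖x - y‖ := norm_snd_le (x - y)
  have a1 : ‖nem (F := BilForm) σ.continuous_form X - nem (F := BilForm) σ.continuous_form Y‖ ≤ C * (2 * ‖x - y‖) :=
    (norm_nem_sub_le (F := BilForm) _ hC.pos.le hC.form_sub X Y).trans (by gcongr)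
  have a3 := norm_nem_le (F := BilForm) σ.continuous_form hC.form Y
  have b1 : ‖applyC (nem (F := BilForm) σ.continuous_form X - nem (F := BilForm) σ.continuous_form Y) ξ‖
      ≤ C * (2 * ‖x - y‖) * (2 * ‖h‖) :=
    (norm_applyC_le _ _).trans (mul_le_mul a1 hξ (norm_nonneg _) (by positivity))
  have b2 : ‖applyC (nem (F := BilForm) σ.continuous_form Y) ξ‖ ≤ C * (2 * ‖h‖) :=
    (norm_applyC_le _ _).trans (mul_le_mul a3 hξ (norm_nonneg _) (by positivity))
  have e : tau σ x h - tau σ y h =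
      Lin (applyC (nem (F := BilForm) σ.continuous_form X - nem (F := BilForm) σ.continuous_form Y) ξ) v
        + Lin (applyC (nem (F := BilForm) σ.continuous_form Y) ξ) (v - v') := by
    rw [tau_apply, tau_apply]
    simp only [map_sub, sub_apply]
    ring
  have c1 := (norm_Lin_le (applyC (nem (F := BilForm) σ.continuous_form X - nem (F := BilForm) σ.continuous_form Y) ξ) v).trans
    (show _ ≤ C * (2 * ‖x - y‖) * (2 * ‖h‖) * R by gcongr)
  have c2 := (norm_Lin_le (applyC (nem (F := BilForm) σ.continuous_form Y) ξ) (v - v')).trans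
    (show _ ≤ C * (2 * ‖h‖) * ‖x - y‖ by gcongr)
  rw [e]
  rw [abs_le] at c1 c2 ⊢
  constructor <;> linarith [c1.1, c1.2, c2.1, c2.2]

end Action

section ActionForm

variable (g : RiemannianMetric) (σ : TwoForm)

/-- The free period action of lifted loops with total displacement `m`. -/
def act (k : ℝ) (m : Plane) (z : Lifted) : ℝ := kin g z.1 / z.2 + k * z.2 + mag σ m z.1

/-- The action one-form. -/
def act' (k : ℝ) (z : Lifted) : Lifted →L[ℝ] ℝ :=
  (z.2⁻¹ • kin' g z.1 + tau σ z.1).comp (ContinuousLinearMap.fst ℝ (Plane × L2) ℝ)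
    + (k - kin g z.1 * z.2⁻¹ ^ 2) • ContinuousLinearMap.snd ℝ (Plane × L2) ℝ

theorem act'_apply (k : ℝ) (z h : Lifted) : act' g σ k z h =
    z.2⁻¹ * kin' g z.1 h.1 + tau σ z.1 h.1 + (k - kin g z.1 * z.2⁻¹ ^ 2) * h.2 := by
  simp [act']

/-- Tangent vectors to the space of lifted loops with fixed total displacement. -/
def IsTangent (h : Lifted) : Prop := total h.1.2 = 0

variable {g σ}

theorem IsTangent.smul {h : Lifted} (hh : IsTangent h) (c : ℝ) : IsTangent (c • h) := by
  simp only [IsTangent, Prod.smul_fst, Prod.smul_snd, map_smul] at *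
  rw [hh, smul_zero]

theorem isTangent_sub {z z' : Lifted} (h : total z.1.2 = total z'.1.2) : IsTangent (z - z') := by
  simp [IsTangent, h]

theorem act'_translate (k : ℝ) (p : Plane) {w : Plane} (hw : w ∈ lattice) (v : L2) (T : ℝ) :
    act' g σ k ((p + w, v), T) = act' g σ k ((p, v), T) := by
  simp only [act', kin_translate p hw, kin'_translate p hw, tau_translate σ p hw]

theorem act_translate (k : ℝ) (m : Plane) (hm : m ∈ lattice) (p : Plane) {w : Plane} (hw : w ∈ lattice)
    (v : L2) (hv : total v = m) (T : ℝ) :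
    act g σ k m ((p + w, v), T) = act g σ k m ((p, v), T) + (w 0 * m 1 - w 1 * m 0) * flux σ := by
  simp only [act, kin_translate p hw, mag_translate σ m hm p hw v hv]; ring

theorem exists_hasFDerivAt_act (k : ℝ) (m : Plane) (hm : m ∈ lattice) (z : Lifted)
    (hz : total z.1.2 = m) (hT : z.2 ≠ 0) :
    ∃ D : Lifted →L[ℝ] ℝ, HasFDerivAt (act g σ k m) D z ∧ ∀ h, IsTangent h → D h = act' g σ k z h := by
  obtain ⟨D, hD, hD'⟩ := exists_hasFDerivAt_mag σ m hm z.1 hz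
  have h1 : HasFDerivAt (fun z : Lifted => kin g z.1) _ z := (hasFDerivAt_kin g z.1).comp z hasFDerivAt_fst
  have h2 : HasFDerivAt (fun z : Lifted => z.2) _ z := hasFDerivAt_snd (𝕜 := ℝ) (p := z)
  have h3 : HasFDerivAt (fun z : Lifted => z.2⁻¹) _ z := (hasDerivAt_inv hT).comp_hasFDerivAt z h2
  have h4 : HasFDerivAt (fun z : Lifted => mag σ m z.1) _ z := hD.comp z hasFDerivAt_fst
  have h5 := ((h1.mul h3).add (h2.const_mul k)).add h4
  refine ⟨_, h5.congr_of_eventuallyEq (Eventually.of_forall fun z => ?_), fun h hh => ?_⟩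
  · simp [act, div_eq_mul_inv]
  · rw [act'_apply]
    simp only [add_apply, smul_apply, ContinuousLinearMap.comp_apply, smul_eq_mul,
      ContinuousLinearMap.coe_fst', ContinuousLinearMap.coe_snd']
    rw [hD' h.1 hh]
    field_simp
    ring

theorem abs_inv_sub_inv_le {a x y : ℝ} (ha : 0 < a) (hx : a ≤ x) (hy : a ≤ y) :
    |x⁻¹ - y⁻¹| ≤ a⁻¹ ^ 2 * |x - y| := by
  have hx0 : 0 < x := ha.trans_le hx
  have hy0 : 0 < y := ha.trans_le hy
  have : x⁻¹ - y⁻¹ = (x⁻¹ * y⁻¹) * (y - x) := by field_simp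
  rw [this, abs_mul, abs_of_pos (by positivity), abs_sub_comm y x, sq]
  gcongr

theorem kin_le {C : ℝ} (hC : IsBound g σ C) (x : Plane × L2) : kin g x ≤ C * ‖x.2‖ ^ 2 := by
  have h1 := norm_Bil_le (nem (continuous_metric g) (curveC x)) x.2 x.2
  have h5 := norm_nem_le (continuous_metric g) hC.metric (curveC x)
  have h2 : ‖nem (continuous_metric g) (curveC x)‖ * ‖x.2‖ * ‖x.2‖ ≤ C * ‖x.2‖ * ‖x.2‖ := by gcongr
  have h0 := kin_nonneg (g := g) x
  have h6 := (abs_le.1 h1).2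
  rw [kin] at h0 ⊢
  nlinarith

variable (g σ)

/-- Bounded velocity controls the multilinear integrals, and a lower bound on the period controls
the powers of 1/T. The constant `M` feeds the second order remainder and the length of gradient
steps. -/
theorem exists_lipschitz_act' (k R : ℝ) {a : ℝ} (ha : 0 < a) (hR : 0 ≤ R) : ∃ M, 0 < M ∧ ∀ z z' : Lifted,
    ‖z.1.2‖ ≤ R → ‖z'.1.2‖ ≤ R → a ≤ z.2 → a ≤ z'.2 →
    ∀ h, |act' g σ k z h - act' g σ k z' h| ≤ M * ‖z - z'‖ * ‖h‖ := by
  obtain ⟨C, hC⟩ := exists_isBound g σ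
  have hCp := hC.pos
  set b := a⁻¹ with hb
  have hbp : 0 < b := inv_pos.2 ha
  refine ⟨b * (C * (2 * R ^ 2 + 4 * R + 1)) + b ^ 2 * (C * (R ^ 2 + R)) + C * (4 * R + 2)
    + (C * (R ^ 2 + R)) * b ^ 2 + C * R ^ 2 * (b ^ 2 * (2 * b)), by positivity, ?_⟩
  intro z z' hz hz' hT hT' h
  set i := z.2⁻¹ with hi
  set i' := z'.2⁻¹ with hi'
  have hz0 : 0 < z.2 := ha.trans_le hT
  have hz0' : 0 < z'.2 := ha.trans_le hT'
  have hip : 0 < i := inv_pos.2 hz0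
  have hip' : 0 < i' := inv_pos.2 hz0'
  have hib : i ≤ b := inv_anti₀ ha hT
  have hib' : i' ≤ b := inv_anti₀ ha hT'
  have hii : |i - i'| ≤ b ^ 2 * ‖z - z'‖ := (abs_inv_sub_inv_le ha hT hT').trans (by
    gcongr; exact norm_snd_le (z - z'))
  have hz1 : ‖z.1 - z'.1‖ ≤ ‖z - z'‖ := norm_fst_le (z - z')
  have hh1 : ‖h.1‖ ≤ ‖h‖ := norm_fst_le h
  have hh2 : |h.2| ≤ ‖h‖ := norm_snd_le h
  have k1 := abs_kin'_sub_le hC hz hz' h.1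
  have k2 := abs_kin'_le hC z'.1 h.1
  have k3 := abs_tau_sub_le (y := z'.1) hC hz h.1
  have k4 := abs_kin_sub_le hC hz hz'
  have k5 := kin_le hC z'.1
  have k6 := kin_nonneg (g := g) z'.1
  -- A telescoping sum once more; each of its five terms corresponds to one summand of the constant
  -- chosen above.
  have e : act' g σ k z h - act' g σ k z' h =
      i * (kin' g z.1 h.1 - kin' g z'.1 h.1) + (i - i') * kin' g z'.1 h.1
      + (tau σ z.1 h.1 - tau σ z'.1 h.1) + (kin g z'.1 - kin g z.1) * i ^ 2 * h.2
      + kin g z'.1 * ((i' - i) * (i' + i)) * h.2 := by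
    rw [act'_apply, act'_apply]; ring
  set N := ‖z - z'‖
  set H := ‖h‖
  have c1 : |i * (kin' g z.1 h.1 - kin' g z'.1 h.1)| ≤ b * (C * (2 * R ^ 2 + 4 * R + 1)) * N * H := by
    rw [abs_mul, abs_of_pos hip]
    calc _ ≤ b * (C * (2 * R ^ 2 + 4 * R + 1) * N * H) := by gcongr; exact k1.trans (by gcongr)
      _ = _ := by ring
  have c2 : |(i - i') * kin' g z'.1 h.1| ≤ b ^ 2 * (C * (R ^ 2 + R)) * N * H := by
    rw [abs_mul]
    calc _ ≤ (b ^ 2 * N) * (C * (R ^ 2 + R) * H) := by gcongr; exact k2.trans (by gcongr)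
      _ = _ := by ring
  have c3 : |tau σ z.1 h.1 - tau σ z'.1 h.1| ≤ C * (4 * R + 2) * N * H := k3.trans (by gcongr)
  have c4 : |(kin g z'.1 - kin g z.1) * i ^ 2 * h.2| ≤ (C * (R ^ 2 + R)) * b ^ 2 * N * H := by
    rw [abs_mul, abs_mul, abs_sub_comm, abs_of_pos (by positivity : 0 < i ^ 2)]
    calc _ ≤ (C * (R ^ 2 + R) * N) * b ^ 2 * H := by gcongr; exact k4.trans (by gcongr)
      _ = _ := by ring
  have c5 : |kin g z'.1 * ((i' - i) * (i' + i)) * h.2| ≤ C * R ^ 2 * (b ^ 2 * (2 * b)) * N * H := by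
    rw [abs_mul, abs_mul, abs_mul, abs_sub_comm, abs_of_nonneg k6, abs_of_pos (by positivity : 0 < i' + i)]
    calc _ ≤ (C * R ^ 2) * ((b ^ 2 * N) * (b + b)) * H := by gcongr; exact k5.trans (by gcongr)
      _ = _ := by ring
  rw [e]
  rw [abs_le] at c1 c2 c3 c4 c5 ⊢
  constructor <;> linarith [c1.1, c1.2, c2.1, c2.2, c3.1, c3.2, c4.1, c4.2, c5.1, c5.2]

theorem continuousAt_act' (k : ℝ) {z : Lifted} (hz : 0 < z.2) : ContinuousAt (act' g σ k) z := by
  obtain ⟨M, hM, hL⟩ := exists_lipschitz_act' g σ k (‖z.1.2‖ + 1) (half_pos hz) (by positivity)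
  have h1 : Tendsto (fun y : Lifted => M * ‖y - z‖) (𝓝 z) (𝓝 0) := by
    have : Continuous fun y : Lifted => M * ‖y - z‖ := by fun_prop
    simpa using this.tendsto z
  refine tendsto_iff_norm_sub_tendsto_zero.2 (squeeze_zero' (Eventually.of_forall fun _ => norm_nonneg _) ?_ h1)
  have e1 : ∀ᶠ y : Lifted in 𝓝 z, ‖y.1.2‖ < ‖z.1.2‖ + 1 :=
    (by fun_prop : Continuous fun y : Lifted => ‖y.1.2‖).continuousAt.eventually_lt continuousAt_const (by simp)
  have e2 : ∀ᶠ y : Lifted in 𝓝 z, z.2 / 2 < y.2 :=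
    continuousAt_const.eventually_lt continuous_snd.continuousAt (by linarith)
  filter_upwards [e1, e2] with y hy1 hy2
  refine ContinuousLinearMap.opNorm_le_bound _ (by positivity) fun h => ?_
  exact hL y z hy1.le (by linarith) hy2.le (by linarith) h

/-- The derivative of t ↦ act(z + th) − t act'(z)h is the increment of `act'` along the segment, at
most M‖h‖². The segment stays in the region of the Lipschitz bound because the bounds on velocity
and period are convex conditions. -/
theorem abs_act_remainder_le {k R a M : ℝ} (hM : ∀ z z' : Lifted,
    ‖z.1.2‖ ≤ R → ‖z'.1.2‖ ≤ R → a ≤ z.2 → a ≤ z'.2 →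
    ∀ h, |act' g σ k z h - act' g σ k z' h| ≤ M * ‖z - z'‖ * ‖h‖) (ha : 0 < a) (hM0 : 0 ≤ M)
    (m : Plane) (hm : m ∈ lattice) {z h : Lifted} (hz : total z.1.2 = m) (hh : IsTangent h)
    (h1 : ‖z.1.2‖ ≤ R) (h2 : ‖(z + h).1.2‖ ≤ R) (h3 : a ≤ z.2) (h4 : a ≤ (z + h).2) :
    |act g σ k m (z + h) - act g σ k m z - act' g σ k z h| ≤ M * ‖h‖ ^ 2 := by
  have conv : ∀ t ∈ Icc (0 : ℝ) 1, ‖(z + t • h).1.2‖ ≤ R ∧ a ≤ (z + t • h).2 := by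
    intro t ht
    have e1 : (z + t • h).1.2 = (1 - t) • z.1.2 + t • (z + h).1.2 := by
      simp only [Prod.fst_add, Prod.snd_add, Prod.smul_fst, Prod.smul_snd, smul_add, sub_smul, one_smul]; abel
    have e2 : (z + t • h).2 = (1 - t) * z.2 + t * (z + h).2 := by
      simp only [Prod.snd_add, Prod.smul_snd, smul_eq_mul]; ring
    constructor
    · rw [e1]
      refine (norm_add_le _ _).trans ?_
      rw [norm_smul, norm_smul, Real.norm_of_nonneg (by linarith [ht.2]), Real.norm_of_nonneg ht.1]
      nlinarith [ht.1, ht.2]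
    · rw [e2]; nlinarith [ht.1, ht.2]
  have hd : ∀ t ∈ Icc (0 : ℝ) 1, HasDerivWithinAt (fun t : ℝ => act g σ k m (z + t • h) - t * act' g σ k z h)
      (act' g σ k (z + t • h) h - act' g σ k z h) (Icc 0 1) t := by
    intro t ht
    have hzt : total (z + t • h).1.2 = m := by
      have := hh.smul t
      simp only [IsTangent] at this
      simp only [Prod.fst_add, Prod.snd_add, map_add, hz, this, add_zero]
    obtain ⟨D, hD, hD'⟩ := exists_hasFDerivAt_act (g := g) (σ := σ) k m hm (z + t • h) hzt
      (ha.trans_le (conv t ht).2).ne'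
    have h5 : HasDerivAt (fun t : ℝ => z + t • h) h t := by
      simpa using ((hasDerivAt_id t).smul_const h).const_add z
    have h6 := (hD.comp_hasDerivAt t h5).sub ((hasDerivAt_id t).mul_const (act' g σ k z h))
    rw [hD' h hh, one_mul] at h6
    exact h6.hasDerivWithinAt
  have := norm_image_sub_le_of_norm_deriv_le_segment_01' hd (C := M * ‖h‖ ^ 2) (fun t ht => by
    have ht' : t ∈ Icc (0 : ℝ) 1 := Ico_subset_Icc_self ht
    refine (hM (z + t • h) z (conv t ht').1 h1 (conv t ht').2 h3 h).trans ?_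
    rw [add_sub_cancel_left, norm_smul, Real.norm_of_nonneg ht'.1]
    have : t * ‖h‖ * ‖h‖ ≤ 1 * ‖h‖ * ‖h‖ := by gcongr; exact ht'.2
    nlinarith)
  simp only [one_smul, zero_smul, add_zero, one_mul, zero_mul, sub_zero] at this
  rw [Real.norm_eq_abs] at this
  convert this using 2
  ring

/-! ### The gradient -/

/-- Square integrable functions with mean zero. -/
def L2zero : Submodule ℝ L2 := LinearMap.ker total

theorem isClosed_L2zero : IsClosed (L2zero : Set L2) := by
  have : (L2zero : Set L2) = total ⁻¹' {0} := by ext; simp [L2zero]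
  rw [this]; exact isClosed_singleton.preimage continuous_total

instance : CompleteSpace L2zero := isClosed_L2zero.completeSpace_coe

/-- The restriction of a linear form to starting points. -/
def partP (D : Lifted →L[ℝ] ℝ) : Plane →L[ℝ] ℝ :=
  (D.comp (ContinuousLinearMap.inl ℝ (Plane × L2) ℝ)).comp (ContinuousLinearMap.inl ℝ Plane L2)

/-- The restriction of a linear form to velocities with mean zero. -/
def partV (D : Lifted →L[ℝ] ℝ) : L2zero →L[ℝ] ℝ :=
  ((D.comp (ContinuousLinearMap.inl ℝ (Plane × L2) ℝ)).comp (ContinuousLinearMap.inr ℝ Plane L2)).comp L2zero.subtypeL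

/-- The restriction of a linear form to periods. -/
def partT (D : Lifted →L[ℝ] ℝ) : ℝ := D (0, 1)

/-- The dual vector, tangent to the space of lifted loops with fixed displacement. -/
def dualVec (D : Lifted →L[ℝ] ℝ) : Lifted :=
  (((InnerProductSpace.toDual ℝ Plane).symm (partP D), ((InnerProductSpace.toDual ℝ L2zero).symm (partV D) : L2zero)),
    partT D)

/-- The squared size of the restriction of a linear form to tangent vectors. -/
def sizeSq (D : Lifted →L[ℝ] ℝ) : ℝ := ‖partP D‖ ^ 2 + ‖partV D‖ ^ 2 + partT D ^ 2

theorem isTangent_dualVec (D : Lifted →L[ℝ] ℝ) : IsTangent (dualVec D) :=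
  ((InnerProductSpace.toDual ℝ L2zero).symm (partV D)).2

theorem apply_eq_parts (D : Lifted →L[ℝ] ℝ) (h : Lifted) (w : L2zero) (hw : (w : L2) = h.1.2) :
    D h = partP D h.1.1 + partV D w + partT D * h.2 := by
  have : h = (((h.1.1, 0), 0) : Lifted) + ((0, (w : L2)), 0) + h.2 • (0, 1) := by
    rw [hw]
    ext1
    · simp
    · simp
  conv_lhs => rw [this]
  rw [map_add, map_add, map_smul]
  simp [partP, partV, partT, mul_comm]

theorem apply_dualVec (D : Lifted →L[ℝ] ℝ) : D (dualVec D) = sizeSq D := by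
  rw [apply_eq_parts D _ ((InnerProductSpace.toDual ℝ L2zero).symm (partV D)) rfl]
  have h1 : partP D ((InnerProductSpace.toDual ℝ Plane).symm (partP D)) = ‖partP D‖ ^ 2 := by
    rw [← (InnerProductSpace.toDual ℝ Plane).symm.norm_map (partP D), ← real_inner_self_eq_norm_sq,
      InnerProductSpace.toDual_symm_apply]
  have h2 : partV D ((InnerProductSpace.toDual ℝ L2zero).symm (partV D)) = ‖partV D‖ ^ 2 := by
    rw [← (InnerProductSpace.toDual ℝ L2zero).symm.norm_map (partV D), ← real_inner_self_eq_norm_sq,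
      InnerProductSpace.toDual_symm_apply]
  have e : (dualVec D).1.1 = (InnerProductSpace.toDual ℝ Plane).symm (partP D) := rfl
  have e' : (dualVec D).2 = partT D := rfl
  rw [e, e', h1, h2, sizeSq]; ring

theorem norm_dualVec_sq_le (D : Lifted →L[ℝ] ℝ) : ‖dualVec D‖ ^ 2 ≤ sizeSq D := by
  have h1 : ‖dualVec D‖ = max (max ‖partP D‖ ‖partV D‖) ‖partT D‖ := by
    have h2 : ‖(((InnerProductSpace.toDual ℝ L2zero).symm (partV D) : L2zero) : L2)‖ = ‖partV D‖ :=
      (InnerProductSpace.toDual ℝ L2zero).symm.norm_map _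
    simp only [dualVec, Prod.norm_def, LinearIsometryEquiv.norm_map]
    rw [h2]
  rw [h1, sizeSq]
  have := sq_nonneg ‖partP D‖
  have := sq_nonneg ‖partV D‖
  have := sq_nonneg (partT D)
  rcases max_choice (max ‖partP D‖ ‖partV D‖) ‖partT D‖ with h | h <;> rw [h]
  · rcases max_choice ‖partP D‖ ‖partV D‖ with h | h <;> rw [h] <;> linarith
  · rw [Real.norm_eq_abs, sq_abs]; linarith

theorem sizeSq_nonneg (D : Lifted →L[ℝ] ℝ) : 0 ≤ sizeSq D := by unfold sizeSq; positivity

theorem abs_apply_le_sizeSq (D : Lifted →L[ℝ] ℝ) {h : Lifted} (hh : IsTangent h) :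
    |D h| ≤ 2 * √(sizeSq D) * ‖h‖ := by
  rw [apply_eq_parts D h ⟨h.1.2, hh⟩ rfl]
  have h1 : |partP D h.1.1| ≤ ‖partP D‖ * ‖h‖ := ((partP D).le_opNorm _).trans
    (by gcongr; exact (norm_fst_le h.1).trans (norm_fst_le h))
  have h2 : |partV D ⟨h.1.2, hh⟩| ≤ ‖partV D‖ * ‖h‖ := ((partV D).le_opNorm _).trans
    (by gcongr; exact (norm_snd_le h.1).trans (norm_fst_le h))
  have h3 : |partT D * h.2| ≤ |partT D| * ‖h‖ := by
    rw [abs_mul]; gcongr; exact norm_snd_le h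
  -- The sum of three numbers is at most √3 times the root of the sum of their squares, and √3 ≤ 2.
  have h4 : ‖partP D‖ + ‖partV D‖ + |partT D| ≤ 2 * √(sizeSq D) := by
    have : (2 : ℝ) = √4 := by rw [show (4 : ℝ) = 2 ^ 2 by norm_num]; simp
    rw [this, ← Real.sqrt_mul (by norm_num)]
    refine Real.le_sqrt_of_sq_le ?_
    rw [sizeSq, ← sq_abs (partT D)]
    nlinarith [sq_nonneg (‖partP D‖ - ‖partV D‖), sq_nonneg (‖partP D‖ - |partT D|),
      sq_nonneg (‖partV D‖ - |partT D|), sq_nonneg ‖partP D‖, sq_nonneg ‖partV D‖, sq_nonneg |partT D|]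
  calc _ ≤ |partP D h.1.1| + |partV D ⟨h.1.2, hh⟩| + |partT D * h.2| := abs_add_three _ _ _
    _ ≤ (‖partP D‖ + ‖partV D‖ + |partT D|) * ‖h‖ := by linarith
    _ ≤ _ := by gcongr

theorem continuous_partP : Continuous partP := by unfold partP; fun_prop

theorem continuous_partV : Continuous partV := by unfold partV; fun_prop

theorem continuous_partT : Continuous partT := by unfold partT; fun_prop

theorem continuous_sizeSq : Continuous sizeSq := by
  have h1 : Continuous fun D => ‖partP D‖ := Continuous.norm (E := Plane →L[ℝ] ℝ) continuous_partP
  have h2 : Continuous fun D => ‖partV D‖ := Continuous.norm (E := L2zero →L[ℝ] ℝ) continuous_partV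
  exact ((h1.pow 2).add (h2.pow 2)).add (continuous_partT.pow 2)

theorem continuous_dualVec : Continuous dualVec := by
  have h1 := (InnerProductSpace.toDual ℝ Plane).symm.continuous.comp continuous_partP
  have h2 := continuous_subtype_val.comp ((InnerProductSpace.toDual ℝ L2zero).symm.continuous.comp continuous_partV)
  exact (h1.prodMk h2).prodMk continuous_partT

end ActionForm

/-! ### Lifts of loops and local sections -/

/-- `z` is a lift of the loop `γ`. -/
structure IsLift (z : Lifted) (γ : LoopsR) : Prop where
  base : proj z.1.1 = γ.1.1.1
  vel : z.1.2 = γ.1.1.2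
  per : z.2 = γ.2

/-- The homology class of a loop. -/
def cls (γ : LoopsR) : Plane := total γ.1.1.2

theorem cls_mem (γ : LoopsR) : cls γ ∈ lattice := γ.1.2

/-- The lift of a loop whose base point is in the unit square with lower left corner `c`. -/
def sec (c : Plane) (γ : LoopsR) : Lifted :=
  ((WithLp.toLp 2 fun i => (AddCircle.equivIco (1 : ℝ) (c i) (γ.1.1.1 i) : ℝ), γ.1.1.2), γ.2)

theorem isLift_sec (c : Plane) (γ : LoopsR) : IsLift (sec c γ) γ :=
  ⟨funext fun i => (AddCircle.equivIco (1 : ℝ) (c i)).symm_apply_apply (γ.1.1.1 i), rfl, rfl⟩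

theorem IsLift.total_eq {z : Lifted} {γ : LoopsR} (h : IsLift z γ) : total z.1.2 = cls γ := by
  rw [h.vel]; rfl

theorem IsLift.mem {z : Lifted} {γ : LoopsR} (h : IsLift z γ) : total z.1.2 ∈ lattice :=
  h.total_eq ▸ cls_mem γ

theorem IsLift.exists_eq {z z' : Lifted} {γ : LoopsR} (h : IsLift z γ) (h' : IsLift z' γ) :
    ∃ w ∈ lattice, z' = ((z.1.1 + w, z.1.2), z.2) :=
  ⟨z'.1.1 - z.1.1, proj_eq_iff.1 (h.base.trans h'.base.symm), by
    refine Prod.ext (Prod.ext (by simp) ?_) ?_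
    · exact h'.vel.trans h.vel.symm
    · exact h'.per.trans h.per.symm⟩

theorem IsLift.add_lattice {z : Lifted} {γ : LoopsR} (h : IsLift z γ) {w : Plane} (hw : w ∈ lattice) :
    IsLift ((z.1.1 + w, z.1.2), z.2) γ :=
  ⟨(proj_add_lattice hw _).trans h.base, h.vel, h.per⟩

theorem equivIco_coe_of_mem {c x : ℝ} (hx : x ∈ Ico c (c + 1)) :
    (AddCircle.equivIco (1 : ℝ) c (x : UnitAddCircle) : ℝ) = x := by
  change toIcoMod one_pos c x = x
  exact (toIcoMod_eq_self one_pos).2 hx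

theorem IsLift.eq_sec {z : Lifted} {γ : LoopsR} (h : IsLift z γ) {c : Plane}
    (hc : ∀ i, z.1.1 i ∈ Ico (c i) (c i + 1)) : sec c γ = z := by
  refine Prod.ext (Prod.ext ?_ h.vel.symm) h.per.symm
  ext i
  have h1 : γ.1.1.1 i = ((z.1.1 i : ℝ) : UnitAddCircle) := by rw [← h.base]; rfl
  change (AddCircle.equivIco (1 : ℝ) (c i) (γ.1.1.1 i) : ℝ) = z.1.1 i
  rw [h1, equivIco_coe_of_mem (hc i)]

/-- The half-open fundamental square jumps only where a coordinate of the base point is congruent to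
that of the corner `c`. With the corner adapted to a given lift, the section is continuous at the
loop and returns that lift. -/
theorem continuousAt_sec {c : Plane} {γ : LoopsR} (h : ∀ i, γ.1.1.1 i ≠ ((c i : ℝ) : UnitAddCircle)) :
    ContinuousAt (sec c) γ := by
  have hb : Continuous fun γ : LoopsR => γ.1.1.1 := by fun_prop
  have hv : Continuous fun γ : LoopsR => γ.1.1.2 := by fun_prop
  refine ContinuousAt.prodMk (ContinuousAt.prodMk ?_ hv.continuousAt) continuous_snd.continuousAt
  refine (PiLp.continuous_toLp 2 _).continuousAt.comp (continuousAt_pi.2 fun i => ?_)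
  have h1 : ContinuousAt (fun γ : LoopsR => γ.1.1.1 i) γ := ((continuous_apply i).comp hb).continuousAt
  exact continuous_subtype_val.continuousAt.comp
    (ContinuousAt.comp (f := fun γ : LoopsR => γ.1.1.1 i) (AddCircle.continuousAt_equivIco 1 (c i) (h i)) h1)

/-- The lower left corner of the unit square centered at `p`. -/
def corner (p : Plane) : Plane := WithLp.toLp 2 fun i => p i - 1 / 2

@[simp] theorem corner_apply (p : Plane) (i : Fin 2) : corner p i = p i - 1 / 2 := rfl

theorem coe_ne_corner {p p' : Plane} (h : ∀ i, p' i ∈ Ioo (corner p i) (corner p i + 1)) (i : Fin 2) :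
    proj p' i ≠ ((corner p i : ℝ) : UnitAddCircle) := fun h1 => by
  obtain ⟨h2, h3⟩ := h i
  have h4 : ((p' i : ℝ) : UnitAddCircle) = ((corner p i : ℝ) : UnitAddCircle) := h1
  have h5 := congrArg (AddCircle.equivIco (1 : ℝ) (corner p i)) h4
  have h6 := congrArg (Subtype.val) h5
  rw [equivIco_coe_of_mem ⟨h2.le, h3⟩, equivIco_coe_of_mem ⟨le_rfl, by linarith⟩] at h6
  linarith

theorem mem_corner (p : Plane) (i : Fin 2) : p i ∈ Ioo (corner p i) (corner p i + 1) :=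
  ⟨by simp, by simp only [corner_apply]; linarith⟩

theorem IsLift.ne_corner {z : Lifted} {γ : LoopsR} (h : IsLift z γ) (i : Fin 2) :
    γ.1.1.1 i ≠ ((corner z.1.1 i : ℝ) : UnitAddCircle) := by
  rw [← h.base]
  exact coe_ne_corner (mem_corner _) i

theorem IsLift.sec_corner {z : Lifted} {γ : LoopsR} (h : IsLift z γ) : sec (corner z.1.1) γ = z :=
  h.eq_sec fun i => Ioo_subset_Ico_self (mem_corner _ i)

theorem IsLift.continuousAt_sec {z : Lifted} {γ : LoopsR} (h : IsLift z γ) :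
    ContinuousAt (sec (corner z.1.1)) γ := MagneticTorus.continuousAt_sec h.ne_corner

theorem IsLift.tendsto_sec {z : Lifted} {γ : LoopsR} (h : IsLift z γ) :
    Tendsto (sec (corner z.1.1)) (𝓝 γ) (𝓝 z) := by
  have := h.continuousAt_sec
  rwa [ContinuousAt, h.sec_corner] at this

theorem continuous_cls : Continuous cls :=
  continuous_total.comp (by fun_prop : Continuous fun γ : LoopsR => γ.1.1.2)

theorem lattice_eq_of_dist {a b : Plane} (ha : a ∈ lattice) (hb : b ∈ lattice) (h : dist a b < 1) : a = b := by
  ext i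
  obtain ⟨x, hx⟩ := ha i
  obtain ⟨y, hy⟩ := hb i
  have h1 : |a i - b i| < 1 := lt_of_le_of_lt (by
    simpa [dist_eq_norm] using PiLp.norm_apply_le (a - b) i) h
  rw [hx, hy] at h1 ⊢
  have h2 : |x - y| < 1 := by
    have h4 : ((|x - y| : ℤ) : ℝ) < 1 := by push_cast; exact h1
    exact_mod_cast h4
  have h3 : x = y := by rw [abs_lt] at h2; omega
  rw [h3]

instance : DiscreteTopology (lattice : Set Plane) :=
  DiscreteTopology.of_forall_le_dist one_pos fun x y hxy => by
    by_contra h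
    exact hxy (Subtype.ext (lattice_eq_of_dist x.2 y.2 (not_le.1 h)))

theorem eventually_cls_eq (γ : LoopsR) : ∀ᶠ γ' in 𝓝 γ, cls γ' = cls γ := by
  filter_upwards [continuous_cls.continuousAt.eventually (Metric.ball_mem_nhds _ one_pos)] with γ' h
  exact lattice_eq_of_dist (cls_mem _) (cls_mem _) h

/-- The loop with a given lift. -/
def ofLift (z : Lifted) (hz : total z.1.2 ∈ lattice) (hT : 0 < z.2) : FreeLoop :=
  ⟨(⟨(proj z.1.1, z.1.2), hz⟩, z.2), hT⟩

theorem isLift_ofLift (z : Lifted) (hz : total z.1.2 ∈ lattice) (hT : 0 < z.2) :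
    IsLift z (ofLift z hz hT).1 := ⟨rfl, rfl, rfl⟩

theorem continuous_ofLift {X : Type*} [TopologicalSpace X] {z : X → Lifted} (hz : Continuous z)
    (h : ∀ x, total (z x).1.2 ∈ lattice) (hT : ∀ x, 0 < (z x).2) :
    Continuous fun x => ofLift (z x) (h x) (hT x) := by
  refine Continuous.subtype_mk (Continuous.prodMk (Continuous.subtype_mk (Continuous.prodMk ?_ ?_) _) ?_) _
  · exact continuous_proj.comp (continuous_fst.comp (continuous_fst.comp hz))
  · exact continuous_snd.comp (continuous_fst.comp hz)
  · exact continuous_snd.comp hz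

theorem IsLift.eq {z : Lifted} {γ γ' : LoopsR} (h : IsLift z γ) (h' : IsLift z γ') : γ = γ' :=
  Prod.ext (Subtype.ext (Prod.ext (h.base.symm.trans h'.base) (h.vel.symm.trans h'.vel)))
    (h.per.symm.trans h'.per)

theorem IsLift.ofLift_eq {z : Lifted} {γ : FreeLoop} (h : IsLift z γ.1) (hz hT) : ofLift z hz hT = γ :=
  Subtype.ext ((isLift_ofLift z hz hT).eq h)

theorem IsLift.pos {z : Lifted} {γ : FreeLoop} (h : IsLift z γ.1) : 0 < z.2 := h.per ▸ γ.2

/-! ### Connected components -/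

theorem cls_eq_of_isPreconnected {S : Set FreeLoop} (hS : IsPreconnected S) {γ γ' : FreeLoop}
    (h : γ ∈ S) (h' : γ' ∈ S) : cls γ.1 = cls γ'.1 :=
  hS.constant_of_mapsTo (T := (lattice : Set Plane)) (f := fun γ : FreeLoop => cls γ.1)
    ⟨inferInstance⟩ (continuous_cls.comp continuous_subtype_val).continuousOn (fun γ _ => cls_mem γ.1) h h'

/-- The homology class is continuous with values in a discrete lattice, so it is constant on
connected sets. Conversely, the straight segment between lifts with equal displacement keeps the
displacement and a positive period. -/
theorem mem_connectedComponent_iff {γ γ' : FreeLoop} : γ' ∈ connectedComponent γ ↔ cls γ'.1 = cls γ.1 := by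
  refine ⟨fun h => cls_eq_of_isPreconnected isPreconnected_connectedComponent h mem_connectedComponent, fun h => ?_⟩
  have hz := isLift_sec 0 γ.1
  have hz' := isLift_sec 0 γ'.1
  set z := sec 0 γ.1
  set z' := sec 0 γ'.1
  let w : unitInterval → Lifted := fun s => z + (s : ℝ) • (z' - z)
  have hw : Continuous w := by fun_prop
  have hm : ∀ s, total (w s).1.2 ∈ lattice := fun s => by
    have : total (w s).1.2 = cls γ.1 := by
      change total (z.1.2 + (s : ℝ) • (z'.1.2 - z.1.2)) = _
      rw [map_add, map_smul, map_sub, hz.total_eq, hz'.total_eq, h]; simp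
    rw [this]; exact cls_mem _
  have hT : ∀ s, 0 < (w s).2 := fun s => by
    change 0 < z.2 + (s : ℝ) * (z'.2 - z.2)
    have h1 := hz.pos; have h2 := hz'.pos; have h3 := s.2.1; have h4 := s.2.2
    rcases eq_or_lt_of_le h3 with h5 | h5
    · rw [← h5]; linarith
    · nlinarith [mul_pos h5 h2, mul_nonneg (sub_nonneg.2 h4) h1.le]
  have hc := isPreconnected_range (continuous_ofLift hw hm hT)
  refine hc.subset_connectedComponent ⟨0, ?_⟩ ⟨1, ?_⟩
  · exact IsLift.ofLift_eq (by simpa [w] using hz) _ _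
  · exact IsLift.ofLift_eq (by simpa [w] using hz') _ _

theorem cls_shift (ψ : ℝ) (γ : FreeLoop) : cls (shift ψ γ).1 = cls γ.1 := integral_comp_L2 _ _

theorem cls_iterate (n : ℕ+) (γ : FreeLoop) : cls (iterate n γ).1 = ((n : ℕ) : ℝ) • cls γ.1 := by
  change total (((n : ℕ) : ℝ) • _) = _
  rw [map_smul]
  congr 1
  exact integral_comp_L2 _ _

theorem mem_contractibleLoops {γ : FreeLoop} : γ ∈ contractibleLoops ↔ cls γ.1 = 0 := by
  rw [contractibleLoops, mem_connectedComponent_iff]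
  have : cls constLoop.1 = 0 := map_zero total
  rw [this]

theorem mem_component {α γ : FreeLoop} {n : ℕ+} :
    γ ∈ component α n ↔ cls γ.1 = ((n : ℕ) : ℝ) • cls α.1 := by
  rw [component, mem_connectedComponent_iff, cls_iterate]

/-! ### One-forms in terms of lifts -/

/-- A tangent vector as a displacement of lifts. -/
def incl : Tangent →L[ℝ] Lifted := fields.subtypeL.prodMap (ContinuousLinearMap.id ℝ ℝ)

theorem incl_apply (h : Tangent) : incl h = ((h.1.1.1, h.1.1.2), h.2) := rfl

theorem isTangent_incl (h : Tangent) : IsTangent (incl h) := h.1.2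

theorem IsTangent.exists_incl {h : Lifted} (hh : IsTangent h) : ∃ h' : Tangent, incl h' = h :=
  ⟨(⟨h.1, hh⟩, h.2), rfl⟩

theorem norm_incl (h : Tangent) : ‖incl h‖ = ‖h‖ := rfl

theorem IsLift.displace {z : Lifted} {γ : FreeLoop} (h : IsLift z γ.1) (ξ : Tangent) :
    IsLift (z + incl ξ) (displace γ ξ) where
  base := by
    change proj (z.1.1 + ξ.1.1.1) = γ.1.1.1.1 + proj ξ.1.1.1
    rw [proj_add, h.base]
  vel := by
    change z.1.2 + ξ.1.1.2 = γ.1.1.1.2 + ξ.1.1.2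
    rw [h.vel]
  per := by
    change z.2 + ξ.2 = γ.1.2 + ξ.2
    rw [h.per]

theorem ext01_nem_curveC {F : Type*} [NormedAddCommGroup F] {G : Plane → F} (hG : Continuous G)
    (x : Plane × L2) {s : ℝ} (hs : s ∈ Icc (0 : ℝ) 1) : ext01 (nem hG (curveC x)) s = G (curve x.1 x.2 s) := by
  rw [ext01_of_mem _ hs, nem_apply, curveC_apply]

section

variable (g : RiemannianMetric) (σ : TwoForm)

theorem kin_eq (x : Plane × L2) :
    kin g x = 1 / 2 * ∫ s in (0 : ℝ)..1, g.toFun (curve x.1 x.2 s) (ev x.2 s) (ev x.2 s) := by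
  rw [kin, Bil_apply]
  congr 1
  refine intervalIntegral.integral_congr fun s hs => ?_
  simp only [uIcc_of_le zero_le_one] at hs ⊢
  rw [ext01_nem_curveC _ _ hs]; rfl

theorem kinetic_eq_kin {z : Lifted} {γ : LoopsR} (h : IsLift z γ) : kinetic g γ = kin g z.1 := by
  obtain ⟨w, hw, h2⟩ := (isLift_sec 0 γ).exists_eq h
  rw [h2, kin_translate _ hw, kin_eq]; rfl

theorem tau_eq (x : Plane × L2) (h : Plane × L2) : tau σ x h =
    ∫ s in (0 : ℝ)..1, σ.eval (curve x.1 x.2 s) (curve h.1 h.2 s) (ev x.2 s) := by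
  rw [tau_apply, Lin_apply]
  refine intervalIntegral.integral_congr fun s hs => ?_
  simp only [uIcc_of_le zero_le_one] at hs ⊢
  rw [ext01_of_mem _ hs, applyC_apply, nem_apply, curveC_apply, curveC_apply, TwoForm.form_apply]

theorem transgression_eq {z : Lifted} {γ : FreeLoop} (h : IsLift z γ.1) (ξ : Tangent) :
    transgression σ γ ξ = tau σ z.1 (incl ξ).1 := by
  obtain ⟨w, hw, h2⟩ := (isLift_sec 0 γ.1).exists_eq h
  rw [h2, tau_translate _ _ hw, tau_eq]; rfl

theorem freeAction_displace (k : ℝ) {z : Lifted} {γ : FreeLoop} (h : IsLift z γ.1) (ξ : Tangent) :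
    freeAction g k (displace γ ξ) = kin g (z + incl ξ).1 / (z + incl ξ).2 + k * (z + incl ξ).2 := by
  rw [freeAction, kinetic_eq_kin g (h.displace ξ), (h.displace ξ).per]

theorem actionForm_eq (k : ℝ) {z : Lifted} {γ : FreeLoop} (h : IsLift z γ.1) (ξ : Tangent) :
    actionForm g σ k γ ξ = act' g σ k z (incl ξ) := by
  have hT : z.2 ≠ 0 := h.pos.ne'
  have h1 : HasFDerivAt (fun ξ : Tangent => z + incl ξ) incl 0 := incl.hasFDerivAt.const_add z
  have h2 : HasFDerivAt (fun ξ : Tangent => kin g (z + incl ξ).1)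
      ((kin' g z.1).comp ((ContinuousLinearMap.fst ℝ (Plane × L2) ℝ).comp incl)) 0 := by
    have := (ContinuousLinearMap.fst ℝ (Plane × L2) ℝ).hasFDerivAt.comp (0 : Tangent) h1
    refine HasFDerivAt.comp (0 : Tangent) (g := kin g) ?_ this
    simpa using hasFDerivAt_kin g z.1
  have h3 : HasFDerivAt (fun ξ : Tangent => (z + incl ξ).2)
      ((ContinuousLinearMap.snd ℝ (Plane × L2) ℝ).comp incl) 0 :=
    (ContinuousLinearMap.snd ℝ (Plane × L2) ℝ).hasFDerivAt.comp (0 : Tangent) h1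
  have h4 : HasFDerivAt (fun ξ : Tangent => (z + incl ξ).2⁻¹)
      ((-(z.2 ^ 2)⁻¹) • ((ContinuousLinearMap.snd ℝ (Plane × L2) ℝ).comp incl)) 0 := by
    have h5 : HasDerivAt (fun x : ℝ => x⁻¹) (-((z + incl 0).2 ^ 2)⁻¹) (z + incl (0 : Tangent)).2 :=
      hasDerivAt_inv (by simpa using hT)
    have := h5.comp_hasFDerivAt (0 : Tangent) h3
    simp only [map_zero, add_zero] at this
    exact this
  have h5 : HasFDerivAt (fun ξ : Tangent => kin g (z + incl ξ).1 * (z + incl ξ).2⁻¹ + k * (z + incl ξ).2) _ 0 :=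
    (h2.mul h4).add (h3.const_mul k)
  rw [actionForm, transgression_eq σ h, act'_apply]
  simp only [freeAction_displace g k h, div_eq_mul_inv]
  rw [h5.fderiv]
  simp only [map_zero, add_zero]
  simp [incl_apply]
  ring

/-- The squared size of the action one-form. -/
def slope (k : ℝ) (γ : FreeLoop) : ℝ := sizeSq (act' g σ k (sec 0 γ.1))

theorem slope_eq (k : ℝ) {z : Lifted} {γ : FreeLoop} (h : IsLift z γ.1) : slope g σ k γ = sizeSq (act' g σ k z) := by
  obtain ⟨w, hw, h2⟩ := (isLift_sec 0 γ.1).exists_eq h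
  rw [h2, act'_translate k _ hw]; rfl

theorem slope_nonneg (k : ℝ) (γ : FreeLoop) : 0 ≤ slope g σ k γ := sizeSq_nonneg _

/-- The dual vector is tangent and pairs with the form to `sizeSq`, and conversely `sizeSq` bounds
the form on tangent vectors. -/
theorem isZero_iff_slope (k : ℝ) (γ : FreeLoop) : IsZero g σ k γ ↔ slope g σ k γ = 0 := by
  have hz := isLift_sec 0 γ.1
  constructor
  · intro h
    obtain ⟨ξ, hξ⟩ := (isTangent_dualVec (act' g σ k (sec 0 γ.1))).exists_incl
    rw [slope, ← apply_dualVec, ← hξ, ← actionForm_eq g σ k hz]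
    exact h ξ
  · intro h ξ
    rw [actionForm_eq g σ k hz]
    have := abs_apply_le_sizeSq (act' g σ k (sec 0 γ.1)) (isTangent_incl ξ)
    rw [show sizeSq (act' g σ k (sec 0 γ.1)) = 0 from h] at this
    simpa using this

theorem continuous_slope (k : ℝ) : Continuous (slope g σ k) := by
  refine continuous_iff_continuousAt.2 fun γ => ?_
  have hz := isLift_sec 0 γ.1
  -- The fixed section in the definition of `slope` may jump at γ. Invariance under the lattice
  -- allows it to be replaced by the section centered at a lift of γ.
  have h1 : slope g σ k = fun γ' : FreeLoop => sizeSq (act' g σ k (sec (corner (sec 0 γ.1).1.1) γ'.1)) :=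
    funext fun γ' => slope_eq g σ k (isLift_sec _ _)
  rw [h1]
  refine ContinuousAt.comp (g := fun z => sizeSq (act' g σ k z)) ?_
    (hz.continuousAt_sec.comp continuous_subtype_val.continuousAt)
  refine continuous_sizeSq.continuousAt.comp ?_
  rw [hz.sec_corner]
  exact continuousAt_act' g σ k hz.pos

end

/-! ### Integrals of closed one-forms along paths -/

/-- Only the base point has to be lifted, and this is path lifting for ℝ → ℝ/ℤ in each coordinate.
-/
theorem exists_continuous_lift (u : C(unitInterval, FreeLoop)) {z₀ : Lifted} (h₀ : IsLift z₀ (u 0).1) :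
    ∃ z : unitInterval → Lifted, Continuous z ∧ z 0 = z₀ ∧ ∀ s, IsLift (z s) (u s).1 := by
  have hu : Continuous fun s => (u s).1 := continuous_subtype_val.comp u.continuous
  have hv : Continuous fun s => (u s).1.1.1.2 :=
    (by fun_prop : Continuous fun γ : LoopsR => γ.1.1.2).comp hu
  have hb : ∀ i, Continuous fun s => (u s).1.1.1.1 i := fun i =>
    (by fun_prop : Continuous fun γ : LoopsR => γ.1.1.1 i).comp hu
  have hT : Continuous fun s => (u s).1.2 := continuous_snd.comp hu
  have hc := AddCircle.isCoveringMap_coe (1 : ℝ)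
  have key : ∀ i, ∃ p : C(unitInterval, ℝ), (∀ s, ((p s : ℝ) : UnitAddCircle) = (u s).1.1.1.1 i) ∧ p 0 = z₀.1.1 i := by
    intro i
    obtain ⟨Γ, h1, h2⟩ := hc.exists_path_lifts (γ := ⟨fun s => (u s).1.1.1.1 i, hb i⟩) (e := z₀.1.1 i)
      (congrFun h₀.base i).symm
    exact ⟨Γ, fun s => congrFun h1 s, h2⟩
  choose p hp hp0 using key
  refine ⟨fun s => ((WithLp.toLp 2 fun i => p i s, (u s).1.1.1.2), (u s).1.2), ?_, ?_, fun s => ⟨?_, rfl, rfl⟩⟩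
  · refine Continuous.prodMk (Continuous.prodMk ?_ hv) hT
    exact (PiLp.continuous_toLp 2 _).comp (continuous_pi fun i => (p i).continuous)
  · refine Prod.ext (Prod.ext ?_ h₀.vel.symm) h₀.per.symm
    ext i; exact hp0 i
  · funext i; exact hp i s

/-- The one-form `η` on loops is represented by the form `A'` on lifts, with primitives `A m` on the
classes `m`. -/
structure IsRepresented (η : OneForm) (A : Plane → Lifted → ℝ) (A' : Lifted → Lifted →L[ℝ] ℝ) : Prop where
  eq : ∀ {z : Lifted} {γ : FreeLoop}, IsLift z γ.1 → ∀ ξ, η γ ξ = A' z (incl ξ)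
  deriv : ∀ m ∈ lattice, ∀ z : Lifted, total z.1.2 = m → z.2 ≠ 0 →
    ∃ D : Lifted →L[ℝ] ℝ, HasFDerivAt (A m) D z ∧ ∀ h, IsTangent h → D h = A' z h

section

variable {η : OneForm} {A : Plane → Lifted → ℝ} {A' : Lifted → Lifted →L[ℝ] ℝ}

theorem IsRepresented.hasFDerivAt (h : IsRepresented η A A') {z : Lifted} {γ : FreeLoop} (hz : IsLift z γ.1) :
    HasFDerivAt (fun ξ => A (cls γ.1) (z + incl ξ)) ((A' z).comp incl) 0 := by
  obtain ⟨D, hD, hD'⟩ := h.deriv _ (cls_mem γ.1) z hz.total_eq hz.pos.ne'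
  have h1 : HasFDerivAt (fun ξ : Tangent => z + incl ξ) incl 0 := incl.hasFDerivAt.const_add z
  have h2 : HasFDerivAt (A (cls γ.1)) D (z + incl (0 : Tangent)) := by simpa using hD
  have h3 : (A' z).comp incl = D.comp incl :=
    ContinuousLinearMap.ext fun ξ => (hD' _ (isTangent_incl ξ)).symm
  rw [h3]
  exact h2.comp (0 : Tangent) h1

theorem isOpen_sec_domain (c m : Plane) :
    IsOpen {γ : FreeLoop | cls γ.1 = m ∧ ∀ i, γ.1.1.1.1 i ≠ ((c i : ℝ) : UnitAddCircle)} := by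
  refine IsOpen.and ?_ ?_
  · refine isOpen_iff_mem_nhds.2 fun γ hγ => ?_
    filter_upwards [continuous_subtype_val.continuousAt.eventually (eventually_cls_eq γ.1)] with γ' h
    exact h.trans hγ
  · simp only [Set.ofPred_forall]
    refine isOpen_iInter_of_finite fun i => isOpen_ne_fun ?_ continuous_const
    exact (by fun_prop : Continuous fun γ : LoopsR => γ.1.1.1 i).comp continuous_subtype_val

theorem sec_mem_Ioo {c : Plane} {γ : LoopsR} (h : ∀ i, γ.1.1.1 i ≠ ((c i : ℝ) : UnitAddCircle)) (i : Fin 2) :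
    (sec c γ).1.1 i ∈ Ioo (c i) (c i + 1) := by
  have h1 := (AddCircle.equivIco (1 : ℝ) (c i) (γ.1.1.1 i)).2
  refine ⟨lt_of_le_of_ne h1.1 fun h2 => h i ?_, h1.2⟩
  rw [h2]
  exact (congrFun (isLift_sec c γ).base i).symm

/-- Off the jump set the lifted base point is interior to the square, so for small ξ the section of
the displaced loop is the displaced lift. -/
theorem IsRepresented.isPrimitiveOn (h : IsRepresented η A A') (c m : Plane) :
    IsPrimitiveOn η (fun γ => A m (sec c γ)) {γ : FreeLoop | cls γ.1 = m ∧ ∀ i, γ.1.1.1.1 i ≠ ((c i : ℝ) : UnitAddCircle)} := by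
  intro γ hγ
  have hz := isLift_sec c γ.1
  have h1 : HasFDerivAt (fun ξ => A m (sec c (displace γ ξ))) ((A' (sec c γ.1)).comp incl) 0 := by
    have h2 := h.hasFDerivAt hz
    rw [hγ.1] at h2
    refine h2.congr_of_eventuallyEq ?_
    have h3 : ∀ i, ∀ᶠ ξ : Tangent in 𝓝 0, (sec c γ.1 + incl ξ).1.1 i ∈ Ioo (c i) (c i + 1) := fun i => by
      have h4 : Continuous fun ξ : Tangent => (sec c γ.1 + incl ξ).1.1 i := by
        have : Continuous fun z : Lifted => z.1.1 i := by fun_prop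
        exact this.comp (continuous_const.add incl.continuous)
      refine h4.continuousAt.eventually (Ioo_mem_nhds ?_ ?_) <;> simp only [map_zero, add_zero]
      exacts [(sec_mem_Ioo hγ.2 i).1, (sec_mem_Ioo hγ.2 i).2]
    filter_upwards [eventually_all.2 h3] with ξ hξ
    rw [(hz.displace ξ).eq_sec fun i => Ioo_subset_Ico_self (hξ i)]
  refine ⟨h1.differentiableAt, fun ξ => ?_⟩
  rw [h1.fderiv, h.eq hz]; rfl

/-- A primitive differs from the primitive on lifts by a locally constant function. -/
theorem IsRepresented.eventually_sub_eq (h : IsRepresented η A A') {F : LoopsR → ℝ} {O : Set FreeLoop} (hO : IsOpen O)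
    (hF : IsPrimitiveOn η F O) {z : Lifted} {γ : FreeLoop} (hγ : γ ∈ O) (hz : IsLift z γ.1) :
    ∀ᶠ z' in 𝓝 z, ∀ γ' : FreeLoop, IsLift z' γ'.1 → cls γ'.1 = cls γ.1 →
      F γ'.1 - F γ.1 = A (cls γ.1) z' - A (cls γ.1) z := by
  set m := cls γ.1
  have hpos : ∀ᶠ ξ : Tangent in 𝓝 0, 0 < (displace γ ξ).2 := by
    have : Continuous fun ξ : Tangent => γ.1.2 + ξ.2 := by fun_prop
    exact this.continuousAt.eventually (lt_mem_nhds (by simpa using γ.2))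
  have hO' : ∀ᶠ ξ : Tangent in 𝓝 0, ∃ h : 0 < (displace γ ξ).2, (⟨displace γ ξ, h⟩ : FreeLoop) ∈ O := by
    obtain ⟨O', hO', rfl⟩ := isOpen_induced_iff.1 hO
    have hc : Continuous (displace γ) := by
      refine continuous_const.add (Continuous.prodMk ?_ continuous_snd)
      refine Continuous.subtype_mk (Continuous.prodMk ?_ ?_) _
      · exact continuous_proj.comp (by fun_prop : Continuous fun ξ : Tangent => ξ.1.1.1)
      · fun_prop
    have h0 : displace γ 0 = γ.1 := by
      have h1 := hz.displace 0
      simp only [map_zero, add_zero] at h1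
      exact h1.eq hz
    filter_upwards [hpos, hc.continuousAt.eventually (hO'.mem_nhds (by rw [h0]; exact hγ))] with ξ h1 h2
    exact ⟨h1, h2⟩
  obtain ⟨r, hr, hball⟩ := Metric.eventually_nhds_iff_ball.1 hO'
  -- On a small ball of tangent vectors both functions have the same differential at every point, so
  -- their difference has derivative zero on a convex set.
  have hder : ∀ ξ ∈ Metric.ball (0 : Tangent) r,
      HasFDerivAt (fun ξ => F (displace γ ξ) - A m (z + incl ξ)) (0 : Tangent →L[ℝ] ℝ) ξ := by
    intro ξ hξ
    obtain ⟨hp, hm⟩ := hball ξ hξ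
    set γ' : FreeLoop := ⟨displace γ ξ, hp⟩
    have hz' : IsLift (z + incl ξ) γ'.1 := hz.displace ξ
    have hm' : cls γ'.1 = m := by
      rw [← hz'.total_eq]
      change total (z.1.2 + (incl ξ).1.2) = _
      rw [map_add, hz.total_eq, show total (incl ξ).1.2 = 0 from isTangent_incl ξ, add_zero]
    obtain ⟨h1, h2⟩ := hF γ' hm
    have h3 := h1.hasFDerivAt.sub (h.hasFDerivAt hz')
    rw [hm'] at h3
    have h4 : fderiv ℝ (fun ζ : Tangent => F (displace γ' ζ)) 0 - (A' (z + incl ξ)).comp incl = 0 := by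
      refine ContinuousLinearMap.ext fun ζ => ?_
      rw [sub_apply, h2, h.eq hz']; simp
    rw [h4] at h3
    have h5 : HasFDerivAt (fun ζ : Tangent => ζ - ξ) (ContinuousLinearMap.id ℝ Tangent) ξ :=
      (hasFDerivAt_id ξ).sub_const ξ
    have h6 := HasFDerivAt.comp ξ (by rw [sub_self]; exact h3) h5
    rw [ContinuousLinearMap.zero_comp] at h6
    refine h6.congr_of_eventuallyEq (Eventually.of_forall fun ζ => ?_)
    have h7 : displace γ' (ζ - ξ) = displace γ ζ := by
      have h8 := hz'.displace (ζ - ξ)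
      have h9 : z + incl ξ + incl (ζ - ξ) = z + incl ζ := by rw [map_sub]; abel
      rw [h9] at h8
      exact h8.eq (hz.displace ζ)
    have h9 : z + incl ξ + incl (ζ - ξ) = z + incl ζ := by rw [map_sub]; abel
    simp only [Function.comp_apply, Pi.sub_apply, h7, h9]
  have hconst : ∀ ξ ∈ Metric.ball (0 : Tangent) r, F (displace γ ξ) - A m (z + incl ξ) = F γ.1 - A m z := by
    intro ξ hξ
    have h1 := (convex_ball (0 : Tangent) r).norm_image_sub_le_of_norm_hasFDerivWithin_le (C := 0)
      (fun ζ hζ => (hder ζ hζ).hasFDerivWithinAt) (fun ζ _ => by simp) (Metric.mem_ball_self hr) hξ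
    have h2 : displace γ 0 = γ.1 := by
      have h1 := hz.displace 0
      simp only [map_zero, add_zero] at h1
      exact h1.eq hz
    simp only [zero_mul, norm_le_zero_iff, h2, map_zero, add_zero] at h1
    linarith
  filter_upwards [Metric.ball_mem_nhds z hr] with z' hz'r γ' hz' hm'
  have ht : IsTangent (z' - z) := isTangent_sub (by rw [hz'.total_eq, hz.total_eq, hm'])
  obtain ⟨ξ, hξ⟩ := ht.exists_incl
  have h1 : ξ ∈ Metric.ball (0 : Tangent) r := by
    rw [mem_ball_zero_iff, ← norm_incl, hξ, ← dist_eq_norm]; exact hz'r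
  have h2 := hconst ξ h1
  have h3 : z + incl ξ = z' := by rw [hξ]; abel
  have h4 : displace γ ξ = γ'.1 := by
    have := hz.displace ξ
    rw [h3] at this
    exact this.eq hz'
  rw [h3, h4] at h2
  linarith

/-- Local sections composed with `A` are local primitives, so the increment of `A` along the lift is
one admissible integral. For any other one the difference to `A` along the lift is locally constant
on the connected interval, so the choice made in `pathIntegral` does not matter. -/
theorem IsRepresented.pathIntegral_eq (h : IsRepresented η A A') (u : C(unitInterval, FreeLoop))
    {z : unitInterval → Lifted} (hz : Continuous z) (hl : ∀ s, IsLift (z s) (u s).1) (s : unitInterval) :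
    pathIntegral η u s = A (cls (u 0).1) (z s) - A (cls (u 0).1) (z 0) := by
  have hcls : ∀ s, cls (u s).1 = cls (u 0).1 := fun s =>
    cls_eq_of_isPreconnected (isPreconnected_range u.continuous) (mem_range_self s) (mem_range_self 0)
  set m := cls (u 0).1
  have hex : IsIntegralAlong η u fun s => A m (z s) - A m (z 0) := by
    refine ⟨sub_self _, fun s₀ => ⟨_, fun γ => A m (sec (corner (z s₀).1.1) γ), isOpen_sec_domain (corner (z s₀).1.1) m,
      ⟨hcls s₀, (hl s₀).ne_corner⟩, h.isPrimitiveOn _ _, ?_⟩⟩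
    have h1 : ∀ i, ∀ᶠ s in 𝓝 s₀, (z s).1.1 i ∈ Ioo (corner (z s₀).1.1 i) (corner (z s₀).1.1 i + 1) := fun i =>
      ((by fun_prop : Continuous fun z : Lifted => z.1.1 i).comp hz).continuousAt.eventually
        (isOpen_Ioo.mem_nhds (mem_corner _ i))
    filter_upwards [eventually_all.2 h1] with s hs
    rw [(hl s).eq_sec fun i => Ioo_subset_Ico_self (hs i), (hl s₀).sec_corner]
    ring
  have hex' : ∃ Φ, IsIntegralAlong η u Φ := ⟨_, hex⟩
  rw [pathIntegral, dif_pos hex']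
  obtain ⟨h0, hΦ⟩ := hex'.choose_spec
  set Φ := hex'.choose
  have hlc : IsLocallyConstant fun s => Φ s - A m (z s) := by
    refine (IsLocallyConstant.iff_eventually_eq _).2 fun s₀ => ?_
    obtain ⟨O, F, hO, hmem, hF, hev⟩ := hΦ s₀
    have h2 := h.eventually_sub_eq hO hF hmem (hl s₀)
    filter_upwards [hev, hz.continuousAt.eventually h2] with s h3 h4
    have h5 := h4 (u s) (hl s) ((hcls s).trans (hcls s₀).symm)
    rw [hcls s₀] at h5
    linarith
  have h6 := hlc.apply_eq_of_preconnectedSpace s 0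
  simp only [h0] at h6
  linarith

end

section

variable (g : RiemannianMetric) (σ : TwoForm)

theorem isRepresented_actionForm (k : ℝ) : IsRepresented (actionForm g σ k) (act g σ k) (act' g σ k) :=
  ⟨fun h ξ => actionForm_eq g σ k h ξ, fun m hm z hz hT => exists_hasFDerivAt_act k m hm z hz hT⟩

theorem isRepresented_transgression : IsRepresented (transgression σ) (fun m z => mag σ m z.1)
    (fun z => (tau σ z.1).comp (ContinuousLinearMap.fst ℝ (Plane × L2) ℝ)) :=
  ⟨fun h ξ => transgression_eq σ h ξ, fun m hm z hz _ => by
    obtain ⟨D, hD, hD'⟩ := exists_hasFDerivAt_mag σ m hm z.1 hz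
    exact ⟨D.comp (ContinuousLinearMap.fst ℝ (Plane × L2) ℝ), hD.comp z
      (ContinuousLinearMap.fst ℝ (Plane × L2) ℝ).hasFDerivAt, fun h hh => hD' _ hh⟩⟩

end

/-! ### Primitives on the punctured torus -/

section Domain

variable {σ : TwoForm}

theorem PuncturedPrimitive.isOpen (P : PuncturedPrimitive σ) : IsOpen {p | proj p ≠ P.q} :=
  isOpen_ne_fun continuous_proj continuous_const

/-- Multiplication by a smooth cutoff that is one near K and vanishes off a compact thickening
avoiding the puncture. The result is smooth on the whole plane, so the calculus of superposition
operators applies to it. -/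
theorem PuncturedPrimitive.exists_extension (P : PuncturedPrimitive σ) {K : Set Plane} (hK : IsCompact K)
    (hq : ∀ p ∈ K, proj p ≠ P.q) :
    ∃ Θ : Plane → Covec, ContDiff ℝ ∞ Θ ∧ ∃ W, IsOpen W ∧ K ⊆ W ∧ (∀ p ∈ W, proj p ≠ P.q) ∧ ∀ p ∈ W, Θ p = P.θ p := by
  obtain ⟨δ, hδ, ht⟩ := hK.exists_cthickening_subset_open P.isOpen hq
  obtain ⟨f, h1, h0, -⟩ := exists_contMDiffMap_one_nhds_of_subset_interior (n := (⊤ : ℕ∞)) (modelWithCornersSelf ℝ Plane) (s := K)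
    (t := Metric.cthickening δ K) hK.isClosed
    ((Metric.self_subset_thickening hδ K).trans
      (Metric.isOpen_thickening.subset_interior_iff.2 (Metric.thickening_subset_cthickening δ K)))
  have hf : ContDiff ℝ ∞ f := f.contMDiff.contDiff
  obtain ⟨W, hW, hKW, hW1⟩ := eventually_nhdsSet_iff_exists.1 h1
  refine ⟨fun p => f p • P.θ p, ?_, W ∩ {p | proj p ≠ P.q}, hW.inter P.isOpen, subset_inter hKW hq,
    fun p hp => hp.2, fun p hp => by simp [hW1 p hp.1]⟩
  refine contDiff_iff_contDiffAt.2 fun p => ?_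
  by_cases hp : p ∈ Metric.cthickening δ K
  · exact hf.contDiffAt.smul (P.smooth.contDiffAt (P.isOpen.mem_nhds (ht hp)))
  · have : (fun p => f p • P.θ p) =ᶠ[𝓝 p] fun _ => (0 : Covec) := by
      filter_upwards [Metric.isClosed_cthickening.isOpen_compl.mem_nhds hp] with p' hp'
      rw [h0 p' hp', zero_smul]
    exact contDiffAt_const.congr_of_eventuallyEq this

theorem PuncturedPrimitive.θ_add (P : PuncturedPrimitive σ) {p w : Plane} (hw : w ∈ lattice) (hp : proj p ≠ P.q) :
    P.θ (p + w) = P.θ p :=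
  (P.periodic _ _ hp (proj_add_lattice hw p).symm).symm

/-- The lifted curve avoids the puncture. -/
def Avoids (P : PuncturedPrimitive σ) (x : Plane × L2) : Prop := ∀ s : ℝ, proj (curve x.1 x.2 s) ≠ P.q

/-- The integral of the primitive along a lifted curve. -/
def thetaInt (P : PuncturedPrimitive σ) (x : Plane × L2) : ℝ :=
  ∫ s in (0 : ℝ)..1, P.θ (curve x.1 x.2 s) (ev x.2 s)

theorem Avoids.of_Icc {P : PuncturedPrimitive σ} {x : Plane × L2} (hm : total x.2 ∈ lattice)
    (h : ∀ s ∈ Icc (0 : ℝ) 1, proj (curve x.1 x.2 s) ≠ P.q) : Avoids P x := by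
  have hp : Function.Periodic (fun s => proj (curve x.1 x.2 s)) 1 := fun s => by
    simp only [curve_add_one, proj_add_lattice hm]
  intro s
  obtain ⟨t, ht, hst⟩ := hp.exists_mem_Ico₀ one_pos s
  rw [hst]
  exact h t (Ico_subset_Icc_self ht)

theorem Avoids.translate {P : PuncturedPrimitive σ} {x : Plane × L2} (h : Avoids P x) {w : Plane} (hw : w ∈ lattice) :
    Avoids P (x.1 + w, x.2) := fun s => by
  simp only [curve_translate, proj_add_lattice hw]; exact h s

theorem thetaInt_translate {P : PuncturedPrimitive σ} {x : Plane × L2} (h : Avoids P x) {w : Plane} (hw : w ∈ lattice) :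
    thetaInt P (x.1 + w, x.2) = thetaInt P x := by
  refine intervalIntegral.integral_congr fun s _ => ?_
  simp only [curve_translate, P.θ_add hw (h s)]

theorem mem_domain_iff {P : PuncturedPrimitive σ} {z : Lifted} {γ : FreeLoop} (h : IsLift z γ.1) :
    γ ∈ P.domain ↔ Avoids P z.1 := by
  have hz := isLift_sec 0 γ.1
  have h1 : γ ∈ P.domain ↔ Avoids P (sec 0 γ.1).1 := Iff.rfl
  rw [h1]
  constructor
  · intro h2
    obtain ⟨w, hw, h3⟩ := hz.exists_eq h
    rw [h3]; exact h2.translate hw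
  · intro h2
    obtain ⟨w, hw, h3⟩ := h.exists_eq hz
    rw [h3]; exact h2.translate hw

/-- Near a curve that avoids the puncture, the integral of the primitive is given by a smooth
one-form on the whole plane. -/
theorem Avoids.exists_eventually {P : PuncturedPrimitive σ} {x : Plane × L2} (h : Avoids P x) :
    ∃ Θ : Plane → Covec, ∃ hΘ : ContDiff ℝ ∞ Θ, (∀ s ∈ Icc (0 : ℝ) 1, Θ =ᶠ[𝓝 (curve x.1 x.2 s)] P.θ) ∧
      ∀ᶠ x' in 𝓝 x, (∀ s ∈ Icc (0 : ℝ) 1, proj (curve x'.1 x'.2 s) ≠ P.q ∧ Θ (curve x'.1 x'.2 s) = P.θ (curve x'.1 x'.2 s)) ∧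
        thetaInt P x' = Lin (nem hΘ.continuous (curveC x')) x'.2 := by
  obtain ⟨Θ, hΘ, W, hW, hKW, hq, hWθ⟩ := P.exists_extension (K := curve x.1 x.2 '' Icc 0 1)
    (isCompact_Icc.image (continuous_curve _ _)) (by rintro _ ⟨s, -, rfl⟩; exact h s)
  refine ⟨Θ, hΘ, fun s hs => ?_, ?_⟩
  · filter_upwards [hW.mem_nhds (hKW (mem_image_of_mem _ hs))] with p hp using hWθ p hp
  · have hopen : IsOpen {y : CI Plane | ∀ s : unitInterval, y s ∈ W} := by
      have := ContinuousMap.isOpen_setOfPred_mapsTo (X := unitInterval) (Y := Plane) isCompact_univ hW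
      simp only [MapsTo, mem_univ, true_imp_iff] at this
      exact this
    have hx : curveC x ∈ {y : CI Plane | ∀ s : unitInterval, y s ∈ W} := fun s => by
      rw [curveC_apply]; exact hKW (mem_image_of_mem _ s.2)
    filter_upwards [curveC.continuous.continuousAt.eventually (hopen.mem_nhds hx)] with x' hx'
    have h1 : ∀ s ∈ Icc (0 : ℝ) 1, curve x'.1 x'.2 s ∈ W := fun s hs => by
      have := hx' ⟨s, hs⟩; rwa [curveC_apply] at this
    refine ⟨fun s hs => ⟨hq _ (h1 s hs), hWθ _ (h1 s hs)⟩, ?_⟩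
    rw [thetaInt, Lin_apply]
    refine intervalIntegral.integral_congr fun s hs => ?_
    simp only [uIcc_of_le zero_le_one] at hs ⊢
    rw [ext01_nem_curveC _ _ hs, hWθ _ (h1 s hs)]

theorem Avoids.eventually {P : PuncturedPrimitive σ} {x : Plane × L2} (h : Avoids P x) :
    ∀ᶠ x' in 𝓝 x, total x'.2 ∈ lattice → Avoids P x' := by
  obtain ⟨Θ, hΘ, -, hev⟩ := h.exists_eventually
  filter_upwards [hev] with x' hx' hm
  exact Avoids.of_Icc hm fun s hs => (hx'.1 s hs).1

theorem Avoids.intervalIntegrable {P : PuncturedPrimitive σ} {x : Plane × L2} (h : Avoids P x) :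
    IntervalIntegrable (fun s => P.θ (curve x.1 x.2 s) (ev x.2 s)) volume 0 1 := by
  obtain ⟨Θ, hΘ, hev, -⟩ := h.exists_eventually
  refine (integrable_lin (nem hΘ.continuous (curveC x)) x.2 0 1).congr fun s hs => ?_
  rw [uIoc_of_le zero_le_one] at hs
  rw [ext01_nem_curveC _ _ (Ioc_subset_Icc_self hs), (hev s (Ioc_subset_Icc_self hs)).eq_of_nhds]

/-- The integration by parts used for `mag`, with a periodic primitive: the two boundary terms
cancel and no correction is needed. -/
theorem Avoids.exists_hasFDerivAt {P : PuncturedPrimitive σ} {x : Plane × L2} (h : Avoids P x)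
    (hm : total x.2 ∈ lattice) :
    ∃ D : (Plane × L2) →L[ℝ] ℝ, HasFDerivAt (thetaInt P) D x ∧ ∀ h, total h.2 = 0 → D h = tau σ x h := by
  obtain ⟨Θ, hΘ, hev, hev'⟩ := h.exists_eventually
  have hΘ' : Continuous (fderiv ℝ Θ) := hΘ.continuous_fderiv (by simp)
  have hflip : Continuous fun p => (fderiv ℝ Θ p).flip :=
    (ContinuousLinearMap.flipₗᵢ ℝ Plane Plane ℝ).continuous.comp hΘ'
  have hd : ∀ p, HasFDerivAt Θ (fderiv ℝ Θ p) p := fun p => ((hΘ.differentiable (by simp)) p).hasFDerivAt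
  have h1 : HasFDerivAt (fun x : Plane × L2 => nem hΘ.continuous (curveC x))
      ((applyC (F := Covec) (nem hΘ' (curveC x))).comp curveC) x :=
    (hasFDerivAt_nem (F := Covec) hΘ.continuous hΘ' hd _).comp x curveC.hasFDerivAt
  have h2 := (Lin.hasFDerivAt.comp x h1).clm_apply (hasFDerivAt_snd (𝕜 := ℝ) (p := x))
  refine ⟨_, h2.congr_of_eventuallyEq ?_, fun ξ hξ => ?_⟩
  · filter_upwards [hev'] with x' hx' using hx'.2
  have hI := integral_by_parts hΘ.continuous hflip hd x ξ
  have e0 : Θ (x.1 + total x.2) = Θ x.1 := by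
    have e1 := (hev 1 ⟨zero_le_one, le_rfl⟩).eq_of_nhds
    have e2 := (hev 0 ⟨le_rfl, zero_le_one⟩).eq_of_nhds
    have e3 := h 0
    rw [curve_one] at e1
    rw [curve_zero] at e2 e3
    rw [e1, e2, P.θ_add hm e3]
  rw [hξ, add_zero, e0, sub_self] at hI
  have e : nem σ.continuous_form (curveC x)
      = nem hΘ' (curveC x) - nem (F := BilForm) hflip (curveC x) := by
    refine CI.ext fun s => ContinuousLinearMap.ext fun v => ContinuousLinearMap.ext fun w => ?_
    have e1 := hev s s.2
    have e2 := P.primitive _ (h s) v w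
    rw [← e1.fderiv_eq] at e2
    rw [CI.sub_apply]
    simp only [nem_apply, curveC_apply, TwoForm.form_apply, sub_apply, ContinuousLinearMap.flip_apply]
    exact e2.symm
  rw [tau_apply, e]
  simp only [map_sub, sub_apply, add_apply, ContinuousLinearMap.comp_apply,
    ContinuousLinearMap.flip_apply]
  simp only [Function.comp_apply, ContinuousLinearMap.coe_snd'] at *
  linarith

section

variable (g : RiemannianMetric) (P : PuncturedPrimitive σ) (k : ℝ)

/-- The local action as a function of pairs. -/
def locAct (γ : LoopsR) : ℝ := kinetic g γ / γ.2 + k * γ.2 + thetaInt P (sec 0 γ).1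

variable {g P k}

theorem locAct_eq {z : Lifted} {γ : LoopsR} (h : IsLift z γ) (hz : Avoids P z.1) :
    locAct g P k γ = kin g z.1 / z.2 + k * z.2 + thetaInt P z.1 := by
  obtain ⟨w, hw, h2⟩ := h.exists_eq (isLift_sec 0 γ)
  rw [locAct, kinetic_eq_kin g h, h2, h.per]
  rw [thetaInt_translate hz hw]

theorem localAction_eq {z : Lifted} {γ : FreeLoop} (h : IsLift z γ.1) (hz : Avoids P z.1) :
    localAction g P k γ = kin g z.1 / z.2 + k * z.2 + thetaInt P z.1 := by
  have hs := isLift_sec 0 γ.1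
  have hd : Avoids P (sec 0 γ.1).1 := (mem_domain_iff hs).1 ((mem_domain_iff h).2 hz)
  rw [← locAct_eq h hz, locAct_eq hs hd]
  set z' := sec 0 γ.1
  have hT := hs.pos
  have h1 : ∀ s, 1 / 2 * g.toFun (lift γ.1 s) ((period γ)⁻¹ • vel γ.1 s) ((period γ)⁻¹ • vel γ.1 s)
      + P.θ (lift γ.1 s) ((period γ)⁻¹ • vel γ.1 s) + k
      = z'.2⁻¹ ^ 2 * (1 / 2 * g.toFun (curve z'.1.1 z'.1.2 s) (ev z'.1.2 s) (ev z'.1.2 s))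
        + z'.2⁻¹ * P.θ (curve z'.1.1 z'.1.2 s) (ev z'.1.2 s) + k := fun s => by
    change 1 / 2 * g.toFun (curve z'.1.1 z'.1.2 s) (z'.2⁻¹ • ev z'.1.2 s) (z'.2⁻¹ • ev z'.1.2 s)
      + P.θ (curve z'.1.1 z'.1.2 s) (z'.2⁻¹ • ev z'.1.2 s) + k = _
    simp only [map_smul, smul_apply, smul_eq_mul]
    ring
  have hi : IntervalIntegrable (fun s => g.toFun (curve z'.1.1 z'.1.2 s) (ev z'.1.2 s) (ev z'.1.2 s)) volume 0 1 := by
    refine (integrable_bil (nem (continuous_metric g) (curveC z'.1)) z'.1.2 z'.1.2 0 1).congr fun s hs => ?_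
    rw [uIoc_of_le zero_le_one] at hs
    rw [ext01_nem_curveC _ _ (Ioc_subset_Icc_self hs)]; rfl
  rw [localAction]
  simp only [h1]
  rw [intervalIntegral.integral_add (((hi.const_mul _).const_mul _).add (hd.intervalIntegrable.const_mul _))
    intervalIntegrable_const, intervalIntegral.integral_add ((hi.const_mul _).const_mul _)
    (hd.intervalIntegrable.const_mul _), intervalIntegral.integral_const_mul, intervalIntegral.integral_const_mul,
    intervalIntegral.integral_const_mul, ← kin_eq, ← thetaInt]
  have hp : period γ = z'.2 := rfl
  rw [hp]
  simp only [intervalIntegral.integral_const, sub_zero, one_smul]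
  field_simp
  ring

theorem localAction_eq_locAct {γ : FreeLoop} (h : γ ∈ P.domain) : localAction g P k γ = locAct g P k γ.1 := by
  have hs := isLift_sec 0 γ.1
  have hd := (mem_domain_iff hs).1 h
  rw [localAction_eq hs hd, locAct_eq hs hd]

theorem isOpen_domain : IsOpen P.domain := by
  refine isOpen_iff_mem_nhds.2 fun γ hγ => ?_
  have hz := isLift_sec 0 γ.1
  have h1 := (((mem_domain_iff hz).1 hγ).eventually)
  have h2 := (continuous_fst.tendsto _).comp (hz.tendsto_sec.comp (continuous_subtype_val.tendsto γ))
  filter_upwards [h2.eventually h1] with γ' h3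
  exact (mem_domain_iff (isLift_sec _ γ'.1)).2 (h3 (isLift_sec _ γ'.1).mem)

/-- The local action arises from `act` by exchanging `mag` for `thetaInt`, and on tangent vectors
both of these have the differential `tau`. -/
theorem hasFDerivAt_locAct {z : Lifted} {γ : FreeLoop} (h : IsLift z γ.1) (hγ : γ ∈ P.domain) :
    HasFDerivAt (fun ξ => locAct g P k (displace γ ξ)) ((act' g σ k z).comp incl) 0 := by
  have hz := (mem_domain_iff h).1 hγ
  obtain ⟨D, hD, hD'⟩ := hz.exists_hasFDerivAt h.mem
  have h1 := (isRepresented_actionForm g σ k).hasFDerivAt h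
  have h2 := (isRepresented_transgression σ).hasFDerivAt h
  have hi : HasFDerivAt (fun ξ : Tangent => (z + incl ξ).1) ((ContinuousLinearMap.fst ℝ (Plane × L2) ℝ).comp incl) 0 :=
    (ContinuousLinearMap.fst ℝ (Plane × L2) ℝ).hasFDerivAt.comp (0 : Tangent) (incl.hasFDerivAt.const_add z)
  have h3 : HasFDerivAt (fun ξ : Tangent => thetaInt P (z + incl ξ).1)
      (D.comp ((ContinuousLinearMap.fst ℝ (Plane × L2) ℝ).comp incl)) 0 := by
    refine HasFDerivAt.comp (0 : Tangent) (g := thetaInt P) ?_ hi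
    simpa using hD
  have h4 := (h1.sub h2).add h3
  have e : (act' g σ k z).comp incl - ((tau σ z.1).comp (ContinuousLinearMap.fst ℝ (Plane × L2) ℝ)).comp incl
      + D.comp ((ContinuousLinearMap.fst ℝ (Plane × L2) ℝ).comp incl) = (act' g σ k z).comp incl := by
    refine ContinuousLinearMap.ext fun ξ => ?_
    have := hD' (incl ξ).1 (isTangent_incl ξ)
    simp only [add_apply, sub_apply, ContinuousLinearMap.comp_apply, ContinuousLinearMap.coe_fst', this]
    ring
  rw [e] at h4
  refine h4.congr_of_eventuallyEq ?_
  have hev : ∀ᶠ ξ : Tangent in 𝓝 0, total (z + incl ξ).1.2 ∈ lattice → Avoids P (z + incl ξ).1 := by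
    have ht : Tendsto (fun ξ : Tangent => (z + incl ξ).1) (𝓝 0) (𝓝 z.1) := by
      have := hi.continuousAt.tendsto
      simpa only [map_zero, add_zero] using this
    exact ht.eventually hz.eventually
  filter_upwards [hev] with ξ hξ
  have hd := h.displace ξ
  rw [locAct_eq hd (hξ hd.mem)]
  simp only [Pi.add_apply, Pi.sub_apply, act]
  ring

theorem isPrimitiveOn_locAct : IsPrimitiveOn (actionForm g σ k) (locAct g P k) P.domain := fun γ hγ => by
  have hz := isLift_sec 0 γ.1
  have h1 := hasFDerivAt_locAct (g := g) (k := k) hz hγ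
  exact ⟨h1.differentiableAt, fun ξ => by rw [h1.fderiv, actionForm_eq g σ k hz]; rfl⟩

theorem eventually_localAction_sub {z : Lifted} {γ : FreeLoop} (h : IsLift z γ.1) (hγ : γ ∈ P.domain) :
    ∀ᶠ z' in 𝓝 z, ∀ γ' : FreeLoop, IsLift z' γ'.1 → γ' ∈ P.domain ∧ cls γ'.1 = cls γ.1 ∧
      localAction g P k γ' - localAction g P k γ = act g σ k (cls γ.1) z' - act g σ k (cls γ.1) z := by
  have h1 := (isRepresented_actionForm g σ k).eventually_sub_eq isOpen_domain isPrimitiveOn_locAct hγ h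
  have h2 := (continuous_fst.tendsto z).eventually (((mem_domain_iff h).1 hγ).eventually)
  have h3 : ∀ᶠ z' : Lifted in 𝓝 z, total z'.1.2 ∈ lattice → total z'.1.2 = total z.1.2 := by
    have : Continuous fun z : Lifted => total z.1.2 := continuous_total.comp (by fun_prop)
    filter_upwards [this.continuousAt.eventually (Metric.ball_mem_nhds _ one_pos)] with z' hz' hm
    exact lattice_eq_of_dist hm h.mem hz'
  filter_upwards [h1, h2, h3] with z' h1 h2 h3 γ' hz'
  have hd : γ' ∈ P.domain := (mem_domain_iff hz').2 (h2 hz'.mem)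
  have hc : cls γ'.1 = cls γ.1 := by rw [← hz'.total_eq, h3 hz'.mem, h.total_eq]
  refine ⟨hd, hc, ?_⟩
  rw [localAction_eq_locAct hd, localAction_eq_locAct hγ]
  exact h1 γ' hz' hc

theorem continuousAt_act {z : Lifted} (hm : total z.1.2 ∈ lattice) (hT : z.2 ≠ 0) :
    ContinuousAt (act g σ k (total z.1.2)) z := by
  obtain ⟨D, hD, -⟩ := exists_hasFDerivAt_act (g := g) (σ := σ) k _ hm z rfl hT
  exact hD.continuousAt

theorem continuousAt_localAction {γ : FreeLoop} (hγ : γ ∈ P.domain) : ContinuousAt (localAction g P k) γ := by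
  have hz := isLift_sec 0 γ.1
  have h2 := hz.tendsto_sec.comp (continuous_subtype_val.tendsto γ)
  have h3 := continuousAt_act (g := g) (σ := σ) (k := k) hz.mem hz.pos.ne'
  rw [hz.total_eq] at h3
  have h4 := ((h3.tendsto.comp h2).sub_const (act g σ k (cls γ.1) (sec 0 γ.1))).add_const (localAction g P k γ)
  rw [sub_self, zero_add] at h4
  refine h4.congr' ?_
  filter_upwards [h2.eventually (eventually_localAction_sub (g := g) (k := k) hz hγ)] with γ' h5
  have := (h5 γ' (isLift_sec _ _)).2.2
  simp only [Function.comp_apply] at this ⊢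
  linarith

theorem isZero_of_isLocalMin {γ : FreeLoop} (hγ : γ ∈ P.domain) (h : IsLocalMin (localAction g P k) γ) :
    IsZero g σ k γ := by
  have hz := isLift_sec 0 γ.1
  have h1 := hasFDerivAt_locAct (g := g) (k := k) hz hγ
  have h0 : displace γ 0 = γ.1 := by
    have h1 := hz.displace 0
    simp only [map_zero, add_zero] at h1
    exact h1.eq hz
  have hc : Continuous (displace γ) := by
    refine continuous_const.add (Continuous.prodMk ?_ continuous_snd)
    refine Continuous.subtype_mk (Continuous.prodMk ?_ ?_) _
    · exact continuous_proj.comp (by fun_prop : Continuous fun ξ : Tangent => ξ.1.1.1)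
    · fun_prop
  have h2 : IsLocalMin (fun ξ => locAct g P k (displace γ ξ)) 0 := by
    have h3 : ∀ᶠ γ' in 𝓝 γ, localAction g P k γ ≤ localAction g P k γ' ∧ γ' ∈ P.domain :=
      h.and (isOpen_domain.mem_nhds hγ)
    rw [nhds_subtype_eq_comap, eventually_comap] at h3
    have h4 : ∀ᶠ ξ in 𝓝 0, 0 < (displace γ ξ).2 :=
      (continuous_snd.comp hc).continuousAt.eventually (lt_mem_nhds (by simp only [Function.comp_apply, h0]; exact γ.2))
    have h5 : Tendsto (displace γ) (𝓝 0) (𝓝 γ.1) := by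
      have := hc.tendsto 0; rwa [h0] at this
    filter_upwards [h5.eventually h3, h4] with ξ h6 h7
    obtain ⟨h8, h9⟩ := h6 ⟨displace γ ξ, h7⟩ rfl
    rw [localAction_eq_locAct hγ, localAction_eq_locAct h9] at h8
    rw [h0]
    exact h8
  have h3 := h2.hasFDerivAt_eq_zero h1
  intro ξ
  rw [actionForm_eq g σ k hz]
  exact congrArg (fun D : Tangent →L[ℝ] ℝ => D ξ) h3

/-- On connected sets of loops, the local action and the action of lifts differ by a constant up to
multiples of the flux. -/
theorem localAction_sub_act_mem {S : Set FreeLoop} (hS : IsPreconnected S) (hP : S ⊆ P.domain)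
    {γ γ' : FreeLoop} (hγ : γ ∈ S) (hγ' : γ' ∈ S) {z z' : Lifted} (hz : IsLift z γ.1) (hz' : IsLift z' γ'.1) :
    (localAction g P k γ' - act g σ k (cls γ.1) z') - (localAction g P k γ - act g σ k (cls γ.1) z)
      ∈ AddSubgroup.zmultiples (flux σ) := by
  set m := cls γ.1
  -- Two lifts of one loop differ by a lattice vector, and the coefficient of the flux in
  -- `act_translate` is then an integer.
  have hlift : ∀ {γ : FreeLoop} {z z' : Lifted}, IsLift z γ.1 → IsLift z' γ.1 → cls γ.1 = m →
      act g σ k m z' - act g σ k m z ∈ AddSubgroup.zmultiples (flux σ) := by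
    intro γ z z' h h' hc
    obtain ⟨w, hw, rfl⟩ := h.exists_eq h'
    have hm : m ∈ lattice := cls_mem _
    rw [act_translate k m hm z.1.1 hw z.1.2 (h.total_eq.trans hc)]
    obtain ⟨a, ha⟩ := hw 0
    obtain ⟨b, hb⟩ := hw 1
    obtain ⟨c, hc⟩ := hm 0
    obtain ⟨d, hd⟩ := hm 1
    refine ⟨a * d - b * c, ?_⟩
    simp only [zsmul_eq_mul, Int.cast_sub, Int.cast_mul, ← ha, ← hb, ← hc, ← hd]
    ring
  let R : FreeLoop → FreeLoop → Prop := fun γ γ' => ∀ z z', IsLift z γ.1 → IsLift z' γ'.1 →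
    (localAction g P k γ' - act g σ k m z') - (localAction g P k γ - act g σ k m z)
      ∈ AddSubgroup.zmultiples (flux σ)
  have hR : R γ γ' := by
    -- The relation holds between nearby loops and is transitive and symmetric, so it holds on the
    -- whole preconnected set.
    refine hS.induction₂ R ?_ ?_ ?_ hγ hγ'
    · intro γ₁ h₁
      have hc : cls γ₁.1 = m := cls_eq_of_isPreconnected hS h₁ hγ
      have hz := isLift_sec 0 γ₁.1
      have h2 := hz.tendsto_sec.comp (continuous_subtype_val.tendsto γ₁)
      refine Eventually.filter_mono nhdsWithin_le_nhds ?_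
      filter_upwards [h2.eventually (eventually_localAction_sub (g := g) (k := k) hz (hP h₁))] with γ₂ h3 z₁ z₂ hz₁ hz₂
      obtain ⟨-, hc', h4⟩ := h3 γ₂ (isLift_sec _ _)
      rw [hc] at h4 hc'
      have h5 := hlift (isLift_sec (corner (sec 0 γ₁.1).1.1) γ₂.1) hz₂ hc'
      have h6 := hlift hz hz₁ hc
      have h7 := sub_mem h6 h5
      simp only [Function.comp_apply] at h4
      convert h7 using 1
      linarith
    · intro γ₁ γ₂ γ₃ _ _ _ h12 h23 z₁ z₃ hz₁ hz₃
      have h4 := add_mem (h12 z₁ _ hz₁ (isLift_sec 0 _)) (h23 _ z₃ (isLift_sec 0 _) hz₃)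
      convert h4 using 1
      ring
    · intro γ₁ γ₂ _ _ h12 z₂ z₁ hz₂ hz₁
      have h4 := neg_mem (h12 z₁ z₂ hz₁ hz₂)
      convert h4 using 1
      ring
  exact hR z z' hz hz'

end

end Domain

/-! ### Rotations and iterates -/

/-- Rotation of the parameter of a velocity. -/
def rotV (ψ : ℝ) (v : L2) : L2 := Lp.compMeasurePreserving (fun s : UnitAddCircle => (ψ : UnitAddCircle) + s)
  (measurePreserving_add_left volume (ψ : UnitAddCircle)) v

/-- Multiplication of the parameter of a velocity. -/
def mulV (n : ℕ+) (v : L2) : L2 := Lp.compMeasurePreserving (fun s : UnitAddCircle => (n : ℤ) • s)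
  (measurePreserving_mul n) v

theorem ev_rotV (ψ : ℝ) (v : L2) : ∀ᵐ s, ev (rotV ψ v) s = ev v (ψ + s) :=
  (ae_of_ae_circle (P := fun x => rotV ψ v x = v ((ψ : UnitAddCircle) + x))
    (Lp.coeFn_compMeasurePreserving v _)).mono fun s hs => by
      simp only [ev]; rw [hs, AddCircle.coe_add]

theorem ev_mulV (n : ℕ+) (v : L2) : ∀ᵐ s, ev (mulV n v) s = ev v (((n : ℕ) : ℝ) * s) :=
  (ae_of_ae_circle (P := fun x => mulV n v x = v ((n : ℤ) • x))
    (Lp.coeFn_compMeasurePreserving v _)).mono fun s hs => by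
      simp only [ev]; rw [hs, ← AddCircle.coe_zsmul]; simp

theorem rotV_rotV (ψ φ : ℝ) (v : L2) : rotV ψ (rotV φ v) = rotV (φ + ψ) v := by
  unfold rotV
  rw [← Lp.compMeasurePreserving_comp_apply]
  congr 2
  funext s
  simp only [Function.comp_apply, AddCircle.coe_add, add_assoc]

theorem rotV_mulV (ψ : ℝ) (n : ℕ+) (v : L2) : rotV ψ (mulV n v) = mulV n (rotV (((n : ℕ) : ℝ) * ψ) v) := by
  unfold rotV mulV
  rw [← Lp.compMeasurePreserving_comp_apply, ← Lp.compMeasurePreserving_comp_apply]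
  congr 2
  funext s
  simp only [Function.comp_apply, smul_add]
  congr 1
  rw [← AddCircle.coe_zsmul]; simp

theorem rotV_zero (v : L2) : rotV 0 v = v := by
  have h : (fun s : UnitAddCircle => ((0 : ℝ) : UnitAddCircle) + s) = id := by funext s; simp
  unfold rotV
  simp only [h]
  exact Lp.compMeasurePreserving_id_apply v

theorem rotV_one (v : L2) : rotV 1 v = v := by
  have h : (fun s : UnitAddCircle => ((1 : ℝ) : UnitAddCircle) + s) = id := by
    funext s; simp
  unfold rotV
  simp only [h]
  exact Lp.compMeasurePreserving_id_apply v

theorem rotV_smul (ψ c : ℝ) (v : L2) : rotV ψ (c • v) = c • rotV ψ v :=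
  map_smul (Lp.compMeasurePreservingₗ ℝ _ (measurePreserving_add_left volume (ψ : UnitAddCircle))) c v

theorem norm_rotV (ψ : ℝ) (v : L2) : ‖rotV ψ v‖ = ‖v‖ := Lp.norm_compMeasurePreserving v _

theorem mulV_injective (n : ℕ+) : Function.Injective (mulV n) :=
  (Lp.isometry_compMeasurePreserving (measurePreserving_mul n)).injective

theorem continuous_mulV (n : ℕ+) : Continuous (mulV n) :=
  (Lp.isometry_compMeasurePreserving (measurePreserving_mul n)).continuous

theorem total_rotV (ψ : ℝ) (v : L2) : total (rotV ψ v) = total v := integral_comp_L2 _ _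

theorem total_mulV (n : ℕ+) (v : L2) : total (mulV n v) = total v := integral_comp_L2 _ _

/-- Strong continuity of translations in L², from uniform continuity of the rotations of the circle
in the parameter. -/
theorem continuous_rotV (v : L2) : Continuous fun ψ : ℝ => rotV ψ v := by
  let f : ℝ → C(UnitAddCircle, UnitAddCircle) := fun ψ => ⟨fun s => (ψ : UnitAddCircle) + s, by fun_prop⟩
  have hf : Continuous f := by
    refine ContinuousMap.continuous_of_continuous_uncurry _ ?_
    exact ((AddCircle.continuous_mk' 1).comp continuous_fst).add continuous_snd
  exact Continuous.compMeasurePreservingLp (p := 2) (f := fun _ => v) (g := f) continuous_const hf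
    (fun ψ => (measurePreserving_add_left volume (ψ : UnitAddCircle) :
      MeasurePreserving (f ψ) volume volume)) ENNReal.ofNat_ne_top

theorem curve_rotV (p : Plane) (v : L2) (ψ s : ℝ) :
    curve (curve p v ψ) (rotV ψ v) s = curve p v (ψ + s) := by
  have h : ∫ r in (0 : ℝ)..s, ev (rotV ψ v) r = ∫ r in ψ..ψ + s, ev v r := by
    rw [intervalIntegral.integral_congr_ae ((ev_rotV ψ v).mono fun s hs _ => hs),
      intervalIntegral.integral_comp_add_left, add_zero]
  rw [curve, h, ← curve_sub_curve p v ψ (ψ + s)]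
  abel

theorem curve_mulV (p : Plane) (v : L2) (n : ℕ+) (s : ℝ) :
    curve p (((n : ℕ) : ℝ) • mulV n v) s = curve p v (((n : ℕ) : ℝ) * s) := by
  have h : ∫ r in (0 : ℝ)..s, ev (((n : ℕ) : ℝ) • mulV n v) r = ∫ r in (0 : ℝ)..((n : ℕ) : ℝ) * s, ev v r := by
    rw [intervalIntegral.integral_congr_ae (g := fun r => ((n : ℕ) : ℝ) • ev v (((n : ℕ) : ℝ) * r)),
      intervalIntegral.integral_smul, intervalIntegral.smul_integral_comp_mul_left, mul_zero]
    filter_upwards [ev_smul ((n : ℕ) : ℝ) (mulV n v), ev_mulV n v] with r h1 h2 _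
    rw [h1, h2]
  rw [curve, h, curve]

/-- Rotation of lifts and of tangent vectors. -/
def rot (ψ : ℝ) (z : Lifted) : Lifted := ((curve z.1.1 z.1.2 ψ, rotV ψ z.1.2), z.2)

/-- Iteration of lifts. -/
def iter (n : ℕ+) (z : Lifted) : Lifted := ((z.1.1, ((n : ℕ) : ℝ) • mulV n z.1.2), ((n : ℕ) : ℝ) * z.2)

theorem IsLift.rot {z : Lifted} {γ : FreeLoop} (h : IsLift z γ.1) (ψ : ℝ) : IsLift (rot ψ z) (shift ψ γ).1 where
  base := by
    have hz := isLift_sec 0 γ.1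
    change proj (curve z.1.1 z.1.2 ψ) = proj (curve (sec 0 γ.1).1.1 (sec 0 γ.1).1.2 ψ)
    obtain ⟨w, hw, h2⟩ := hz.exists_eq h
    rw [h2]
    simp only [curve_translate, proj_add_lattice hw]
  vel := congrArg (rotV ψ) h.vel
  per := h.per

theorem IsLift.iter {z : Lifted} {γ : FreeLoop} (h : IsLift z γ.1) (n : ℕ+) : IsLift (iter n z) (iterate n γ).1 where
  base := h.base
  vel := congrArg (fun v => ((n : ℕ) : ℝ) • mulV n v) h.vel
  per := congrArg (fun T => ((n : ℕ) : ℝ) * T) h.per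

theorem rot_rot (ψ φ : ℝ) (z : Lifted) : rot ψ (rot φ z) = rot (φ + ψ) z := by
  simp only [rot, curve_rotV, rotV_rotV]

theorem rot_zero (z : Lifted) : rot 0 z = z := by simp only [rot, curve_zero, rotV_zero]

theorem rot_iter (ψ : ℝ) (n : ℕ+) (z : Lifted) : rot ψ (iter n z) = iter n (rot (((n : ℕ) : ℝ) * ψ) z) := by
  simp only [rot, iter, curve_mulV, rotV_smul, rotV_mulV]

theorem continuous_rot (z : Lifted) : Continuous fun ψ : ℝ => rot ψ z :=
  (((continuous_curve _ _).prodMk (continuous_rotV _)).prodMk continuous_const)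

theorem shift_shift (ψ φ : ℝ) (γ : FreeLoop) : shift ψ (shift φ γ) = shift (φ + ψ) γ := by
  have hz := isLift_sec 0 γ.1
  refine Subtype.ext (((hz.rot φ).rot ψ).eq ?_)
  rw [rot_rot]
  exact hz.rot _

theorem shift_zero (γ : FreeLoop) : shift 0 γ = γ := by
  have hz := isLift_sec 0 γ.1
  have := hz.rot 0
  rw [rot_zero] at this
  exact Subtype.ext (this.eq hz)

theorem shift_iterate (ψ : ℝ) (n : ℕ+) (γ : FreeLoop) :
    shift ψ (iterate n γ) = iterate n (shift (((n : ℕ) : ℝ) * ψ) γ) := by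
  have hz := isLift_sec 0 γ.1
  refine Subtype.ext (((hz.iter n).rot ψ).eq ?_)
  rw [rot_iter]
  exact (hz.rot _).iter n

theorem shift_one (γ : FreeLoop) : shift 1 γ = γ := by
  have hz := isLift_sec 0 γ.1
  have h1 := hz.rot 1
  have h2 : rot 1 (sec 0 γ.1) = (((sec 0 γ.1).1.1 + total (sec 0 γ.1).1.2, (sec 0 γ.1).1.2), (sec 0 γ.1).2) := by
    simp only [rot, curve_one, rotV_one]
  rw [h2] at h1
  exact Subtype.ext (h1.eq (hz.add_lattice hz.mem))

theorem mem_orbit_self (γ : FreeLoop) : γ ∈ orbit γ := ⟨0, shift_zero γ⟩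

theorem continuous_shift (γ : FreeLoop) : Continuous fun ψ : ℝ => shift ψ γ := by
  have hz := isLift_sec 0 γ.1
  have hm : ∀ ψ, total (rot ψ (sec 0 γ.1)).1.2 ∈ lattice := fun ψ => (hz.rot ψ).mem
  have hT : ∀ ψ, 0 < (rot ψ (sec 0 γ.1)).2 := fun ψ => (hz.rot ψ).pos
  have h := continuous_ofLift (continuous_rot (sec 0 γ.1)) hm hT
  refine h.congr fun ψ => ?_
  exact (hz.rot ψ).ofLift_eq _ _

theorem orbit_eq_image (γ : FreeLoop) : orbit γ = (fun ψ : ℝ => shift ψ γ) '' Icc 0 1 := by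
  have hp : Function.Periodic (fun ψ : ℝ => shift ψ γ) 1 := fun ψ => by
    simp only
    rw [add_comm, ← shift_shift, shift_one]
  refine Subset.antisymm ?_ (image_subset_range _ _)
  rintro _ ⟨ψ, rfl⟩
  obtain ⟨t, ht, hst⟩ := hp.exists_mem_Ico₀ one_pos ψ
  exact ⟨t, Ico_subset_Icc_self ht, hst.symm⟩

theorem isCompact_orbit (γ : FreeLoop) : IsCompact (orbit γ) := by
  rw [orbit_eq_image]; exact isCompact_Icc.image (continuous_shift γ)

theorem isConnected_orbit (γ : FreeLoop) : IsConnected (orbit γ) := isConnected_range (continuous_shift γ)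

theorem period_of_mem_orbit {γ γ' : FreeLoop} (h : γ' ∈ orbit γ) : period γ' = period γ := by
  obtain ⟨ψ, rfl⟩ := h; rfl

theorem cls_of_mem_orbit {γ γ' : FreeLoop} (h : γ' ∈ orbit γ) : cls γ'.1 = cls γ.1 := by
  obtain ⟨ψ, rfl⟩ := h; exact cls_shift ψ γ

theorem iterate_injective (n : ℕ+) : Function.Injective (iterate n) := by
  intro γ γ' h
  have hn : ((n : ℕ) : ℝ) ≠ 0 := by exact_mod_cast n.ne_zero
  have h1 : (iterate n γ).1.1.1 = (iterate n γ').1.1.1 := by rw [h]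
  have h2 : ((n : ℕ) : ℝ) * γ.1.2 = ((n : ℕ) : ℝ) * γ'.1.2 := congrArg (fun γ : FreeLoop => γ.1.2) h
  have h3 : ((n : ℕ) : ℝ) • mulV n γ.1.1.1.2 = ((n : ℕ) : ℝ) • mulV n γ'.1.1.1.2 := congrArg Prod.snd h1
  exact Subtype.ext (Prod.ext (Subtype.ext (Prod.ext (congrArg Prod.fst h1 :)
    (mulV_injective n (smul_right_injective _ hn h3)))) (mul_left_cancel₀ hn h2))

theorem continuous_iterate (n : ℕ+) : Continuous (iterate n) := by
  have hv : Continuous fun γ : FreeLoop => γ.1.1.1.2 := by fun_prop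
  have hb : Continuous fun γ : FreeLoop => γ.1.1.1.1 := by fun_prop
  have hT : Continuous fun γ : FreeLoop => γ.1.2 := by fun_prop
  exact Continuous.subtype_mk (Continuous.prodMk (Continuous.subtype_mk
    (hb.prodMk (((continuous_mulV n).comp hv).const_smul ((n : ℕ) : ℝ))) _) (hT.const_mul _)) _

/-! ### Invariance of the functionals -/

theorem integral_rot {f f' : ℝ → ℝ} (ψ : ℝ) (hp : Function.Periodic f 1) (h : ∀ᵐ s, f' s = f (ψ + s)) :
    ∫ s in (0 : ℝ)..1, f' s = ∫ s in (0 : ℝ)..1, f s := by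
  rw [intervalIntegral.integral_congr_ae (h.mono fun s hs _ => hs), intervalIntegral.integral_comp_add_left]
  have := hp.intervalIntegral_add_eq ψ 0
  simpa using this

theorem integral_iter {f f' : ℝ → ℝ} {n : ℕ+} {c : ℝ} (hp : Function.Periodic f 1)
    (hi : IntervalIntegrable f volume 0 1) (h : ∀ᵐ s, f' s = c * f (((n : ℕ) : ℝ) * s)) :
    ∫ s in (0 : ℝ)..1, f' s = c * ∫ s in (0 : ℝ)..1, f s := by
  have hn : ((n : ℕ) : ℝ) ≠ 0 := by exact_mod_cast n.ne_zero
  have hi' : ∀ a b, IntervalIntegrable f volume a b := fun a b =>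
    hp.intervalIntegrable one_ne_zero (t := 0) (by simpa using hi) a b
  have h2 := hp.intervalIntegral_add_zsmul_eq (n : ℤ) 0 hi'
  rw [intervalIntegral.integral_congr_ae (h.mono fun s hs _ => hs), intervalIntegral.integral_const_mul,
    intervalIntegral.integral_comp_mul_left _ hn]
  simp only [zero_add, zsmul_eq_mul, mul_one, mul_zero, Int.cast_natCast, smul_eq_mul] at h2 ⊢
  rw [h2]
  field_simp

section

variable (g : RiemannianMetric) {σ : TwoForm}

theorem g_add (p : Plane) {w : Plane} (hw : w ∈ lattice) : g.toFun (p + w) = g.toFun p := g.latticePeriodic p w hw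

theorem periodic_kin {x : Plane × L2} (hm : total x.2 ∈ lattice) :
    Function.Periodic (fun s => g.toFun (curve x.1 x.2 s) (ev x.2 s) (ev x.2 s)) 1 := fun s => by
  simp only [curve_add_one, ev_add_one, g_add g _ hm]

theorem intervalIntegrable_kin (x : Plane × L2) :
    IntervalIntegrable (fun s => g.toFun (curve x.1 x.2 s) (ev x.2 s) (ev x.2 s)) volume 0 1 := by
  refine (integrable_bil (nem (continuous_metric g) (curveC x)) x.2 x.2 0 1).congr fun s hs => ?_
  rw [uIoc_of_le zero_le_one] at hs
  rw [ext01_nem_curveC _ _ (Ioc_subset_Icc_self hs)]; rfl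

theorem kin_rot {z : Lifted} (hm : total z.1.2 ∈ lattice) (ψ : ℝ) : kin g (rot ψ z).1 = kin g z.1 := by
  rw [kin_eq, kin_eq]
  congr 1
  refine integral_rot ψ (periodic_kin g hm) ((ev_rotV ψ z.1.2).mono fun s hs => ?_)
  simp only [rot, curve_rotV, hs]

theorem kin_iter {z : Lifted} (hm : total z.1.2 ∈ lattice) (n : ℕ+) :
    kin g (iter n z).1 = ((n : ℕ) : ℝ) ^ 2 * kin g z.1 := by
  rw [kin_eq, kin_eq, integral_iter (n := n) (c := ((n : ℕ) : ℝ) ^ 2) (periodic_kin g hm) (intervalIntegrable_kin g z.1)]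
  · ring
  · filter_upwards [ev_smul ((n : ℕ) : ℝ) (mulV n z.1.2), ev_mulV n z.1.2] with s h1 h2
    simp only [iter, curve_mulV, h1, h2, map_smul, smul_apply, smul_eq_mul]
    ring

variable {P : PuncturedPrimitive σ}

theorem Avoids.rot {z : Lifted} (h : Avoids P z.1) (ψ : ℝ) : Avoids P (rot ψ z).1 := fun s => by
  simp only [MagneticTorus.rot, curve_rotV]; exact h _

theorem avoids_iter {z : Lifted} (n : ℕ+) : Avoids P (iter n z).1 ↔ Avoids P z.1 := by
  have hn : ((n : ℕ) : ℝ) ≠ 0 := by exact_mod_cast n.ne_zero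
  constructor
  · intro h s
    have := h (s / ((n : ℕ) : ℝ))
    simp only [iter, curve_mulV] at this
    rwa [mul_div_cancel₀ _ hn] at this
  · intro h s
    simp only [iter, curve_mulV]; exact h _

theorem Avoids.periodic {x : Plane × L2} (h : Avoids P x) (hm : total x.2 ∈ lattice) :
    Function.Periodic (fun s => P.θ (curve x.1 x.2 s) (ev x.2 s)) 1 := fun s => by
  simp only [curve_add_one, ev_add_one, P.θ_add hm (h s)]

theorem thetaInt_rot {z : Lifted} (h : Avoids P z.1) (hm : total z.1.2 ∈ lattice) (ψ : ℝ) :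
    thetaInt P (rot ψ z).1 = thetaInt P z.1 := by
  refine integral_rot ψ (h.periodic hm) ((ev_rotV ψ z.1.2).mono fun s hs => ?_)
  simp only [rot, curve_rotV, hs]

theorem thetaInt_iter {z : Lifted} (h : Avoids P z.1) (hm : total z.1.2 ∈ lattice) (n : ℕ+) :
    thetaInt P (iter n z).1 = ((n : ℕ) : ℝ) * thetaInt P z.1 := by
  refine integral_iter (n := n) (h.periodic hm) h.intervalIntegrable ?_
  filter_upwards [ev_smul ((n : ℕ) : ℝ) (mulV n z.1.2), ev_mulV n z.1.2] with s h1 h2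
  simp only [iter, curve_mulV, h1, h2, map_smul, smul_eq_mul]

theorem shift_mem_domain {γ : FreeLoop} (h : γ ∈ P.domain) (ψ : ℝ) : shift ψ γ ∈ P.domain := by
  have hz := isLift_sec 0 γ.1
  exact (mem_domain_iff (hz.rot ψ)).2 (((mem_domain_iff hz).1 h).rot ψ)

theorem iterate_mem_domain {γ : FreeLoop} {n : ℕ+} : iterate n γ ∈ P.domain ↔ γ ∈ P.domain := by
  have hz := isLift_sec 0 γ.1
  rw [mem_domain_iff (hz.iter n), mem_domain_iff hz, avoids_iter]

variable {g} {k : ℝ}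

theorem localAction_shift {γ : FreeLoop} (h : γ ∈ P.domain) (ψ : ℝ) :
    localAction g P k (shift ψ γ) = localAction g P k γ := by
  have hz := isLift_sec 0 γ.1
  have hd := (mem_domain_iff hz).1 h
  rw [localAction_eq hz hd, localAction_eq (hz.rot ψ) (hd.rot ψ), kin_rot g hz.mem, thetaInt_rot hd hz.mem]
  rfl

/-- The kinetic energy is multiplied by n² and the period by n, while the integral of the primitive
is multiplied by n. -/
theorem localAction_iterate {γ : FreeLoop} (h : γ ∈ P.domain) (n : ℕ+) :
    localAction g P k (iterate n γ) = ((n : ℕ) : ℝ) * localAction g P k γ := by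
  have hz := isLift_sec 0 γ.1
  have hd := (mem_domain_iff hz).1 h
  have hn : ((n : ℕ) : ℝ) ≠ 0 := by exact_mod_cast n.ne_zero
  have hT := hz.pos.ne'
  rw [localAction_eq hz hd, localAction_eq (hz.iter n) ((avoids_iter n).2 hd), kin_iter g hz.mem,
    thetaInt_iter hd hz.mem]
  simp only [iter]
  field_simp

variable (g σ)

theorem intervalIntegral_congr01 {f f' : ℝ → ℝ} (h : ∀ s ∈ Icc (0 : ℝ) 1, f s = f' s) :
    ∫ s in (0 : ℝ)..1, f s = ∫ s in (0 : ℝ)..1, f' s :=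
  intervalIntegral.integral_congr fun s hs => h s (by rwa [uIcc_of_le zero_le_one] at hs)

theorem kin'_eq (x h : Plane × L2) : kin' g x h =
    1 / 2 * (∫ s in (0 : ℝ)..1, (fderiv ℝ g.q (curve x.1 x.2 s) (curve h.1 h.2 s)) (ev x.2 s) (ev x.2 s))
      + ∫ s in (0 : ℝ)..1, g.toFun (curve x.1 x.2 s) (ev x.2 s) (ev h.2 s) := by
  rw [kin'_apply, Bil_apply, Bil_apply]
  congr 1
  · congr 1
    refine intervalIntegral_congr01 fun s hs => ?_
    rw [ext01_of_mem _ hs, applyC_apply, nem_apply, curveC_apply, curveC_apply]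
  · refine intervalIntegral_congr01 fun s hs => ?_
    rw [ext01_nem_curveC _ _ hs]; rfl

theorem act'_rot {z h : Lifted} (hm : total z.1.2 ∈ lattice) (hh : IsTangent h) (ψ : ℝ) :
    act' g σ k (rot ψ z) (rot ψ h) = act' g σ k z h := by
  have hc : ∀ s, curve h.1.1 h.1.2 (s + 1) = curve h.1.1 h.1.2 s := fun s => by
    rw [curve_add_one, show total h.1.2 = 0 from hh, add_zero]
  have e1 : kin' g (rot ψ z).1 (rot ψ h).1 = kin' g z.1 h.1 := by
    rw [kin'_eq, kin'_eq]
    congr 1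
    · congr 1
      refine integral_rot ψ (fun s => ?_) ((ev_rotV ψ z.1.2).mono fun s hs => ?_)
      · simp only [curve_add_one z.1.1, hc, ev_add_one, g.latticePeriodic_q.fderiv _ _ hm]
      · simp only [rot, curve_rotV, hs]
    · refine integral_rot ψ (fun s => ?_) ?_
      · simp only [curve_add_one z.1.1, ev_add_one, g_add g _ hm]
      · filter_upwards [ev_rotV ψ z.1.2, ev_rotV ψ h.1.2] with s h1 h2
        simp only [rot, curve_rotV, h1, h2]
  have e2 : tau σ (rot ψ z).1 (rot ψ h).1 = tau σ z.1 h.1 := by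
    rw [tau_eq, tau_eq]
    refine integral_rot ψ (fun s => ?_) ((ev_rotV ψ z.1.2).mono fun s hs => ?_)
    · simp only [curve_add_one z.1.1, hc, ev_add_one, TwoForm.eval, σ.latticePeriodic _ _ hm]
    · simp only [rot, curve_rotV, hs]
  rw [act'_apply, act'_apply, e1, e2, kin_rot g hm]
  rfl

variable {g σ}

/-- A tangent vector at the rotated loop is the rotation of a tangent vector at the original one,
and the form is invariant under simultaneous rotation. -/
theorem IsZero.shift {γ : FreeLoop} (h : IsZero g σ k γ) (ψ : ℝ) : IsZero g σ k (shift ψ γ) := by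
  have hz := isLift_sec 0 γ.1
  intro ξ
  rw [actionForm_eq g σ k (hz.rot ψ)]
  have hr : IsTangent (rot (-ψ) (incl ξ)) := (total_rotV _ _).trans (isTangent_incl ξ)
  have h1 : rot ψ (rot (-ψ) (incl ξ)) = incl ξ := by rw [rot_rot, neg_add_cancel, rot_zero]
  rw [← h1, act'_rot g σ hz.mem hr]
  obtain ⟨ζ, hζ⟩ := hr.exists_incl
  rw [← hζ, ← actionForm_eq g σ k hz]
  exact h ζ

theorem IsZero.of_mem_orbit {γ γ' : FreeLoop} (h : IsZero g σ k γ) (h' : γ' ∈ orbit γ) : IsZero g σ k γ' := by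
  obtain ⟨ψ, rfl⟩ := h'; exact h.shift ψ

/-- The standard magnetic functional is invariant under rotation. -/
theorem mag_std_rot (z : Lifted) (ψ : ℝ) :
    mag stdTwoForm (total z.1.2) (rot ψ z).1 = mag stdTwoForm (total z.1.2) z.1 := by
  set m := total z.1.2
  have hpc : ∀ q, primCoeff stdTwoForm q = q 0 := fun q => by
    rw [primCoeff_eq]; simp [stdTwoForm]
  have hv : ∀ y, vprim stdTwoForm y = y := fun y => by simp [vprim, hflux, stdTwoForm]
  have hL : ∀ x : Plane × L2, Lin (nem (continuous_prim stdTwoForm) (curveC x)) x.2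
      = ∫ s in (0 : ℝ)..1, (curve x.1 x.2 s) 0 * (ev x.2 s) 1 := fun x => by
    rw [Lin_apply]
    refine intervalIntegral_congr01 fun s hs => ?_
    rw [ext01_nem_curveC _ _ hs, prim, hpc]; rfl
  have hi1 : ∀ a b, IntervalIntegrable (fun s => (ev z.1.2 s) 1) volume a b := fun a b => by
    have := (intervalIntegrable_ev z.1.2 a b)
    exact ⟨(dq 1).integrable_comp this.1, (dq 1).integrable_comp this.2⟩
  have hi : ∀ a b, IntervalIntegrable (fun s => (curve z.1.1 z.1.2 s) 0 * (ev z.1.2 s) 1) volume a b := fun a b =>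
    (hi1 a b).continuousOn_mul ((dq 0).continuous.comp (continuous_curve _ _)).continuousOn
  have hci : ∀ a b, (∫ s in a..b, (ev z.1.2 s) 1) = (curve z.1.1 z.1.2 b) 1 - (curve z.1.1 z.1.2 a) 1 := fun a b => by
    have h1 := curve_sub_curve z.1.1 z.1.2 a b
    have h2 := (dq 1).intervalIntegral_comp_comm (intervalIntegrable_ev z.1.2 a b)
    simp only [dq_apply] at h2
    rw [h2, ← h1]; rfl
  rw [mag, mag, hL, hL, hv, hv]
  have h1 : ∫ s in (0 : ℝ)..1, (curve (rot ψ z).1.1 (rot ψ z).1.2 s) 0 * (ev (rot ψ z).1.2 s) 1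
      = ∫ s in ψ..ψ + 1, (curve z.1.1 z.1.2 s) 0 * (ev z.1.2 s) 1 := by
    rw [intervalIntegral.integral_congr_ae (g := fun s => (curve z.1.1 z.1.2 (ψ + s)) 0 * (ev z.1.2 (ψ + s)) 1),
      intervalIntegral.integral_comp_add_left (fun s => (curve z.1.1 z.1.2 s) 0 * (ev z.1.2 s) 1), add_zero]
    exact (ev_rotV ψ z.1.2).mono fun s hs _ => by simp only [rot, curve_rotV, hs]
  -- Moving the window of integration past a period shifts the first coordinate by m⁰. The extra
  -- term is m⁰ times the change of the second coordinate of the base point, which the correction in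
  -- `mag` removes.
  have h2 : ∫ s in (1 : ℝ)..ψ + 1, (curve z.1.1 z.1.2 s) 0 * (ev z.1.2 s) 1
      = (∫ s in (0 : ℝ)..ψ, (curve z.1.1 z.1.2 s) 0 * (ev z.1.2 s) 1)
        + m 0 * ((curve z.1.1 z.1.2 ψ) 1 - (curve z.1.1 z.1.2 0) 1) := by
    have h3 := intervalIntegral.integral_comp_add_right (a := 0) (b := ψ)
      (fun s => (curve z.1.1 z.1.2 s) 0 * (ev z.1.2 s) 1) 1
    rw [zero_add] at h3
    rw [← h3, ← hci, ← intervalIntegral.integral_const_mul, ← intervalIntegral.integral_add (hi _ _) ((hi1 _ _).const_mul _)]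
    refine intervalIntegral.integral_congr fun s _ => ?_
    simp only [curve_add_one, ev_add_one, PiLp.add_apply]
    ring
  have h4 := intervalIntegral.integral_add_adjacent_intervals (hi 0 ψ) (hi ψ (ψ + 1))
  have h5 := intervalIntegral.integral_add_adjacent_intervals (hi 0 1) (hi 1 (ψ + 1))
  rw [h1]
  rw [curve_zero] at h2
  have h6 : (rot ψ z).1.1 = curve z.1.1 z.1.2 ψ := rfl
  rw [h6]
  linarith

end

/-! ### Velocities from functions on the unit interval -/

theorem memLp_ev (v : L2) : MemLp (ev v) 2 (volume.restrict (Ioc (0 : ℝ) 1)) := by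
  have h := (Lp.memLp v).comp_measurePreserving (UnitAddCircle.measurePreserving_mk 0)
  rw [zero_add] at h
  exact h

/-- The velocity that is given by a square integrable function on the unit interval. -/
def ofFun (f : ℝ → Plane) (hf : MemLp f 2 (volume.restrict (Ioc (0 : ℝ) 1))) : L2 :=
  MemLp.toLp (fun x : UnitAddCircle => f (AddCircle.measurableEquivIoc 1 0 x)) <| by
    have h1 : MemLp (fun x : Ioc (0 : ℝ) (0 + 1) => f x) 2 (Measure.comap Subtype.val volume) := by
      refine MemLp.comp_measurePreserving (g := f) ?_ (measurePreserving_subtype_coe measurableSet_Ioc)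
      simpa using hf
    exact h1.comp_measurePreserving (AddCircle.measurePreserving_equivIoc 1 (a := 0))

theorem ev_ofFun {f : ℝ → Plane} (hf : MemLp f 2 (volume.restrict (Ioc (0 : ℝ) 1))) :
    ∀ᵐ s ∂(volume.restrict (Ioc (0 : ℝ) 1)), ev (ofFun f hf) s = f s := by
  have hmp : MeasurePreserving (fun s : ℝ => (s : UnitAddCircle)) (volume.restrict (Ioc (0 : ℝ) 1)) volume := by
    have := UnitAddCircle.measurePreserving_mk 0
    rwa [zero_add] at this
  have h := hmp.quasiMeasurePreserving.ae
    (MemLp.coeFn_toLp (f := fun x : UnitAddCircle => f (AddCircle.measurableEquivIoc 1 0 x)) _ :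
      ∀ᵐ x, ofFun f hf x = f (AddCircle.measurableEquivIoc 1 0 x))
  filter_upwards [h, ae_restrict_mem measurableSet_Ioc] with s h1 h2
  have h3 : (AddCircle.measurableEquivIoc 1 0 (s : UnitAddCircle) : ℝ) = s := by
    have := (AddCircle.equivIoc (1 : ℝ) 0).right_inv ⟨s, by simpa using h2⟩
    exact congrArg Subtype.val this
  exact h1.trans (congrArg f h3)

theorem ae_of_ae_Ioc {P : ℝ → Prop} (hp : ∀ s, P s → P (s + 1)) (hp' : ∀ s, P (s + 1) → P s)
    (h : ∀ᵐ s ∂(volume.restrict (Ioc (0 : ℝ) 1)), P s) : ∀ᵐ s, P s := by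
  have hz : ∀ n : ℤ, ∀ s, P (s + n) ↔ P s := by
    intro n
    induction n using Int.induction_on with
    | zero => simp
    | succ n ih => intro s; rw [← ih s]; push_cast; rw [← add_assoc]; exact ⟨hp' _, hp _⟩
    | pred n ih =>
      intro s
      rw [← ih s]
      have : s + ((-(n : ℤ) : ℤ) : ℝ) = s + ((-(n : ℤ) - 1 : ℤ) : ℝ) + 1 := by push_cast; ring
      rw [this]
      exact ⟨hp _, hp' _⟩
  have h1 : ∀ n : ℤ, ∀ᵐ s : ℝ ∂volume.restrict (Ioc (n : ℝ) (n + 1)), P s := fun n => by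
    have h2 := (ae_restrict_iff' measurableSet_Ioc).1 h
    have h3 := (measurePreserving_add_right (volume : Measure ℝ) (-(n : ℝ))).quasiMeasurePreserving.ae h2
    refine (ae_restrict_iff' measurableSet_Ioc).2 ?_
    filter_upwards [h3] with s h4 hs
    have h5 := h4 ⟨by linarith [hs.1], by linarith [hs.2]⟩
    rw [← hz n] at h5
    simpa using h5
  have h2 : ∀ᵐ s : ℝ ∂volume.restrict (⋃ n : ℤ, Ioc (n : ℝ) (n + 1)), P s := by
    rw [ae_restrict_iUnion_iff]; exact h1
  rwa [iUnion_Ioc_intCast, Measure.restrict_univ] at h2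

/-- Integration by parts for absolutely continuous primitives, whose derivatives are the given
integrands almost everywhere. -/
theorem integral_mul_primitive {R φ : ℝ → ℝ} (hR : IntervalIntegrable R volume 0 1)
    (hφ : IntervalIntegrable φ volume 0 1) :
    ∫ s in (0 : ℝ)..1, R s * ∫ r in (0 : ℝ)..s, φ r = (∫ s in (0 : ℝ)..1, R s) * (∫ s in (0 : ℝ)..1, φ s)
      - ∫ s in (0 : ℝ)..1, (∫ r in (0 : ℝ)..s, R r) * φ s := by
  have h1 := hR.absolutelyContinuousOnInterval_intervalIntegral (c := 0) (by simp)
  have h2 := hφ.absolutelyContinuousOnInterval_intervalIntegral (c := 0) (by simp)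
  have h3 := h1.integral_mul_deriv_eq_deriv_mul h2
  have e1 : ∫ x in (0 : ℝ)..1, (∫ v in (0 : ℝ)..x, R v) * deriv (fun x => ∫ v in (0 : ℝ)..x, φ v) x
      = ∫ s in (0 : ℝ)..1, (∫ r in (0 : ℝ)..s, R r) * φ s := by
    refine intervalIntegral.integral_congr_ae ?_
    filter_upwards [hφ.ae_hasDerivAt_integral] with x hx hx'
    rw [(hx (uIoc_subset_uIcc hx') 0 (by simp)).deriv]
  have e2 : ∫ x in (0 : ℝ)..1, deriv (fun x => ∫ v in (0 : ℝ)..x, R v) x * (∫ v in (0 : ℝ)..x, φ v)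
      = ∫ s in (0 : ℝ)..1, R s * ∫ r in (0 : ℝ)..s, φ r := by
    refine intervalIntegral.integral_congr_ae ?_
    filter_upwards [hR.ae_hasDerivAt_integral] with x hx hx'
    rw [(hx (uIoc_subset_uIcc hx') 0 (by simp)).deriv]
  rw [e1, e2] at h3
  simp only [intervalIntegral.integral_same, zero_mul, sub_zero] at h3
  linarith

/-! ### The Euler-Lagrange equation -/

section EulerLagrange

variable (g : RiemannianMetric) (σ : TwoForm)

/-- The force along a lifted loop. -/
def force (z : Lifted) (η : Plane) (s : ℝ) : ℝ :=
  z.2⁻¹ * (1 / 2 * (fderiv ℝ g.q (curve z.1.1 z.1.2 s) η) (ev z.1.2 s) (ev z.1.2 s))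
    + σ.eval (curve z.1.1 z.1.2 s) η (ev z.1.2 s)

theorem force_periodic {z : Lifted} (hm : total z.1.2 ∈ lattice) (η : Plane) : Function.Periodic (force g σ z η) 1 :=
  fun s => by
    simp only [force, curve_add_one, ev_add_one, g.latticePeriodic_q.fderiv _ _ hm, TwoForm.eval,
      σ.latticePeriodic _ _ hm]

theorem intervalIntegrable_force₁ (z : Lifted) {ξ : ℝ → Plane} (hξ : Continuous ξ) :
    IntervalIntegrable (fun s => (fderiv ℝ g.q (curve z.1.1 z.1.2 s) (ξ s)) (ev z.1.2 s) (ev z.1.2 s)) volume 0 1 := by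
  refine (integrable_bil (applyC (nem (continuous_metric' g) (curveC z.1))
    (CI.mk (fun s => ξ s) (hξ.comp continuous_subtype_val))) z.1.2 z.1.2 0 1).congr fun s hs => ?_
  rw [uIoc_of_le zero_le_one] at hs
  rw [ext01_of_mem _ (Ioc_subset_Icc_self hs), applyC_apply, nem_apply, curveC_apply, CI.mk_apply]

theorem intervalIntegrable_force₂ (z : Lifted) {ξ : ℝ → Plane} (hξ : Continuous ξ) :
    IntervalIntegrable (fun s => σ.eval (curve z.1.1 z.1.2 s) (ξ s) (ev z.1.2 s)) volume 0 1 := by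
  refine (integrable_lin (applyC (nem σ.continuous_form (curveC z.1))
    (CI.mk (fun s => ξ s) (hξ.comp continuous_subtype_val))) z.1.2 0 1).congr fun s hs => ?_
  rw [uIoc_of_le zero_le_one] at hs
  rw [ext01_of_mem _ (Ioc_subset_Icc_self hs), applyC_apply, nem_apply, curveC_apply, CI.mk_apply, TwoForm.form_apply]

theorem intervalIntegrable_force {z : Lifted} (hm : total z.1.2 ∈ lattice) (η : Plane) (a b : ℝ) :
    IntervalIntegrable (force g σ z η) volume a b := by
  refine (force_periodic g σ hm η).intervalIntegrable one_ne_zero (t := 0) ?_ a b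
  rw [zero_add]
  exact (((intervalIntegrable_force₁ g z continuous_const).const_mul _).const_mul _).add
    (intervalIntegrable_force₂ σ z continuous_const)

theorem act'_eq (k : ℝ) (z : Lifted) (x : Plane × L2) : act' g σ k z (x, 0) =
    (∫ s in (0 : ℝ)..1, force g σ z (curve x.1 x.2 s) s)
      + z.2⁻¹ * ∫ s in (0 : ℝ)..1, g.toFun (curve z.1.1 z.1.2 s) (ev z.1.2 s) (ev x.2 s) := by
  have hc := continuous_curve x.1 x.2
  rw [act'_apply, kin'_eq, tau_eq]
  unfold force
  rw [intervalIntegral.integral_add (((intervalIntegrable_force₁ g z hc).const_mul _).const_mul _)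
    (intervalIntegrable_force₂ σ z hc), intervalIntegral.integral_const_mul, intervalIntegral.integral_const_mul]
  ring

theorem force_smul (z : Lifted) (c : ℝ) (η : Plane) (s : ℝ) : force g σ z (c • η) s = c * force g σ z η s := by
  simp only [force, TwoForm.eval, map_smul, QForm.smul_apply, PiLp.smul_apply, smul_eq_mul]
  ring

/-- The basis vectors of the plane. -/
def bas (i : Fin 2) : Plane := EuclideanSpace.single i 1

theorem norm_bas (i : Fin 2) : ‖bas i‖ = 1 := by simp [bas]

theorem eq_sum_bas (η : Plane) : η = η 0 • bas 0 + η 1 • bas 1 := by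
  ext i; fin_cases i <;> simp [bas]

variable {g σ}

theorem curve_ofFun_smul {φ : ℝ → ℝ} {c : ℝ} {e : Plane} (hf : MemLp (fun s => φ s • e) 2 (volume.restrict (Ioc (0 : ℝ) 1)))
    {s : ℝ} (hs : s ∈ Icc (0 : ℝ) 1) : curve (c • e) (ofFun _ hf) s = (c + ∫ r in (0 : ℝ)..s, φ r) • e := by
  rw [curve, add_smul, ← intervalIntegral.integral_smul_const]
  congr 1
  refine intervalIntegral.integral_congr_ae ?_
  filter_upwards [(ae_restrict_iff' measurableSet_Ioc).1 (ev_ofFun hf)] with r hr hr'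
  rw [uIoc_of_le hs.1] at hr'
  exact hr ⟨hr'.1, hr'.2.trans hs.2⟩

theorem act'_ofFun (k : ℝ) {z : Lifted} {φ : ℝ → ℝ} {c : ℝ} {i : Fin 2}
    (hf : MemLp (fun s => φ s • bas i) 2 (volume.restrict (Ioc (0 : ℝ) 1))) :
    act' g σ k z ((c • bas i, ofFun _ hf), 0) =
      (∫ s in (0 : ℝ)..1, force g σ z (bas i) s * (c + ∫ r in (0 : ℝ)..s, φ r))
      + z.2⁻¹ * ∫ s in (0 : ℝ)..1, g.toFun (curve z.1.1 z.1.2 s) (ev z.1.2 s) (bas i) * φ s := by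
  rw [act'_eq]
  congr 1
  · refine intervalIntegral_congr01 fun s hs => ?_
    rw [curve_ofFun_smul hf hs, force_smul, mul_comm]
  · congr 1
    refine intervalIntegral.integral_congr_ae ?_
    filter_upwards [(ae_restrict_iff' measurableSet_Ioc).1 (ev_ofFun hf)] with r hr hr'
    rw [uIoc_of_le zero_le_one] at hr'
    rw [hr hr', map_smul, smul_eq_mul, mul_comm]

theorem aestronglyMeasurable_metric_bas (z : Lifted) (i : Fin 2) : AEStronglyMeasurable
    (fun s => g.toFun (curve z.1.1 z.1.2 s) (ev z.1.2 s) (bas i)) (volume.restrict (Ioc (0 : ℝ) 1)) := by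
  have h : Continuous fun x : QForm × Plane => x.1 x.2 (bas i) :=
    QForm.continuous_apply.comp (continuous_fst.prodMk (continuous_snd.prodMk continuous_const))
  exact h.comp_aestronglyMeasurable ((((continuous_metric g).comp (continuous_curve z.1.1 z.1.2)).aestronglyMeasurable).prodMk
    (aestronglyMeasurable_ev z.1.2).restrict)

theorem memLp_metric_bas (z : Lifted) (i : Fin 2) : MemLp
    (fun s => g.toFun (curve z.1.1 z.1.2 s) (ev z.1.2 s) (bas i)) 2 (volume.restrict (Ioc (0 : ℝ) 1)) := by
  obtain ⟨C, hC⟩ := exists_isBound g stdTwoForm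
  refine (memLp_ev z.1.2).of_le_mul (c := C) (aestronglyMeasurable_metric_bas z i) (ae_of_all _ fun s => ?_)
  have h := (g.q (curve z.1.1 z.1.2 s)).norm_apply_le (ev z.1.2 s) (bas i)
  rw [norm_bas, mul_one] at h
  exact h.trans (mul_le_mul_of_nonneg_right (hC.metric _) (norm_nonneg _))

theorem memLp_of_continuous {f : ℝ → ℝ} (hf : Continuous f) : MemLp f 2 (volume.restrict (Ioc (0 : ℝ) 1)) := by
  obtain ⟨C, hC⟩ := isCompact_Icc.exists_bound_of_continuousOn (s := Icc (0 : ℝ) 1) hf.continuousOn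
  refine MemLp.of_bound hf.aestronglyMeasurable C ?_
  filter_upwards [ae_restrict_mem measurableSet_Ioc] with s hs using hC s (Ioc_subset_Icc_self hs)

/-- Testing the form on a constant field removes the momentum term and leaves the mean force. -/
theorem integral_force_bas {k : ℝ} {z : Lifted} (hz : ∀ h, IsTangent h → act' g σ k z h = 0)
    (i : Fin 2) : ∫ s in (0 : ℝ)..1, force g σ z (bas i) s = 0 := by
  have h0 : MemLp (fun s : ℝ => (0 : ℝ) • bas i) 2 (volume.restrict (Ioc (0 : ℝ) 1)) := by
    simp only [zero_smul]; exact MemLp.zero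
  have h1 := act'_ofFun (g := g) (σ := σ) k (z := z) (φ := fun _ => 0) (c := 1) (i := i) h0
  have ht : total (ofFun _ h0) = 0 := by
    have := curve_ofFun_smul (φ := fun _ => 0) (c := 0) h0 (s := 1) ⟨zero_le_one, le_rfl⟩
    rw [curve_one] at this
    simpa using this
  rw [hz (((1 : ℝ) • bas i, ofFun _ h0), 0) ht] at h1
  simp at h1
  exact h1.symm

/-- The du Bois-Reymond argument. The function T⁻¹g(ẋ, eᵢ) minus the primitive of the force is
orthogonal to all functions of mean zero and hence constant almost everywhere. So the momentum has a
representative that is an integral of the force, and it is periodic because the mean force vanishes.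
-/
theorem exists_momentum {k : ℝ} {z : Lifted} (hm : total z.1.2 ∈ lattice) (hT : z.2 ≠ 0)
    (hz : ∀ h, IsTangent h → act' g σ k z h = 0) :
    ∃ κ : Fin 2 → ℝ → ℝ, (∀ i, Function.Periodic (κ i) 1) ∧
      (∀ i s s', κ i s' - κ i s = z.2 * ∫ r in s..s', force g σ z (bas i) r) ∧
      ∀ i, ∀ᵐ s, g.toFun (curve z.1.1 z.1.2 s) (ev z.1.2 s) (bas i) = κ i s := by
  have hI := intervalIntegrable_force g σ hm
  have key : ∀ i, ∃ c : ℝ, ∀ᵐ s, g.toFun (curve z.1.1 z.1.2 s) (ev z.1.2 s) (bas i)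
      = z.2 * (c + ∫ r in (0 : ℝ)..s, force g σ z (bas i) r) := by
    intro i
    set G : ℝ → ℝ := fun s => g.toFun (curve z.1.1 z.1.2 s) (ev z.1.2 s) (bas i) with hG
    set Q : ℝ → ℝ := fun s => ∫ r in (0 : ℝ)..s, force g σ z (bas i) r with hQ
    have hQc : Continuous Q := intervalIntegral.continuous_primitive (hI (bas i)) 0
    have hGm : MemLp G 2 (volume.restrict (Ioc (0 : ℝ) 1)) := memLp_metric_bas z i
    set f : ℝ → ℝ := fun s => z.2⁻¹ * G s - Q s with hf
    have hfm : MemLp f 2 (volume.restrict (Ioc (0 : ℝ) 1)) := (hGm.const_mul _).sub (memLp_of_continuous hQc)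
    have hii : ∀ {f : ℝ → ℝ}, MemLp f 2 (volume.restrict (Ioc (0 : ℝ) 1)) → IntervalIntegrable f volume 0 1 := fun h =>
      (intervalIntegrable_iff_integrableOn_Ioc_of_le zero_le_one).2 (h.integrable one_le_two)
    set c := ∫ s in (0 : ℝ)..1, f s with hc
    -- Subtracting the mean makes the primitive of φ vanish at both ends, so it is an admissible
    -- closed test field.
    set φ : ℝ → ℝ := fun s => f s - c with hφ
    have hφm : MemLp φ 2 (volume.restrict (Ioc (0 : ℝ) 1)) := hfm.sub (memLp_const c)
    have hφ0 : ∫ s in (0 : ℝ)..1, φ s = 0 := by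
      rw [hφ, intervalIntegral.integral_sub (hii hfm) intervalIntegrable_const]; simp [hc]
    have hv : MemLp (fun s => φ s • bas i) 2 (volume.restrict (Ioc (0 : ℝ) 1)) := by
      refine hφm.of_le_mul (c := 1) (hφm.1.smul_const _) (ae_of_all _ fun s => ?_)
      rw [norm_smul, norm_bas]; simp
    have ht : total (ofFun _ hv) = 0 := by
      have := curve_ofFun_smul (c := 0) hv (s := 1) ⟨zero_le_one, le_rfl⟩
      rw [curve_one, hφ0] at this
      simpa using this
    have h1 := act'_ofFun (g := g) (σ := σ) k (z := z) (c := 0) hv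
    rw [hz (((0 : ℝ) • bas i, ofFun _ hv), 0) ht] at h1
    simp only [zero_add] at h1
    -- Moving the primitive from φ to the force turns the vanishing of the form into ∫(T⁻¹G − Q)φ =
    -- 0. As φ has mean zero, this says ∫φ² = 0.
    rw [integral_mul_primitive (hI _ 0 1) (hii hφm), hφ0, mul_zero, zero_sub,
      ← intervalIntegral.integral_const_mul] at h1
    have hmul : ∀ {f f' : ℝ → ℝ}, MemLp f 2 (volume.restrict (Ioc (0 : ℝ) 1)) → MemLp f' 2 (volume.restrict (Ioc (0 : ℝ) 1)) →
        IntervalIntegrable (fun s => f s * f' s) volume 0 1 := fun h h' =>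
      (intervalIntegrable_iff_integrableOn_Ioc_of_le zero_le_one).2 (h.integrable_mul h')
    have h2 : ∫ s in (0 : ℝ)..1, φ s * φ s = 0 := by
      have h3 : ∀ s, φ s * φ s = z.2⁻¹ * (G s * φ s) - Q s * φ s - c * φ s := fun s => by
        simp only [hφ, hf]; ring
      simp only [h3]
      rw [intervalIntegral.integral_sub (((hmul hGm hφm).const_mul _).sub (hmul (memLp_of_continuous hQc) hφm))
        ((hii hφm).const_mul _), intervalIntegral.integral_sub ((hmul hGm hφm).const_mul _) (hmul (memLp_of_continuous hQc) hφm),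
        intervalIntegral.integral_const_mul c, hφ0]
      linarith
    have h3 : ∀ᵐ s ∂(volume.restrict (Ioc (0 : ℝ) 1)), φ s * φ s = 0 := by
      have := (intervalIntegral.integral_eq_zero_iff_of_le_of_nonneg_ae zero_le_one
        (ae_of_all _ fun s => mul_self_nonneg (φ s)) (hmul hφm hφm)).1 h2
      exact this
    refine ⟨c, ae_of_ae_Ioc ?_ ?_ (h3.mono fun s hs => ?_)⟩
    all_goals try
      have hQp : ∀ s, Q (s + 1) = Q s := fun s => by
        have h4 := intervalIntegral.integral_add_adjacent_intervals (hI (bas i) 0 s) (hI (bas i) s (s + 1))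
        have h5 := (force_periodic g σ hm (bas i)).intervalIntegral_add_eq s 0
        rw [zero_add, integral_force_bas hz i] at h5
        rw [h5, add_zero] at h4
        exact h4.symm
      have hGp : ∀ s, G (s + 1) = G s := fun s => by simp only [hG, curve_add_one, ev_add_one, g_add g _ hm]
    · intro s hs
      change G (s + 1) = z.2 * (c + Q (s + 1))
      rw [hQp, hGp]; exact hs
    · intro s hs
      change G (s + 1) = z.2 * (c + Q (s + 1)) at hs
      rw [hQp, hGp] at hs; exact hs
    · have h4 : f s = c := sub_eq_zero.1 (mul_self_eq_zero.1 hs)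
      simp only [hf] at h4
      change G s = z.2 * (c + Q s)
      rw [← h4]; field_simp; ring
  choose c hc using key
  refine ⟨fun i s => z.2 * (c i + ∫ r in (0 : ℝ)..s, force g σ z (bas i) r), fun i s => ?_, fun i s s' => ?_, hc⟩
  · have h4 := intervalIntegral.integral_add_adjacent_intervals (hI (bas i) 0 s) (hI (bas i) s (s + 1))
    have h5 := (force_periodic g σ hm (bas i)).intervalIntegral_add_eq s 0
    rw [zero_add, integral_force_bas hz i] at h5
    rw [h5, add_zero] at h4
    simp only [h4]
  · have h4 := intervalIntegral.integral_add_adjacent_intervals (hI (bas i) 0 s) (hI (bas i) s s')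
    simp only [← h4]; ring

end EulerLagrange

/-! ### Regularity and conservation of energy for zeros of the action form -/

section Velocity

variable {g : RiemannianMetric} {σ : TwoForm}

theorem const_of_sub_le_sq {H : ℝ → ℝ} {M : ℝ} (h : ∀ s s', |H s' - H s| ≤ M * |s' - s| ^ 2) (s s' : ℝ) :
    H s = H s' := by
  have hd : ∀ s, HasDerivAt H 0 s := fun s => by
    rw [hasDerivAt_iff_tendsto]
    refine squeeze_zero (g := fun s' => M * |s' - s|) (fun s' => by positivity) (fun s' => ?_) ?_
    · rw [smul_zero, sub_zero, Real.norm_eq_abs, Real.norm_eq_abs]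
      rcases eq_or_ne s' s with rfl | hs
      · simp
      · rw [inv_mul_le_iff₀ (abs_pos.2 (sub_ne_zero.2 hs))]
        exact (h s s').trans (le_of_eq (by ring))
    · have : Continuous fun s' => M * |s' - s| := by fun_prop
      simpa using this.tendsto s
  exact is_const_of_deriv_eq_zero (fun s => (hd s).differentiableAt) (fun s => (hd s).deriv) s s'

theorem metric_eq_inner {p : Plane} {v κ : Plane} (h : ∀ i, g.toFun p v (bas i) = κ i) (η : Plane) :
    g.toFun p v η = inner ℝ κ η := by
  conv_lhs => rw [eq_sum_bas η]
  rw [map_add, map_smul, map_smul, h, h, PiLp.inner_apply]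
  simp

theorem isCoercive_metric (p : Plane) : IsCoercive (g.toFun p) := by
  obtain ⟨c, hc, h⟩ := g.exists_coercive
  exact ⟨c, hc, fun u => by rw [mul_assoc, ← sq]; exact h p u⟩

theorem abs_half_add_mul_le {T B C d x₁ x₂ x₃ x₄ : ℝ} (hT : 0 < T) (h₁ : |x₁| ≤ C * B * B * d)
    (h₂ : |x₂| ≤ C * B * B * d) (h₃ : |x₃| ≤ C * B * B * d) (h₄ : |x₄| ≤ C * B * d) :
    |1 / 2 * (x₁ + x₂ - x₃) + T * x₄| ≤ (3 / 2 * (C * B * B) + T * (C * B)) * d := by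
  have h₅ : |T * x₄| ≤ T * (C * B * d) := by
    rw [abs_mul, abs_of_pos hT]; gcongr
  rw [abs_le] at *
  constructor <;> linarith [h₁.1, h₁.2, h₂.1, h₂.2, h₃.1, h₃.2, h₅.1, h₅.2]

set_option maxHeartbeats 2000000 in
/-- A lift of a zero of the action form has a Lipschitz continuous velocity without zeros. -/
theorem exists_velocity {k : ℝ} (hk : 0 < k) {z : Lifted} (hm : total z.1.2 ∈ lattice) (hT : 0 < z.2)
    (hz : ∀ h, IsTangent h → act' g σ k z h = 0) :
    ∃ V : ℝ → Plane, ∃ L b : ℝ, 0 < L ∧ 0 < b ∧ Function.Periodic V 1 ∧ (∀ s s', ‖V s - V s'‖ ≤ L * |s - s'|) ∧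
      (∀ s, b ≤ ‖V s‖) ∧ ∀ᵐ s, ev z.1.2 s = V s := by
  obtain ⟨κ, hκp, hκ, hae⟩ := exists_momentum hm hT.ne' hz
  obtain ⟨c, hc, hcoer⟩ := g.exists_coercive
  obtain ⟨C, hC⟩ := exists_isBound g σ
  have hC0 := hC.pos
  set x : ℝ → Plane := curve z.1.1 z.1.2 with hx
  set T := z.2 with hTdef
  set K : ℝ → Plane := fun s => WithLp.toLp 2 fun i => κ i s with hK
  have hKp : ∀ s, K (s + 1) = K s := fun s => by simp only [hK, hκp _ s]
  -- The metric dual of the momentum, obtained from Lax–Milgram, is defined at every parameter and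
  -- represents the velocity.
  set V : ℝ → Plane := fun s => ((isCoercive_metric (g := g) (x s)).continuousLinearEquivOfBilin).symm (K s) with hV
  have hVg : ∀ s η, g.toFun (x s) (V s) η = inner ℝ (K s) η := fun s η => by
    rw [← (isCoercive_metric (g := g) (x s)).continuousLinearEquivOfBilin_apply, hV]
    simp
  have huniq : ∀ s v, (∀ η, g.toFun (x s) v η = inner ℝ (K s) η) → v = V s := fun s v h => by
    have h1 := hcoer (x s) (v - V s)
    rw [(g.toFun (x s)).map_sub, sub_apply, h, hVg, sub_self] at h1
    have h2 : ‖v - V s‖ ^ 2 ≤ 0 := by nlinarith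
    exact sub_eq_zero.1 (norm_eq_zero.1 (pow_eq_zero_iff two_ne_zero |>.1 (le_antisymm h2 (sq_nonneg _))))
  have hgp : ∀ s, g.toFun (x (s + 1)) = g.toFun (x s) := fun s => by
    simp only [hx, curve_add_one, g_add g _ hm]
  have hVp : Function.Periodic V 1 := fun s => huniq s _ fun η => by rw [← hgp, hVg, hKp]
  have hVae : ∀ᵐ s, ev z.1.2 s = V s := by
    filter_upwards [ae_all_iff.2 hae] with s hs
    exact huniq s _ fun η => metric_eq_inner hs η
  -- boundedness
  have hκc : ∀ i, Continuous (κ i) := fun i => by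
    have h1 : κ i = fun s => κ i 0 + T * ∫ r in (0 : ℝ)..s, force g σ z (bas i) r := funext fun s => by
      rw [← hκ i 0 s]; ring
    rw [h1]
    exact continuous_const.add ((intervalIntegral.continuous_primitive (intervalIntegrable_force g σ hm _) 0).const_mul _)
  have hKc : Continuous K := (PiLp.continuous_toLp 2 _).comp (continuous_pi hκc)
  obtain ⟨B₀, hB₀⟩ := isCompact_Icc.exists_bound_of_continuousOn (s := Icc (0 : ℝ) 1) hKc.continuousOn
  have hKb : ∀ s, ‖K s‖ ≤ B₀ := fun s => by
    obtain ⟨t, ht, hst⟩ := Function.Periodic.exists_mem_Ico₀ hKp one_pos s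
    rw [hst]; exact hB₀ t (Ico_subset_Icc_self ht)
  have hB₀0 : 0 ≤ B₀ := (norm_nonneg _).trans (hKb 0)
  set B := B₀ / c with hBdef
  have hB0 : 0 ≤ B := by positivity
  have hVb : ∀ s, ‖V s‖ ≤ B := fun s => by
    have h1 := hcoer (x s) (V s)
    rw [hVg] at h1
    have h2 := real_inner_le_norm (K s) (V s)
    rw [hBdef, le_div_iff₀ hc]
    by_contra h3
    push Not at h3
    have h4 : 0 < ‖V s‖ := by
      rcases eq_or_lt_of_le (norm_nonneg (V s)) with h | h
      · rw [← h] at h3; linarith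
      · exact h
    have h5 := mul_le_mul_of_nonneg_right (hKb s) h4.le
    nlinarith
  have hxL : ∀ s s', ‖x s' - x s‖ ≤ B * |s' - s| := fun s s' => by
    rw [hx, curve_sub_curve]
    exact intervalIntegral.norm_integral_le_of_norm_le_const_ae (hVae.mono fun r hr _ => by rw [hr]; exact hVb r)
  have heval : ∀ p u w, |σ.eval p u w| ≤ C * ‖u‖ * ‖w‖ := fun p u w => by
    rw [← TwoForm.form_apply, ← Real.norm_eq_abs]
    exact ((σ.form p).le_opNorm₂ u w).trans (by gcongr; exact hC.form p)
  have hD : ∀ p u w w', |(fderiv ℝ g.q p u) w w'| ≤ C * ‖u‖ * ‖w‖ * ‖w'‖ := fun p u w w' => by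
    refine ((fderiv ℝ g.q p u).norm_apply_le w w').trans ?_
    gcongr
    exact ((fderiv ℝ g.q p).le_opNorm u).trans (by gcongr; exact hC.metric' p)
  have hforce : ∀ i, ∀ᵐ s, |force g σ z (bas i) s| ≤ T⁻¹ * (1 / 2 * (C * B * B)) + C * B := fun i => by
    filter_upwards [hVae] with s hs
    rw [force, hs]
    refine (abs_add_le _ _).trans (add_le_add ?_ ?_)
    · rw [abs_mul, abs_mul, abs_of_pos (inv_pos.2 hT), abs_of_pos (by norm_num : (0 : ℝ) < 1 / 2)]
      gcongr
      refine (hD _ _ _ _).trans ?_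
      rw [norm_bas, mul_one]
      gcongr <;> exact hVb s
    · refine (heval _ _ _).trans ?_
      rw [norm_bas, mul_one]
      gcongr; exact hVb s
  set F := T⁻¹ * (1 / 2 * (C * B * B)) + C * B with hF
  have hF0 : 0 ≤ F := by positivity
  have hκL : ∀ i s s', |κ i s' - κ i s| ≤ T * F * |s' - s| := fun i s s' => by
    rw [hκ, abs_mul, abs_of_pos hT, mul_assoc]
    gcongr
    exact intervalIntegral.norm_integral_le_of_norm_le_const_ae (C := F) (f := force g σ z (bas i)) ((hforce i).mono fun r hr _ => hr)
  have hKL : ∀ s s', ‖K s - K s'‖ ≤ 2 * (T * F) * |s - s'| := fun s s' => by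
    have h1 : ‖K s - K s'‖ ^ 2 = (κ 0 s - κ 0 s') ^ 2 + (κ 1 s - κ 1 s') ^ 2 := by
      rw [EuclideanSpace.norm_sq_eq]; simp [hK]
    have h2 := hκL 0 s' s
    have h3 := hκL 1 s' s
    refine abs_le_of_sq_le_sq' ?_ (by positivity) |>.2
    rw [h1, ← sq_abs (κ 0 s - κ 0 s'), ← sq_abs (κ 1 s - κ 1 s')]
    nlinarith [abs_nonneg (κ 0 s - κ 0 s'), abs_nonneg (κ 1 s - κ 1 s'), mul_nonneg (mul_nonneg hT.le hF0) (abs_nonneg (s - s'))]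
  have hgd : ∀ p p' u w, |g.toFun p u w - g.toFun p' u w| ≤ C * ‖p - p'‖ * ‖u‖ * ‖w‖ := fun p p' u w => by
    refine ((g.q p - g.q p').norm_apply_le u w).trans ?_
    gcongr; exact hC.metric_sub p p'
  set L := (2 * (T * F) + C * B * B) / c with hL
  have hL0 : 0 ≤ L := by positivity
  -- Coercivity bounds ‖V s − V s'‖² by the change of the momentum plus the change of the metric
  -- between the two points, both Lipschitz and both paired with V s − V s'.
  have hVL : ∀ s s', ‖V s - V s'‖ ≤ L * |s - s'| := fun s s' => by
    have h1 := hcoer (x s) (V s - V s')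
    have h2 : g.toFun (x s) (V s - V s') (V s - V s') = inner ℝ (K s - K s') (V s - V s')
        + (g.toFun (x s') (V s') (V s - V s') - g.toFun (x s) (V s') (V s - V s')) := by
      rw [(g.toFun (x s)).map_sub, sub_apply, hVg, inner_sub_left, hVg]; ring
    have h3 := real_inner_le_norm (K s - K s') (V s - V s')
    have h4 := le_abs_self (g.toFun (x s') (V s') (V s - V s') - g.toFun (x s) (V s') (V s - V s'))
    have h5 := hgd (x s') (x s) (V s') (V s - V s')
    have h6 := mul_le_mul_of_nonneg_right (hKL s s') (norm_nonneg (V s - V s'))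
    have h7 : C * ‖x s' - x s‖ * ‖V s'‖ * ‖V s - V s'‖ ≤ C * (B * |s - s'|) * B * ‖V s - V s'‖ := by
      gcongr
      · rw [abs_sub_comm]; exact hxL s s'
      · exact hVb s'
    rw [hL, div_mul_eq_mul_div, le_div_iff₀ hc]
    by_contra h8
    push Not at h8
    have h9 : 0 < ‖V s - V s'‖ := by
      rcases eq_or_lt_of_le (norm_nonneg (V s - V s')) with h | h
      · rw [← h] at h8
        have : 0 ≤ (2 * (T * F) + C * B * B) * |s - s'| := by positivity
        linarith
      · exact h
    have h10 := mul_lt_mul_of_pos_right h8 h9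
    nlinarith
  have hVc : Continuous V := by
    refine continuous_iff_continuousAt.2 fun s => tendsto_iff_norm_sub_tendsto_zero.2 ?_
    refine squeeze_zero (fun _ => norm_nonneg _) (fun s' => hVL s' s) ?_
    have : Continuous fun s' => L * |s' - s| := by fun_prop
    simpa using this.tendsto s
  -- derivatives
  have hxd : ∀ s, HasDerivAt x (V s) s := fun s => by
    have h1 : x = fun s => z.1.1 + ∫ r in (0 : ℝ)..s, V r := funext fun s => by
      rw [hx, curve, intervalIntegral.integral_congr_ae (hVae.mono fun r hr _ => hr)]
    rw [h1]
    exact (hVc.integral_hasStrictDerivAt 0 s).hasDerivAt.const_add _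
  set FV : Plane → ℝ → ℝ := fun η s => T⁻¹ * (1 / 2 * (fderiv ℝ g.q (x s) η) (V s) (V s)) + σ.eval (x s) η (V s) with hFV
  have hxc : Continuous x := continuous_curve _ _
  have hFVc : ∀ η, Continuous (FV η) := fun η => by
    have h1 : Continuous fun s => (fderiv ℝ g.q (x s) η) (V s) (V s) :=
      QForm.continuous_apply.comp ((((continuous_metric' g).comp hxc).clm_apply continuous_const).prodMk (hVc.prodMk hVc))
    have h2 : Continuous fun s => σ.eval (x s) η (V s) := by
      have h3 := σ.continuous_density.comp hxc
      have h4 : ∀ i, Continuous fun s => V s i := fun i => (dq i).continuous.comp hVc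
      exact h3.mul (((h4 1).const_mul _).sub ((h4 0).const_mul _))
    exact ((h1.const_mul _).const_mul _).add h2
  have hκd : ∀ i s, HasDerivAt (κ i) (T * FV (bas i) s) s := fun i s => by
    have h1 : κ i = fun s => κ i 0 + T * ∫ r in (0 : ℝ)..s, FV (bas i) r := funext fun s => by
      have h2 := hκ i 0 s
      rw [intervalIntegral.integral_congr_ae (g := FV (bas i)) (hVae.mono fun r hr _ => by rw [force, hr])] at h2
      rw [← h2]; ring
    rw [h1]
    exact (((hFVc (bas i)).integral_hasStrictDerivAt 0 s).hasDerivAt.const_mul T).const_add _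
  have hFVlin : ∀ η s, FV η s = η 0 * FV (bas 0) s + η 1 * FV (bas 1) s := fun η s => by
    simp only [hFV]
    conv_lhs => rw [eq_sum_bas η]
    simp only [map_add, map_smul, QForm.add_apply, QForm.smul_apply, TwoForm.eval, PiLp.add_apply, PiLp.smul_apply, smul_eq_mul]
    ring
  -- conservation of energy
  set H : ℝ → ℝ := fun s => g.toFun (x s) (V s) (V s) with hH
  set M := (3 / 2 * (C * B * B) + T * (C * B)) * L with hM
  have hM0 : 0 ≤ M := by positivity
  -- A Lipschitz velocity cannot simply be differentiated. Instead V s is frozen in φ(r) = ⟨K r, V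
  -- s⟩ − ½g(V s, V s) at x(r). This equals ½H(s) at r = s and is at most ½H(s') at r = s', and its
  -- derivative is of order ‖V r − V s‖. So H changes at most quadratically and is constant.
  have hlow : ∀ s s', H s - 2 * M * |s' - s| ^ 2 ≤ H s' := by
    intro s s'
    set φ : ℝ → ℝ := fun r => (κ 0 r * V s 0 + κ 1 r * V s 1) - 1 / 2 * g.toFun (x r) (V s) (V s) with hφ
    have hin : ∀ r η, inner ℝ (K r) η = κ 0 r * η 0 + κ 1 r * η 1 := fun r η => by
      rw [PiLp.inner_apply]; simp [hK, mul_comm]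
    have hφd : ∀ r, HasDerivAt φ (T * FV (V s) r - 1 / 2 * (fderiv ℝ g.q (x r) (V r)) (V s) (V s)) r := fun r => by
      have h1 : HasDerivAt (fun r => g.q (x r)) (fderiv ℝ g.q (x r) (V r)) r :=
        HasFDerivAt.comp_hasDerivAt r ((g.contDiff_q.differentiable (by simp)) (x r)).hasFDerivAt (hxd r)
      have h2 : HasDerivAt (fun r => g.toFun (x r) (V s) (V s)) ((fderiv ℝ g.q (x r) (V r)) (V s) (V s)) r := by
        have h3 : IsBoundedLinearMap ℝ fun Q : QForm => Q (V s) (V s) :=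
          { map_add := fun _ _ => rfl, map_smul := fun _ _ => rfl
            bound := ⟨‖V s‖ * ‖V s‖ + 1, by positivity, fun Q => (Q.norm_apply_le _ _).trans (by
              nlinarith [norm_nonneg Q])⟩ }
        exact h3.toContinuousLinearMap.hasFDerivAt.comp_hasDerivAt r h1
      have h4 := (((hκd 0 r).mul_const (V s 0)).add ((hκd 1 r).mul_const (V s 1))).sub (h2.const_mul (1 / 2))
      refine h4.congr_deriv ?_
      rw [hFVlin (V s)]; ring
    have hφb : ∀ r, |T * FV (V s) r - 1 / 2 * (fderiv ℝ g.q (x r) (V r)) (V s) (V s)|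
        ≤ (3 / 2 * (C * B * B) + T * (C * B)) * ‖V r - V s‖ := fun r => by
      -- The derivative of φ vanishes when V r = V s; this regrouping exhibits a factor V r − V s in
      -- each term.
      have e : T * FV (V s) r - 1 / 2 * (fderiv ℝ g.q (x r) (V r)) (V s) (V s)
          = 1 / 2 * ((fderiv ℝ g.q (x r) (V s)) (V r - V s) (V r) + (fderiv ℝ g.q (x r) (V s)) (V s) (V r - V s)
            - (fderiv ℝ g.q (x r) (V r - V s)) (V s) (V s)) + T * σ.eval (x r) (V s) (V r - V s) := by
        have e1 : σ.eval (x r) (V s) (V r - V s) = σ.eval (x r) (V s) (V r) := by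
          simp only [TwoForm.eval, PiLp.sub_apply]; ring
        rw [e1]
        simp only [hFV, map_sub, QForm.app_sub, sub_apply, QForm.sub_apply]
        field_simp
        ring
      rw [e]
      have b1 := hD (x r) (V s) (V r - V s) (V r)
      have b2 := hD (x r) (V s) (V s) (V r - V s)
      have b3 := hD (x r) (V r - V s) (V s) (V s)
      have b4 := heval (x r) (V s) (V r - V s)
      have d0 := norm_nonneg (V r - V s)
      have b0 : C * ‖V s‖ ≤ C * B := by gcongr; exact hVb _
      refine abs_half_add_mul_le hT (b1.trans ?_) (b2.trans ?_) (b3.trans ?_) (b4.trans (by gcongr))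
      · calc C * ‖V s‖ * ‖V r - V s‖ * ‖V r‖ ≤ C * B * ‖V r - V s‖ * B := by gcongr; exact hVb _
          _ = _ := by ring
      · exact mul_le_mul_of_nonneg_right (mul_le_mul b0 (hVb s) (norm_nonneg _) (by positivity)) d0
      · calc C * ‖V r - V s‖ * ‖V s‖ * ‖V s‖ = C * ‖V s‖ * ‖V s‖ * ‖V r - V s‖ := by ring
          _ ≤ C * B * B * ‖V r - V s‖ := mul_le_mul_of_nonneg_right (mul_le_mul b0 (hVb s) (norm_nonneg _) (by positivity)) d0
    have hmv : |φ s' - φ s| ≤ M * |s' - s| * |s' - s| := by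
      refine (convex_uIcc s s').norm_image_sub_le_of_norm_hasDerivWithin_le (C := M * |s' - s|)
        (fun r _ => (hφd r).hasDerivWithinAt) (fun r hr => (hφb r).trans ?_) left_mem_uIcc right_mem_uIcc
      rw [hM, mul_assoc _ L]
      gcongr
      exact (hVL r s).trans (mul_le_mul_of_nonneg_left (abs_sub_left_of_mem_uIcc hr) hL0)
    have h1 : φ s = 1 / 2 * H s := by
      simp only [hφ, ← hin, ← hVg, hH]; ring
    -- Young's inequality for the quadratic form at x(s'), in the shape of the non-negativity of its
    -- value on V s' − V s.
    have h2 : φ s' ≤ 1 / 2 * H s' := by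
      have h3 : 0 ≤ g.toFun (x s') (V s' - V s) (V s' - V s) := (by positivity : 0 ≤ c * ‖V s' - V s‖ ^ 2).trans (hcoer _ _)
      simp only [map_sub, sub_apply] at h3
      simp only [hφ, ← hin, ← hVg, hH]
      rw [g.symm (x s') (V s) (V s')] at h3
      linarith
    rw [abs_le] at hmv
    nlinarith [hmv.1]
  have hconst := const_of_sub_le_sq (H := H) (M := 2 * M) fun s s' => by
    have h1 := hlow s s'
    have h2 := hlow s' s
    rw [abs_sub_comm s s'] at h2
    rw [abs_le]; constructor <;> linarith
  have hkin : kin g z.1 = 1 / 2 * H 0 := by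
    rw [kin_eq, intervalIntegral.integral_congr_ae (g := fun _ => H 0)]
    · simp
    · filter_upwards [hVae] with s hs _
      rw [hs]; exact hconst s 0
  -- The variation of the period alone gives H = 2kT². Since k > 0, the constant speed is positive;
  -- this is where the lower bound on ‖V‖ comes from.
  have hper := hz ((0, 0), 1) (map_zero total)
  rw [act'_apply, hkin] at hper
  have h1 : k - 1 / 2 * H 0 * T⁻¹ ^ 2 = 0 := by
    have e1 : ((0, 0) : Plane × L2) = 0 := rfl
    simp only [e1, map_zero, mul_zero, mul_one, zero_add] at hper
    exact hper
  have hHpos : 0 < H 0 := by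
    have : 0 < T⁻¹ ^ 2 := by positivity
    by_contra h2
    push Not at h2
    nlinarith
  refine ⟨V, L + 1, √(H 0 / C), by positivity, Real.sqrt_pos.2 (by positivity), hVp, fun s s' => (hVL s s').trans ?_,
    fun s => ?_, hVae⟩
  · nlinarith [abs_nonneg (s - s')]
  · refine Real.sqrt_le_iff.2 ⟨norm_nonneg _, ?_⟩
    rw [div_le_iff₀ hC0, hconst 0 s]
    have h2 := (le_abs_self _).trans ((g.q (x s)).norm_apply_le (V s) (V s))
    have h3 := hC.metric (x s)
    calc H s ≤ ‖g.q (x s)‖ * ‖V s‖ * ‖V s‖ := h2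
      _ ≤ C * ‖V s‖ * ‖V s‖ := by gcongr
      _ = ‖V s‖ ^ 2 * C := by ring

end Velocity

/-! ### The Poincaré–Miranda theorem in the plane -/

theorem lt_of_forall_ne {h : ℝ → ℝ} (hh : Continuous h) {c : ℝ} (hne : ∀ x ∈ Icc (0 : ℝ) 1, h x ≠ c) (h0 : h 0 < c) :
    h 1 < c := by
  by_contra h1
  obtain ⟨x, hx, hxc⟩ := intermediate_value_Icc zero_le_one hh.continuousOn ⟨h0.le, not_lt.1 h1⟩
  exact hne x hx hxc

theorem gt_of_forall_ne {h : ℝ → ℝ} (hh : Continuous h) {c : ℝ} (hne : ∀ x ∈ Icc (0 : ℝ) 1, h x ≠ c) (h0 : c < h 0) :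
    c < h 1 :=
  neg_lt_neg_iff.1 (lt_of_forall_ne (h := fun x => -h x) (c := -c) hh.neg (fun x hx hc => hne x hx (neg_inj.1 hc)) (neg_lt_neg h0))

/-- Without a common zero, f₁ + if₂ has a continuous argument θ, with cos θ negative at the bottom,
positive at the top, sin θ ≥ 0 on the left and sin θ ≤ 0 on the right. Starting in (π/2, 3π/2), θ
cannot pass 3π/2 on the left side, so it is below π/2 at the top left corner. It cannot pass π/2 on
the bottom or on the right side, so it is above π/2 at the top right corner. But it never equals π/2
on the top side. -/
theorem exists_common_zero {f₁ f₂ : ℝ × ℝ → ℝ} (h₁ : Continuous f₁) (h₂ : Continuous f₂)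
    (hb : ∀ x ∈ Icc (0 : ℝ) 1, f₁ (x, 0) < 0) (ht : ∀ x ∈ Icc (0 : ℝ) 1, 0 < f₁ (x, 1))
    (hl : ∀ y ∈ Icc (0 : ℝ) 1, 0 ≤ f₂ (0, y)) (hr : ∀ y ∈ Icc (0 : ℝ) 1, f₂ (1, y) ≤ 0) :
    ∃ x ∈ Icc (0 : ℝ) 1, ∃ y ∈ Icc (0 : ℝ) 1, f₁ (x, y) = 0 ∧ f₂ (x, y) = 0 := by
  by_contra hcon
  push Not at hcon
  -- Clamping extends the functions from the square to the plane without new zeros, so the logarithm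
  -- can be taken on a simply connected open set.
  let cl : ℝ × ℝ → ℝ × ℝ := fun p => (projIcc 0 1 zero_le_one p.1, projIcc 0 1 zero_le_one p.2)
  have hcl : Continuous cl := by
    refine Continuous.prodMk ?_ ?_
    · exact continuous_subtype_val.comp (continuous_projIcc.comp continuous_fst)
    · exact continuous_subtype_val.comp (continuous_projIcc.comp continuous_snd)
  have hcl' : ∀ x ∈ Icc (0 : ℝ) 1, ∀ y ∈ Icc (0 : ℝ) 1, cl (x, y) = (x, y) := fun x hx y hy => by
    simp only [cl]; rw [projIcc_of_mem _ hx, projIcc_of_mem _ hy]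
  let F : ℝ × ℝ → ℂ := fun p => ⟨f₁ (cl p), f₂ (cl p)⟩
  have hF : Continuous F := by
    have : F = fun p => ((f₁ (cl p) : ℝ) : ℂ) + ((f₂ (cl p) : ℝ) : ℂ) * Complex.I := funext fun p => Complex.mk_eq_add_mul_I _ _
    rw [this]
    have c1 := h₁.comp hcl
    have c2 := h₂.comp hcl
    exact (Complex.continuous_ofReal.comp c1).add ((Complex.continuous_ofReal.comp c2).mul continuous_const)
  have hsc : IsSimplyConnected (univ : Set (ℝ × ℝ)) := by
    have := (Homeomorph.Set.univ (ℝ × ℝ)).contractibleSpace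
    exact (inferInstance : SimplyConnectedSpace (univ : Set (ℝ × ℝ)))
  obtain ⟨L, hL, hLF⟩ := Complex.exists_continuousOn_eqOn_exp_comp hsc isOpen_univ hF.continuousOn (by
    rintro ⟨p, -, hp⟩
    have e1 := congrArg Complex.re hp
    have e2 := congrArg Complex.im hp
    exact hcon _ (projIcc 0 1 zero_le_one p.1).2 _ (projIcc 0 1 zero_le_one p.2).2 e1 e2)
  rw [continuousOn_univ] at hL
  -- The branch is fixed by requiring the argument at the lower left corner to lie in [0, 2π).
  obtain ⟨n, hn, -⟩ := existsUnique_add_zsmul_mem_Ico Real.two_pi_pos (L (0, 0)).im 0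
  rw [zero_add] at hn
  let θ : ℝ × ℝ → ℝ := fun p => (L p).im + n • (2 * Real.pi)
  have hθ : Continuous θ := (Complex.continuous_im.comp hL).add continuous_const
  have hcos : ∀ x ∈ Icc (0 : ℝ) 1, ∀ y ∈ Icc (0 : ℝ) 1, f₁ (x, y) = Real.exp (L (x, y)).re * Real.cos (θ (x, y)) ∧
      f₂ (x, y) = Real.exp (L (x, y)).re * Real.sin (θ (x, y)) := fun x hx y hy => by
    have e := hLF (mem_univ (x, y))
    have e3 : cl (x, y) = (x, y) := hcl' x hx y hy
    have e1 := congrArg Complex.re e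
    have e2 := congrArg Complex.im e
    simp only [Function.comp_apply, Complex.exp_re, Complex.exp_im, F, e3] at e1 e2
    constructor
    · rw [← e1]; simp only [θ]; rw [zsmul_eq_mul, Real.cos_add_int_mul_two_pi]
    · rw [← e2]; simp only [θ]; rw [zsmul_eq_mul, Real.sin_add_int_mul_two_pi]
  have z0 : (0 : ℝ) ∈ Icc (0 : ℝ) 1 := by simp
  have z1 : (1 : ℝ) ∈ Icc (0 : ℝ) 1 := by simp
  have cneg : ∀ x ∈ Icc (0 : ℝ) 1, Real.cos (θ (x, 0)) < 0 := fun x hx => by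
    have := (hcos x hx 0 z0).1 ▸ hb x hx
    by_contra h
    exact absurd this (not_lt.2 (mul_nonneg (Real.exp_pos _).le (not_lt.1 h)))
  have cpos : ∀ x ∈ Icc (0 : ℝ) 1, 0 < Real.cos (θ (x, 1)) := fun x hx => by
    have := (hcos x hx 1 z1).1 ▸ ht x hx
    exact pos_of_mul_pos_right this (Real.exp_pos _).le
  have sl : ∀ y ∈ Icc (0 : ℝ) 1, 0 ≤ Real.sin (θ (0, y)) := fun y hy => by
    have := (hcos 0 z0 y hy).2 ▸ hl y hy
    exact nonneg_of_mul_nonneg_right this (Real.exp_pos _)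
  have sr : ∀ y ∈ Icc (0 : ℝ) 1, Real.sin (θ (1, y)) ≤ 0 := fun y hy => by
    have := (hcos 1 z1 y hy).2 ▸ hr y hy
    by_contra h
    exact absurd this (not_le.2 (mul_pos (Real.exp_pos _) (not_le.1 h)))
  have v1 : Real.cos (Real.pi / 2) = 0 := Real.cos_pi_div_two
  have v3 : Real.cos (3 * Real.pi / 2) = 0 := by
    rw [show 3 * Real.pi / 2 = Real.pi / 2 + Real.pi by ring, Real.cos_add_pi, v1, neg_zero]
  have w3 : Real.sin (3 * Real.pi / 2) = -1 := by
    rw [show 3 * Real.pi / 2 = Real.pi / 2 + Real.pi by ring, Real.sin_add_pi, Real.sin_pi_div_two]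
  have s0 : Real.pi / 2 < θ (0, 0) ∧ θ (0, 0) < 3 * Real.pi / 2 := by
    have hc := cneg 0 z0
    constructor
    · by_contra h
      exact absurd hc (not_lt.2 (Real.cos_nonneg_of_neg_pi_div_two_le_of_le (by linarith [hn.1, Real.pi_pos]) (not_lt.1 h)))
    · by_contra h
      rw [← Real.cos_sub_two_pi] at hc
      exact absurd hc (not_lt.2 (Real.cos_nonneg_of_neg_pi_div_two_le_of_le (by linarith [Real.pi_pos]) (by
        linarith [hn.2, Real.pi_pos])))
  have cb : Continuous fun x : ℝ => θ (x, 0) := by fun_prop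
  have ct : Continuous fun x : ℝ => θ (x, 1) := by fun_prop
  have cL : Continuous fun y : ℝ => θ (0, y) := by fun_prop
  have cR : Continuous fun y : ℝ => θ (1, y) := by fun_prop
  have l1 := lt_of_forall_ne cL (c := 3 * Real.pi / 2) (fun y hy e => by
    have := sl y hy
    rw [e, w3] at this; linarith) s0.2
  have l2 : θ (0, 1) < Real.pi / 2 := by
    by_contra h
    have := cpos 0 z0
    exact absurd this (not_lt.2 (Real.cos_nonpos_of_pi_div_two_le_of_le (not_lt.1 h) (by linarith)))
  have r0 := gt_of_forall_ne cb (c := Real.pi / 2) (fun x hx e => by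
    have := cneg x hx
    rw [e, v1] at this; exact lt_irrefl _ this) s0.1
  have r1 := gt_of_forall_ne cR (c := Real.pi / 2) (fun y hy e => by
    have := sr y hy
    rw [e, Real.sin_pi_div_two] at this; linarith) r0
  have t1 := lt_of_forall_ne ct (c := Real.pi / 2) (fun x hx e => by
    have := cpos x hx
    rw [e, v1] at this; exact lt_irrefl _ this) l2
  exact lt_asymm r1 t1

/-! ### Cutting a curve close to an iterated one -/

/-- A curve that stays close to the `N`-th iterate of a regular periodic curve closes up after about
one period of the latter. -/
theorem exists_closing_time {β V : ℝ → Plane} {m : Plane} {L B b : ℝ} (hL : 0 < L) (hb : 0 < b)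
    (hVB : ∀ s, ‖V s‖ ≤ B) (hVb : ∀ s, b ≤ ‖V s‖) (hVL : ∀ s s', ‖V s - V s'‖ ≤ L * |s - s'|)
    (hVp : Function.Periodic V 1) (hβ : ∀ s, HasDerivAt β (V s) s) (hβp : ∀ s, β (s + 1) = β s + m)
    {N : ℕ} (hN : 2 ≤ N) {η : ℝ} (hη : 0 < η) :
    ∃ ε > 0, ∀ y : ℝ → Plane, Continuous y → (∀ t, y (t + 1) = y t + (N : ℝ) • m) → (∀ t, ‖y t - β ((N : ℝ) * t)‖ ≤ ε) →
      ∃ a c, 0 < c ∧ c < 1 ∧ |(N : ℝ) * c - 1| ≤ η ∧ y (a + c) = y a + m := by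
  have hB : b ≤ B := (hVb 0).trans (hVB 0)
  have hB0 : 0 < B := hb.trans_le hB
  -- Within a window of length 2ρ the tangent turns by at most b/2, so the curve advances in the
  -- direction of its tangent at rate at least b²/2.
  set ρ := b ^ 2 / (8 * L * B) with hρd
  have hρ : 0 < ρ := by positivity
  have hρ1 : L * (B * ρ) = b ^ 2 / 8 := by rw [hρd]; field_simp
  have hρ2 : L * (2 * ρ) ≤ b / 2 := by
    have : L * (2 * ρ) = b * (b / B) / 4 := by rw [hρd]; field_simp; ring
    rw [this]
    have : b / B ≤ 1 := (div_le_one hB0).2 hB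
    nlinarith
  -- The three entries keep the perpendicular foot unique in the window, make it exist within ρ/2 of
  -- Nt, and place it within η/2 of Nt.
  refine ⟨min (b ^ 2 / (8 * L)) (min (b ^ 2 * ρ / (8 * B)) (b ^ 2 * η / (8 * B))), by positivity, fun y hy hyp hyβ => ?_⟩
  set ε := min (b ^ 2 / (8 * L)) (min (b ^ 2 * ρ / (8 * B)) (b ^ 2 * η / (8 * B))) with hε
  have hε1 : L * ε ≤ b ^ 2 / 8 := by
    have : ε ≤ b ^ 2 / (8 * L) := min_le_left _ _
    rw [le_div_iff₀ (by positivity)] at this; linarith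
  have hε2 : B * ε ≤ b ^ 2 * ρ / 8 := by
    have : ε ≤ b ^ 2 * ρ / (8 * B) := (min_le_right _ _).trans (min_le_left _ _)
    rw [le_div_iff₀ (by positivity)] at this; linarith
  have hε3 : B * ε ≤ b ^ 2 * η / 8 := by
    have : ε ≤ b ^ 2 * η / (8 * B) := (min_le_right _ _).trans (min_le_right _ _)
    rw [le_div_iff₀ (by positivity)] at this; linarith
  have hβL : ∀ s s', ‖β s - β s'‖ ≤ B * |s - s'| := fun s s' =>
    convex_univ.norm_image_sub_le_of_norm_hasDerivWithin_le (fun r _ => (hβ r).hasDerivWithinAt) (fun r _ => hVB r)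
      (mem_univ s') (mem_univ s)
  have hβc : Continuous β := continuous_iff_continuousAt.2 fun s => (hβ s).continuousAt
  have hVc : Continuous V := by
    refine continuous_iff_continuousAt.2 fun s => tendsto_iff_norm_sub_tendsto_zero.2 ?_
    refine squeeze_zero (fun _ => norm_nonneg _) (fun s' => hVL s' s) ?_
    have : Continuous fun s' => L * |s' - s| := by fun_prop
    simpa using this.tendsto s
  have hprog : ∀ s s', s ≤ s' → s' - s ≤ 2 * ρ → b ^ 2 / 2 * (s' - s) ≤ inner ℝ (V s') (β s' - β s) := by
    intro s s' hss hsρ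
    have hd : ∀ r, HasDerivAt (fun r => inner ℝ (V s') (β r)) (inner ℝ (V s') (V r)) r := fun r => by
      simpa using (hasDerivAt_const r (V s')).inner ℝ (hβ r)
    have := (convex_Icc s s').mul_sub_le_image_sub_of_le_deriv (f := fun r => inner ℝ (V s') (β r)) (C := b ^ 2 / 2)
      (fun r _ => (hd r).continuousAt.continuousWithinAt) (fun r _ => (hd r).differentiableAt.differentiableWithinAt)
      (fun r hr => by
        rw [(hd r).deriv]
        rw [interior_Icc] at hr
        have e : inner ℝ (V s') (V r) = ‖V s'‖ ^ 2 - inner ℝ (V s') (V s' - V r) := by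
          rw [inner_sub_right, real_inner_self_eq_norm_sq]; ring
        have e1 := real_inner_le_norm (V s') (V s' - V r)
        have e2 : ‖V s' - V r‖ ≤ b / 2 := (hVL s' r).trans (le_trans (by
          rw [abs_of_nonneg (by linarith [hr.2])]
          exact mul_le_mul_of_nonneg_left (by linarith [hr.1]) hL.le) hρ2)
        have e3 := mul_le_mul_of_nonneg_left e2 (norm_nonneg (V s'))
        have e4 := hVb s'
        rw [e]
        nlinarith) s (left_mem_Icc.2 hss) s' (right_mem_Icc.2 hss) hss
    rwa [← inner_sub_right] at this
  -- A zero s of F t means that y(t) lies on the normal line of β at s, so solving F t s = 0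
  -- introduces tubular coordinates along β.
  let F : ℝ → ℝ → ℝ := fun t s => inner ℝ (V s) (y t - β s)
  have hmono : ∀ t s s' : ℝ, |s - (N : ℝ) * t| ≤ ρ → |s' - (N : ℝ) * t| ≤ ρ → s ≤ s' → b ^ 2 / 4 * (s' - s) ≤ F t s - F t s' := by
    intro t s s' hs hs' hss
    have e : F t s - F t s' = inner ℝ (V s') (β s' - β s) - inner ℝ (V s' - V s) (y t - β s) := by
      simp only [F, inner_sub_left, inner_sub_right]; ring
    have e1 := real_inner_le_norm (V s' - V s) (y t - β s)
    have e2 : ‖y t - β s‖ ≤ ε + B * ρ := by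
      have h1 : y t - β s = (y t - β ((N : ℝ) * t)) + (β ((N : ℝ) * t) - β s) := by abel
      rw [h1]
      refine (norm_add_le _ _).trans (add_le_add (hyβ t) ((hβL _ _).trans ?_))
      rw [abs_sub_comm]; gcongr
    have e3 : ‖V s' - V s‖ * ‖y t - β s‖ ≤ L * (s' - s) * (ε + B * ρ) := by
      refine mul_le_mul ((hVL s' s).trans_eq (by rw [abs_of_nonneg (sub_nonneg.2 hss)])) e2 (norm_nonneg _) ?_
      exact mul_nonneg hL.le (sub_nonneg.2 hss)
    have e4 := hprog s s' hss (by rw [abs_le] at hs hs'; linarith [hs.1, hs'.2])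
    have e5 : L * (s' - s) * (ε + B * ρ) ≤ b ^ 2 / 4 * (s' - s) := by
      have : L * (ε + B * ρ) ≤ b ^ 2 / 4 := by rw [mul_add, hρ1]; linarith
      have := mul_le_mul_of_nonneg_right this (sub_nonneg.2 hss)
      linarith
    rw [e]; linarith
  have hsep : ∀ t s s' : ℝ, |s - (N : ℝ) * t| ≤ ρ → |s' - (N : ℝ) * t| ≤ ρ → b ^ 2 / 4 * |s' - s| ≤ |F t s - F t s'| := by
    intro t s s' hs hs'
    rcases le_total s s' with h | h
    · rw [abs_of_nonneg (sub_nonneg.2 h)]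
      exact (hmono t s s' hs hs' h).trans (le_abs_self _)
    · rw [abs_sub_comm, abs_of_nonneg (sub_nonneg.2 h), abs_sub_comm (F t s)]
      exact (hmono t s' s hs' hs h).trans (le_abs_self _)
  have hF0 : ∀ t, |F t ((N : ℝ) * t)| ≤ B * ε := fun t =>
    (abs_real_inner_le_norm _ _).trans (mul_le_mul (hVB _) (hyβ t) (norm_nonneg _) hB0.le)
  -- F t is small at Nt and strictly decreasing on the window, so it changes sign there.
  have hex : ∀ t, ∃ s, |s - (N : ℝ) * t| ≤ ρ ∧ F t s = 0 := by
    intro t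
    have w0 : |((N : ℝ) * t) - (N : ℝ) * t| ≤ ρ := by rw [sub_self, abs_zero]; exact hρ.le
    have h1 := hmono t ((N : ℝ) * t - ρ) ((N : ℝ) * t) (by rw [sub_sub_cancel_left, abs_neg, abs_of_pos hρ]) w0 (by linarith)
    have h2 := hmono t ((N : ℝ) * t) ((N : ℝ) * t + ρ) w0 (by rw [add_sub_cancel_left, abs_of_pos hρ]) (by linarith)
    have h3 := abs_le.1 (hF0 t)
    have hbr : 0 < b ^ 2 * ρ := by positivity
    have hc : Continuous (F t) := by
      have : Continuous fun s => y t - β s := continuous_const.sub hβc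
      exact hVc.inner this
    obtain ⟨s, hs, hs0⟩ := intermediate_value_Icc' (a := (N : ℝ) * t - ρ) (b := (N : ℝ) * t + ρ) (by linarith) hc.continuousOn
      (show (0 : ℝ) ∈ Icc _ _ by constructor <;> linarith [h3.1, h3.2])
    exact ⟨s, by rw [abs_le]; constructor <;> linarith [hs.1, hs.2], hs0⟩
  choose s hsρ hsF using hex
  have hs0 : ∀ t, b ^ 2 / 4 * |s t - (N : ℝ) * t| ≤ B * ε := fun t => by
    have := hsep t ((N : ℝ) * t) (s t) (by rw [sub_self, abs_zero]; exact hρ.le) (hsρ t)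
    rw [hsF, sub_zero] at this
    exact this.trans (hF0 t)
  have hsρ' : ∀ t, |s t - (N : ℝ) * t| ≤ ρ / 2 := fun t =>
    le_of_mul_le_mul_left ((hs0 t).trans (hε2.trans_eq (by ring))) (show 0 < b ^ 2 / 4 by positivity)
  have hsη : ∀ t, |s t - (N : ℝ) * t| ≤ η / 2 := fun t =>
    le_of_mul_le_mul_left ((hs0 t).trans (hε3.trans_eq (by ring))) (show 0 < b ^ 2 / 4 by positivity)
  have hsc : Continuous s := by
    refine continuous_iff_continuousAt.2 fun t => tendsto_iff_norm_sub_tendsto_zero.2 ?_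
    have hb4 : 0 < b ^ 2 / 4 := by positivity
    have hev : ∀ᶠ t' in 𝓝 t, |((N : ℝ) * t') - (N : ℝ) * t| < ρ / 2 := by
      have : Continuous fun t' : ℝ => |((N : ℝ) * t') - (N : ℝ) * t| := by fun_prop
      refine this.continuousAt.eventually_lt continuousAt_const ?_
      simp only [sub_self, abs_zero]; positivity
    refine squeeze_zero' (g := fun t' => (b ^ 2 / 4)⁻¹ * (B * ‖y t' - y t‖)) (Eventually.of_forall fun _ => norm_nonneg _) ?_ ?_
    · filter_upwards [hev] with t' ht'
      have h1 : |s t - (N : ℝ) * t'| ≤ ρ := by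
        have h2 := hsρ' t
        rw [abs_le] at h2 ⊢
        rw [abs_lt] at ht'
        constructor <;> linarith [h2.1, h2.2, ht'.1, ht'.2]
      have h3 := hsep t' (s t) (s t') h1 (hsρ t')
      rw [hsF t', sub_zero, ← sub_zero (F t' (s t)), ← hsF t] at h3
      have h4 : F t' (s t) - F t (s t) = inner ℝ (V (s t)) (y t' - y t) := by
        simp only [F, inner_sub_right]; ring
      rw [h4] at h3
      rw [Real.norm_eq_abs, ← div_eq_inv_mul, le_div_iff₀' hb4]
      exact h3.trans ((abs_real_inner_le_norm _ _).trans (mul_le_mul_of_nonneg_right (hVB _) (norm_nonneg _)))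
    · have : Continuous fun t' => (b ^ 2 / 4)⁻¹ * (B * ‖y t' - y t‖) := by fun_prop
      simpa using this.tendsto t
  have hβN : ∀ s, β (s + N) = β s + (N : ℝ) • m := by
    intro s
    have : ∀ n : ℕ, β (s + n) = β s + (n : ℝ) • m := by
      intro n
      induction n with
      | zero => simp
      | succ n ih => push_cast; rw [← add_assoc, hβp, ih, add_smul, one_smul, add_assoc]
    exact this N
  have hVN : ∀ s, V (s + N) = V s := fun s => by simpa using hVp.nat_mul N s
  -- Both sides are zeros of F (t + 1) in one window, and the separation estimate makes such a zero
  -- unique.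
  have hsp : ∀ t, s (t + 1) = s t + N := by
    intro t
    have h1 : F (t + 1) (s t + N) = 0 := by
      simp only [F]; rw [hVN, hβN, hyp, add_sub_add_right_eq_sub]; exact hsF t
    have h2 := hsep (t + 1) (s t + N) (s (t + 1)) (by
      rw [show s t + N - (N : ℝ) * (t + 1) = s t - (N : ℝ) * t by ring]; exact hsρ t) (hsρ (t + 1))
    rw [h1, hsF, sub_zero, abs_zero] at h2
    have h3 : |s (t + 1) - (s t + N)| ≤ 0 := by
      by_contra h
      have : 0 < b ^ 2 / 4 * |s (t + 1) - (s t + N)| := mul_pos (by positivity) (not_le.1 h)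
      linarith
    exact sub_eq_zero.1 (abs_nonpos_iff.1 h3)
  -- The signed normal coordinate of y(t), scaled by the speed of β.
  let r : ℝ → ℝ := fun t => V (s t) 0 * (y t - β (s t)) 1 - V (s t) 1 * (y t - β (s t)) 0
  have hrc : Continuous r := by
    have c1 : ∀ i, Continuous fun t => V (s t) i := fun i => (EuclideanSpace.proj i).continuous.comp (hVc.comp hsc)
    have c2 : ∀ i, Continuous fun t => (y t - β (s t)) i := fun i =>
      (EuclideanSpace.proj i).continuous.comp (hy.sub (hβc.comp hsc))
    exact ((c1 0).mul (c2 1)).sub ((c1 1).mul (c2 0))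
  have hrp : Function.Periodic r 1 := fun t => by
    simp only [r]; rw [hsp, hVN, hβN, hyp, add_sub_add_right_eq_sub]
  obtain ⟨t₁, -, ht₁⟩ := isCompact_Icc.exists_isMinOn (nonempty_Icc.2 (zero_le_one (α := ℝ))) hrc.continuousOn
  obtain ⟨t₂, -, ht₂⟩ := isCompact_Icc.exists_isMaxOn (nonempty_Icc.2 (zero_le_one (α := ℝ))) hrc.continuousOn
  have hmin : ∀ t, r t₁ ≤ r t := fun t => by
    obtain ⟨t', ht', e⟩ := hrp.exists_mem_Ico₀ one_pos t
    rw [e]; exact ht₁ (Ico_subset_Icc_self ht')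
  have hmax : ∀ t, r t ≤ r t₂ := fun t => by
    obtain ⟨t', ht', e⟩ := hrp.exists_mem_Ico₀ one_pos t
    rw [e]; exact ht₂ (Ico_subset_Icc_self ht')
  -- The square consists of a starting time, running from a minimum t₁ to a maximum t₂ of the normal
  -- coordinate, and a duration. The progress along β minus one equals −1 for duration 0 and N − 1
  -- for duration 1. The change of the normal coordinate is non-negative from t₁ and non-positive
  -- from t₂.
  obtain ⟨x, -, c, hc, h1, h2⟩ := exists_common_zero
    (f₁ := fun q => s (t₁ + q.1 * (t₂ - t₁) + q.2) - s (t₁ + q.1 * (t₂ - t₁)) - 1)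
    (f₂ := fun q => r (t₁ + q.1 * (t₂ - t₁) + q.2) - r (t₁ + q.1 * (t₂ - t₁))) (by fun_prop) (by fun_prop)
    (fun x _ => by simp) (fun x _ => by
      rw [hsp]
      have : (2 : ℝ) ≤ N := by exact_mod_cast hN
      linarith)
    (fun τ _ => by simpa using hmin _) (fun τ _ => by
      have e : t₁ + 1 * (t₂ - t₁) = t₂ := by ring
      simp only [e]; linarith [hmax (t₂ + τ)])
  set a := t₁ + x * (t₂ - t₁)
  have hsa : s (a + c) = s a + 1 := by linarith
  refine ⟨a, c, ?_, ?_, ?_, ?_⟩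
  · refine lt_of_le_of_ne hc.1 fun h => ?_
    rw [← h, add_zero] at hsa; linarith
  · refine lt_of_le_of_ne hc.2 fun h => ?_
    rw [h, hsp] at hsa
    have : (2 : ℝ) ≤ N := by exact_mod_cast hN
    linarith
  · have e1 := abs_le.1 (hsη (a + c))
    have e2 := abs_le.1 (hsη a)
    rw [hsa] at e1
    rw [abs_le]
    constructor <;> linarith [e1.1, e1.2, e2.1, e2.2]
  · have f1 : inner ℝ (V (s a)) (y (a + c) - m - y a) = 0 := by
      have g1 := hsF (a + c)
      simp only [F] at g1
      rw [hsa, hVp, hβp] at g1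
      have g2 := hsF a
      simp only [F] at g2
      have : y (a + c) - m - y a = (y (a + c) - (β (s a) + m)) - (y a - β (s a)) := by abel
      rw [this, inner_sub_right, g1, g2, sub_zero]
    have f2 : V (s a) 0 * (y (a + c) - m - y a) 1 - V (s a) 1 * (y (a + c) - m - y a) 0 = 0 := by
      have g1 : r (a + c) = r a := by linarith
      simp only [r] at g1
      rw [hsa, hVp, hβp] at g1
      simp only [PiLp.sub_apply, PiLp.add_apply] at g1 ⊢
      linarith
    have f3 : V (s a) 0 * (y (a + c) - m - y a) 0 + V (s a) 1 * (y (a + c) - m - y a) 1 = 0 := by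
      rw [PiLp.inner_apply] at f1
      simpa [mul_comm] using f1
    have f4 : V (s a) 0 ^ 2 + V (s a) 1 ^ 2 ≠ 0 := by
      have := EuclideanSpace.norm_sq_eq (V (s a))
      simp only [Fin.sum_univ_two, Real.norm_eq_abs, sq_abs] at this
      rw [← this]
      have := hb.trans_le (hVb (s a))
      positivity
    set w := y (a + c) - m - y a with hw
    have w0 : w 0 = 0 := by
      refine (mul_eq_zero.1 (?_ : (V (s a) 0 ^ 2 + V (s a) 1 ^ 2) * w 0 = 0)).resolve_left f4
      linear_combination V (s a) 0 * f3 - V (s a) 1 * f2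
    have w1 : w 1 = 0 := by
      refine (mul_eq_zero.1 (?_ : (V (s a) 0 ^ 2 + V (s a) 1 ^ 2) * w 1 = 0)).resolve_left f4
      linear_combination V (s a) 1 * f3 + V (s a) 0 * f2
    have hw0 : w = 0 := by
      ext i; fin_cases i
      · exact w0
      · exact w1
    rw [hw, sub_eq_zero, sub_eq_iff_eq_add] at hw0
    rw [hw0]

/-! ### Arcs of a curve -/

section Arc

/-- Translations preserve null sets and a scaling by c ≠ 0 multiplies their measure by a finite
constant. -/
theorem ae_comp_affine {P : ℝ → Prop} (h : ∀ᵐ s, P s) (a : ℝ) {c : ℝ} (hc : c ≠ 0) : ∀ᵐ s, P (a + c * s) := by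
  have h1 := (measurePreserving_add_left (volume : Measure ℝ) a).quasiMeasurePreserving.ae h
  rw [ae_iff] at h1 ⊢
  have := Real.volume_preimage_mul_left hc {s | ¬P (a + s)}
  rw [h1, mul_zero] at this
  exact this

theorem intervalIntegrable_comp_affine {E : Type*} [NormedAddCommGroup E] {f : ℝ → E}
    (hf : ∀ a b, IntervalIntegrable f volume a b) (a : ℝ) {c : ℝ} (hc : c ≠ 0) :
    IntervalIntegrable (fun s => f (a + c * s)) volume 0 1 := by
  have h := ((hf a (a + c)).comp_add_left a).comp_mul_left (c := c)
  simpa [hc] using h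

theorem memLp_arc (v : L2) (a : ℝ) {c : ℝ} (hc : c ≠ 0) :
    MemLp (fun s => c • ev v (a + c * s)) 2 (volume.restrict (Ioc (0 : ℝ) 1)) := by
  have h1 := (intervalIntegrable_iff_integrableOn_Ioc_of_le zero_le_one).1
    (intervalIntegrable_comp_affine (intervalIntegrable_ev v) a hc)
  have h2 := (intervalIntegrable_iff_integrableOn_Ioc_of_le zero_le_one).1
    (intervalIntegrable_comp_affine (intervalIntegrable_norm_sq_ev v) a hc)
  exact ((memLp_two_iff_integrable_sq_norm h1.aestronglyMeasurable).2 h2).const_smul c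

/-- The velocity of the arc `s ↦ x (a + c s)`. -/
def arcV (v : L2) (a : ℝ) {c : ℝ} (hc : c ≠ 0) : L2 := ofFun _ (memLp_arc v a hc)

/-- The arc of a lifted curve over `[a, a + c]`. -/
def arc (z : Lifted) (a : ℝ) {c : ℝ} (hc : c ≠ 0) : Lifted := ((curve z.1.1 z.1.2 a, arcV z.1.2 a hc), c * z.2)

theorem ev_arcV (v : L2) (a : ℝ) {c : ℝ} (hc : c ≠ 0) :
    ∀ᵐ s ∂(volume.restrict (Ioc (0 : ℝ) 1)), ev (arcV v a hc) s = c • ev v (a + c * s) := ev_ofFun _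

theorem curve_arcV (p : Plane) (v : L2) (a : ℝ) {c : ℝ} (hc : c ≠ 0) {s : ℝ} (hs : s ∈ Icc (0 : ℝ) 1) :
    curve (curve p v a) (arcV v a hc) s = curve p v (a + c * s) := by
  have h : ∫ r in (0 : ℝ)..s, ev (arcV v a hc) r = ∫ r in a..a + c * s, ev v r := by
    rw [intervalIntegral.integral_congr_ae_restrict (g := fun r => c • ev v (a + c * r)),
      intervalIntegral.integral_smul, intervalIntegral.smul_integral_comp_add_mul, mul_zero, add_zero]
    rw [uIoc_of_le hs.1]
    exact ae_restrict_of_ae_restrict_of_subset (Ioc_subset_Ioc_right hs.2) (ev_arcV v a hc)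
  rw [curve, h, ← curve_sub_curve p v a, add_sub_cancel]

theorem total_arcV (p : Plane) (v : L2) (a : ℝ) {c : ℝ} (hc : c ≠ 0) :
    total (arcV v a hc) = curve p v (a + c) - curve p v a := by
  have := curve_arcV p v a hc (right_mem_Icc.2 zero_le_one)
  rw [curve_one, mul_one] at this
  rw [← this, add_sub_cancel_left]

variable {σ : TwoForm} (g : RiemannianMetric) (P : PuncturedPrimitive σ) (k : ℝ)

/-- The value of the free period action functional at a lift. -/
def liftAct (z : Lifted) : ℝ := kin g z.1 / z.2 + k * z.2 + thetaInt P z.1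

variable {P}

theorem Avoids.arc {z : Lifted} (h : Avoids P z.1) {a c : ℝ} {hc : c ≠ 0}
    (hm : curve z.1.1 z.1.2 (a + c) - curve z.1.1 z.1.2 a ∈ lattice) : Avoids P (arc z a hc).1 := by
  refine Avoids.of_Icc (by rw [MagneticTorus.arc, total_arcV z.1.1]; exact hm) fun s hs => ?_
  simp only [MagneticTorus.arc, curve_arcV _ _ _ _ hs]
  exact h _

theorem kin_arc (z : Lifted) (a : ℝ) {c : ℝ} (hc : c ≠ 0) :
    kin g (arc z a hc).1 = 1 / 2 * (c * ∫ s in a..a + c, g.toFun (curve z.1.1 z.1.2 s) (ev z.1.2 s) (ev z.1.2 s)) := by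
  rw [kin_eq]
  congr 1
  have h1 := intervalIntegral.smul_integral_comp_add_mul (a := 0) (b := 1)
    (fun s => g.toFun (curve z.1.1 z.1.2 s) (ev z.1.2 s) (ev z.1.2 s)) c a
  simp only [mul_zero, add_zero, mul_one, smul_eq_mul] at h1
  rw [← h1, ← intervalIntegral.integral_const_mul, ← intervalIntegral.integral_const_mul]
  refine intervalIntegral.integral_congr_ae_restrict ?_
  rw [uIoc_of_le zero_le_one]
  filter_upwards [ev_arcV z.1.2 a hc, ae_restrict_mem measurableSet_Ioc] with s hs hs'
  simp only [arc]
  rw [curve_arcV _ _ _ _ (Ioc_subset_Icc_self hs'), hs]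
  simp only [map_smul, smul_apply, smul_eq_mul]

theorem thetaInt_arc (z : Lifted) (a : ℝ) {c : ℝ} (hc : c ≠ 0) :
    thetaInt P (arc z a hc).1 = ∫ s in a..a + c, P.θ (curve z.1.1 z.1.2 s) (ev z.1.2 s) := by
  have h1 := intervalIntegral.smul_integral_comp_add_mul (a := 0) (b := 1)
    (fun s => P.θ (curve z.1.1 z.1.2 s) (ev z.1.2 s)) c a
  simp only [mul_zero, add_zero, mul_one, smul_eq_mul] at h1
  rw [← h1, ← intervalIntegral.integral_const_mul, thetaInt]
  refine intervalIntegral.integral_congr_ae_restrict ?_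
  rw [uIoc_of_le zero_le_one]
  filter_upwards [ev_arcV z.1.2 a hc, ae_restrict_mem measurableSet_Ioc] with s hs hs'
  simp only [arc]
  rw [curve_arcV _ _ _ _ (Ioc_subset_Icc_self hs'), hs, map_smul, smul_eq_mul]

/-- The action is additive under cutting a loop at a self-intersection of its projection. -/
theorem liftAct_arc_add {z : Lifted} (h : Avoids P z.1) (hm : total z.1.2 ∈ lattice) (a : ℝ)
    {c c' : ℝ} (hc : c ≠ 0) (hc' : c' ≠ 0) (hcc : c + c' = 1) :
    liftAct g P k (arc z a hc) + liftAct g P k (arc z (a + c) hc') = liftAct g P k z := by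
  have hk := periodic_kin g hm (x := z.1)
  have hki : ∀ a b, IntervalIntegrable _ volume a b := hk.intervalIntegrable one_ne_zero (t := 0) (by
    simpa using intervalIntegrable_kin g z.1)
  have hθ := h.periodic hm
  have hθi : ∀ a b, IntervalIntegrable _ volume a b := hθ.intervalIntegrable one_ne_zero (t := 0) (by
    simpa using h.intervalIntegrable)
  have e1 := intervalIntegral.integral_add_adjacent_intervals (hki a (a + c)) (hki (a + c) (a + c + c'))
  have e2 := intervalIntegral.integral_add_adjacent_intervals (hθi a (a + c)) (hθi (a + c) (a + c + c'))
  rw [add_assoc a c c', hcc, hk.intervalIntegral_add_eq a 0, zero_add] at e1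
  rw [add_assoc a c c', hcc, hθ.intervalIntegral_add_eq a 0, zero_add] at e2
  have hw : c' = 1 - c := by linarith
  -- An arc of parameter length c has period cT and kinetic energy carrying a factor c, so c cancels
  -- in the quotient and all three terms are additive.
  simp only [liftAct, kin_arc, thetaInt_arc]
  rw [kin_eq g z.1, thetaInt, ← e1, ← e2, add_assoc a c c', hcc]
  simp only [arc]
  rcases eq_or_ne z.2 0 with hT | hT
  · rw [hT]; simp
  · field_simp
    rw [hw]; ring

end Arc

/-! ### Iterates of local minimizers -/

theorem norm_curve_le_of_total {p : Plane} {v : L2} (h : total v = 0) (s : ℝ) : ‖curve p v s‖ ≤ ‖p‖ + ‖v‖ := by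
  have hp : Function.Periodic (curve p v) 1 := fun s => by rw [curve_add_one, h, add_zero]
  obtain ⟨t, ht, e⟩ := hp.exists_mem_Ico₀ one_pos s
  rw [e]; exact norm_curve_le p v (Ico_subset_Icc_self ht)

theorem norm_curve_sub_le {x x' : Plane × L2} (h : total x.2 = total x'.2) (s : ℝ) :
    ‖curve x.1 x.2 s - curve x'.1 x'.2 s‖ ≤ 2 * ‖x - x'‖ := by
  have e : curve x.1 x.2 s - curve x'.1 x'.2 s = curve (x.1 - x'.1) (x.2 - x'.2) s := by
    have h1 := curve_add x'.1 (x.1 - x'.1) x'.2 (x.2 - x'.2) s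
    rw [add_sub_cancel, add_sub_cancel] at h1
    rw [h1, add_sub_cancel_left]
  rw [e]
  refine (norm_curve_le_of_total (by rw [map_sub, h, sub_self]) s).trans ?_
  have h1 := norm_fst_le (x - x')
  have h2 := norm_snd_le (x - x')
  simp only [Prod.fst_sub, Prod.snd_sub] at h1 h2
  linarith

/-- With equal displacements the difference of the lifts is a closed field, so its values are
bounded over all of ℝ and the estimate is uniform in ψ. -/
theorem norm_rot_sub_le {z z' : Lifted} (h : total z.1.2 = total z'.1.2) (ψ : ℝ) :
    ‖rot ψ z - rot ψ z'‖ ≤ 2 * ‖z - z'‖ := by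
  have h1 := norm_fst_le (z - z')
  have h2 := norm_snd_le (z - z')
  have h3 := norm_snd_le (z - z').1
  have h0 := norm_nonneg (z - z')
  simp only [Prod.fst_sub, Prod.snd_sub] at h1 h2 h3
  refine norm_prod_le_iff.2 ⟨norm_prod_le_iff.2 ⟨?_, ?_⟩, ?_⟩
  · exact (norm_curve_sub_le h ψ).trans (by linarith)
  · have e : rotV ψ z.1.2 - rotV ψ z'.1.2 = rotV ψ (z.1.2 - z'.1.2) :=
      (map_sub (Lp.compMeasurePreservingₗ ℝ _ (measurePreserving_add_left volume (ψ : UnitAddCircle))) _ _).symm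
    change ‖rotV ψ z.1.2 - rotV ψ z'.1.2‖ ≤ _
    rw [e, norm_rotV]; linarith
  · change ‖z.2 - z'.2‖ ≤ _
    linarith

/-- An arc of a curve close to an iterate is close to a rotated iterate. -/
theorem norm_arc_sub_le {z z₀ : Lifted} {N w : ℕ+} {V : ℝ → Plane} {L B η : ℝ} (hL : 0 ≤ L)
    (ht : total z.1.2 = total (iter N z₀).1.2) (hVae : ∀ᵐ s, ev z₀.1.2 s = V s) (hVB : ∀ s, ‖V s‖ ≤ B)
    (hVL : ∀ s s', ‖V s - V s'‖ ≤ L * |s - s'|) (hT : 0 ≤ z₀.2) (a : ℝ) {c : ℝ} (hc : 0 < c) (hc1 : c ≤ 1)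
    (hw : |((N : ℕ) : ℝ) * c - ((w : ℕ) : ℝ)| ≤ η) :
    ‖arc z a hc.ne' - rot (((N : ℕ) : ℝ) * a / ((w : ℕ) : ℝ)) (iter w z₀)‖
      ≤ 2 * ‖z - iter N z₀‖ + 2 * (B + ((w : ℕ) : ℝ) * L + z₀.2) * η := by
  set n : ℝ := ((N : ℕ) : ℝ) with hn
  set l : ℝ := ((w : ℕ) : ℝ) with hl
  have hl0 : l ≠ 0 := by rw [hl]; exact_mod_cast w.ne_zero
  have hl1 : 0 < l := by rw [hl]; exact_mod_cast w.pos
  have hn0 : n ≠ 0 := by rw [hn]; exact_mod_cast N.ne_zero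
  have hη : 0 ≤ η := (abs_nonneg _).trans hw
  have hB : 0 ≤ B := (norm_nonneg _).trans (hVB 0)
  have h1 := norm_fst_le (z - iter N z₀)
  have h2 := norm_snd_le (z - iter N z₀)
  have h3 := norm_snd_le (z - iter N z₀).1
  have h0 := norm_nonneg (z - iter N z₀)
  simp only [Prod.fst_sub, Prod.snd_sub] at h1 h2 h3
  have hK1 : 0 ≤ (B + l * L) * η := by positivity
  have hK2 : 0 ≤ z₀.2 * η := by positivity
  have hψ : l * (n * a / l) = n * a := by field_simp
  refine norm_prod_le_iff.2 ⟨norm_prod_le_iff.2 ⟨?_, ?_⟩, ?_⟩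
  · have e : curve (iter w z₀).1.1 (iter w z₀).1.2 (n * a / l) = curve (iter N z₀).1.1 (iter N z₀).1.2 a := by
      simp only [iter]
      rw [curve_mulV, curve_mulV, ← hl, hψ]
    change ‖curve z.1.1 z.1.2 a - curve (iter w z₀).1.1 (iter w z₀).1.2 (n * a / l)‖ ≤ _
    rw [e]
    exact (norm_curve_sub_le ht a).trans (by nlinarith)
  · set e : L2 := z.1.2 - (iter N z₀).1.2 with he
    set D := (B + l * L) * η with hD
    change ‖arcV z.1.2 a hc.ne' - rotV (n * a / l) (l • mulV w z₀.1.2)‖ ≤ _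
    set f := arcV z.1.2 a hc.ne' - rotV (n * a / l) (l • mulV w z₀.1.2) with hf
    have hv2 : rotV (n * a / l) (l • mulV w z₀.1.2) = l • mulV w (rotV (n * a) z₀.1.2) := by
      rw [rotV_smul, rotV_mulV, ← hl, hψ]
    have a1 : ∀ᵐ s, ev (rotV (n * a / l) (l • mulV w z₀.1.2)) s = l • V (n * a + l * s) := by
      rw [hv2]
      have b1 := ae_comp_affine (ev_rotV (n * a) z₀.1.2) 0 hl0
      filter_upwards [ev_smul l (mulV w (rotV (n * a) z₀.1.2)), ev_mulV w (rotV (n * a) z₀.1.2), b1,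
        ae_comp_affine hVae (n * a) hl0] with s c1 c2 c3 c4
      rw [zero_add] at c3
      rw [c1, c2, ← hl, c3, c4]
    have a2 : ∀ᵐ s, ev z.1.2 s = ev e s + n • V (n * s) := by
      filter_upwards [ev_sub z.1.2 (iter N z₀).1.2, ev_smul n (mulV N z₀.1.2), ev_mulV N z₀.1.2,
        ae_comp_affine hVae 0 hn0] with s c1 c2 c3 c4
      rw [zero_add] at c4
      have c5 : ev (iter N z₀).1.2 s = n • V (n * s) := by
        rw [← c4, ← c3, ← c2]; rfl
      rw [he, c1, c5, sub_add_cancel]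
    -- The velocity error splits into the rescaled error of z and a model error D. The latter
    -- collects the mismatch of speeds, at most Bη, and the mismatch of phases, at most wLη.
    have a3 : ∀ᵐ s ∂(volume.restrict (Ioc (0 : ℝ) 1)), ‖ev f s‖ ^ 2 ≤ 2 * (c ^ 2 * ‖ev e (a + c * s)‖ ^ 2) + 2 * D ^ 2 := by
      filter_upwards [ev_arcV z.1.2 a hc.ne', ae_restrict_of_ae a1, ae_restrict_of_ae (ae_comp_affine a2 a hc.ne'),
        ae_restrict_of_ae (ev_sub (arcV z.1.2 a hc.ne') (rotV (n * a / l) (l • mulV w z₀.1.2))),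
        ae_restrict_mem measurableSet_Ioc] with s c1 c2 c3 c4 c5
      have d1 : ev f s = c • ev e (a + c * s) + ((c * n - l) • V (n * (a + c * s))
          + l • (V (n * (a + c * s)) - V (n * a + l * s))) := by
        rw [hf, c4, c1, c2, c3]; module
      have d2 : ‖(c * n - l) • V (n * (a + c * s)) + l • (V (n * (a + c * s)) - V (n * a + l * s))‖ ≤ D := by
        refine (norm_add_le _ _).trans ?_
        rw [norm_smul, norm_smul, Real.norm_eq_abs, Real.norm_eq_abs, abs_of_pos hl1, mul_comm c n, hD, add_mul]
        refine add_le_add ?_ ?_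
        · rw [mul_comm]; exact mul_le_mul (hVB _) hw (abs_nonneg _) hB
        · rw [mul_assoc]
          refine mul_le_mul_of_nonneg_left ((hVL _ _).trans (mul_le_mul_of_nonneg_left ?_ hL)) hl1.le
          rw [show n * (a + c * s) - (n * a + l * s) = (n * c - l) * s by ring, abs_mul, abs_of_pos c5.1]
          exact (mul_le_of_le_one_right (abs_nonneg _) c5.2).trans hw
      have d3 : ‖ev f s‖ ≤ c * ‖ev e (a + c * s)‖ + D := by
        rw [d1]
        refine (norm_add_le _ _).trans (add_le_add ?_ d2)
        rw [norm_smul, Real.norm_eq_abs, abs_of_pos hc]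
      nlinarith [norm_nonneg (ev f s), sq_nonneg (c * ‖ev e (a + c * s)‖ - D)]
    have hper : Function.Periodic (fun s => ‖ev e s‖ ^ 2) 1 := fun s => by simp only [ev_add_one]
    -- The substitution leaves one factor c ≤ 1 in front of an integral over at most one period.
    have a4 : ∫ s in (0 : ℝ)..1, c ^ 2 * ‖ev e (a + c * s)‖ ^ 2 ≤ ‖e‖ ^ 2 := by
      have b1 := intervalIntegral.smul_integral_comp_add_mul (a := 0) (b := 1) (fun s => ‖ev e s‖ ^ 2) c a
      simp only [mul_zero, add_zero, mul_one, smul_eq_mul] at b1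
      rw [intervalIntegral.integral_const_mul, sq, mul_assoc, b1, ← integral_norm_sq_ev]
      have b2 : ∫ s in a..a + c, ‖ev e s‖ ^ 2 ≤ ∫ s in (0 : ℝ)..1, ‖ev e s‖ ^ 2 := by
        have b3 := hper.intervalIntegral_add_eq a 0
        rw [zero_add] at b3
        rw [← b3]
        exact intervalIntegral.integral_mono_interval le_rfl (by linarith) (by linarith)
          (ae_of_all _ fun _ => by positivity) (intervalIntegrable_norm_sq_ev e _ _)
      have b4 : 0 ≤ ∫ s in (0 : ℝ)..1, ‖ev e s‖ ^ 2 := by rw [integral_norm_sq_ev]; positivity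
      nlinarith
    have a5 : ‖f‖ ^ 2 ≤ 2 * ‖e‖ ^ 2 + 2 * D ^ 2 := by
      rw [← integral_norm_sq_ev f]
      have i1 : IntervalIntegrable (fun s => 2 * (c ^ 2 * ‖ev e (a + c * s)‖ ^ 2) + 2 * D ^ 2) volume 0 1 :=
        ((((intervalIntegrable_comp_affine (intervalIntegrable_norm_sq_ev e) a hc.ne').const_mul (c ^ 2)).const_mul 2)).add
          intervalIntegrable_const
      have b1 := intervalIntegral.integral_mono_ae_restrict zero_le_one (intervalIntegrable_norm_sq_ev f 0 1) i1
        (by rw [restrict_Ioc_eq_restrict_Icc] at a3; exact a3)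
      rw [intervalIntegral.integral_add _ intervalIntegrable_const, intervalIntegral.integral_const_mul 2] at b1
      · simp only [intervalIntegral.integral_const, sub_zero, one_smul] at b1
        linarith
      · exact ((intervalIntegrable_comp_affine (intervalIntegrable_norm_sq_ev e) a hc.ne').const_mul (c ^ 2)).const_mul 2
    have a6 : ‖f‖ ≤ 2 * ‖e‖ + 2 * D := by
      refine le_of_sq_le_sq ?_ (by positivity)
      nlinarith [norm_nonneg e, mul_nonneg (norm_nonneg e) hK1]
    nlinarith
  · change |c * z.2 - l * z₀.2| ≤ _
    have e : c * z.2 - l * z₀.2 = c * (z.2 - n * z₀.2) + (n * c - l) * z₀.2 := by ring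
    rw [e]
    refine (abs_add_le _ _).trans ?_
    rw [abs_mul, abs_mul, abs_of_pos hc, abs_of_nonneg hT]
    have e1 : c * |z.2 - n * z₀.2| ≤ |z.2 - n * z₀.2| := mul_le_of_le_one_left (abs_nonneg _) hc1
    have e2 : |z.2 - n * z₀.2| ≤ ‖z - iter N z₀‖ := h2
    have e3 := mul_le_mul_of_nonneg_right hw hT
    nlinarith

section IterateMin

variable {σ : TwoForm} {g : RiemannianMetric} {P : PuncturedPrimitive σ} {k : ℝ}

theorem liftAct_rot {z : Lifted} (h : Avoids P z.1) (hm : total z.1.2 ∈ lattice) (ψ : ℝ) :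
    liftAct g P k (rot ψ z) = liftAct g P k z := by
  rw [liftAct, liftAct, kin_rot g hm, thetaInt_rot h hm]; rfl

theorem liftAct_iter {z : Lifted} (h : Avoids P z.1) (hm : total z.1.2 ∈ lattice) (hT : z.2 ≠ 0) (N : ℕ+) :
    liftAct g P k (iter N z) = ((N : ℕ) : ℝ) * liftAct g P k z := by
  have hn : ((N : ℕ) : ℝ) ≠ 0 := by exact_mod_cast N.ne_zero
  rw [liftAct, liftAct, kin_iter g hm, thetaInt_iter h hm]
  simp only [iter]
  field_simp

theorem total_iter (N : ℕ+) (z : Lifted) : total (iter N z).1.2 = ((N : ℕ) : ℝ) • total z.1.2 := by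
  simp only [iter, map_smul, total_mulV]

variable (g P k) in
/-- The lift is a local minimizer of the action. -/
def IsLiftMin (z₀ : Lifted) : Prop := ∃ ε > 0, ∀ z : Lifted, total z.1.2 = total z₀.1.2 → 0 < z.2 → ‖z - z₀‖ < ε →
  Avoids P z.1 → liftAct g P k z₀ ≤ liftAct g P k z

/-- Nearby loops lift to nearby points through the section centered at the lift, and the projection
from lifts of fixed displacement is continuous. -/
theorem isLiftMin_iff {z₀ : Lifted} {γ : FreeLoop} (h : IsLift z₀ γ.1) (hγ : γ ∈ P.domain) :
    IsLiftMin g P k z₀ ↔ IsLocalMin (localAction g P k) γ := by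
  have hz₀ := (mem_domain_iff h).1 hγ
  constructor
  · rintro ⟨ε, hε, H⟩
    have h1 : ∀ᶠ γ' : FreeLoop in 𝓝 γ, ‖sec (corner z₀.1.1) γ'.1 - z₀‖ < ε := by
      have := (h.tendsto_sec.comp continuous_subtype_val.continuousAt : Tendsto (fun γ' : FreeLoop => _) (𝓝 γ) _)
      filter_upwards [this (Metric.ball_mem_nhds z₀ hε)] with γ' h'
      rwa [← dist_eq_norm]
    filter_upwards [h1, continuous_subtype_val.continuousAt.eventually (eventually_cls_eq γ.1),
      isOpen_domain.mem_nhds hγ] with γ' h2 h3 h4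
    have hs := isLift_sec (corner z₀.1.1) γ'.1
    have ha := (mem_domain_iff hs).1 h4
    rw [localAction_eq h hz₀, localAction_eq hs ha]
    exact H _ (by rw [hs.total_eq, h.total_eq, h3]) hs.pos h2 ha
  · intro H
    have hT := h.pos
    let X := {z : Lifted // total z.1.2 = total z₀.1.2 ∧ 0 < z.2}
    let f : X → FreeLoop := fun z => ofLift z.1 (by rw [z.2.1]; exact h.mem) z.2.2
    have hf : Continuous f := continuous_ofLift continuous_subtype_val _ _
    have hf0 : f ⟨z₀, rfl, hT⟩ = γ := h.ofLift_eq _ _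
    have h1 : ∀ᶠ x in 𝓝 (⟨z₀, rfl, hT⟩ : X), localAction g P k γ ≤ localAction g P k (f x) := by
      have := hf.continuousAt (x := (⟨z₀, rfl, hT⟩ : X))
      rw [ContinuousAt, hf0] at this
      exact this.eventually H
    obtain ⟨ε, hε, h2⟩ := Metric.eventually_nhds_iff.1 h1
    refine ⟨ε, hε, fun z ht hT' hz ha => ?_⟩
    have h3 := @h2 ⟨z, ht, hT'⟩ (by rw [Subtype.dist_eq, dist_eq_norm]; exact hz)
    rwa [localAction_eq h hz₀, localAction_eq (isLift_ofLift _ _ _) ha] at h3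

/-- Rotating a competitor back by −ψ at most doubles distances, so half the original radius serves
for every ψ. This uniformity is needed because cutting produces arcs with an uncontrolled starting
phase. -/
theorem IsLiftMin.rot {z₀ : Lifted} (h : IsLiftMin g P k z₀) (hm : total z₀.1.2 ∈ lattice) :
    ∃ ε > 0, ∀ (ψ : ℝ) (z : Lifted), total z.1.2 = total z₀.1.2 → 0 < z.2 → ‖z - rot ψ z₀‖ < ε → Avoids P z.1 →
      liftAct g P k z₀ ≤ liftAct g P k z := by
  obtain ⟨ε, hε, H⟩ := h
  refine ⟨ε / 2, by positivity, fun ψ z ht hT hz ha => ?_⟩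
  have ht' : total z.1.2 = total (MagneticTorus.rot ψ z₀).1.2 := ht.trans (total_rotV _ _).symm
  rw [← liftAct_rot ha (by rw [ht]; exact hm) (-ψ)]
  refine H _ ((total_rotV _ _).trans ht) hT ?_ (ha.rot _)
  have h1 := norm_rot_sub_le ht' (-ψ)
  rw [rot_rot, add_neg_cancel, rot_zero] at h1
  linarith

/-- Induction on N. A competitor of the (N+1)-st iterate closes up after a parameter time c near
1/(N+1), and cutting there gives loops close to rotations of the first and of the N-th iterate.
Their actions add up to that of the competitor and are bounded below by the inductive hypotheses. -/
theorem isLiftMin_iter (hk : 0 < k) {z₀ : Lifted} (hm : total z₀.1.2 ∈ lattice) (hT : 0 < z₀.2) (hA : Avoids P z₀.1)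
    (hz : ∀ h, IsTangent h → act' g σ k z₀ h = 0) (hmin : IsLiftMin g P k (iter 1 z₀)) (N : ℕ+) :
    IsLiftMin g P k (iter N z₀) := by
  obtain ⟨V, L, b, hL, hb, hVp, hVL, hVb, hVae⟩ := exists_velocity hk hm hT hz
  have hVc : Continuous V := by
    refine continuous_iff_continuousAt.2 fun s => tendsto_iff_norm_sub_tendsto_zero.2 ?_
    refine squeeze_zero (fun _ => norm_nonneg _) (fun s' => hVL s' s) ?_
    have : Continuous fun s' => L * |s' - s| := by fun_prop
    simpa using this.tendsto s
  obtain ⟨B, hB⟩ := isCompact_Icc.exists_bound_of_continuousOn (s := Icc (0 : ℝ) 1) hVc.continuousOn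
  have hVB : ∀ s, ‖V s‖ ≤ B := fun s => by
    obtain ⟨t, ht, e⟩ := hVp.exists_mem_Ico₀ one_pos s
    rw [e]; exact hB t (Ico_subset_Icc_self ht)
  have hB0 : 0 ≤ B := (norm_nonneg _).trans (hVB 0)
  set m := total z₀.1.2 with hmd
  have hβd : ∀ s, HasDerivAt (curve z₀.1.1 z₀.1.2) (V s) s := fun s => by
    have h1 : curve z₀.1.1 z₀.1.2 = fun s => z₀.1.1 + ∫ r in (0 : ℝ)..s, V r := funext fun s => by
      rw [curve, intervalIntegral.integral_congr_ae (hVae.mono fun r hr _ => hr)]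
    rw [h1]
    exact (hVc.integral_hasStrictDerivAt 0 s).hasDerivAt.const_add _
  induction N with
  | one => exact hmin
  | succ N ih =>
  obtain ⟨ε₁, hε₁, H₁⟩ := hmin.rot (by rw [total_iter]; simpa using hm)
  obtain ⟨ε₂, hε₂, H₂⟩ := ih.rot (by
    rw [total_iter, Nat.cast_smul_eq_nsmul]; exact lattice.nsmul_mem hm _)
  set n : ℝ := ((N : ℕ) : ℝ) with hn
  have hn1 : (1 : ℝ) ≤ n := by rw [hn]; exact_mod_cast N.pos
  have hN' : (((N + 1 : ℕ+) : ℕ) : ℝ) = n + 1 := by rw [PNat.add_coe]; push_cast; rfl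
  set ε := min ε₁ ε₂ with hε
  have hε0 : 0 < ε := lt_min hε₁ hε₂
  set K := B + n * L + z₀.2 with hK
  have hK0 : 0 ≤ K := by positivity
  -- The tolerance is such that the reparametrization error 2Kη in `norm_arc_sub_le` stays below
  -- ε/2, the other half being left for the distance of the competitor.
  obtain ⟨ε₃, hε₃, H₃⟩ := exists_closing_time hL hb hVB hVb hVL hVp hβd (fun s => curve_add_one _ _ s)
    (N := N + 1) (by have := N.pos; omega) (η := ε / (8 * (K + 1))) (by positivity)
  have hη0 : 0 ≤ ε / (8 * (K + 1)) := by positivity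
  have hη : 2 * K * (ε / (8 * (K + 1))) < ε / 2 := by
    rw [show 2 * K * (ε / (8 * (K + 1))) = K / (K + 1) * (ε / 4) by field_simp; ring]
    have : K / (K + 1) ≤ 1 := (div_le_one (by positivity)).2 (by linarith)
    nlinarith
  refine ⟨min (ε / 4) (ε₃ / 2), by positivity, fun z ht hzT hz hza => ?_⟩
  have hz1 : ‖z - iter (N + 1) z₀‖ < ε / 4 := hz.trans_le (min_le_left _ _)
  have hz2 : ‖z - iter (N + 1) z₀‖ < ε₃ / 2 := hz.trans_le (min_le_right _ _)
  have htm : total z.1.2 = (n + 1) • m := by rw [ht, total_iter, hN']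
  have htl : total z.1.2 ∈ lattice := by
    rw [ht, total_iter, Nat.cast_smul_eq_nsmul]; exact lattice.nsmul_mem hm _
  obtain ⟨a, c, hc, hc1, hcN, hclose⟩ := H₃ (curve z.1.1 z.1.2) (continuous_curve _ _) (fun t => by
      rw [curve_add_one, htm]; push_cast; rfl) (fun t => by
      have h1 := norm_curve_sub_le (x := z.1) (x' := (iter (N + 1) z₀).1) ht t
      have h2 : curve (iter (N + 1) z₀).1.1 (iter (N + 1) z₀).1.2 t = curve z₀.1.1 z₀.1.2 (((N : ℕ) + 1 : ℕ) * t) := by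
        simp only [iter]; rw [curve_mulV]; rfl
      rw [h2] at h1
      have h3 := norm_fst_le (z - iter (N + 1) z₀)
      rw [Prod.fst_sub] at h3
      linarith)
  push_cast at hcN
  have hc' : 0 < 1 - c := by linarith
  have e1 : curve z.1.1 z.1.2 (a + c) - curve z.1.1 z.1.2 a = m := by rw [hclose, add_sub_cancel_left]
  have e2 : curve z.1.1 z.1.2 (a + c + (1 - c)) - curve z.1.1 z.1.2 (a + c) = n • m := by
    rw [show a + c + (1 - c) = a + 1 by ring, curve_add_one, htm, hclose]
    module
  have e2m : n • m ∈ lattice := by rw [hn, Nat.cast_smul_eq_nsmul]; exact lattice.nsmul_mem hm _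
  rw [← liftAct_arc_add g k hza htl a hc.ne' hc'.ne' (by ring), liftAct_iter hA hm hT.ne', hN']
  have d1 := norm_arc_sub_le (w := 1) hL.le ht hVae hVB hVL hT.le a hc hc1.le (η := ε / (8 * (K + 1))) (by
    rw [hN']; simpa using hcN)
  have d2 := norm_arc_sub_le (w := N) hL.le ht hVae hVB hVL hT.le (a + c) hc' (by linarith) (η := ε / (8 * (K + 1))) (by
    rw [hN', ← hn, show (n + 1) * (1 - c) - n = -((n + 1) * c - 1) by ring, abs_neg]; exact hcN)
  have d1' : 2 * (B + (((1 : ℕ+) : ℕ) : ℝ) * L + z₀.2) * (ε / (8 * (K + 1))) ≤ 2 * K * (ε / (8 * (K + 1))) := by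
    refine mul_le_mul_of_nonneg_right ?_ hη0
    simp only [PNat.one_coe, Nat.cast_one]
    nlinarith
  have f1 := H₁ _ (arc z a hc.ne') (by rw [arc, total_arcV z.1.1, e1, total_iter]; simp [hmd]) (mul_pos hc hzT)
    (d1.trans_lt (by linarith [min_le_left ε₁ ε₂])) (hza.arc (by rw [e1]; exact hm))
  have f2 := H₂ _ (arc z (a + c) hc'.ne') (by rw [arc, total_arcV z.1.1, e2, total_iter]) (mul_pos hc' hzT)
    (d2.trans_lt (by linarith [min_le_right ε₁ ε₂])) (hza.arc (by rw [e2]; exact e2m))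
  rw [liftAct_iter hA hm hT.ne'] at f1 f2
  simp only [PNat.one_coe, Nat.cast_one, one_mul] at f1
  linarith

/-- Iterates of local minimizers of the action are local minimizers. -/
theorem isLocalMin_iterate (hk : 0 < k) {γ : FreeLoop} (hγ : γ ∈ P.domain) (h : IsLocalMin (localAction g P k) γ) (N : ℕ+) :
    IsLocalMin (localAction g P k) (iterate N γ) := by
  have hz := isLift_sec 0 γ.1
  have h1 : IsLiftMin g P k (iter 1 (sec 0 γ.1)) := by
    have h2 : iterate 1 γ = γ := by
      have e : IsLift (sec 0 γ.1) (iterate 1 γ).1 := by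
        refine ⟨hz.base, ?_, ?_⟩
        · have : rotV 0 (sec 0 γ.1).1.2 = (sec 0 γ.1).1.2 := rotV_zero _
          have h3 : mulV 1 (sec 0 γ.1).1.2 = (sec 0 γ.1).1.2 := by
            unfold mulV
            have h4 : (fun s : UnitAddCircle => (((1 : ℕ+) : ℕ) : ℤ) • s) = id := by funext s; simp
            simp only [h4]
            exact Lp.compMeasurePreserving_id_apply _
          change (sec 0 γ.1).1.2 = (((1 : ℕ+) : ℕ) : ℝ) • mulV 1 (sec 0 γ.1).1.2
          rw [h3]; simp
        · change γ.1.2 = (((1 : ℕ+) : ℕ) : ℝ) * γ.1.2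
          simp
      exact Subtype.ext (e.eq hz)
    rw [isLiftMin_iff (hz.iter 1) (iterate_mem_domain.2 hγ), h2]
    exact h
  refine (isLiftMin_iff (hz.iter N) (iterate_mem_domain.2 hγ)).1
    (isLiftMin_iter hk hz.mem hz.pos ((mem_domain_iff hz).1 hγ) ?_ h1 N)
  intro ξ hξ
  obtain ⟨η, rfl⟩ := hξ.exists_incl
  rw [← actionForm_eq g σ k hz]
  exact isZero_of_isLocalMin hγ h η

end IterateMin

/-! ### The Palais–Smale condition -/

section Compactness

/-- Young's inequality |v| ≤ l/2 + |v|²/(2l) under the integral; the free parameter l replaces the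
square root in the Hölder estimate. -/
theorem norm_curve_sub_curve_le {l : ℝ} (hl : 0 < l) (p : Plane) (v : L2) {a b : ℝ} (ha : a ∈ Icc (0 : ℝ) 1)
    (hb : b ∈ Icc (0 : ℝ) 1) : ‖curve p v b - curve p v a‖ ≤ l / 2 * |b - a| + ‖v‖ ^ 2 / (2 * l) := by
  wlog hab : a ≤ b generalizing a b
  · rw [norm_sub_rev, abs_sub_comm]; exact this hb ha (le_of_not_ge hab)
  rw [curve_sub_curve]
  have i2 : IntervalIntegrable (fun s => l / 2 + ‖ev v s‖ ^ 2 / (2 * l)) volume a b :=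
    intervalIntegrable_const.add ((intervalIntegrable_norm_sq_ev v a b).div_const _)
  have h1 : ‖∫ r in a..b, ev v r‖ ≤ ∫ s in a..b, (l / 2 + ‖ev v s‖ ^ 2 / (2 * l)) := by
    refine intervalIntegral.norm_integral_le_of_norm_le hab (ae_of_all _ fun s _ => ?_) i2
    have h2 : l / 2 + ‖ev v s‖ ^ 2 / (2 * l) - ‖ev v s‖ = (l - ‖ev v s‖) ^ 2 / (2 * l) := by field_simp; ring
    have : 0 ≤ (l - ‖ev v s‖) ^ 2 / (2 * l) := by positivity
    linarith
  refine h1.trans ?_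
  rw [intervalIntegral.integral_add intervalIntegrable_const ((intervalIntegrable_norm_sq_ev v a b).div_const _),
    intervalIntegral.integral_const, intervalIntegral.integral_div, smul_eq_mul, abs_of_nonneg (sub_nonneg.2 hab)]
  have h3 : ∫ s in a..b, ‖ev v s‖ ^ 2 ≤ ‖v‖ ^ 2 := by
    rw [← integral_norm_sq_ev]
    exact intervalIntegral.integral_mono_interval ha.1 hab hb.2 (ae_of_all _ fun _ => by positivity)
      (intervalIntegrable_norm_sq_ev v _ _)
  have h4 : (∫ s in a..b, ‖ev v s‖ ^ 2) / (2 * l) ≤ ‖v‖ ^ 2 / (2 * l) := by gcongr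
  linarith

/-- Bounded sets of lifted curves are relatively compact for the supremum norm. -/
theorem exists_subseq_curveC {x : ℕ → Plane × L2} {R : ℝ} (h1 : ∀ j, ‖(x j).1‖ ≤ R) (h2 : ∀ j, ‖(x j).2‖ ≤ R) :
    ∃ φ : ℕ → ℕ, StrictMono φ ∧ CauchySeq fun j => curveC (x (φ j)) := by
  have hR : 0 ≤ R := (norm_nonneg _).trans (h1 0)
  let f : ℕ → BoundedContinuousFunction unitInterval Plane := fun j =>
    BoundedContinuousFunction.mkOfCompact (curveC (x j) : C(unitInterval, Plane))
  have hf : ∀ j s, f j s = curve (x j).1 (x j).2 s := fun j s => rfl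
  have hc : IsCompact (closure (range f)) := by
    refine BoundedContinuousFunction.arzela_ascoli (Metric.closedBall 0 (2 * R)) (isCompact_closedBall _ _) _ ?_ ?_
    · rintro _ s ⟨j, rfl⟩
      rw [mem_closedBall_zero_iff, hf]
      refine (norm_curve_le _ _ s.2).trans ?_
      linarith [h1 j, h2 j]
    · intro s₀
      rw [Metric.equicontinuousAt_iff]
      intro ε hε
      -- This l makes the energy term R²/(2l) at most ε/2; the distance of the parameters then takes
      -- care of the rest.
      set l := R ^ 2 / ε + 1 with hl
      have hl0 : 0 < l := by positivity
      refine ⟨ε / l, by positivity, fun s hs => ?_⟩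
      rintro ⟨_, j, rfl⟩
      change dist (f j s₀) (f j s) < ε
      rw [dist_eq_norm, hf, hf]
      refine (norm_curve_sub_curve_le hl0 _ _ s.2 s₀.2).trans_lt ?_
      have e1 : l / 2 * |(s₀ : ℝ) - s| < ε / 2 := by
        rw [abs_sub_comm]
        have : |(s : ℝ) - s₀| < ε / l := hs
        rw [lt_div_iff₀ hl0] at this
        linarith
      have e2 : ‖(x j).2‖ ^ 2 / (2 * l) ≤ ε / 2 := by
        rw [div_le_iff₀ (by positivity)]
        have : ‖(x j).2‖ ^ 2 ≤ R ^ 2 := by gcongr; exact h2 j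
        have e3 : ε / 2 * (2 * l) = R ^ 2 + ε := by rw [hl]; field_simp
        linarith
      linarith
  obtain ⟨f₀, -, φ, hφ, hlim⟩ := hc.tendsto_subseq fun j => subset_closure (mem_range_self j)
  refine ⟨φ, hφ, ?_⟩
  have h3 := hlim.cauchySeq
  rw [Metric.cauchySeq_iff] at h3 ⊢
  intro ε hε
  obtain ⟨N, hN⟩ := h3 (ε / 2) (half_pos hε)
  refine ⟨N, fun i hi j hj => ?_⟩
  have h4 := hN i hi j hj
  rw [dist_eq_norm]
  refine lt_of_le_of_lt ((CI.norm_le (by positivity)).2 fun s => ?_) (half_lt_self hε)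
  have := (BoundedContinuousFunction.dist_coe_le_dist (f := f (φ i)) (g := f (φ j)) s).trans h4.le
  rw [dist_eq_norm, hf, hf] at this
  exact this

variable {g : RiemannianMetric} {σ : TwoForm}

/-- The form is solved for its leading term ∫g(ẋ, ξ'). What remains is controlled either by the
slope or by the supremum norm of the field, which is weak enough for compactness. -/
theorem abs_bil_velocity_le {C R B k : ℝ} (hC : IsBound g σ C) {z : Lifted} (hz : ‖z.1.2‖ ≤ R) (hT : 0 < z.2)
    (hTB : z.2 ≤ B) {x : Plane × L2} (hx : total x.2 = 0) :
    |Bil (nem (continuous_metric g) (curveC z.1)) z.1.2 x.2|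
      ≤ B * (2 * √(sizeSq (act' g σ k z)) * ‖x‖) + (C * R ^ 2 + B * (C * R)) * ‖curveC x‖ := by
  have hR : 0 ≤ R := (norm_nonneg _).trans hz
  have hB : 0 ≤ B := hT.le.trans hTB
  have hCp := hC.pos.le
  have h0 : IsTangent (x, 0) := hx
  have e := act'_apply g σ k z (x, 0)
  rw [kin'_apply, mul_zero, add_zero, tau_apply] at e
  have h1 := abs_apply_le_sizeSq (act' g σ k z) h0
  have hn : ‖((x, 0) : Lifted)‖ = ‖x‖ := by simp [Prod.norm_def]
  rw [hn] at h1
  set A := Bil (applyC (nem (continuous_metric' g) (curveC z.1)) (curveC x)) z.1.2 z.1.2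
  set D := Bil (nem (continuous_metric g) (curveC z.1)) z.1.2 x.2
  set E := Lin (applyC (nem (F := BilForm) σ.continuous_form (curveC z.1)) (curveC x)) z.1.2
  have hA : |A| ≤ C * ‖curveC x‖ * R * R := by
    refine (norm_Bil_le _ _ _).trans ?_
    gcongr
    exact (norm_applyC_le _ _).trans (by gcongr; exact norm_nem_le _ hC.metric' _)
  have hE : |E| ≤ C * ‖curveC x‖ * R := by
    refine (norm_Lin_le _ _).trans ?_
    gcongr
    exact (norm_applyC_le _ _).trans (by gcongr; exact norm_nem_le (F := BilForm) σ.continuous_form hC.form _)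
  have hD : D = z.2 * act' g σ k z (x, 0) - z.2 * E - 1 / 2 * A := by
    rw [e]; field_simp; ring
  rw [hD]
  have f1 : |z.2 * act' g σ k z (x, 0)| ≤ B * (2 * √(sizeSq (act' g σ k z)) * ‖x‖) := by
    rw [abs_mul, abs_of_pos hT]; gcongr
  have f2 : |z.2 * E| ≤ B * (C * ‖curveC x‖ * R) := by rw [abs_mul, abs_of_pos hT]; gcongr
  have f3 : |1 / 2 * A| ≤ C * ‖curveC x‖ * R * R := by
    rw [abs_mul, abs_of_pos (by norm_num : (0 : ℝ) < 1 / 2)]; linarith [abs_nonneg A]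
  calc _ ≤ |z.2 * act' g σ k z (x, 0)| + |z.2 * E| + |1 / 2 * A| :=
        (abs_sub _ _).trans (add_le_add_left (abs_sub _ _) _)
    _ ≤ _ := by nlinarith

/-- The leading terms of two lifts are compared on the field given by their difference, and
coercivity turns the result into a bound of the L² distance of the velocities. Small slopes and
uniformly close curves thus give close velocities. -/
theorem norm_sq_sub_le {C c R B k : ℝ} (hC : IsBound g σ C) (hc : ∀ p v, c * ‖v‖ ^ 2 ≤ g.toFun p v v) {z z' : Lifted}
    (ht : total z.1.2 = total z'.1.2)
    (hz : ‖z.1.2‖ ≤ R) (hT : 0 < z.2) (hTB : z.2 ≤ B) (hz' : ‖z'.1.2‖ ≤ R) (hT' : 0 < z'.2) (hTB' : z'.2 ≤ B)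
    (hd : ‖z.1 - z'.1‖ ≤ 2 * R) :
    c * ‖z.1.2 - z'.1.2‖ ^ 2 ≤ B * (2 * √(sizeSq (act' g σ k z)) * (2 * R)) + B * (2 * √(sizeSq (act' g σ k z')) * (2 * R))
      + (2 * (C * R ^ 2 + B * (C * R)) + 2 * C * R ^ 2) * ‖curveC z.1 - curveC z'.1‖ := by
  have hR : 0 ≤ R := (norm_nonneg _).trans hz
  have hB : 0 ≤ B := hT.le.trans hTB
  have hCp := hC.pos.le
  have hx : total (z.1 - z'.1).2 = 0 := by rw [Prod.snd_sub, map_sub, ht, sub_self]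
  have h1 := abs_bil_velocity_le (k := k) hC hz hT hTB hx
  have h2 := abs_bil_velocity_le (k := k) hC hz' hT' hTB' hx
  rw [map_sub curveC, Prod.snd_sub] at h1 h2
  set w := z.1.2 - z'.1.2 with hw
  have h3 : c * ‖w‖ ^ 2 ≤ Bil (nem (continuous_metric g) (curveC z.1)) w w := by
    rw [Bil_apply, ← integral_norm_sq_ev, ← intervalIntegral.integral_const_mul]
    exact intervalIntegral.integral_mono_on zero_le_one ((intervalIntegrable_norm_sq_ev _ _ _).const_mul _)
      (integrable_bil _ _ _ _ _) fun s _ => hc _ _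
  have h4 : Bil (nem (continuous_metric g) (curveC z.1)) w w = Bil (nem (continuous_metric g) (curveC z.1)) z.1.2 w
      - Bil (nem (continuous_metric g) (curveC z'.1)) z'.1.2 w
      - Bil (nem (continuous_metric g) (curveC z.1) - nem (continuous_metric g) (curveC z'.1)) z'.1.2 w := by
    rw [map_sub Bil, sub_apply, sub_apply]
    conv_lhs => rw [hw, map_sub (Bil (nem (continuous_metric g) (curveC z.1))), sub_apply]
    rw [← hw]; ring
  have h5 := norm_Bil_le (nem (continuous_metric g) (curveC z.1) - nem (continuous_metric g) (curveC z'.1)) z'.1.2 w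
  have h6 := norm_nem_sub_le (continuous_metric g) hCp hC.metric_sub (curveC z.1) (curveC z'.1)
  have h7 : ‖w‖ ≤ 2 * R := (norm_sub_le _ _).trans (by linarith)
  set δ := ‖curveC z.1 - curveC z'.1‖
  have h8 : ‖nem (continuous_metric g) (curveC z.1) - nem (continuous_metric g) (curveC z'.1)‖ * ‖z'.1.2‖ * ‖w‖
      ≤ C * δ * R * (2 * R) := by gcongr
  have h9 : B * (2 * √(sizeSq (act' g σ k z)) * ‖z.1 - z'.1‖) ≤ B * (2 * √(sizeSq (act' g σ k z)) * (2 * R)) := by gcongr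
  have h10 : B * (2 * √(sizeSq (act' g σ k z')) * ‖z.1 - z'.1‖) ≤ B * (2 * √(sizeSq (act' g σ k z')) * (2 * R)) := by gcongr
  have a1 := (abs_le.1 h1).2
  have a2 := (abs_le.1 h2).1
  have a3 := (abs_le.1 h5).1
  linarith

end Compactness

section PalaisSmale

variable {g : RiemannianMetric} {σ : TwoForm}

theorem one_le_norm_of_mem_lattice {m : Plane} (hm : m ∈ lattice) (h0 : m ≠ 0) : 1 ≤ ‖m‖ := by
  by_contra h
  exact h0 (lattice_eq_of_dist hm lattice.zero_mem (by rw [dist_zero_right]; exact not_le.1 h))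

theorem abs_partT_le (D : Lifted →L[ℝ] ℝ) : |partT D| ≤ √(sizeSq D) :=
  Real.abs_le_sqrt (by unfold sizeSq; nlinarith [sq_nonneg ‖partP D‖, sq_nonneg ‖partV D‖])

theorem partT_act' (k : ℝ) (z : Lifted) : partT (act' g σ k z) = k - kin g z.1 * z.2⁻¹ ^ 2 := by
  rw [partT, act'_apply]
  have e1 : ((0 : Lifted).1) = 0 := rfl
  simp

/-- A non-zero lattice vector has norm at least one, so the velocity does too, and coercivity bounds
the kinetic energy from below. Together with the upper bound κT² this keeps T away from zero and, as
T ≤ B, bounds the velocity. -/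
theorem exists_period_bounds {κ : ℝ} (hk : 0 < κ) {m : Plane} (hm : m ∈ lattice) (h0 : m ≠ 0) (B : ℝ) :
    ∃ a R, 0 < a ∧ 0 < R ∧ ∀ z : Lifted, total z.1.2 = m → 0 < z.2 → z.2 ≤ B → kin g z.1 ≤ κ * z.2 ^ 2 →
      a ≤ z.2 ∧ ‖z.1.2‖ ≤ R := by
  obtain ⟨c, hc, hcoer⟩ := g.exists_coercive
  refine ⟨√(c / (2 * κ)), √(κ * B ^ 2 * (2 / c)) + 1, by positivity, by positivity, fun z ht hT hTB hK => ?_⟩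
  have h1 := kin_coercive hcoer z.1
  have h2 : 1 ≤ ‖z.1.2‖ := (one_le_norm_of_mem_lattice hm h0).trans (ht ▸ norm_total_le _)
  have h3 : z.2 ^ 2 ≤ B ^ 2 := by gcongr
  constructor
  · refine Real.sqrt_le_iff.2 ⟨hT.le, ?_⟩
    rw [div_le_iff₀ (by positivity)]
    have h4 : 1 ≤ ‖z.1.2‖ ^ 2 := one_le_pow₀ h2
    have h5 : c / 2 ≤ c / 2 * ‖z.1.2‖ ^ 2 := le_mul_of_one_le_right (by positivity) h4
    linarith
  · refine le_trans ?_ (le_add_of_nonneg_right zero_le_one)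
    refine Real.le_sqrt_of_sq_le ?_
    rw [mul_div_assoc', le_div_iff₀ hc]
    nlinarith

/-- The period component of the form is k − e/T² with e the kinetic energy, and it is bounded by the
square root of the slope. -/
theorem kin_le_of_slope {k : ℝ} {z : Lifted} (hT : 0 < z.2) (h : sizeSq (act' g σ k z) ≤ 1) :
    kin g z.1 ≤ (k + 1) * z.2 ^ 2 := by
  have h1 := abs_partT_le (act' g σ k z)
  rw [partT_act'] at h1
  have h2 := (abs_le.1 (h1.trans (Real.sqrt_le_one.2 h))).1
  have h3 : kin g z.1 * z.2⁻¹ ^ 2 ≤ k + 1 := by linarith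
  rwa [← le_div_iff₀ (by positivity), inv_pow, div_inv_eq_mul] at h3

/-- The Palais–Smale condition for lifts of bounded period in a non-contractible class. -/
theorem exists_subseq_lift {k : ℝ} (hk : 0 < k) {m : Plane} (hm : m ∈ lattice) (h0 : m ≠ 0) {B R₀ : ℝ}
    {z : ℕ → Lifted} (ht : ∀ j, total (z j).1.2 = m) (hT : ∀ j, 0 < (z j).2) (hTB : ∀ j, (z j).2 ≤ B)
    (hb : ∀ j, ‖(z j).1.1‖ ≤ R₀) (hs : Tendsto (fun j => sizeSq (act' g σ k (z j))) atTop (𝓝 0)) :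
    ∃ φ : ℕ → ℕ, StrictMono φ ∧ ∃ z₀ : Lifted, Tendsto (z ∘ φ) atTop (𝓝 z₀) ∧ total z₀.1.2 = m ∧ 0 < z₀.2 ∧ z₀.2 ≤ B := by
  obtain ⟨c, hc, hcoer⟩ := g.exists_coercive
  obtain ⟨C, hC⟩ := exists_isBound g σ
  obtain ⟨a, R₁, ha, hR₁, hbd⟩ := exists_period_bounds (g := g) (κ := k + 1) (by positivity) hm h0 B
  obtain ⟨N₀, hN₀⟩ := eventually_atTop.1 (hs.eventually_le_const (u := 1) one_pos)
  have hbd' : ∀ j, N₀ ≤ j → a ≤ (z j).2 ∧ ‖(z j).1.2‖ ≤ R₁ := fun j hj =>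
    hbd _ (ht j) (hT j) (hTB j) (kin_le_of_slope (hT j) (hN₀ j hj))
  set R := max R₀ R₁ with hRd
  have hR : 0 ≤ R := hR₁.le.trans (le_max_right _ _)
  have hB : 0 ≤ B := (hT 0).le.trans (hTB 0)
  obtain ⟨φ, hφ, hX⟩ := exists_subseq_curveC (x := fun j => (z (N₀ + j)).1) (R := R) (fun j => (hb _).trans (le_max_left _ _))
    (fun j => (hbd' _ (Nat.le_add_right _ _)).2.trans (le_max_right _ _))
  obtain ⟨T₀, hT₀, φ', hφ', hTlim⟩ := isCompact_Icc.tendsto_subseq (s := Icc a B) (x := fun j => (z (N₀ + φ j)).2)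
    fun j => ⟨(hbd' _ (Nat.le_add_right _ _)).1, hTB _⟩
  obtain ⟨p₀, -, φ₂, hφ₂, hplim⟩ := (isCompact_closedBall (0 : Plane) R₀).tendsto_subseq
    (x := fun j => (z (N₀ + φ (φ' j))).1.1) fun j => mem_closedBall_zero_iff.2 (hb _)
  let χ : ℕ → ℕ := fun j => N₀ + φ (φ' (φ₂ j))
  have hχ : StrictMono χ := fun i j hij => Nat.add_lt_add_left (hφ (hφ' (hφ₂ hij))) _
  have hv2 : ∀ j, ‖(z (χ j)).1.2‖ ≤ R := fun j => (hbd' _ (Nat.le_add_right _ _)).2.trans (le_max_right _ _)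
  have hX' : CauchySeq fun j => curveC (z (χ j)).1 := hX.comp_tendsto ((hφ'.comp hφ₂).tendsto_atTop)
  -- The curves converge uniformly and the slopes tend to zero, so `norm_sq_sub_le` makes the
  -- velocities Cauchy in L².
  have hcau : CauchySeq fun j => (z (χ j)).1.2 := by
    rw [Metric.cauchySeq_iff]
    intro ε hε
    set K := 2 * (C * R ^ 2 + B * (C * R)) + 2 * C * R ^ 2 with hK
    have hCp := hC.pos
    have hK0 : 0 ≤ K := by positivity
    have h1 : Tendsto (fun j => B * (2 * √(sizeSq (act' g σ k (z (χ j)))) * (2 * R))) atTop (𝓝 0) := by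
      have := ((((Real.continuous_sqrt.tendsto 0).comp (hs.comp hχ.tendsto_atTop)).const_mul 2).mul_const (2 * R)).const_mul B
      simpa using this
    have hpos : 0 < c * ε ^ 2 := by positivity
    obtain ⟨N₁, hN₁⟩ := eventually_atTop.1 (h1.eventually_lt_const (u := c * ε ^ 2 / 4) (by positivity))
    obtain ⟨N₂, hN₂⟩ := Metric.cauchySeq_iff.1 hX' (c * ε ^ 2 / (4 * (K + 1))) (by positivity)
    refine ⟨max N₁ N₂, fun i hi j hj => ?_⟩
    have e1 := hN₁ i (le_of_max_le_left hi)
    have e2 := hN₁ j (le_of_max_le_left hj)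
    have e3 := hN₂ i (le_of_max_le_right hi) j (le_of_max_le_right hj)
    rw [dist_eq_norm, lt_div_iff₀ (by positivity)] at e3
    have hd : ‖(z (χ i)).1 - (z (χ j)).1‖ ≤ 2 * R := by
      refine (norm_sub_le _ _).trans ?_
      have : ∀ j, ‖(z (χ j)).1‖ ≤ R := fun j => norm_prod_le_iff.2 ⟨(hb _).trans (le_max_left _ _), hv2 j⟩
      linarith [this i, this j]
    have e4 := norm_sq_sub_le (k := k) hC hcoer ((ht (χ i)).trans (ht (χ j)).symm) (hv2 i) (hT _) (hTB _) (hv2 j) (hT _) (hTB _) hd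
    rw [← hK] at e4
    rw [dist_eq_norm]
    have e5 : c * ‖(z (χ i)).1.2 - (z (χ j)).1.2‖ ^ 2 < c * ε ^ 2 := by
      have := norm_nonneg (curveC (z (χ i)).1 - curveC (z (χ j)).1)
      nlinarith
    exact lt_of_pow_lt_pow_left₀ 2 hε.le (lt_of_mul_lt_mul_left e5 hc.le)
  obtain ⟨v₀, hv₀⟩ := cauchySeq_tendsto_of_complete hcau
  refine ⟨χ, hχ, ((p₀, v₀), T₀), (hplim.prodMk_nhds hv₀).prodMk_nhds (hTlim.comp hφ₂.tendsto_atTop), ?_, ha.trans_le hT₀.1, hT₀.2⟩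
  refine tendsto_nhds_unique ((continuous_total.tendsto v₀).comp hv₀) ?_
  refine tendsto_const_nhds.congr fun j => (ht (χ j)).symm

/-- The Palais–Smale condition for loops of bounded period in a non-contractible class. -/
theorem exists_subseq_loop {k : ℝ} (hk : 0 < k) {m : Plane} (h0 : m ≠ 0) {B : ℝ} {γ : ℕ → FreeLoop}
    (hc : ∀ j, cls (γ j).1 = m) (hB : ∀ j, period (γ j) ≤ B) (hs : Tendsto (fun j => slope g σ k (γ j)) atTop (𝓝 0)) :
    ∃ φ : ℕ → ℕ, StrictMono φ ∧ ∃ γ₀ : FreeLoop, Tendsto (γ ∘ φ) atTop (𝓝 γ₀) ∧ cls γ₀.1 = m ∧ period γ₀ ≤ B ∧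
      IsZero g σ k γ₀ := by
  have hm : m ∈ lattice := hc 0 ▸ cls_mem _
  obtain ⟨φ, hφ, z₀, hz₀, ht₀, hT₀, hB₀⟩ := exists_subseq_lift (g := g) (σ := σ) hk hm h0 (B := B) (R₀ := 2)
    (z := fun j => sec 0 (γ j).1) (fun j => hc j) (fun j => (γ j).2) hB (fun j => norm_rep_le _) hs
  let X := {z : Lifted // total z.1.2 = m ∧ 0 < z.2}
  let f : X → FreeLoop := fun z => ofLift z.1 (by rw [z.2.1]; exact hm) z.2.2
  have hf : Continuous f := continuous_ofLift continuous_subtype_val _ _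
  have h1 : Tendsto (fun j => (⟨sec 0 (γ (φ j)).1, hc _, (γ (φ j)).2⟩ : X)) atTop (𝓝 ⟨z₀, ht₀, hT₀⟩) :=
    tendsto_subtype_rng.2 hz₀
  have h2 := (hf.tendsto _).comp h1
  have h3 : Tendsto (γ ∘ φ) atTop (𝓝 (f ⟨z₀, ht₀, hT₀⟩)) := by
    refine h2.congr fun j => ?_
    exact (isLift_sec 0 (γ (φ j)).1).ofLift_eq _ _
  refine ⟨φ, hφ, _, h3, ht₀, hB₀, ?_⟩
  rw [isZero_iff_slope]
  exact tendsto_nhds_unique (((continuous_slope g σ k).tendsto _).comp h3) (hs.comp hφ.tendsto_atTop)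

/-- A sequence of counterexamples has slopes tending to zero, so it subconverges to a zero in W, and
so do the loops at vanishing distance from it; W being open, this is absurd. -/
theorem exists_slope_lt_imp {k : ℝ} (hk : 0 < k) {m : Plane} (h0 : m ≠ 0) (B : ℝ) {W : Set FreeLoop} (hW : IsOpen W)
    (h : ∀ γ : FreeLoop, cls γ.1 = m → period γ ≤ B → IsZero g σ k γ → γ ∈ W) :
    ∃ δ > 0, ∀ γ γ' : FreeLoop, cls γ.1 = m → period γ ≤ B → slope g σ k γ < δ → dist γ γ' < δ → γ' ∈ W := by
  by_contra hcon
  push Not at hcon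
  choose γ γ' h1 h2 h3 h4 h5 using fun j : ℕ => hcon (1 / ((j : ℝ) + 1)) (by positivity)
  have hs : Tendsto (fun j => slope g σ k (γ j)) atTop (𝓝 0) :=
    squeeze_zero (fun j => slope_nonneg g σ k _) (fun j => (h3 j).le) tendsto_one_div_add_atTop_nhds_zero_nat
  obtain ⟨φ, hφ, γ₀, hγ₀, e1, e2, e3⟩ := exists_subseq_loop hk h0 h1 h2 hs
  have hd : Tendsto (fun j => dist (γ (φ j)) (γ' (φ j))) atTop (𝓝 0) :=
    (squeeze_zero (fun j => dist_nonneg) (fun j => (h4 j).le) tendsto_one_div_add_atTop_nhds_zero_nat).comp hφ.tendsto_atTop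
  have h6 : Tendsto (fun j => γ' (φ j)) atTop (𝓝 γ₀) := (tendsto_iff_of_dist hd).1 hγ₀
  obtain ⟨j, hj⟩ := (h6.eventually (hW.mem_nhds (h _ e1 e2 e3))).exists
  exact h5 _ hj

theorem isCompact_zeros {k : ℝ} (hk : 0 < k) {m : Plane} (h0 : m ≠ 0) (B : ℝ) :
    IsCompact {γ : FreeLoop | cls γ.1 = m ∧ period γ ≤ B ∧ IsZero g σ k γ} := by
  refine IsSeqCompact.isCompact fun γ hγ => ?_
  obtain ⟨φ, hφ, γ₀, hγ₀, e⟩ := exists_subseq_loop (g := g) (σ := σ) hk h0 (fun j => (hγ j).1) (fun j => (hγ j).2.1)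
    (tendsto_const_nhds.congr fun j => ((isZero_iff_slope g σ k _).1 (hγ j).2.2).symm)
  exact ⟨γ₀, e, φ, hφ, hγ₀⟩

end PalaisSmale

/-! ### Gradient steps and branches of the action -/

section GradientStep

variable {g : RiemannianMetric} {σ : TwoForm}

theorem exists_abs_act'_le (g : RiemannianMetric) (σ : TwoForm) (k R : ℝ) {a : ℝ} (ha : 0 < a) : ∃ C₀, 0 < C₀ ∧ ∀ z : Lifted,
    ‖z.1.2‖ ≤ R → a ≤ z.2 → ∀ h, |act' g σ k z h| ≤ C₀ * ‖h‖ := by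
  obtain ⟨C, hC⟩ := exists_isBound g σ
  have hCp := hC.pos
  refine ⟨a⁻¹ * (C * (R ^ 2 + |R|)) + C * 2 * |R| + (|k| + C * R ^ 2 * a⁻¹ ^ 2) + 1, by positivity, fun z hz hT h => ?_⟩
  have hR : 0 ≤ R := (norm_nonneg _).trans hz
  rw [abs_of_nonneg hR, act'_apply]
  have hT0 : 0 < z.2 := ha.trans_le hT
  have h1 := abs_kin'_le hC z.1 h.1
  have h2 := abs_tau_le hC z.1 h.1
  have h3 := kin_le hC z.1
  have h4 := kin_nonneg (g := g) z.1
  have n1 := norm_fst_le h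
  have n2 : |h.2| ≤ ‖h‖ := norm_snd_le h
  have hi : z.2⁻¹ ≤ a⁻¹ := inv_anti₀ ha hT
  have hi0 : 0 < z.2⁻¹ := inv_pos.2 hT0
  have b1 : |z.2⁻¹ * kin' g z.1 h.1| ≤ a⁻¹ * (C * (R ^ 2 + R)) * ‖h‖ := by
    rw [abs_mul, abs_of_pos hi0, mul_assoc]
    refine mul_le_mul hi (h1.trans ?_) (abs_nonneg _) (by positivity)
    gcongr
  have b2 : |tau σ z.1 h.1| ≤ C * 2 * R * ‖h‖ := h2.trans (by gcongr)
  have b3 : |k - kin g z.1 * z.2⁻¹ ^ 2| ≤ |k| + C * R ^ 2 * a⁻¹ ^ 2 := by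
    refine (abs_sub _ _).trans (add_le_add_right ?_ _)
    rw [abs_of_nonneg (by positivity)]
    gcongr
    exact h3.trans (by gcongr)
  have b4 : |(k - kin g z.1 * z.2⁻¹ ^ 2) * h.2| ≤ (|k| + C * R ^ 2 * a⁻¹ ^ 2) * ‖h‖ := by
    rw [abs_mul]; gcongr
  calc _ ≤ |z.2⁻¹ * kin' g z.1 h.1| + |tau σ z.1 h.1| + |(k - kin g z.1 * z.2⁻¹ ^ 2) * h.2| := abs_add_three _ _ _
    _ ≤ _ := by nlinarith [norm_nonneg h]

/-- On regions of bounded velocity, short gradient steps decrease the action. -/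
theorem exists_step (g : RiemannianMetric) (σ : TwoForm) (k : ℝ) {m : Plane} (hm : m ∈ lattice) {R a ρ : ℝ} (hR : 0 ≤ R)
    (ha : 0 < a) (hρ : 0 < ρ) :
    ∃ ε, 0 < ε ∧ ∀ z : Lifted, total z.1.2 = m → ‖z.1.2‖ ≤ R → a ≤ z.2 → ∀ t ∈ Icc 0 ε,
      ‖t • dualVec (act' g σ k z)‖ ≤ ρ ∧ 0 < (z - t • dualVec (act' g σ k z)).2 ∧
      ‖t • dualVec (act' g σ k z)‖ ≤ t * √(sizeSq (act' g σ k z)) ∧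
      act g σ k m (z - t • dualVec (act' g σ k z)) ≤ act g σ k m z - t * sizeSq (act' g σ k z) / 2 := by
  obtain ⟨M, hM, hL⟩ := exists_lipschitz_act' g σ k (R + 1) (half_pos ha) (by positivity)
  obtain ⟨C₀, hC₀, hb⟩ := exists_abs_act'_le g σ k R ha
  -- Steps of length at most ν keep the velocity below R + 1 and the period above a/2, where the
  -- Lipschitz constant M is valid.
  set ν := min ρ (min 1 (a / 2)) with hν
  have hν0 : 0 < ν := by positivity
  refine ⟨min (ν / C₀) (1 / (2 * M)), by positivity, fun z hz hzR hza t ht => ?_⟩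
  set D := act' g σ k z with hD
  set X := dualVec D with hX
  have ht1 : t * C₀ ≤ ν := by
    have := ht.2.trans (min_le_left _ _); rwa [le_div_iff₀ hC₀] at this
  have ht2 : t * (2 * M) ≤ 1 := by
    have := ht.2.trans (min_le_right _ _); rwa [le_div_iff₀ (by positivity)] at this
  have hs := norm_dualVec_sq_le D
  have hs0 := sizeSq_nonneg D
  have hX0 : ‖X‖ ≤ C₀ := by
    have h1 := hb z hzR hza X
    rw [← hD, hX, apply_dualVec, abs_of_nonneg hs0] at h1
    by_contra h
    have h2 : 0 < ‖X‖ := hC₀.trans (not_le.1 h)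
    nlinarith [mul_lt_mul_of_pos_right (not_le.1 h) h2]
  have hn : ‖t • X‖ = t * ‖X‖ := by rw [norm_smul, Real.norm_eq_abs, abs_of_nonneg ht.1]
  have hle : ‖t • X‖ ≤ ν := by rw [hn]; exact (mul_le_mul_of_nonneg_left hX0 ht.1).trans ht1
  have hsq : ‖X‖ ≤ √(sizeSq D) := Real.le_sqrt_of_sq_le hs
  have c1 : |(t • X).2| ≤ ‖t • X‖ := norm_snd_le (t • X)
  have c2 : ‖(t • X).1.2‖ ≤ ‖t • X‖ := (norm_snd_le (t • X).1).trans (norm_fst_le (t • X))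
  have d1 : ν ≤ ρ := min_le_left _ _
  have d2 : ν ≤ 1 := (min_le_right _ _).trans (min_le_left _ _)
  have d3 : ν ≤ a / 2 := (min_le_right _ _).trans (min_le_right _ _)
  have e1 : a / 2 ≤ (z - t • X).2 := by
    rw [Prod.snd_sub]; linarith [(abs_le.1 c1).2]
  refine ⟨hle.trans d1, (half_pos ha).trans_le e1, by rw [hn]; exact mul_le_mul_of_nonneg_left hsq ht.1, ?_⟩
  have hsub : z - t • X = z + (-t) • X := by rw [neg_smul, sub_eq_add_neg]
  have key := abs_act_remainder_le (g := g) (σ := σ) (k := k) hL (half_pos ha) hM.le m hm (z := z) (h := (-t) • X) hz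
    ((isTangent_dualVec D).smul _) (by linarith) (by
      rw [← hsub, Prod.fst_sub, Prod.snd_sub]
      exact (norm_sub_le _ _).trans (by linarith)) (by linarith) (by rw [← hsub]; exact e1)
  rw [← hsub, ← hD, map_smul, hX, apply_dualVec, ← hX, norm_smul, norm_neg, Real.norm_eq_abs, abs_of_nonneg ht.1,
    smul_eq_mul] at key
  have k1 := (abs_le.1 key).2
  -- For t ≤ 1/(2M) the quadratic remainder uses up at most half of the first order gain.
  have k2 : M * (t * ‖X‖) ^ 2 ≤ t * sizeSq D / 2 := by
    calc M * (t * ‖X‖) ^ 2 = (t * (2 * M)) * (t * ‖X‖ ^ 2) / 2 := by ring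
      _ ≤ 1 * (t * sizeSq D) / 2 := by
        have : t * ‖X‖ ^ 2 ≤ t * sizeSq D := mul_le_mul_of_nonneg_left hs ht.1
        have h0 : 0 ≤ t * ‖X‖ ^ 2 := mul_nonneg ht.1 (sq_nonneg _)
        have : (t * (2 * M)) * (t * ‖X‖ ^ 2) ≤ 1 * (t * sizeSq D) := mul_le_mul ht2 this h0 zero_le_one
        linarith
      _ = _ := by ring
  linarith

theorem dist_le_of_isLift {z z' : Lifted} {γ γ' : FreeLoop} (h : IsLift z γ.1) (h' : IsLift z' γ'.1) : dist γ γ' ≤ ‖z - z'‖ := by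
  have n1 := norm_fst_le (z - z')
  have n2 := norm_snd_le (z - z')
  have n3 := norm_fst_le (z - z').1
  have n4 := norm_snd_le (z - z').1
  refine max_le (max_le ?_ ?_) ?_
  · change dist γ.1.1.1.1 γ'.1.1.1.1 ≤ _
    rw [← h.base, ← h'.base]
    refine (dist_pi_le_iff (norm_nonneg _)).2 fun i => ?_
    rw [dist_eq_norm]
    refine le_trans ?_ ((PiLp.norm_apply_le (z - z').1.1 i).trans (n3.trans n1))
    change ‖((z.1.1 i : ℝ) : UnitAddCircle) - ((z'.1.1 i : ℝ) : UnitAddCircle)‖ ≤ _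
    rw [← AddCircle.coe_sub]
    exact QuotientAddGroup.norm_mk_le_norm
  · change dist γ.1.1.1.2 γ'.1.1.1.2 ≤ _
    rw [← h.vel, ← h'.vel, dist_eq_norm]
    exact n4.trans n1
  · change dist γ.1.2 γ'.1.2 ≤ _
    rw [← h.per, ← h'.per, dist_eq_norm]
    exact n2

/-- Along paths in the domain, the local action and its lift have the same increments. -/
theorem localAction_sub_eq {P : PuncturedPrimitive σ} {k : ℝ} {m : Plane} {z : unitInterval → Lifted} (hz : Continuous z)
    {u : unitInterval → FreeLoop} (hl : ∀ s, IsLift (z s) (u s).1) (ht : ∀ s, total (z s).1.2 = m)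
    {s₀ : unitInterval} (hd : ∀ s ≤ s₀, u s ∈ P.domain) :
    localAction g P k (u s₀) - localAction g P k (u 0) = act g σ k m (z s₀) - act g σ k m (z 0) := by
  -- The initial piece up to s₀ is reparametrized by the whole interval, where a locally constant
  -- function is constant.
  let f : unitInterval → unitInterval := fun s => s₀ * s
  have hf : Continuous f := continuous_const.mul continuous_id
  have hf0 : ∀ s, u (f s) ∈ P.domain := fun s => hd _ unitInterval.mul_le_left
  have hloc : IsLocallyConstant fun s => localAction g P k (u (f s)) - act g σ k m (z (f s)) := by
    refine (IsLocallyConstant.iff_eventually_eq _).2 fun s => ?_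
    have h1 := (hz.comp hf).continuousAt.eventually (eventually_localAction_sub (g := g) (k := k) (hl (f s)) (hf0 s))
    filter_upwards [h1] with s' h2
    obtain ⟨-, -, h3⟩ := h2 _ (hl (f s'))
    rw [← (hl (f s)).total_eq, ht] at h3
    simp only [Function.comp_apply] at h3
    linarith
  have h := hloc.apply_eq_of_preconnectedSpace 1 0
  have e1 : f 1 = s₀ := mul_one _
  have e0 : f 0 = 0 := mul_zero _
  simp only [e1, e0] at h
  linarith

/-- A coset of a cyclic subgroup of ℝ is discrete, so it has no non-zero elements arbitrarily close
to zero, whether or not zero belongs to it. The case f = 0 is included. -/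
theorem exists_eq_zero_of_abs_lt (e f : ℝ) : ∃ ε > 0, ∀ x, x - e ∈ AddSubgroup.zmultiples f → |x| < ε → x = 0 := by
  have hdiff : ∀ x y, x - e ∈ AddSubgroup.zmultiples f → y - e ∈ AddSubgroup.zmultiples f → |x - y| < |f| → x = y := by
    intro x y hx hy hxy
    have h1 := sub_mem hx hy
    rw [sub_sub_sub_cancel_right] at h1
    obtain ⟨n, hn⟩ := h1
    simp only [zsmul_eq_mul] at hn
    rw [← hn, abs_mul] at hxy
    rcases eq_or_ne n 0 with rfl | h0
    · simp only [Int.cast_zero, zero_mul] at hn; linarith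
    · exfalso
      have : (1 : ℝ) ≤ |(n : ℝ)| := by rw [← Int.cast_abs]; exact_mod_cast Int.one_le_abs h0
      nlinarith [abs_nonneg f]
  rcases eq_or_ne f 0 with rfl | hf
  · rcases eq_or_ne e 0 with rfl | he
    · exact ⟨1, one_pos, fun x hx _ => by
        obtain ⟨n, hn⟩ := hx
        simpa using hn.symm⟩
    · refine ⟨|e|, abs_pos.2 he, fun x hx h => ?_⟩
      obtain ⟨n, hn⟩ := hx
      simp only [smul_zero] at hn
      rw [← sub_eq_zero.1 hn.symm] at h
      exact absurd h (lt_irrefl _)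
  · have hf' : 0 < |f| := abs_pos.2 hf
    by_cases hx : ∃ x₀, x₀ - e ∈ AddSubgroup.zmultiples f ∧ x₀ ≠ 0 ∧ |x₀| < |f| / 2
    · obtain ⟨x₀, h1, h2, h3⟩ := hx
      refine ⟨|x₀|, abs_pos.2 h2, fun x hx h => ?_⟩
      have := hdiff x x₀ hx h1 ((abs_sub _ _).trans_lt (by linarith))
      rw [this] at h
      exact absurd h (lt_irrefl _)
    · push Not at hx
      refine ⟨|f| / 2, by positivity, fun x hx' h => ?_⟩
      by_contra h0
      exact absurd h (not_lt.2 (hx x hx' h0))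

end GradientStep

/-! ### Spheres around isolated compact sets of zeros, and enclosed areas -/

section Barrier

variable {g : RiemannianMetric} {σ : TwoForm} {P : PuncturedPrimitive σ} {k : ℝ}

/-- If the action came arbitrarily close to v₀ on the sphere, a gradient step of fixed duration
would still end in G, where v₀ is a lower bound; so the slopes would tend to zero. The Palais–Smale
condition would then produce a zero on the sphere, against isolation. -/
theorem exists_sphere_bound (hk : 0 < k) {m : Plane} (h0 : m ≠ 0) {B R a v₀ : ℝ} (ha : 0 < a) (hR : 0 ≤ R)
    {C G : Set FreeLoop} (hC : IsCompact C) (hne : C.Nonempty) (hG : IsOpen G) (hCG : C ⊆ G) (hGd : G ⊆ P.domain)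
    (hGv : ∀ γ ∈ G, v₀ ≤ localAction g P k γ) (hGB : ∀ γ ∈ G, period γ ≤ B) (hGa : ∀ γ ∈ G, a ≤ period γ)
    (hGR : ∀ γ ∈ G, ‖γ.1.1.1.2‖ ≤ R) (hGm : ∀ γ ∈ G, cls γ.1 = m) (hiso : ∀ γ ∈ G, IsZero g σ k γ → γ ∈ C) :
    ∃ r > 0, (∀ γ, Metric.infDist γ C ≤ r → γ ∈ G) ∧
      ∃ δ > 0, ∀ γ, Metric.infDist γ C = r → v₀ + δ ≤ localAction g P k γ := by
  obtain ⟨γ₁, hγ₁⟩ := hne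
  have hm : m ∈ lattice := hGm γ₁ (hCG hγ₁) ▸ cls_mem _
  obtain ⟨ρ, hρ, hρG⟩ := hC.exists_cthickening_subset_open hG hCG
  have hin : ∀ γ, Metric.infDist γ C < ρ → γ ∈ G := fun γ h => by
    obtain ⟨c, hc, hd⟩ := (Metric.infDist_lt_iff ⟨γ₁, hγ₁⟩).1 h
    exact hρG (Metric.mem_cthickening_of_dist_le γ c ρ C hc hd.le)
  refine ⟨ρ / 2, by positivity, fun γ h => hin γ (by linarith), ?_⟩
  by_contra hcon
  push Not at hcon
  choose γ h1 h2 using fun j : ℕ => hcon (1 / ((j : ℝ) + 1)) (by positivity)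
  have hγG : ∀ j, γ j ∈ G := fun j => hin _ (by rw [h1]; linarith)
  -- The sphere has radius ρ/2, so steps of length at most ρ/4 do not leave the ball of radius ρ.
  obtain ⟨ε, hε, hstep⟩ := exists_step g σ k hm hR ha (ρ := ρ / 4) (by positivity)
  have hsl : ∀ j, slope g σ k (γ j) ≤ 2 / ε * (1 / ((j : ℝ) + 1)) := by
    intro j
    set z₀ := sec 0 (γ j).1 with hz₀
    have hl₀ := isLift_sec 0 (γ j).1
    have ht : total z₀.1.2 = m := hl₀.total_eq.trans (hGm _ (hγG j))
    set X := dualVec (act' g σ k z₀) with hX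
    have hst : ∀ s : unitInterval, ((s : ℝ) * ε) ∈ Icc 0 ε := fun s =>
      ⟨mul_nonneg s.2.1 hε.le, mul_le_of_le_one_left hε.le s.2.2⟩
    have hst' := fun s => hstep z₀ ht (hGR _ (hγG j)) (hGa _ (hγG j)) _ (hst s)
    let z : unitInterval → Lifted := fun s => z₀ - ((s : ℝ) * ε) • X
    have hz : Continuous z := by
      have : Continuous fun s : unitInterval => (s : ℝ) * ε := by fun_prop
      exact continuous_const.sub (this.smul continuous_const)
    have htz : ∀ s, total (z s).1.2 = m := fun s => by
      have h3 : total (((s : ℝ) * ε) • X).1.2 = 0 := (isTangent_dualVec _).smul _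
      change total (z₀.1.2 - (((s : ℝ) * ε) • X).1.2) = m
      rw [map_sub, h3, sub_zero, ht]
    let u : unitInterval → FreeLoop := fun s => ofLift (z s) (by rw [htz]; exact hm) (hst' s).2.1
    have hl : ∀ s, IsLift (z s) (u s).1 := fun s => isLift_ofLift _ _ _
    have hu0 : u 0 = γ j := by
      have : z 0 = z₀ := by simp [z]
      exact Subtype.ext ((this ▸ hl 0).eq hl₀)
    have huG : ∀ s, u s ∈ G := fun s => by
      refine hin _ ?_
      have d1 := dist_le_of_isLift (hl s) hl₀
      have d2 : ‖z s - z₀‖ ≤ ρ / 4 := by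
        simp only [z, sub_sub_cancel_left, norm_neg]; exact (hst' s).1
      have d3 := Metric.infDist_le_infDist_add_dist (s := C) (x := u s) (y := γ j)
      rw [h1] at d3
      linarith
    have h3 := localAction_sub_eq (g := g) (P := P) (k := k) hz hl htz (s₀ := 1) fun s _ => hGd (huG s)
    have h4 := hGv _ (huG 1)
    have h5 := (hst' 1).2.2.2
    have e1 : z 1 = z₀ - (((1 : unitInterval) : ℝ) * ε) • X := rfl
    have e0 : z 0 = z₀ := by simp [z]
    rw [← e1] at h5
    rw [e0, hu0] at h3
    have h6 := h2 j
    have e2 : slope g σ k (γ j) = sizeSq (act' g σ k z₀) := rfl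
    rw [← e2] at h5
    have e3 : ((1 : unitInterval) : ℝ) = 1 := rfl
    rw [e3, one_mul] at h5
    rw [div_mul_eq_mul_div, le_div_iff₀ hε]
    linarith
  have hlim : Tendsto (fun j => slope g σ k (γ j)) atTop (𝓝 0) := by
    refine squeeze_zero (fun j => slope_nonneg g σ k _) hsl ?_
    simpa using tendsto_one_div_add_atTop_nhds_zero_nat.const_mul (2 / ε)
  obtain ⟨φ, hφ, γ₀, hγ₀, e1, e2, e3⟩ := exists_subseq_loop hk h0 (fun j => hGm _ (hγG j)) (fun j => hGB _ (hγG j)) hlim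
  have h3 : Metric.infDist γ₀ C = ρ / 2 := by
    refine tendsto_nhds_unique (((Metric.continuous_infDist_pt C).tendsto γ₀).comp hγ₀) ?_
    exact tendsto_const_nhds.congr fun j => (h1 (φ j)).symm
  have h4 := hiso γ₀ (hin _ (by rw [h3]; linarith)) e3
  rw [Metric.infDist_zero_of_mem h4] at h3
  linarith

/-- By connectedness |A| would otherwise take the value 1/2, which is at distance 1/2 from every
integer. -/
theorem abs_lt_of_forall_near_int {A : unitInterval → ℝ} (hA : Continuous A) (h0 : A 0 = 0)
    (h : ∀ s, ∃ n : ℤ, |A s - n| < 1 / 4) (s : unitInterval) : |A s| < 1 / 2 := by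
  by_contra hcon
  push Not at hcon
  have hpre := isPreconnected_univ.image _ (hA.abs.continuousOn (s := univ))
  have h1 : Icc (|A 0|) (|A s|) ⊆ (fun s => |A s|) '' univ :=
    hpre.Icc_subset (mem_image_of_mem _ (mem_univ 0)) (mem_image_of_mem _ (mem_univ s))
  obtain ⟨t, -, ht⟩ := h1 (show (1 / 2 : ℝ) ∈ _ from ⟨by rw [h0, abs_zero]; norm_num, hcon⟩)
  obtain ⟨n, hn⟩ := h t
  simp only at ht
  rw [abs_lt] at hn
  rcases abs_eq (by norm_num : (0 : ℝ) ≤ 1 / 2) |>.1 ht with h2 | h2 <;> rw [h2] at hn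
  · have h3 : (0 : ℝ) < n := by linarith [hn.2]
    have h4 : (n : ℝ) < 1 := by linarith [hn.1]
    have h3' : 0 < n := by exact_mod_cast h3
    have h4' : n < 1 := by exact_mod_cast h4
    omega
  · have h3 : (-1 : ℝ) < n := by linarith [hn.2]
    have h4 : (n : ℝ) < 0 := by linarith [hn.1]
    have h3' : -1 < n := by exact_mod_cast h3
    have h4' : n < 0 := by exact_mod_cast h4
    omega

/-- The flux of the standard form is one, so its ambiguity is an integer. This quantizes the area
enclosed by closed paths of loops. -/
theorem mag_std_sub_mem_int {m : Plane} (hm : m ∈ lattice) {z z' : Lifted} {γ : LoopsR} (h : IsLift z γ) (h' : IsLift z' γ)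
    (ht : cls γ = m) : ∃ n : ℤ, mag stdTwoForm m z'.1 - mag stdTwoForm m z.1 = n := by
  obtain ⟨w, hw, e⟩ := h.exists_eq h'
  obtain ⟨a, ha⟩ := hw 0
  obtain ⟨b, hb⟩ := hw 1
  obtain ⟨c, hc⟩ := hm 0
  obtain ⟨d, hd⟩ := hm 1
  refine ⟨a * d - b * c, ?_⟩
  rw [e]
  simp only
  rw [mag_translate stdTwoForm m hm z.1.1 hw z.1.2 (h.total_eq.trans ht), flux_stdTwoForm, ha, hb, hc, hd]
  push_cast; ring

theorem continuousAt_mag (σ : TwoForm) {z : Lifted} (hm : total z.1.2 ∈ lattice) :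
    ContinuousAt (fun z : Lifted => mag σ (total z.1.2) z.1) z ∧ ContinuousAt (fun z' : Lifted => mag σ (total z.1.2) z'.1) z := by
  obtain ⟨D, hD, -⟩ := exists_hasFDerivAt_mag σ _ hm z.1 rfl
  have h1 : ContinuousAt (fun z' : Lifted => mag σ (total z.1.2) z'.1) z :=
    ContinuousAt.comp (g := mag σ (total z.1.2)) hD.continuousAt continuousAt_fst
  refine ⟨?_, h1⟩
  have h2 : ∀ x m, mag σ m x = mag σ (total z.1.2) x - (m 0 - total z.1.2 0) * vprim σ (x.1 1) := fun x m => by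
    simp only [mag]; ring
  have h3 : ContinuousAt (fun z' : Lifted => (total z'.1.2 0 - total z.1.2 0) * vprim σ (z'.1.1 1)) z := by
    have c1 : Continuous fun z' : Lifted => total z'.1.2 := continuous_total.comp (continuous_snd.comp continuous_fst)
    have c2 : Continuous fun z' : Lifted => total z'.1.2 0 := (EuclideanSpace.proj 0).continuous.comp c1
    have c3 : Continuous (vprim σ) := continuous_iff_continuousAt.2 fun y => (hasDerivAt_vprim σ y).continuousAt
    have c4 : Continuous fun z' : Lifted => z'.1.1 1 := (EuclideanSpace.proj 1).continuous.comp (continuous_fst.comp continuous_fst)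
    exact ((c2.sub continuous_const).mul (c3.comp c4)).continuousAt
  have h4 := h1.sub h3
  refine h4.congr (Eventually.of_forall fun z' => ?_)
  exact (h2 _ _).symm

end Barrier

/-! ### Barriers around circles of local minimizers -/

section Barriers

variable {σ : TwoForm} {g : RiemannianMetric} {P : PuncturedPrimitive σ} {k : ℝ}

theorem isLocalMin_shift {γ : FreeLoop} (hγ : γ ∈ P.domain) (h : IsLocalMin (localAction g P k) γ) (ψ : ℝ) :
    IsLocalMin (localAction g P k) (shift ψ γ) := by
  have hz := isLift_sec 0 γ.1
  have hA := (mem_domain_iff hz).1 hγ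
  obtain ⟨ε, hε, hm⟩ := ((isLiftMin_iff hz hγ).2 h).rot hz.mem
  refine (isLiftMin_iff (hz.rot ψ) (shift_mem_domain hγ ψ)).1 ⟨ε, hε, fun z' h1 h2 h3 h4 => ?_⟩
  rw [liftAct_rot hA hz.mem]
  exact hm ψ z' (h1.trans (total_rotV ψ _)) h2 h3 h4

/-- A path of lifts that starts on an isolated circle of local minimizers and returns to its starting point with a
different enclosed area has to climb by a definite amount. -/
theorem exists_barrier (hk : 0 < k) {m : Plane} (h0 : m ≠ 0) {γ₀ : FreeLoop} (hγ : γ₀ ∈ P.domain)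
    (hmin : IsLocalMin (localAction g P k) γ₀) (hm : cls γ₀.1 = m) {B : ℝ} (hB : period γ₀ < B) {O : Set FreeLoop}
    (hO : IsOpen O) (hγO : orbit γ₀ ⊆ O)
    (hiso : ∀ γ ∈ O, cls γ.1 = m → period γ ≤ B → IsZero g σ k γ → γ ∈ orbit γ₀) :
    ∃ δ > 0, ∀ (u : C(unitInterval, FreeLoop)) (z : unitInterval → Lifted), Continuous z →
      (∀ s, IsLift (z s) (u s).1) → (∀ s, total (z s).1.2 = m) → u 0 ∈ orbit γ₀ → u 1 = u 0 →
      mag stdTwoForm m (z 1).1 ≠ mag stdTwoForm m (z 0).1 → ∃ s, act g σ k m (z 0) + δ ≤ act g σ k m (z s) := by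
  have hml : m ∈ lattice := hm ▸ cls_mem _
  obtain ⟨z₀, hz₀⟩ : ∃ z₀, IsLift z₀ γ₀.1 := ⟨_, isLift_sec 0 _⟩
  have hz₀m : total z₀.1.2 = m := hz₀.total_eq.trans hm
  set a₀ := mag stdTwoForm m z₀.1 with ha₀
  have hrot : ∀ ψ, mag stdTwoForm m (rot ψ z₀).1 = a₀ := fun ψ => by
    rw [ha₀, ← hz₀m]; exact mag_std_rot z₀ ψ
  have hp0 : 0 < period γ₀ := γ₀.2
  -- The last condition confines the enclosed area, modulo integers, to within 1/4 of its constant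
  -- value on the circle; the others are the hypotheses of `exists_sphere_bound` and hold near each
  -- point of the circle.
  let S : Set FreeLoop := {γ | γ ∈ P.domain ∧ localAction g P k γ₀ ≤ localAction g P k γ ∧ period γ ≤ B ∧
    period γ₀ / 2 ≤ period γ ∧ ‖γ.1.1.1.2‖ ≤ ‖γ₀.1.1.1.2‖ + 1 ∧ cls γ.1 = m ∧ γ ∈ O ∧
    ∃ z, IsLift z γ.1 ∧ |mag stdTwoForm m z.1 - a₀| < 1 / 4}
  have hCS : orbit γ₀ ⊆ interior S := by
    rintro _ ⟨ψ, rfl⟩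
    have hlift := hz₀.rot ψ
    have hdom := shift_mem_domain hγ ψ
    have hcont : Continuous fun γ : FreeLoop => ‖γ.1.1.1.2‖ := by fun_prop
    have hper : Continuous period := by unfold period; fun_prop
    have e1 : ∀ᶠ γ in 𝓝 (shift ψ γ₀), γ ∈ P.domain := isOpen_domain.mem_nhds hdom
    have e2 : ∀ᶠ γ in 𝓝 (shift ψ γ₀), localAction g P k γ₀ ≤ localAction g P k γ := by
      have := isLocalMin_shift hγ hmin ψ
      rw [IsLocalMin, IsMinFilter, localAction_shift hγ] at this
      exact this
    have e3 : ∀ᶠ γ in 𝓝 (shift ψ γ₀), period γ < B := hper.continuousAt.eventually_lt_const hB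
    have e4 : ∀ᶠ γ in 𝓝 (shift ψ γ₀), period γ₀ / 2 < period γ :=
      hper.continuousAt.eventually_const_lt (show period γ₀ / 2 < period γ₀ by linarith)
    have e5 : ∀ᶠ γ : FreeLoop in 𝓝 (shift ψ γ₀), ‖γ.1.1.1.2‖ < ‖γ₀.1.1.1.2‖ + 1 :=
      hcont.continuousAt.eventually_lt_const (by
        change ‖rotV ψ γ₀.1.1.1.2‖ < _
        rw [norm_rotV]; linarith)
    have e6 : ∀ᶠ γ : FreeLoop in 𝓝 (shift ψ γ₀), cls γ.1 = cls (shift ψ γ₀).1 :=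
      continuous_subtype_val.continuousAt.eventually (eventually_cls_eq _)
    have e7 : ∀ᶠ γ in 𝓝 (shift ψ γ₀), γ ∈ O := hO.mem_nhds (hγO ⟨ψ, rfl⟩)
    have e8 : ∀ᶠ γ : FreeLoop in 𝓝 (shift ψ γ₀), |mag stdTwoForm m (sec (corner (rot ψ z₀).1.1) γ.1).1 - a₀| < 1 / 4 := by
      have t1 : Tendsto (fun γ : FreeLoop => sec (corner (rot ψ z₀).1.1) γ.1) (𝓝 (shift ψ γ₀)) (𝓝 (rot ψ z₀)) :=
        hlift.tendsto_sec.comp continuous_subtype_val.continuousAt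
      have t2 := (continuousAt_mag stdTwoForm hlift.mem).2
      rw [show total (rot ψ z₀).1.2 = m from (total_rotV ψ _).trans hz₀m] at t2
      have t3 := ((t2.tendsto.comp t1).sub_const a₀).abs
      rw [hrot ψ, sub_self, abs_zero] at t3
      exact t3.eventually_lt_const (by norm_num)
    refine mem_interior_iff_mem_nhds.2 ?_
    filter_upwards [e1, e2, e3, e4, e5, e6, e7, e8] with γ h1 h2 h3 h4 h5 h6 h7 h8
    exact ⟨h1, h2, h3.le, h4.le, h5.le, h6.trans ((cls_shift ψ γ₀).trans hm), h7, _, isLift_sec _ _, h8⟩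
  have hS : interior S ⊆ S := interior_subset
  obtain ⟨r, hr, hrG, δ, hδ, hsph⟩ := exists_sphere_bound (g := g) (P := P) hk h0 (half_pos hp0)
    (add_nonneg (norm_nonneg (γ₀.1.1.1.2)) zero_le_one) (isCompact_orbit γ₀) ⟨γ₀, mem_orbit_self γ₀⟩ isOpen_interior hCS
    (fun γ h => (hS h).1) (fun γ h => (hS h).2.1) (fun γ h => (hS h).2.2.1) (fun γ h => (hS h).2.2.2.1)
    (fun γ h => (hS h).2.2.2.2.1) (fun γ h => (hS h).2.2.2.2.2.1)
    (fun γ h hzero => hiso γ (hS h).2.2.2.2.2.2.1 (hS h).2.2.2.2.2.1 (hS h).2.2.1 hzero)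
  refine ⟨δ, hδ, fun u z hz hl ht hu0 hu1 hmag => ?_⟩
  have hclsu : ∀ s, cls (u s).1 = m := fun s => (hl s).total_eq.symm.trans (ht s)
  have hd0 : Metric.infDist (u 0) (orbit γ₀) = 0 := Metric.infDist_zero_of_mem hu0
  have hdc : Continuous fun s => Metric.infDist (u s) (orbit γ₀) := (Metric.continuous_infDist_pt _).comp u.continuous
  -- A path that stays in the ball has area increments within 1/4 of the integers, hence below 1/2
  -- by continuity. The total increment is an integer, so it would be zero.
  by_cases hall : ∀ s, Metric.infDist (u s) (orbit γ₀) ≤ r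
  · exfalso
    obtain ⟨ψ, hψ⟩ := hu0
    have hl0 : IsLift (rot ψ z₀) (u 0).1 := hψ ▸ hz₀.rot ψ
    obtain ⟨n₀, hn₀⟩ := mag_std_sub_mem_int hml hl0 (hl 0) (hclsu 0)
    rw [hrot] at hn₀
    have hcm : Continuous fun s => mag stdTwoForm m (z s).1 := continuous_iff_continuousAt.2 fun s => by
      have := (continuousAt_mag stdTwoForm (hl s).mem).2
      rw [ht s] at this
      exact ContinuousAt.comp (g := fun z : Lifted => mag stdTwoForm m z.1) this hz.continuousAt
    have hlt := abs_lt_of_forall_near_int (A := fun s => mag stdTwoForm m (z s).1 - mag stdTwoForm m (z 0).1)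
      (hcm.sub continuous_const) (sub_self _) (fun s => by
        obtain ⟨-, -, -, -, -, -, -, z', hz', hlt'⟩ := hS (hrG _ (hall s))
        obtain ⟨n₁, hn₁⟩ := mag_std_sub_mem_int hml hz' (hl s) (hclsu s)
        refine ⟨n₁ - n₀, ?_⟩
        push_cast
        rw [← hn₁, ← hn₀]
        convert hlt' using 2
        ring) 1
    have hl1 : IsLift (z 1) (u 0).1 := hu1 ▸ hl 1
    obtain ⟨n₂, hn₂⟩ := mag_std_sub_mem_int hml (hl 0) hl1 (hclsu 0)
    simp only [hn₂] at hlt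
    have h3 : n₂ = 0 := by
      have h4 : |(n₂ : ℝ)| < 1 := by linarith
      rw [← Int.cast_abs] at h4
      exact Int.abs_lt_one_iff.1 (by exact_mod_cast h4)
    rw [h3, Int.cast_zero, sub_eq_zero] at hn₂
    exact hmag hn₂
  · push Not at hall
    obtain ⟨s₁, hs₁⟩ := hall
    have hK : IsClosed {s | r ≤ Metric.infDist (u s) (orbit γ₀)} := isClosed_le continuous_const hdc
    -- At the first time on the sphere the whole initial piece lies in the domain of the local
    -- action, so the increment of `act` is that of the local action.
    obtain ⟨s₀, hs₀, hleast⟩ := hK.isCompact.exists_isLeast ⟨s₁, hs₁.le⟩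
    have hlt : ∀ s < s₀, Metric.infDist (u s) (orbit γ₀) < r := fun s hs => by
      by_contra hcon
      exact absurd (hleast (not_lt.1 hcon)) (not_le.2 hs)
    have heq : Metric.infDist (u s₀) (orbit γ₀) = r := by
      obtain ⟨s, hs, hsr⟩ := intermediate_value_Icc (show (0 : unitInterval) ≤ s₀ from unitInterval.nonneg s₀) hdc.continuousOn
        (show r ∈ Icc _ _ from ⟨by simp only [hd0]; exact hr.le, hs₀⟩)
      rcases hs.2.lt_or_eq with h | h
      · exact absurd hsr (hlt s h).ne
      · rw [← h]; exact hsr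
    refine ⟨s₀, ?_⟩
    have h1 := localAction_sub_eq (g := g) (P := P) (k := k) hz hl ht (s₀ := s₀) (fun s hs => by
      refine (hS (hrG _ ?_)).1
      rcases hs.lt_or_eq with h | h
      · exact (hlt s h).le
      · rw [h]; exact heq.le)
    have h2 := hsph _ heq
    obtain ⟨ψ, hψ⟩ := hu0
    rw [← hψ] at h1
    simp only [localAction_shift hγ] at h1
    linarith

end Barriers

/-! ### Local minimizers in the well -/

section Well

variable {σ : TwoForm} {g : RiemannianMetric} {P : PuncturedPrimitive σ} {k k₀ : ℝ} {α : FreeLoop} {U : Set FreeLoop}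

theorem continuous_period : Continuous period := by unfold period; fun_prop

theorem minimizers_subset_closure : minimizers g P U k ⊆ closure U := closure_mono fun _ h => h.1

theorem IsWell.closure_subset_domain (hU : IsWell g P k₀ α U) : closure U ⊆ P.domain := by
  rw [closure_eq_self_union_frontier]
  exact union_subset hU.subset_domain hU.frontier_subset

theorem IsWell.cls_eq (hU : IsWell g P k₀ α U) {β : FreeLoop} (hβ : β ∈ closure U) : cls β.1 = cls α.1 := by
  have hc : IsClosed {β : FreeLoop | cls β.1 = cls α.1} :=
    isClosed_eq (continuous_cls.comp continuous_subtype_val) continuous_const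
  exact closure_minimal (fun β h => mem_connectedComponent_iff.1 (hU.subset_component h)) hc hβ

theorem IsWell.bddAbove_period (hU : IsWell g P k₀ α U) : BddAbove (period '' U) := by
  have hl : LipschitzWith 1 period := LipschitzWith.mk_one fun γ γ' => le_max_right _ _
  exact (hl.isBounded_image hU.bounded).bddAbove

theorem IsWell.period_le (hU : IsWell g P k₀ α U) {β : FreeLoop} (hβ : β ∈ closure U) :
    period β ≤ sSup (period '' U) :=
  closure_minimal (fun _ h => le_csSup hU.bddAbove_period (mem_image_of_mem _ h))
    (isClosed_le continuous_period continuous_const) hβ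

/-- Iterates of local minimizers are again local minimizers and hence zeros; vanishing of the slope
is a closed condition and passes to the closure. -/
theorem isZero_iterate_of_mem_minimizers (hU : IsWell g P k₀ α U) (hk : 0 < k) (n : ℕ+) {β : FreeLoop}
    (hβ : β ∈ minimizers g P U k) : IsZero g σ k (iterate n β) := by
  have hc : IsClosed {β : FreeLoop | IsZero g σ k (iterate n β)} := by
    simp only [isZero_iff_slope]
    exact isClosed_eq ((continuous_slope g σ k).comp (continuous_iterate n)) continuous_const
  refine closure_minimal (fun β h => ?_) hc hβ
  have hd := hU.subset_domain h.1
  exact isZero_of_isLocalMin (iterate_mem_domain.2 hd) (isLocalMin_iterate hk hd h.2 n)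

theorem orbit_iterate_mem_circlesBelow (hU : IsWell g P k₀ α U) (hk : 0 < k) (n : ℕ+) {B : ℝ}
    (hB : ((n : ℕ) : ℝ) * sSup (period '' U) ≤ B) {β : FreeLoop} (hβ : β ∈ minimizers g P U k) :
    orbit (iterate n β) ∈ circlesBelow g σ α n k B := by
  have hcl := minimizers_subset_closure hβ
  refine ⟨⟨_, isZero_iterate_of_mem_minimizers hU hk n hβ, rfl⟩, fun γ hγ => ⟨?_, ?_⟩⟩
  · rw [mem_component, cls_of_mem_orbit hγ, cls_iterate, hU.cls_eq hcl]
  · change period γ ≤ B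
    rw [period_of_mem_orbit hγ]
    refine le_trans ?_ hB
    change ((n : ℕ) : ℝ) * period β ≤ _
    gcongr
    exact hU.period_le hcl

/-- A genuine local minimizer close to β has its n-th iterate in the isolating neighborhood of the
circle of the n-th iterate of β, so the two circles coincide. As iteration is injective, β is a
rotation of that minimizer. -/
theorem isLocalMin_of_mem_minimizers (hU : IsWell g P k₀ α U) (hk : 0 < k) (n : ℕ+) {B : ℝ}
    (hB : ((n : ℕ) : ℝ) * sSup (period '' U) ≤ B) (hd : IsDiscreteFamily (circlesBelow g σ α n k B)) {β : FreeLoop}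
    (hβ : β ∈ minimizers g P U k) : IsLocalMin (localAction g P k) β := by
  obtain ⟨O, hO, hβO, hiso⟩ := hd _ (orbit_iterate_mem_circlesBelow hU hk n hB hβ)
  have hnhds : iterate n ⁻¹' O ∈ 𝓝 β := (continuous_iterate n).continuousAt.preimage_mem_nhds
    (hO.mem_nhds (hβO (mem_orbit_self _)))
  obtain ⟨β', h1, h2⟩ := mem_closure_iff_nhds.1 hβ _ hnhds
  have h3 : orbit (iterate n β') = orbit (iterate n β) := by
    by_contra hne
    exact disjoint_left.1 (hiso _ (orbit_iterate_mem_circlesBelow hU hk n hB (subset_closure h2)) hne)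
      (mem_orbit_self _) h1
  obtain ⟨ψ, hψ⟩ : iterate n β ∈ orbit (iterate n β') := h3 ▸ mem_orbit_self _
  simp only [shift_iterate] at hψ
  rw [← iterate_injective n hψ]
  exact isLocalMin_shift (hU.subset_domain h2.1) h2.2 _

end Well

/-! ### Deformation along the gradient -/

section Deformation

variable {σ : TwoForm} {g : RiemannianMetric} {k : ℝ} {m : Plane}

/-- The first stage of the deformation: increase the period where it is far too small for the energy. -/
def stretch (g : RiemannianMetric) (k : ℝ) (z : Lifted) : Lifted :=
  (z.1, max z.2 (min √(kin g z.1 / (2 * k)) (z.2 + 1 / 2)))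

theorem continuous_stretch : Continuous (stretch g k) := by
  have h : Continuous (kin g) := continuous_iff_continuousAt.2 fun x => (hasFDerivAt_kin g x).continuousAt
  unfold stretch
  fun_prop

theorem le_stretch (z : Lifted) : z.2 ≤ (stretch g k z).2 := le_max_left _ _

theorem stretch_le (z : Lifted) : (stretch g k z).2 ≤ z.2 + 1 / 2 :=
  max_le (by linarith) (min_le_right _ _)

theorem div_add_sub_div_add (K : ℝ) {T T' : ℝ} (h : T ≠ 0) (h' : T' ≠ 0) :
    (K / T + k * T) - (K / T' + k * T') = (T' - T) * (K / (T * T') - k) := by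
  field_simp; ring

/-- With e the kinetic energy, passing from T to T' changes the action by −(T' − T)(e/(TT') − k),
and the last factor is at least k as long as T' ≤ √(e/(2k)). Either the threshold is reached, so
that e ≤ 2kT'², or the period has grown by the full 1/2 and the action has dropped by k/2. -/
theorem act_stretch (hk : 0 < k) {z : Lifted} (hT : 0 < z.2) :
    act g σ k m (stretch g k z) ≤ act g σ k m z ∧
      (kin g z.1 ≤ 2 * k * (stretch g k z).2 ^ 2 ∨ act g σ k m (stretch g k z) ≤ act g σ k m z - k / 2) := by
  set T' := (stretch g k z).2 with hT'
  set K := kin g z.1 with hK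
  have hK0 : 0 ≤ K := kin_nonneg _
  have hle : z.2 ≤ T' := le_stretch z
  have hT0 : 0 < T' := hT.trans_le hle
  have e : act g σ k m z - act g σ k m (stretch g k z) = (T' - z.2) * (K / (z.2 * T') - k) := by
    rw [← div_add_sub_div_add K hT.ne' hT0.ne']
    simp only [act]
    change K / z.2 + k * z.2 + mag σ m z.1 - (K / T' + k * T' + mag σ m z.1) = _
    ring
  have hsq : √(K / (2 * k)) ^ 2 = K / (2 * k) := Real.sq_sqrt (by positivity)
  rcases hle.eq_or_lt with h | h
  · refine ⟨by rw [← h, sub_self, zero_mul] at e; linarith, Or.inl ?_⟩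
    have h1 : √(K / (2 * k)) ≤ z.2 := by
      by_contra hcon
      push Not at hcon
      have : z.2 < T' := lt_max_of_lt_right (lt_min hcon (by linarith))
      linarith
    have h2 : K / (2 * k) ≤ T' ^ 2 := by
      rw [← hsq, ← h]
      exact pow_le_pow_left₀ (Real.sqrt_nonneg _) h1 2
    rw [div_le_iff₀ (by positivity)] at h2
    linarith
  · have h1 : T' = min √(K / (2 * k)) (z.2 + 1 / 2) := by
      rcases max_choice z.2 (min √(K / (2 * k)) (z.2 + 1 / 2)) with h2 | h2
      · exact absurd (show T' = z.2 from h2) h.ne'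
      · exact h2
    have h3 : 2 * k * T' ^ 2 ≤ K := by
      have h4 : T' ≤ √(K / (2 * k)) := h1 ▸ min_le_left _ _
      have h5 := pow_le_pow_left₀ hT0.le h4 2
      rw [hsq, le_div_iff₀ (by positivity)] at h5
      linarith
    have h6 : k ≤ K / (z.2 * T') - k := by
      have : 2 * k ≤ K / (z.2 * T') := by
        rw [le_div_iff₀ (by positivity)]
        refine le_trans ?_ h3
        rw [sq]
        gcongr
      linarith
    refine ⟨by have := mul_nonneg (sub_nonneg.2 hle) (hk.le.trans h6); linarith, ?_⟩
    rcases min_choice √(K / (2 * k)) (z.2 + 1 / 2) with h2 | h2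
    · left
      rw [h1, h2, hsq]
      exact le_of_eq (by field_simp)
    · right
      have h7 : T' - z.2 = 1 / 2 := by rw [h1, h2]; ring
      rw [h7] at e
      linarith

/-- At a zero the period component gives kinetic energy kT², well within the threshold 2kT². -/
theorem stretch_eq_self (hk : 0 < k) {z : Lifted} (hT : 0 < z.2) (h : sizeSq (act' g σ k z) = 0) : stretch g k z = z := by
  have h1 := abs_partT_le (act' g σ k z)
  rw [h, Real.sqrt_zero] at h1
  have h2 := abs_nonpos_iff.1 h1
  rw [partT_act', sub_eq_zero] at h2
  have h3 : kin g z.1 = k * z.2 ^ 2 := by rw [h2]; field_simp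
  refine Prod.ext rfl (max_eq_left ((min_le_left _ _).trans ?_))
  rw [h3, Real.sqrt_le_left hT.le]
  rw [show k * z.2 ^ 2 / (2 * k) = z.2 ^ 2 / 2 by field_simp]
  linarith [sq_nonneg z.2]

/-- Pushing down a path along which the period is bounded near the top level: in the end only loops close to the zeros of
the action form remain near that level. -/
theorem exists_deformation (hk : 0 < k) (hm : m ∈ lattice) (h0 : m ≠ 0) (T : ℝ) {W : Set FreeLoop} (hW : IsOpen W)
    (h : ∀ γ : FreeLoop, cls γ.1 = m → period γ ≤ T + 3 → IsZero g σ k γ → γ ∈ W) :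
    ∃ μ > 0, ∀ (c ν : ℝ), 0 < ν → ν ≤ μ → ∀ z : unitInterval → Lifted, Continuous z → (∀ s, total (z s).1.2 = m) →
      (∀ s, 0 < (z s).2) → (∀ s, act g σ k m (z s) ≤ c + μ) → (∀ s, c - ν < act g σ k m (z s) → (z s).2 ≤ T + 2) →
      ∃ z' : unitInterval → Lifted, Continuous z' ∧ (∀ s, total (z' s).1.2 = m) ∧ (∀ s, 0 < (z' s).2) ∧
        (∀ s, sizeSq (act' g σ k (z s)) = 0 → z' s = z s) ∧ (∀ s, act g σ k m (z' s) ≤ act g σ k m (z s)) ∧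
        ∀ s, c - ν / 2 < act g σ k m (z' s) → ∀ γ : FreeLoop, IsLift (z' s) γ.1 → γ ∈ W := by
  obtain ⟨δ, hδ, hslope⟩ := exists_slope_lt_imp hk h0 (T + 3) hW h
  obtain ⟨a, R, ha, hR, hbd⟩ := exists_period_bounds (g := g) (by positivity : 0 < 2 * k) hm h0 (T + 3)
  obtain ⟨ε, hε, hstep⟩ := exists_step g σ k hm hR.le ha (half_pos hδ)
  -- The first bound sends the loops that lose k/2 under stretching below c − ν; the second makes a
  -- gradient step at slope δ cross the whole band from c + μ to c − ν/2.
  refine ⟨min (k / 8) (ε * δ / 8), by positivity, fun c ν hν hνμ z hz ht hT hle hper => ?_⟩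
  set μ := min (k / 8) (ε * δ / 8)
  have hμ1 : μ ≤ k / 8 := min_le_left _ _
  have hμ2 : μ ≤ ε * δ / 8 := min_le_right _ _
  let y : unitInterval → Lifted := fun s => stretch g k (z s)
  have hy : Continuous y := continuous_stretch.comp hz
  have hyt : ∀ s, total (y s).1.2 = m := ht
  have hyT : ∀ s, 0 < (y s).2 := fun s => (hT s).trans_le (le_stretch _)
  have hyc : Continuous fun s => act g σ k m (y s) := continuous_iff_continuousAt.2 fun s => by
    have h1 := continuousAt_act (g := g) (σ := σ) (k := k) (z := y s) (by rw [hyt]; exact hm) (hyT s).ne'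
    rw [hyt] at h1
    exact ContinuousAt.comp (g := act g σ k m) h1 hy.continuousAt
  have hXc : Continuous fun s => dualVec (act' g σ k (y s)) := continuous_iff_continuousAt.2 fun s =>
    continuous_dualVec.continuousAt.comp (ContinuousAt.comp (g := act' g σ k) (continuousAt_act' g σ k (hyT s)) hy.continuousAt)
  -- The cutoff vanishes below level c − ν, where there is no control of the period, and equals one
  -- above c − ν/2.
  let χ : unitInterval → ℝ := fun s => max 0 (min 1 ((act g σ k m (y s) - (c - ν)) / (ν / 2)))
  have hχc : Continuous χ := by
    refine continuous_const.max (continuous_const.min ?_)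
    exact (hyc.sub continuous_const).div_const _
  have hχ0 : ∀ s, 0 ≤ χ s := fun s => le_max_left _ _
  have hχ1 : ∀ s, χ s ≤ 1 := fun s => max_le zero_le_one (min_le_left _ _)
  have hact : ∀ s, c - ν < act g σ k m (y s) → (y s).2 ≤ T + 3 ∧ a ≤ (y s).2 ∧ ‖(y s).1.2‖ ≤ R := fun s hs => by
    obtain ⟨h1, h2⟩ := act_stretch (g := g) (σ := σ) (m := m) hk (hT s)
    have h3 : (y s).2 ≤ T + 3 := by
      have := stretch_le (g := g) (k := k) (z s)
      have := hper s (hs.trans_le h1)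
      change (stretch g k (z s)).2 ≤ _
      linarith
    rcases h2 with h2 | h2
    · exact ⟨h3, hbd _ (hyt s) (hyT s) h3 h2⟩
    · exfalso
      have := hle s
      change c - ν < act g σ k m (stretch g k (z s)) at hs
      linarith
  have hχpos : ∀ s, χ s ≠ 0 → c - ν < act g σ k m (y s) := fun s hs => by
    by_contra hcon
    push Not at hcon
    refine hs (max_eq_left ((min_le_right _ _).trans ?_))
    exact div_nonpos_of_nonpos_of_nonneg (by linarith) (by positivity)
  let z' : unitInterval → Lifted := fun s => y s - (χ s * ε) • dualVec (act' g σ k (y s))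
  have hst : ∀ s, χ s ≠ 0 → _ := fun s hs =>
    hstep (y s) (hyt s) (hact s (hχpos s hs)).2.2 (hact s (hχpos s hs)).2.1 (χ s * ε)
      ⟨mul_nonneg (hχ0 s) hε.le, mul_le_of_le_one_left hε.le (hχ1 s)⟩
  have hz'0 : ∀ s, χ s = 0 → z' s = y s := fun s hs => by simp only [z', hs, zero_mul, zero_smul, sub_zero]
  have hle1 : ∀ s, act g σ k m (z' s) ≤ act g σ k m (y s) := fun s => by
    by_cases h1 : χ s = 0
    · rw [hz'0 s h1]
    · refine (hst s h1).2.2.2.trans ?_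
      have := mul_nonneg (mul_nonneg (hχ0 s) hε.le) (sizeSq_nonneg (act' g σ k (y s)))
      linarith
  refine ⟨z', hy.sub ((hχc.mul continuous_const).smul hXc), fun s => ?_, fun s => ?_, fun s hs => ?_,
    fun s => (hle1 s).trans (act_stretch (g := g) (σ := σ) (m := m) hk (hT s)).1, fun s hs γ hγ => ?_⟩
  · change total ((y s).1.2 - (χ s * ε) • (dualVec (act' g σ k (y s))).1.2) = m
    rw [map_sub, map_smul, show total (dualVec (act' g σ k (y s))).1.2 = 0 from isTangent_dualVec _, smul_zero, sub_zero, hyt]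
  · by_cases h1 : χ s = 0
    · rw [hz'0 s h1]; exact hyT s
    · exact (hst s h1).2.1
  · have h1 : y s = z s := stretch_eq_self hk (hT s) hs
    -- At a zero the stretching is trivial and the gradient vanishes, so neither stage moves the
    -- point, whatever the value of the cutoff.
    have h2 : dualVec (act' g σ k (z s)) = 0 := by
      have := norm_dualVec_sq_le (act' g σ k (z s))
      rw [hs] at this
      exact norm_eq_zero.1 (pow_eq_zero_iff two_ne_zero |>.1 (le_antisymm this (sq_nonneg _)))
    simp only [z', h1, h2, smul_zero, sub_zero]
  · have hle1 := hle1 s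
    have h1 : χ s = 1 := by
      have h2 : 1 ≤ (act g σ k m (y s) - (c - ν)) / (ν / 2) := by
        rw [le_div_iff₀ (by positivity)]; linarith
      simp only [χ, min_eq_left h2, max_eq_right zero_le_one]
    obtain ⟨b1, -, -, b4⟩ := hst s (by rw [h1]; exact one_ne_zero)
    rw [h1, one_mul] at b1 b4
    have hz' : z' s = y s - ε • dualVec (act' g σ k (y s)) := by simp only [z', h1, one_mul]
    rw [← hz'] at b4
    have hb := hact s (by linarith)
    have hyl := isLift_ofLift (y s) (by rw [hyt]; exact hm) (hyT s)
    refine hslope (ofLift (y s) (by rw [hyt]; exact hm) (hyT s)) γ (hyl.total_eq.symm.trans (hyt s)) hb.1 ?_ ?_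
    · rw [slope_eq _ _ _ hyl]
      have h5 := (act_stretch (g := g) (σ := σ) (m := m) hk (hT s)).1
      have h6 := hle s
      change act g σ k m (y s) ≤ _ at h5
      -- The point ended above c − ν/2 and started below c + μ, so half of ε times the slope is less
      -- than μ + ν/2 ≤ 3εδ/16.
      have h7 : ε * sizeSq (act' g σ k (y s)) < ε * δ := by nlinarith
      exact lt_of_mul_lt_mul_left h7 hε.le
    · refine (dist_le_of_isLift hyl hγ).trans_lt ?_
      rw [hz', sub_sub_cancel]
      linarith

end Deformation

/-! ### Minimax classes in terms of lifts -/

section MinimaxClass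

variable {σ : TwoForm} {g : RiemannianMetric} {P : PuncturedPrimitive σ} {k k₀ : ℝ} {α : FreeLoop} {U : Set FreeLoop} {n : ℕ+}

theorem continuous_act_comp {m : Plane} (hm : m ∈ lattice) {z : unitInterval → Lifted} (hz : Continuous z)
    (ht : ∀ s, total (z s).1.2 = m) (hT : ∀ s, 0 < (z s).2) : Continuous fun s => act g σ k m (z s) :=
  continuous_iff_continuousAt.2 fun s => by
    have h1 := continuousAt_act (g := g) (σ := σ) (k := k) (z := z s) (by rw [ht]; exact hm) (hT s).ne'
    rw [ht] at h1
    exact ContinuousAt.comp (g := act g σ k m) h1 hz.continuousAt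

theorem actionAlong_eq {m : Plane} (u : C(unitInterval, FreeLoop)) {z : unitInterval → Lifted} (hz : Continuous z)
    (hl : ∀ s, IsLift (z s) (u s).1) (ht : ∀ s, total (z s).1.2 = m) (s : unitInterval) :
    actionAlong g P k u s = localAction g P k (u 0) + (act g σ k m (z s) - act g σ k m (z 0)) := by
  rw [actionAlong, (isRepresented_actionForm g σ k).pathIntegral_eq u hz hl, ← (hl 0).total_eq, ht]

theorem exists_mem_minimaxClass {m : Plane} (hm : m = ((n : ℕ) : ℝ) • cls α.1) {z : unitInterval → Lifted}
    (hz : Continuous z) (ht : ∀ s, total (z s).1.2 = m) (hT : ∀ s, 0 < (z s).2) {β : FreeLoop}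
    (hβ : β ∈ minimizers g P U k) (h0 : IsLift (z 0) (iterate n β).1) (h1 : IsLift (z 1) (iterate n β).1)
    (hmag : mag stdTwoForm m (z 1).1 ≠ mag stdTwoForm m (z 0).1) :
    ∃ u ∈ minimaxClass g P α U n k, u 0 = iterate n β ∧ ∀ s, IsLift (z s) (u s).1 := by
  have hml : ∀ s, total (z s).1.2 ∈ lattice := fun s => by
    rw [ht, ← ht 0]; exact h0.mem
  let u : C(unitInterval, FreeLoop) := ⟨fun s => ofLift (z s) (hml s) (hT s), continuous_ofLift hz hml hT⟩
  have hl : ∀ s, IsLift (z s) (u s).1 := fun s => isLift_ofLift _ _ _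
  have e0 : u 0 = iterate n β := Subtype.ext ((hl 0).eq h0)
  have e1 : u 1 = iterate n β := Subtype.ext ((hl 1).eq h1)
  refine ⟨u, ⟨fun s => ?_, e0.trans e1.symm, ⟨β, hβ, e0.symm⟩, ?_⟩, e0, hl⟩
  · rw [mem_component, ← hm, ← (hl s).total_eq, ht]
  · rw [(isRepresented_transgression stdTwoForm).pathIntegral_eq u hz hl, ← (hl 0).total_eq, ht]
    exact sub_ne_zero.2 hmag

theorem exists_lift_of_mem_minimaxClass {m : Plane} (hm : m = ((n : ℕ) : ℝ) • cls α.1) {u : C(unitInterval, FreeLoop)}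
    (hu : u ∈ minimaxClass g P α U n k) {z₀ : Lifted} (h₀ : IsLift z₀ (u 0).1) :
    ∃ z : unitInterval → Lifted, Continuous z ∧ z 0 = z₀ ∧ (∀ s, IsLift (z s) (u s).1) ∧ (∀ s, total (z s).1.2 = m) ∧
      mag stdTwoForm m (z 1).1 ≠ mag stdTwoForm m (z 0).1 := by
  obtain ⟨z, hz, hz0, hl⟩ := exists_continuous_lift u h₀
  have ht : ∀ s, total (z s).1.2 = m := fun s => by
    rw [(hl s).total_eq, hm]; exact mem_component.1 (hu.1 s)
  refine ⟨z, hz, hz0, hl, ht, ?_⟩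
  have h := hu.2.2.2
  rw [(isRepresented_transgression stdTwoForm).pathIntegral_eq u hz hl, ← (hl 0).total_eq, ht] at h
  exact sub_ne_zero.1 h

/-- Translation of a lift by a vector of the plane. -/
def translate (w : Plane) (z : Lifted) : Lifted := ((z.1.1 + w, z.1.2), z.2)

theorem continuous_translate : Continuous fun p : Plane × Lifted => translate p.1 p.2 := by
  unfold translate; fun_prop

/-- Translating the loop along the lattice vector w = (−m¹, m⁰) closes up on the torus and changes
the enclosed area by −((m⁰)² + (m¹)²), which is non-zero for m ≠ 0. -/
theorem minimaxClass_nonempty {m : Plane} (hm : m = ((n : ℕ) : ℝ) • cls α.1) (h0 : m ≠ 0) {β : FreeLoop}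
    (hβ : β ∈ minimizers g P U k) (hc : cls β.1 = cls α.1) : (minimaxClass g P α U n k).Nonempty := by
  obtain ⟨z₀, hz₀⟩ : ∃ z₀, IsLift z₀ (iterate n β).1 := ⟨_, isLift_sec 0 _⟩
  have ht : total z₀.1.2 = m := by rw [hz₀.total_eq, cls_iterate, hc, hm]
  have hml : m ∈ lattice := ht ▸ hz₀.mem
  let w : Plane := WithLp.toLp 2 ![-m 1, m 0]
  have hw : w ∈ lattice := by
    intro i
    obtain ⟨a, ha⟩ := hml 0
    obtain ⟨b, hb⟩ := hml 1
    fin_cases i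
    · exact ⟨-b, by simp [w, hb]⟩
    · exact ⟨a, by simp [w, ha]⟩
  let z : unitInterval → Lifted := fun s => translate ((s : ℝ) • w) z₀
  have e0 : z 0 = z₀ := by simp [z, translate]
  have e1 : z 1 = ((z₀.1.1 + w, z₀.1.2), z₀.2) := by simp [z, translate]
  obtain ⟨u, hu, -⟩ := exists_mem_minimaxClass hm (z := z)
    (continuous_translate.comp (by fun_prop : Continuous fun s : unitInterval => ((s : ℝ) • w, z₀)))
    (fun _ => ht) (fun _ => hz₀.pos) hβ (e0 ▸ hz₀) (e1 ▸ hz₀.add_lattice hw) (by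
      rw [e0, e1]
      simp only
      rw [mag_translate stdTwoForm m hml z₀.1.1 hw z₀.1.2 ht, flux_stdTwoForm]
      intro h
      have h1 : m 0 ^ 2 + m 1 ^ 2 = 0 := by
        simp [w] at h
        linarith
      refine h0 ?_
      ext i
      fin_cases i
      · simp; nlinarith
      · simp; nlinarith)
  exact ⟨u, hu⟩

theorem act_add (k' : ℝ) (m : Plane) (z : Lifted) : act g σ k' m z = act g σ k m z + (k' - k) * z.2 := by
  simp only [act]; ring

theorem localAction_add (k' : ℝ) {γ : FreeLoop} (hγ : γ ∈ P.domain) :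
    localAction g P k' γ = localAction g P k γ + (k' - k) * period γ := by
  have hz := isLift_sec 0 γ.1
  have hA := (mem_domain_iff hz).1 hγ
  rw [localAction_eq hz hA, localAction_eq hz hA]
  change _ = _ + (k' - k) * (sec 0 γ.1).2
  ring

end MinimaxClass

/-! ### Almost optimal paths with bounded period -/

section AlmostOptimal

variable {σ : TwoForm} {g : RiemannianMetric} {P : PuncturedPrimitive σ} {k k₀ : ℝ} {α : FreeLoop} {U : Set FreeLoop} {n : ℕ+}

theorem actionAlong_le_iSup {m : Plane} (hm : m ∈ lattice) (u : C(unitInterval, FreeLoop)) {z : unitInterval → Lifted}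
    (hz : Continuous z) (hl : ∀ s, IsLift (z s) (u s).1) (ht : ∀ s, total (z s).1.2 = m) (s : unitInterval) :
    actionAlong g P k u s ≤ ⨆ s, actionAlong g P k u s := by
  refine le_ciSup (f := fun s => actionAlong g P k u s) ?_ s
  simp only [actionAlong_eq u hz hl ht]
  exact (isCompact_range (continuous_const.add
    ((continuous_act_comp hm hz ht fun s => (hl s).pos).sub continuous_const))).bddAbove

/-- Concatenation of a path `z₁` with a path `z₂` starting at its end and with a translate of the inverse of `z₁`. -/
theorem exists_conjugate {z₁ z₂ : unitInterval → Lifted} (h₁ : Continuous z₁) (h₂ : Continuous z₂) (h12 : z₂ 0 = z₁ 1)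
    {q : Plane} (hq : z₂ 1 = translate q (z₁ 1)) :
    ∃ z : unitInterval → Lifted, Continuous z ∧ z 0 = z₁ 0 ∧ z 1 = translate q (z₁ 0) ∧
      ∀ s, (∃ t, z s = z₁ t) ∨ (∃ t, z s = z₂ t) ∨ ∃ t, z s = translate q (z₁ t) := by
  let p₁ : Path (z₁ 0) (z₁ 1) := ⟨⟨z₁, h₁⟩, rfl, rfl⟩
  let p₂ : Path (z₁ 1) (translate q (z₁ 1)) := ⟨⟨z₂, h₂⟩, h12, hq⟩
  let p₃ : Path (translate q (z₁ 1)) (translate q (z₁ 0)) :=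
    p₁.symm.map (f := translate q) (continuous_translate.comp (by fun_prop : Continuous fun z : Lifted => (q, z)))
  let p := p₁.trans (p₂.trans p₃)
  refine ⟨p, p.continuous, p.source, p.target, fun s => ?_⟩
  have h : p s ∈ range p := mem_range_self s
  rw [Path.trans_range, Path.trans_range] at h
  rcases h with ⟨t, ht⟩ | ⟨t, ht⟩ | ⟨t, ht⟩
  · exact Or.inl ⟨t, ht.symm⟩
  · exact Or.inr (Or.inl ⟨t, ht.symm⟩)
  · exact Or.inr (Or.inr ⟨unitInterval.symm t, ht.symm⟩)

/-- Near an energy at which the minimax value is Lipschitz there are almost optimal paths along which the period is bounded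
near the top level. -/
theorem exists_path_period_le (hU : IsWell g P k₀ α U) {I : Set ℝ} (hI : IsEnergyInterval g P U k₀ I) (hk : k ∈ I)
    {m : Plane} (hm : m = ((n : ℕ) : ℝ) • cls α.1) (h0 : m ≠ 0) {T : ℝ}
    (hT : ∀ᶠ k' in 𝓝 k, |minimaxValue g P α U n k' - minimaxValue g P α U n k| ≤ T * |k' - k|)
    (hsup : ((n : ℕ) : ℝ) * sSup (period '' U) ≤ T + 2) {θ : ℝ} (hθ : 0 < θ) :
    ∃ ε ∈ Ioo 0 θ, ∃ β ∈ minimizers g P U k, ∃ z : unitInterval → Lifted, Continuous z ∧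
      (∀ s, total (z s).1.2 = m) ∧ (∀ s, 0 < (z s).2) ∧ IsLift (z 0) (iterate n β).1 ∧ IsLift (z 1) (iterate n β).1 ∧
      mag stdTwoForm m (z 1).1 ≠ mag stdTwoForm m (z 0).1 ∧ ∀ s,
        localAction g P k (iterate n β) + (act g σ k m (z s) - act g σ k m (z 0)) ≤ minimaxValue g P α U n k + (T + 1) * ε ∧
        (minimaxValue g P α U n k - ε < localAction g P k (iterate n β) + (act g σ k m (z s) - act g σ k m (z 0)) →
          (z s).2 ≤ T + 2) := by
  obtain ⟨ε, ⟨hε0, hεθ⟩, hεT, hεI⟩ : ∃ ε ∈ Ioo 0 θ,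
      |minimaxValue g P α U n (k + ε) - minimaxValue g P α U n k| ≤ T * |k + ε - k| ∧ k + ε ∈ I := by
    have h1 : Tendsto (fun ε : ℝ => k + ε) (𝓝[>] 0) (𝓝 k) := by
      have : Tendsto (fun ε : ℝ => k + ε) (𝓝 0) (𝓝 (k + 0)) := (by fun_prop : Continuous fun ε : ℝ => k + ε).tendsto 0
      rw [add_zero] at this
      exact this.mono_left nhdsWithin_le_nhds
    have h2 : ∀ᶠ ε : ℝ in 𝓝[>] 0, ε ∈ Ioo 0 θ := Ioo_mem_nhdsGT hθ
    exact (h2.and ((h1.eventually hT).and (h1.eventually (hI.isOpen.mem_nhds hk)))).exists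
  set k' := k + ε with hk'
  set c := minimaxValue g P α U n k with hc
  have hcls : ∀ β ∈ closure U, cls (iterate n β).1 = m := fun β hβ => by rw [cls_iterate, hU.cls_eq hβ, hm]
  have hml : m ∈ lattice := by
    rw [hm, ← cls_iterate]; exact cls_mem _
  rw [show k + ε - k = ε by ring, abs_of_pos hε0] at hεT
  obtain ⟨β₁, hβ₁⟩ := hI.minimizers_nonempty k' hεI
  -- Without this the infimum would be taken over an empty set and have a default value.
  have hne : (minimaxClass g P α U n k').Nonempty :=
    minimaxClass_nonempty hm h0 hβ₁ (hU.cls_eq (minimizers_subset_closure hβ₁))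
  have : Nonempty (minimaxClass g P α U n k') := hne.to_subtype
  obtain ⟨⟨u, hu⟩, hult⟩ := exists_lt_of_ciInf_lt (show minimaxValue g P α U n k' < c + (T + 1) * ε by
    have := (le_abs_self _).trans hεT
    linarith)
  simp only at hult
  obtain ⟨β', hβ', hβ'u⟩ := hu.2.2.1
  obtain ⟨w, hwU, hw0, hw1, hwS⟩ := hI.exists_path k hk k' hεI (by linarith) β' hβ'
  have hdom : ∀ γ ∈ U, iterate n γ ∈ P.domain := fun γ hγ => iterate_mem_domain.2 (hU.subset_domain hγ)
  have hβ'dom : β' ∈ P.domain := hU.closure_subset_domain (minimizers_subset_closure hβ')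
  let v : C(unitInterval, FreeLoop) := ⟨fun s => iterate n (w s), (continuous_iterate n).comp w.continuous⟩
  obtain ⟨z₁, hz₁, -, hl₁⟩ := exists_continuous_lift v (isLift_sec 0 _)
  have ht₁ : ∀ s, total (z₁ s).1.2 = m := fun s => (hl₁ s).total_eq.trans (hcls _ (subset_closure (hwU s)))
  have hv1 : v 1 = u 0 := by rw [← hβ'u, ← hw1]; rfl
  have hlift1 : IsLift (z₁ 1) (u 0).1 := hv1 ▸ hl₁ 1
  obtain ⟨z₂, hz₂, h12, hl₂, ht₂, hmag⟩ := exists_lift_of_mem_minimaxClass hm hu hlift1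
  have hlift2 : IsLift (z₂ 1) (u 0).1 := hu.2.1 ▸ hl₂ 1
  obtain ⟨q, hq, hq1⟩ := hlift1.exists_eq hlift2
  obtain ⟨z, hz, hz0, hz1, hcases⟩ := exists_conjugate hz₁ hz₂ h12 hq1
  have hper1 : ∀ s, (z₁ s).2 ≤ T + 2 := fun s => by
    rw [(hl₁ s).per]
    refine le_trans ?_ hsup
    change ((n : ℕ) : ℝ) * period (w s) ≤ _
    gcongr
    exact hU.period_le (subset_closure (hwU s))
  -- The returning part is a translate of the outgoing one, so its action is shifted by a constant,
  -- the same one as at the endpoint of z₂.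
  have htr : ∀ t, act g σ k m (translate q (z₁ t)) = act g σ k m (z₁ t) + (q 0 * m 1 - q 1 * m 0) * flux σ := fun t =>
    act_translate k m hml _ hq _ (ht₁ t) _
  have e1 : ∀ t, localAction g P k (iterate n (w t)) - localAction g P k (iterate n (w 0)) =
      act g σ k m (z₁ t) - act g σ k m (z₁ 0) := fun t =>
    localAction_sub_eq (u := v) hz₁ hl₁ ht₁ fun s _ => hdom _ (hwU s)
  have hwle : ∀ t, localAction g P k (iterate n (w t)) ≤ localAction g P k (iterate n β') := fun t => by
    rw [localAction_iterate (hU.subset_domain (hwU t)), localAction_iterate hβ'dom]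
    exact mul_le_mul_of_nonneg_left (hwS t) (Nat.cast_nonneg _)
  -- The monotonicity trick: at energy k the action is lower by ε times the period than at energy k
  -- + ε, where the path stays below c + (T + 1)ε.
  have e2 : ∀ t, localAction g P k (iterate n β') + (act g σ k m (z₂ t) - act g σ k m (z₂ 0)) ≤
      c + (T + 1) * ε - ε * (z₂ t).2 := fun t => by
    have h1 := (actionAlong_le_iSup hml u hz₂ hl₂ ht₂ t).trans_lt hult
    rw [actionAlong_eq u hz₂ hl₂ ht₂, ← hβ'u, localAction_add (k := k) k' (iterate_mem_domain.2 hβ'dom), act_add (k := k) k',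
      act_add (k := k) k' m (z₂ 0)] at h1
    have h2 : period (iterate n β') = (z₂ 0).2 := by rw [(hl₂ 0).per, ← hβ'u]; rfl
    rw [h2, show k' - k = ε by rw [hk']; ring] at h1
    linarith
  have e3 : localAction g P k (iterate n β') - localAction g P k (iterate n (w 0)) = act g σ k m (z₁ 1) - act g σ k m (z₁ 0) := by
    rw [← e1 1, hw1]
  have hq2 : act g σ k m (z₂ 1) = act g σ k m (z₁ 1) + (q 0 * m 1 - q 1 * m 0) * flux σ := by
    rw [hq1]; exact htr 1
  have hz₂0 := fun t => mul_nonneg hε0.le (hl₂ t).pos.le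
  have hlift0 : IsLift (z 0) (iterate n (w 0)).1 := hz0 ▸ hl₁ 0
  refine ⟨ε, ⟨hε0, hεθ⟩, w 0, hw0, z, hz, fun s => ?_, fun s => ?_, hlift0, ?_, ?_, fun s => ?_⟩
  · rcases hcases s with ⟨t, ht⟩ | ⟨t, ht⟩ | ⟨t, ht⟩ <;> rw [ht]
    exacts [ht₁ t, ht₂ t, ht₁ t]
  · rcases hcases s with ⟨t, ht⟩ | ⟨t, ht⟩ | ⟨t, ht⟩ <;> rw [ht]
    exacts [(hl₁ t).pos, (hl₂ t).pos, (hl₁ t).pos]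
  · rw [hz1]; exact (hl₁ 0).add_lattice hq
  · rw [hz1, hz0]
    rw [hq1, h12] at hmag
    simp only [translate] at hmag ⊢
    rw [mag_translate stdTwoForm m hml _ hq _ (ht₁ _)] at hmag ⊢
    simpa using hmag
  · rw [hz0]
    rcases hcases s with ⟨t, ht⟩ | ⟨t, ht⟩ | ⟨t, ht⟩ <;> rw [ht]
    · have h1 := e2 0
      rw [h12] at h1
      exact ⟨by linarith [e1 t, hwle t, h12 ▸ hz₂0 0], fun _ => hper1 t⟩
    · have h1 := e2 t
      rw [h12] at h1
      refine ⟨by linarith [hz₂0 t], fun h2 => ?_⟩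
      -- A point above c − ε leaves room for at most (T + 2)ε in the preceding inequality.
      have h3 : ε * (z₂ t).2 ≤ ε * (T + 2) := by linarith
      exact le_of_mul_le_mul_left h3 hε0
    · rw [htr]
      have h1 := e2 1
      rw [h12] at h1
      -- On the conjugating pieces the period is that of n-th iterates of loops in 𝓤, bounded by
      -- hypothesis, and the action does not exceed its value at the corresponding end of z₂.
      exact ⟨by linarith [e1 t, hwle t, hz₂0 1], fun _ => hper1 t⟩

end AlmostOptimal

/-! ### The mountain pass argument -/

section MountainPass

theorem exists_pos_forall_le {J : Type*} [Finite J] {f : J → ℝ} (hf : ∀ j, 0 < f j) : ∃ δ > 0, ∀ j, δ ≤ f j := by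
  have h1 : ∀ᶠ δ : ℝ in 𝓝[>] 0, ∀ j, δ ≤ f j :=
    eventually_all.2 fun j => mem_of_superset (Ioo_mem_nhdsGT (hf j)) fun _ h => h.2.le
  obtain ⟨δ, h, hδ⟩ := (h1.and self_mem_nhdsWithin).exists
  exact ⟨δ, hδ, h⟩

variable {σ : TwoForm} {g : RiemannianMetric} {P₀ : PuncturedPrimitive σ} {k k₀ : ℝ} {α : FreeLoop} {U : Set FreeLoop} {n : ℕ+}

section Family

variable {J : Type*} {γ : J → FreeLoop} {B : ℝ}

theorem isZero_of_orbit_mem_circlesBelow {γ : FreeLoop} (h : orbit γ ∈ circlesBelow g σ α n k B) : IsZero g σ k γ := by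
  obtain ⟨⟨γ', h1, h2⟩, -⟩ := h
  exact h1.of_mem_orbit (h2 ▸ mem_orbit_self γ)

theorem orbit_mem_circlesBelow {γ : FreeLoop} (h : IsZero g σ k γ) (hc : cls γ.1 = ((n : ℕ) : ℝ) • cls α.1)
    (hB : period γ ≤ B) : orbit γ ∈ circlesBelow g σ α n k B :=
  ⟨⟨γ, h, rfl⟩, fun _ h' => ⟨mem_component.2 ((cls_of_mem_orbit h').trans hc), (period_of_mem_orbit h').trans_le hB⟩⟩

/-- Families of vanishing circles with bounded period that have a separating neighborhood are finite. -/
theorem finite_of_isSeparating (hk : 0 < k) (h0 : ((n : ℕ) : ℝ) • cls α.1 ≠ 0) {P : J → PuncturedPrimitive σ}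
    (hr : range (fun j => orbit (γ j)) = circlesBelow g σ α n k B) {W : J → Set FreeLoop} (hW : IsSeparating γ P W) :
    Finite J := by
  have hmem : ∀ j, orbit (γ j) ∈ circlesBelow g σ α n k B := fun j => hr ▸ mem_range_self j
  -- The disjoint sets W j cover the compact set of zeros of bounded period, and each of them
  -- contains a circle that no other one meets; a finite subcover thus uses all indices.
  obtain ⟨t, ht⟩ := (isCompact_zeros (g := g) (σ := σ) hk h0 B).elim_finite_subcover W hW.isOpen fun γ' h' => by
    have h1 := orbit_mem_circlesBelow h'.2.2 h'.1 h'.2.1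
    rw [← hr] at h1
    obtain ⟨j, hj⟩ := h1
    exact mem_iUnion.2 ⟨j, hW.orbit_subset j (show γ' ∈ orbit (γ j) from (show orbit (γ j) = orbit γ' from hj) ▸ mem_orbit_self γ')⟩
  refine Finite.of_surjective (fun j : t => (j : J)) fun j => ?_
  have h2 := (hmem j).2 (mem_orbit_self _)
  obtain ⟨i, hi, h3⟩ := mem_iUnion₂.1 (ht ⟨mem_component.1 h2.1, h2.2, isZero_of_orbit_mem_circlesBelow (hmem j)⟩)
  refine ⟨⟨i, hi⟩, ?_⟩
  by_contra hne
  exact disjoint_left.1 (hW.disjoint i j hne) h3 (hW.orbit_subset j (mem_orbit_self _))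

/-- The increments of the local actions around two zeros agree up to finitely many branches. -/
theorem sub_localAction_mem {P : PuncturedPrimitive σ} {m : Plane} {W : Set FreeLoop} (hW : IsPreconnected W) (hWP : W ⊆ P.domain)
    {γ₁ γ₂ : FreeLoop} (h₁ : γ₁ ∈ P₀.domain) (hm₁ : cls γ₁.1 = m) (h₂ : γ₂ ∈ W) (hm₂ : cls γ₂.1 = m) {γ γ' : FreeLoop}
    (hγ : γ ∈ orbit γ₁) (hγ' : γ' ∈ W) {z z' : Lifted} (hz : IsLift z γ.1) (hz' : IsLift z' γ'.1) (c : ℝ) :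
    (c - (localAction g P₀ k γ + (act g σ k m z' - act g σ k m z)) - (localAction g P k γ₂ - localAction g P k γ'))
      - (c - localAction g P₀ k γ₁ + act g σ k m (sec 0 γ₁.1) - act g σ k m (sec 0 γ₂.1)) ∈ AddSubgroup.zmultiples (flux σ) := by
  have hO : orbit γ₁ ⊆ P₀.domain := by
    rintro _ ⟨ψ, rfl⟩; exact shift_mem_domain h₁ ψ
  have e1 := localAction_sub_act_mem (g := g) (k := k) hW hWP h₂ hγ' (isLift_sec 0 _) hz'
  have e2 := localAction_sub_act_mem (g := g) (k := k) (isConnected_orbit γ₁).isPreconnected hO (mem_orbit_self _) hγ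
    (isLift_sec 0 _) hz
  rw [hm₂] at e1
  rw [hm₁] at e2
  convert sub_mem e1 e2 using 1
  ring

/-- One almost optimal path is deformed once. Its parameter ε is chosen after the barrier height δ,
the branch gap ε₁ and the deformation threshold μ, which depend only on the circles and their
neighborhoods. -/
theorem exists_minimax_path (hU : IsWell g P₀ k₀ α U) {I : Set ℝ} (hI : IsEnergyInterval g P₀ U k₀ I) (hk : k ∈ I)
    (h0 : cls α.1 ≠ 0) {T : ℝ} (hT0 : 0 < T)
    (hT : ∀ᶠ k' in 𝓝 k, |minimaxValue g P₀ α U n k' - minimaxValue g P₀ α U n k| ≤ T * |k' - k|)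
    (hsup : ((n : ℕ) : ℝ) * sSup (period '' U) ≤ T + 2) (hd : IsDiscreteFamily (circlesBelow g σ α n k (T + 3)))
    {P : J → PuncturedPrimitive σ} (hr : range (fun j => orbit (γ j)) = circlesBelow g σ α n k (T + 3))
    {W : J → Set FreeLoop} (hW : IsSeparating γ P W) :
    ∃ u ∈ minimaxClass g P₀ α U n k, ∃ lam : ℝ, 0 < lam ∧
      (actionAlong g P₀ k u 0 ≤ minimaxValue g P₀ α U n k - lam ∧ actionAlong g P₀ k u 1 ≤ minimaxValue g P₀ α U n k - lam) ∧
      ∀ s, minimaxValue g P₀ α U n k - lam < actionAlong g P₀ k u s → ∃ j, u s ∈ W j ∧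
        minimaxValue g P₀ α U n k - actionAlong g P₀ k u s = localAction g (P j) k (γ j) - localAction g (P j) k (u s) := by
  have hk0 : 0 < k := hI.pos k hk
  obtain ⟨m, hm⟩ : ∃ m, m = ((n : ℕ) : ℝ) • cls α.1 := ⟨_, rfl⟩
  have hm0 : m ≠ 0 := by
    rw [hm]; exact smul_ne_zero (Nat.cast_ne_zero.2 n.ne_zero) h0
  have hml : m ∈ lattice := by rw [hm, ← cls_iterate]; exact cls_mem _
  have hfin : Finite J := finite_of_isSeparating hk0 (hm ▸ hm0) hr hW
  have hmem : ∀ j, orbit (γ j) ∈ circlesBelow g σ α n k (T + 3) := fun j => hr ▸ mem_range_self j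
  have hcls : ∀ j, cls (γ j).1 = m := fun j => hm ▸ mem_component.1 ((hmem j).2 (mem_orbit_self _)).1
  set c := minimaxValue g P₀ α U n k with hc
  -- the height of the barriers around the circles of local minimizers
  obtain ⟨δ, hδ, hbar⟩ : ∃ δ > 0, ∀ i, γ i ∈ P₀.domain → IsLocalMin (localAction g P₀ k) (γ i) → period (γ i) < T + 3 →
      ∀ (u : C(unitInterval, FreeLoop)) (z : unitInterval → Lifted), Continuous z →
        (∀ s, IsLift (z s) (u s).1) → (∀ s, total (z s).1.2 = m) → u 0 ∈ orbit (γ i) → u 1 = u 0 →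
        mag stdTwoForm m (z 1).1 ≠ mag stdTwoForm m (z 0).1 → ∃ s, act g σ k m (z 0) + δ ≤ act g σ k m (z s) := by
    have h1 : ∀ i, ∃ δ > 0, γ i ∈ P₀.domain → IsLocalMin (localAction g P₀ k) (γ i) → period (γ i) < T + 3 →
      ∀ (u : C(unitInterval, FreeLoop)) (z : unitInterval → Lifted), Continuous z →
        (∀ s, IsLift (z s) (u s).1) → (∀ s, total (z s).1.2 = m) → u 0 ∈ orbit (γ i) → u 1 = u 0 →
        mag stdTwoForm m (z 1).1 ≠ mag stdTwoForm m (z 0).1 → ∃ s, act g σ k m (z 0) + δ ≤ act g σ k m (z s) := fun i => by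
      by_cases hQ : γ i ∈ P₀.domain ∧ IsLocalMin (localAction g P₀ k) (γ i) ∧ period (γ i) < T + 3
      · obtain ⟨O, hO, hiO, hiso⟩ := hd _ (hmem i)
        obtain ⟨δ, hδ, h⟩ := exists_barrier hk0 hm0 hQ.1 hQ.2.1 (hcls i) hQ.2.2 hO hiO (fun γ' h1 h2 h3 h4 => by
          have h5 := orbit_mem_circlesBelow (n := n) (α := α) h4 (h2.trans hm) h3
          by_contra hne
          exact disjoint_left.1 (hiso _ h5 fun e => hne (e ▸ mem_orbit_self _)) (mem_orbit_self _) h1)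
        exact ⟨δ, hδ, fun _ _ _ => h⟩
      · exact ⟨1, one_pos, fun a b c => absurd ⟨a, b, c⟩ hQ⟩
    choose f hf hf' using h1
    obtain ⟨δ, hδ, hle⟩ := exists_pos_forall_le hf
    refine ⟨δ, hδ, fun i a b c u z h1 h2 h3 h4 h5 h6 => ?_⟩
    obtain ⟨s, hs⟩ := hf' i a b c u z h1 h2 h3 h4 h5 h6
    exact ⟨s, by linarith [hle i]⟩
  -- the gap between the branches
  obtain ⟨ε₁, hε₁, hgap⟩ : ∃ ε₁ > 0, ∀ i j x, x - (c - localAction g P₀ k (γ i) + act g σ k m (sec 0 (γ i).1)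
      - act g σ k m (sec 0 (γ j).1)) ∈ AddSubgroup.zmultiples (flux σ) → |x| < ε₁ → x = 0 := by
    choose f hf hf' using fun p : J × J => exists_eq_zero_of_abs_lt (c - localAction g P₀ k (γ p.1)
      + act g σ k m (sec 0 (γ p.1).1) - act g σ k m (sec 0 (γ p.2).1)) (flux σ)
    obtain ⟨ε, hε, hle⟩ := exists_pos_forall_le hf
    exact ⟨ε, hε, fun i j x h1 h2 => hf' (i, j) x h1 (h2.trans_le (hle _))⟩
  -- Shrinking W j so that the local action varies by less than half of the branch gap makes
  -- membership in V decide the branch.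
  let V : Set FreeLoop := ⋃ j, W j ∩ {γ' | |localAction g (P j) k γ' - localAction g (P j) k (γ j)| < ε₁ / 2}
  have hV : IsOpen V := isOpen_iUnion fun j => by
    have h1 : ContinuousOn (fun γ' => |localAction g (P j) k γ' - localAction g (P j) k (γ j)|) (W j) := fun γ' h' =>
      ((continuousAt_localAction (hW.subset_domain j h')).sub continuousAt_const).abs.continuousWithinAt
    exact h1.isOpen_inter_preimage (hW.isOpen j) (isOpen_Iio (a := ε₁ / 2))
  have hZV : ∀ γ' : FreeLoop, cls γ'.1 = m → period γ' ≤ T + 3 → IsZero g σ k γ' → γ' ∈ V := fun γ' h1 h2 h3 => by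
    have h4 := orbit_mem_circlesBelow (n := n) (α := α) h3 (h1.trans hm) h2
    rw [← hr] at h4
    obtain ⟨j, hj⟩ := h4
    have h5 : γ' ∈ orbit (γ j) := by
      change orbit (γ j) = orbit γ' at hj
      exact hj ▸ mem_orbit_self γ'
    refine mem_iUnion.2 ⟨j, hW.orbit_subset j h5, ?_⟩
    obtain ⟨ψ, rfl⟩ := h5
    simp only [mem_ofPred_eq]
    rw [localAction_shift (hW.subset_domain j (hW.orbit_subset j (mem_orbit_self _))), sub_self, abs_zero]
    positivity
  obtain ⟨μ, hμ, hdef⟩ := exists_deformation hk0 hml hm0 T hV hZV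
  have hTp : 0 < T + 2 := by linarith
  -- The bound on ε makes (T + 2)ε smaller than each of μ, ε₁/2 and δ.
  obtain ⟨ε, ⟨hε0, hεθ⟩, β, hβ, y, hy, hyt, hyT, hy0, hy1, hymag, hyS⟩ := exists_path_period_le hU hI hk hm hm0 hT hsup
    (θ := min μ (min (ε₁ / 2) δ) / (T + 2)) (by positivity)
  rw [lt_div_iff₀ hTp, lt_min_iff, lt_min_iff] at hεθ
  obtain ⟨hμε, hε₁ε, hδε⟩ := hεθ
  have hTε : 0 < T * ε := by positivity
  set A := localAction g P₀ k (iterate n β) with hA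
  have hβdom : iterate n β ∈ P₀.domain := iterate_mem_domain.2 (hU.closure_subset_domain (minimizers_subset_closure hβ))
  have hβB : ((n : ℕ) : ℝ) * sSup (period '' U) ≤ T + 3 := by linarith
  have hβC := orbit_iterate_mem_circlesBelow hU hk0 n hβB hβ
  have hβmin := isLocalMin_iterate hk0 (hU.closure_subset_domain (minimizers_subset_closure hβ))
    (isLocalMin_of_mem_minimizers hU hk0 n hβB hd hβ) n
  have hβzero := isZero_iterate_of_mem_minimizers hU hk0 n hβ
  obtain ⟨i, hi⟩ : ∃ i, orbit (γ i) = orbit (iterate n β) := by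
    rw [← hr] at hβC; exact hβC
  have hβi : iterate n β ∈ orbit (γ i) := hi ▸ mem_orbit_self _
  obtain ⟨ψ, hψ⟩ : γ i ∈ orbit (iterate n β) := hi ▸ mem_orbit_self _
  have hidom : γ i ∈ P₀.domain := hψ ▸ shift_mem_domain hβdom ψ
  have himin : IsLocalMin (localAction g P₀ k) (γ i) := hψ ▸ isLocalMin_shift hβdom hβmin ψ
  have hiper : period (γ i) < T + 3 := by
    have h1 : period (iterate n β) ≤ T + 2 := by
      refine le_trans ?_ hsup
      change ((n : ℕ) : ℝ) * period β ≤ _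
      gcongr
      exact hU.period_le (minimizers_subset_closure hβ)
    rw [← hψ]
    change period (iterate n β) < _
    linarith
  obtain ⟨v, hv, hv0, hvl⟩ := exists_mem_minimaxClass hm hy hyt hyT hβ hy0 hy1 hymag
  have hv1 : v 1 = v 0 := hv.2.1.symm
  -- The path must climb by δ from its start but never exceeds c + (T + 1)ε; as δ > (T + 2)ε, the
  -- start lies below c − ε.
  have hstart : A + δ ≤ c + (T + 1) * ε := by
    obtain ⟨s, hs⟩ := hbar i hidom himin hiper v y hy hvl hyt (hv0 ▸ hβi) hv1 hymag
    linarith [(hyS s).1]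
  -- The same barrier applied to the reversed path; the action along the path need not return to its
  -- initial value, so this end is treated separately.
  have hend : A + (act g σ k m (y 1) - act g σ k m (y 0)) + δ ≤ c + (T + 1) * ε := by
    let v' : C(unitInterval, FreeLoop) := v.comp ⟨unitInterval.symm, unitInterval.continuous_symm⟩
    obtain ⟨s, hs⟩ := hbar i hidom himin hiper v' (fun s => y (unitInterval.symm s)) (hy.comp unitInterval.continuous_symm)
      (fun s => hvl _) (fun s => hyt _) (by
        change v (unitInterval.symm 0) ∈ _
        rw [unitInterval.symm_zero, hv1, hv0]; exact hβi)
      (by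
        change v (unitInterval.symm 1) = v (unitInterval.symm 0)
        rw [unitInterval.symm_zero, unitInterval.symm_one, hv1])
      (by simpa only [unitInterval.symm_zero, unitInterval.symm_one] using hymag.symm)
    simp only [unitInterval.symm_zero] at hs
    linarith [(hyS (unitInterval.symm s)).1]
  -- The level is expressed in terms of `act`, which differs from the action along the path by the
  -- constant A − act(y 0).
  obtain ⟨z, hz, hzt, hzT, hzfix, hzle, hzV⟩ := hdef (c - A + act g σ k m (y 0)) ε hε0 (by nlinarith) y hy hyt hyT
    (fun s => by linarith [(hyS s).1]) (fun s hs => (hyS s).2 (by linarith))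
  have hz0 : z 0 = y 0 := hzfix 0 (by rw [← slope_eq g σ k hy0]; exact (isZero_iff_slope g σ k _).1 hβzero)
  have hz1 : z 1 = y 1 := hzfix 1 (by rw [← slope_eq g σ k hy1]; exact (isZero_iff_slope g σ k _).1 hβzero)
  obtain ⟨u, hu, hu0, hul⟩ := exists_mem_minimaxClass hm hz hzt hzT hβ (hz0 ▸ hy0) (hz1 ▸ hy1) (by rwa [hz0, hz1])
  have hS : ∀ s, actionAlong g P₀ k u s = A + (act g σ k m (z s) - act g σ k m (z 0)) := fun s => by
    rw [actionAlong_eq u hz hul hzt, hu0]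
  refine ⟨u, hu, ε / 2, by positivity, ⟨?_, ?_⟩, fun s hs => ?_⟩
  · rw [hS]; linarith
  · rw [hS, hz0, hz1]; linarith
  · have hs' := hs
    rw [hS, hz0] at hs'
    obtain ⟨j, hjW, hjε⟩ := mem_iUnion.1 (hzV s (by linarith) (u s) (hul s))
    -- The defect in the identity belongs to the coset of the pair (i, j) and has absolute value
    -- below ε₁: the distance to the level c and the variation of the local action contribute less
    -- than ε₁/2 each.
    refine ⟨j, hjW, sub_eq_zero.1 (hgap i j _ ?_ ?_)⟩
    · rw [actionAlong_eq u hz hul hzt]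
      exact sub_localAction_mem (hW.connected j).isPreconnected (hW.subset_domain j) hidom (hcls i)
        (hW.orbit_subset j (mem_orbit_self _)) (hcls j) (hu0 ▸ hβi) hjW (hul 0) (hul s) c
    · have h1 := hzle s
      have h2 := (hyS s).1
      simp only [mem_ofPred_eq] at hjε
      rw [abs_lt] at hjε ⊢
      rw [hS, hz0]
      constructor <;> linarith

end Family

end MountainPass

end MagneticTorus

end

/-! ### The vanishing circles as an essential family -/

theorem lemma6p2 (g : MagneticTorus.RiemannianMetric) (σ : MagneticTorus.TwoForm) (hσ : σ.Oscillating)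
    (k₀ : ℝ) (α : MagneticTorus.FreeLoop) (P₀ : MagneticTorus.PuncturedPrimitive σ)
    (hαP : α ∈ P₀.domain) (hα : MagneticTorus.IsStrictLocalMinimizer g P₀ k₀ α)
    (hα_noncontractible : α ∉ MagneticTorus.contractibleLoops)
    (U : Set MagneticTorus.FreeLoop) (hU : MagneticTorus.IsWell g P₀ k₀ α U)
    (I : Set ℝ) (hI : MagneticTorus.IsEnergyInterval g P₀ U k₀ I)
    (n : ℕ+) (k : ℝ) (hk : k ∈ I)
    (hdiff : DifferentiableAt ℝ (MagneticTorus.minimaxValue g P₀ α U n) k)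
    (Tstar : ℝ) (hT_pos : 0 < Tstar)
    (hT_lip : ∀ᶠ k' in 𝓝 k,
      |MagneticTorus.minimaxValue g P₀ α U n k' - MagneticTorus.minimaxValue g P₀ α U n k|
        ≤ Tstar * |k' - k|)
    (hT_sup : ((n : ℕ) : ℝ) * sSup (MagneticTorus.period '' U) - 2 < Tstar)
    (hdiscrete : MagneticTorus.IsDiscreteFamily
      (MagneticTorus.circlesBelow g σ α n k (Tstar + 3)))
    {J : Type*} (γ : J → MagneticTorus.FreeLoop) (P : J → MagneticTorus.PuncturedPrimitive σ)
    (hP : ∀ j, γ j ∈ (P j).domain)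
    (hγ_injective : Function.Injective fun j => MagneticTorus.orbit (γ j))
    (hγ_range : range (fun j => MagneticTorus.orbit (γ j)) =
      MagneticTorus.circlesBelow g σ α n k (Tstar + 3)) :
    MagneticTorus.IsEssentialFamily g P₀ α U n k γ P := by
  have hr : ∀ j, MagneticTorus.orbit (γ j) ∈ MagneticTorus.circlesBelow g σ α n k (Tstar + 3) := fun j =>
    hγ_range ▸ mem_range_self j
  refine ⟨fun j => MagneticTorus.isZero_of_orbit_mem_circlesBelow (hr j), fun j => (hr j).2.trans inter_subset_left,
    fun j => ?_, fun W hW => ?_⟩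
  · obtain ⟨O, hO, hjO, h⟩ := hdiscrete _ (hr j)
    exact ⟨O, hO, hjO, fun i hij => h _ (hr i) fun e => hij (hγ_injective e)⟩
  · exact MagneticTorus.exists_minimax_path hU hI hk (fun h => hα_noncontractible (MagneticTorus.mem_contractibleLoops.2 h))
      hT_pos hT_lip (by linarith) hdiscrete hγ_range hW
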